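/- **Model.** Let $d\ge1$ be an integer, $\lambda>0$, and $a,b\in[0,1]$ with $a\ne b$. Write $\nu_d$ for the volume of the unit Euclidean ball in $\mathbb R^d$. A sample of $\mathrm{GSBM}(\lambda,n,a,b,d)$ is drawn as follows. The vertex set $V$ is a homogeneous Poisson point process of intensity $\lambda$ on $\mathcal S=[-n^{1/d}/2,n^{1/d}/2]^d$ (a $\mathrm{Poisson}(\lambda n)$ number of independent uniform points). The vertices carry independent uniform labels $\sigma_0(u)\in\{-1,1\}$. Given locations and labels, edges are independent, and $\{u,v\}$ is an edge with probability $a$ if $\sigma_0(u)=\sigma_0(v)$ and $b$ otherwise, provided $\|u-v\|\le(\log n)^{1/d}$; otherwise it is not an edge. Here $\|\cdot\|$ is the toroidal Euclidean metric on $\mathcal S$. Let $\mathcal N(u)=\{v\in V:\|u-v\|\le(\log n)^{1/d}\}$. **Phase I** (constants $\chi,\delta>0$). Divide $\mathcal S$ into $k^d$ equal hypercubes (blocks) $B_i$, where $k=\lceil (n/(\chi\log n))^{1/d}\rceil$ (so blocks have volume $\chi\log n$ up to rounding), and let $V_i$ be the set of vertices in $B_i$. A block is $\delta$-occupied if $|V_i|>\delta\log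 n$. Let $H$ be the graph on the occupied blocks in which $B_i,B_j$ are adjacent if $\sup_{x\in B_i,y\in B_j}\|x-y\|\le(\log n)^{1/d}$. If $H$ is not connected (or has no vertices), return FAIL. Otherwise choose, by any rule that depends only on $n$ and on which vertex lies in which block, a rooted spanning tree of $H$ and an ordering of its vertices by level. In the root block $V_1$ choose any vertex $u_0$, set $\widehat\sigma(u_0)=1$, and give $u\in V_1\setminus\{u_0\}$ the label $1$ if $u_0$ and $u$ have more than $(a+b)^2(|V_1|-2)/4$ common neighbours in $V_1$, and $-1$ otherwise. Then treat the other occupied blocks $V_i$ in order. Let $S$ be the vertex set of the parent block, let $s=1$ if at least as many vertices of $S$ are labeled $1$ as $-1$, and $s=-1$ otherwise, and let $m$ be the number of vertices of $S$ labeled $s$. A vertex $u\in V_i$ with $D$ neighbours in $S$ labeled $s$ gets the label $s$ if $a>b$ and $D\ge(a+b)m/2$, or if $a<b$ and $D<(a+b)m/2$; otherwise it gets $-s$. Vertices outside the occupied blocks get $\widehat\sigma=0$. **Theorem.** Suppose that $d=1$ and $\lambda>1$, or $d\ge2$ and $\lambda\nu_d>1$. There are $\chi$ with $$0<\chi<\tfrac12\big[(\mathbf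 1_{d=1}+\nu_d\mathbf 1_{d\ge2})-1/\lambda\big],\qquad \tfrac32\sqrt d\,\chi^{1/d}<1,\qquad \nu_d\big(1-\tfrac32\sqrt d\,\chi^{1/d}\big)^d\ge\tfrac12(\nu_d+1/\lambda),$$ and for each such $\chi$ there is $\delta_0>0$, depending only on $\lambda,d,\chi$, such that for all $0<\delta<\delta_0$ and all $a,b\in[0,1]$ with $a\neq b$ the following hold. 1. Phase I, for a suitable rule for the choice of the tree and of $u_0$, is carried out by a program on a real RAM (unit-cost arithmetic and comparison of real numbers, adjacency queries, real constants in the program that depend on $d,a,b,\chi,\delta$; input $n$, $n^{1/d}$, $(\log n)^{1/d}$, the vertex locations and the graph) in a number of steps bounded by a polynomial in $n+|V|$, for every input with $n\ge2$. There is moreover a constant $M$, depending on $\lambda,d,\chi,\delta,a,b$ only, such that for every rule for the choice of the tree, with probability tending to $1$ as $n\to\infty$, Phase I does not return FAIL and, simultaneously for all choices of $u_0$ in the root block, its output satisfies each of the following. 2. (Almost exact recovery.) For every fixed $\epsilon>0$, $\ \max_{s\in\{\pm1\}}|\{u\in V:\widehat\sigma(u)=s\,\sigma_0(u)\}|\ge(1-\epsilon)|V|$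 and $V\neq\emptyset$. 3. Every $\delta$-occupied block $V_i$ satisfies $|\{v\in V_i:\widehat\sigma(v)\ne\sigma_0(u_0)\sigma_0(v)\}|\le M$. 4. Let $\kappa=\nu_d(1+\sqrt d\,\chi^{1/d})^d/\chi$. For every fixed $\eta>0$ with $\delta<\eta/\kappa$: $\ |\{v\in V:\widehat\sigma(v)\ne\sigma_0(u_0)\sigma_0(v)\}|\le\eta n/(\chi\kappa)$. 5. For every fixed $\eta>0$ with $\delta<\eta/\kappa$: every $u\in V$ satisfies $|\{v\in\mathcal N(u):\widehat\sigma(v)\ne\sigma_0(u_0)\sigma_0(v)\}|\le\eta\log n$. In particular, there is a polynomial-time algorithm that achieves almost exact recovery, and for any $\eta>0$ the constants can be chosen so that every visibility neighbourhood contains at most $\eta\log n$ errors. -/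

import Mathlib

open MeasureTheory ProbabilityTheory Filter Topology

noncomputable section

namespace GSBM

/-! ### Geometry -/

/-- Volume of the unit Euclidean ball in dimension `d`. -/
def unitBallVol (d : ℕ) : ℝ :=
  (volume (Metric.ball (0 : EuclideanSpace ℝ (Fin d)) 1)).toReal

/-- Side length `n^(1/d)` of the region. -/
def sideLen (d n : ℕ) : ℝ := (n : ℝ) ^ (1 / (d : ℝ))

/-- Visibility radius `(log n)^(1/d)`. -/
def radius (d n : ℕ) : ℝ := (Real.log n) ^ (1 / (d : ℝ))

/-- The region `[-n^(1/d)/2, n^(1/d)/2]^d`. -/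
def region (d n : ℕ) : Set (Fin d → ℝ) :=
  {x | ∀ j, -(sideLen d n / 2) ≤ x j ∧ x j ≤ sideLen d n / 2}

/-- The toroidal metric on the region. -/
def torusDist (d n : ℕ) (x y : Fin d → ℝ) : ℝ :=
  Real.sqrt (∑ j, (min |x j - y j| (sideLen d n - |x j - y j|)) ^ 2)

theorem torusDist_comm (d n : ℕ) (x y : Fin d → ℝ) :
    torusDist d n x y = torusDist d n y x := by
  simp only [torusDist, abs_sub_comm]

/-! ### The geometric stochastic block model -/

/-- What an algorithm sees: finitely many vertices, their locations, and the edges. -/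
structure SpatialGraph (d : ℕ) where
  card : ℕ
  pos : Fin card → Fin d → ℝ
  graph : SimpleGraph (Fin card)

/-- Randomness: the number of vertices, a uniform point of the unit cube for every potential
vertex, a fair coin for its label, and a uniform variable for every potential edge. -/
abbrev Sample (d : ℕ) : Type :=
  ℕ × (ℕ → Fin d → unitInterval) × (ℕ → Bool) × (Sym2 ℕ → unitInterval)

/-- A Poisson number of vertices with mean `lam * n`; all other variables independent. -/
def law (d : ℕ) (lam : ℝ) (n : ℕ) : Measure (Sample d) :=
  (poissonMeasure (lam * n).toNNReal).prod
    ((Measure.infinitePi fun _ : ℕ => (volume : Measure (Fin d → unitInterval))).prod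
      ((Measure.infinitePi fun _ : ℕ => (PMF.uniformOfFintype Bool).toMeasure).prod
        (Measure.infinitePi fun _ : Sym2 ℕ => (volume : Measure unitInterval))))

/-- Location of the `i`-th vertex: uniform in the region. -/
def location {d : ℕ} (n : ℕ) (ω : Sample d) (i : ℕ) : Fin d → ℝ :=
  fun j => sideLen d n * ((ω.2.1 i j : ℝ) - 1 / 2)

/-- Community label of the `i`-th vertex. -/
def label {d : ℕ} (ω : Sample d) (i : ℕ) : SignType := if ω.2.2.1 i then 1 else -1

/-- The observed graph: two mutually visible vertices are joined with probability `a` or `b`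
according to whether their labels agree, independently over pairs. -/
def observed {d : ℕ} (a b : ℝ) (n : ℕ) (ω : Sample d) : SpatialGraph d where
  card := ω.1
  pos i := location n ω i
  graph :=
    { Adj := fun i j => i ≠ j ∧
        torusDist d n (location n ω i) (location n ω j) ≤ radius d n ∧
        (ω.2.2.2 s((i : ℕ), (j : ℕ)) : ℝ) < if label ω i = label ω j then a else b
      symm := ⟨by
        rintro i j ⟨h₁, h₂, h₃⟩
        refine ⟨h₁.symm, by rwa [torusDist_comm], ?_⟩
        rw [Sym2.eq_swap]
        simpa only [eq_comm] using h₃⟩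
      loopless := ⟨fun _ h => h.1 rfl⟩ }

/-- The ground truth labels `σ₀`. -/
def truth {d : ℕ} (a b : ℝ) (n : ℕ) (ω : Sample d) :
    Fin (observed a b n ω).card → SignType := fun i => label ω i.val

/-! ### Blocks and the visibility graph -/

/-- Number of blocks per side; the region is divided into `blocksPerSide ^ d` equal hypercubes,
of volume `χ log n` whenever `(n / (χ log n))^(1/d)` is an integer. -/
def blocksPerSide (d n : ℕ) (χ : ℝ) : ℕ := ⌈((n : ℝ) / (χ * Real.log n)) ^ (1 / (d : ℝ))⌉₊

/-- Integer coordinates of the block that contains a point (points on the upper faces of the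
region belong to the last block). -/
def blockIndex (d n : ℕ) (χ : ℝ) (x : Fin d → ℝ) : Fin d → ℕ := fun j =>
  min ⌊(x j + sideLen d n / 2) / (sideLen d n / blocksPerSide d n χ)⌋₊ (blocksPerSide d n χ - 1)

/-- The block with coordinates `i`. -/
def block (d n : ℕ) (χ : ℝ) (i : Fin d → ℕ) : Set (Fin d → ℝ) :=
  {x | x ∈ region d n ∧ blockIndex d n χ x = i}

/-- Mutually visible blocks: all distances between their points are at most the radius. -/
def Visible (d n : ℕ) (χ : ℝ) (i j : Fin d → ℕ) : Prop :=
  ∀ x ∈ block d n χ i, ∀ y ∈ block d n χ j, torusDist d n x y ≤ radius d n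

/-- The block of every vertex. -/
def assignment {d : ℕ} (n : ℕ) (χ : ℝ) (g : SpatialGraph d) : Fin g.card → Fin d → ℕ :=
  fun v => blockIndex d n χ (g.pos v)

/-- The vertices in the block `i`. -/
def vertsIn {d N : ℕ} (β : Fin N → Fin d → ℕ) (i : Fin d → ℕ) : Finset (Fin N) :=
  Finset.univ.filter fun v => β v = i

/-- `δ`-occupied blocks. -/
def Occupied {d N : ℕ} (n : ℕ) (δ : ℝ) (β : Fin N → Fin d → ℕ) (i : Fin d → ℕ) : Prop :=
  δ * Real.log n < ((vertsIn β i).card : ℝ)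

/-- The visibility graph on the occupied blocks. -/
def visGraph {d N : ℕ} (n : ℕ) (χ δ : ℝ) (β : Fin N → Fin d → ℕ) :
    SimpleGraph {i : Fin d → ℕ // Occupied n δ β i} where
  Adj i j := i ≠ j ∧ Visible d n χ i.1 j.1
  symm := ⟨fun _ _ h =>
    ⟨h.1.symm, fun x hx y hy => by rw [torusDist_comm]; exact h.2 y hy x hx⟩⟩
  loopless := ⟨fun _ h => h.1 rfl⟩

/-- A rooted spanning tree of `H`, with its parent map and an ordering of the vertices by
level (breadth-first orderings are of this kind). -/
structure Schedule {V : Type*} (H : SimpleGraph V) where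
  tree : SimpleGraph V
  tree_le : tree ≤ H
  isTree : tree.IsTree
  root : V
  parent : V → V
  parent_adj : ∀ v, v ≠ root → tree.Adj (parent v) v
  parent_dist : ∀ v, v ≠ root → tree.dist root v = tree.dist root (parent v) + 1
  order : List V
  nodup : order.Nodup
  complete : ∀ v, v ∈ order
  byLevel : order.Pairwise fun v w => tree.dist root v ≤ tree.dist root w

/-- A rule that selects a schedule whenever the visibility graph is connected. It sees which
vertex lies in which block, and neither the labels nor the edges. -/
def ScheduleRule (d : ℕ) (χ δ : ℝ) : Type :=
  ∀ (n N : ℕ) (β : Fin N → Fin d → ℕ),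
    (visGraph n χ δ β).Connected → Schedule (visGraph n χ δ β)

/-! ### Phase I -/

open scoped Classical in
/-- `Pairwise Classify` on the vertex set `S` with reference vertex `u₀`. -/
def pairwiseClassify {N : ℕ} (G : SimpleGraph (Fin N)) (a b : ℝ) (S : Finset (Fin N))
    (u₀ u : Fin N) : SignType :=
  if u = u₀ then 1
  else if (a + b) ^ 2 * ((S.card : ℝ) - 2) / 4 <
      (((S \ {u, u₀}).filter fun v => G.Adj u₀ v ∧ G.Adj u v).card : ℝ) then 1
  else -1

open scoped Classical in
/-- Number of neighbours of `u` in `S` that carry the label `s`. -/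
def degPlus {N : ℕ} (G : SimpleGraph (Fin N)) (σ : Fin N → SignType) (S : Finset (Fin N))
    (s : SignType) (u : Fin N) : ℕ :=
  (S.filter fun v => σ v = s ∧ G.Adj u v).card

/-- Number of vertices in `S` that carry the label `s`. -/
def numLabel {N : ℕ} (σ : Fin N → SignType) (S : Finset (Fin N)) (s : SignType) : ℕ :=
  (S.filter fun v => σ v = s).card

open scoped Classical in
/-- `Propagate`: label `S'` with the help of the labels on `S`, and keep all other labels. -/
def propagate {N : ℕ} (G : SimpleGraph (Fin N)) (a b : ℝ) (S S' : Finset (Fin N))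
    (σ : Fin N → SignType) : Fin N → SignType := fun u =>
  if u ∈ S' then
    if numLabel σ S (-1) ≤ numLabel σ S 1 then
      if b < a ∧ (a + b) * (numLabel σ S 1 : ℝ) / 2 ≤ (degPlus G σ S 1 u : ℝ) then 1
      else if a < b ∧ (degPlus G σ S 1 u : ℝ) < (a + b) * (numLabel σ S 1 : ℝ) / 2 then 1
      else -1
    else
      if b < a ∧ (a + b) * (numLabel σ S (-1) : ℝ) / 2 ≤ (degPlus G σ S (-1) u : ℝ) then -1
      else if a < b ∧ (degPlus G σ S (-1) u : ℝ) < (a + b) * (numLabel σ S (-1) : ℝ) / 2 then -1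
      else 1
  else σ u

open scoped Classical in
/-- The Phase I labeling for a given schedule and reference vertex `u₀` (of the root block):
classify the root block, then propagate along the tree. Vertices outside the occupied blocks
get the label `0`. -/
def phaseI {d N : ℕ} {n : ℕ} {χ δ : ℝ} (G : SimpleGraph (Fin N)) (a b : ℝ)
    (β : Fin N → Fin d → ℕ) (s : Schedule (visGraph n χ δ β)) (u₀ : Fin N) :
    Fin N → SignType :=
  s.order.foldl
    (fun σ i => if i = s.root then σ
      else propagate G a b (vertsIn β (s.parent i).1) (vertsIn β i.1) σ)
    (fun v => if v ∈ vertsIn β s.root.1 then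
      pairwiseClassify G a b (vertsIn β s.root.1) u₀ v else 0)

/-- Phase I does not return `FAIL` (that is, the visibility graph is connected), and its labeling
`σ` satisfies `Q u₀ σ` for every choice of the reference vertex `u₀` in the root block. -/
def PhaseISatisfies {d : ℕ} {χ δ : ℝ} (R : ScheduleRule d χ δ) (a b : ℝ) (n : ℕ)
    (g : SpatialGraph d) (Q : Fin g.card → (Fin g.card → SignType) → Prop) : Prop :=
  ∃ h : (visGraph n χ δ (assignment n χ g)).Connected,
    ∀ u₀ ∈ vertsIn (assignment n χ g) (R n g.card (assignment n χ g) h).root.1,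
      Q u₀ (phaseI g.graph a b (assignment n χ g) (R n g.card (assignment n χ g) h) u₀)

/-! ### Recovery -/

/-- The vertices mislabeled by `σ` relative to the label of `u₀`. -/
def mistakes {N : ℕ} (σ₀ σ : Fin N → SignType) (u₀ : Fin N) : Finset (Fin N) :=
  Finset.univ.filter fun v => σ v ≠ σ₀ u₀ * σ₀ v

/-- Agreement up to a global sign. -/
def agreement {N : ℕ} (σ σ₀ : Fin N → SignType) : ℝ :=
  max ((Finset.univ.filter fun v => σ v = σ₀ v).card : ℝ)
    ((Finset.univ.filter fun v => σ v = -σ₀ v).card : ℝ) / (N : ℝ)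

/-- The vertices visible to `u`. -/
def nbhd {d : ℕ} (n : ℕ) (g : SpatialGraph d) (u : Fin g.card) : Finset (Fin g.card) :=
  Finset.univ.filter fun v => torusDist d n (g.pos u) (g.pos v) ≤ radius d n

/-- With high probability, Phase I on a sample of the model succeeds and its labeling `σ` (with
reference vertex `u₀`, observed graph `g` and ground truth `σ₀`) satisfies `Q n g σ₀ u₀ σ`. -/
def PhaseIWhp {d : ℕ} {χ δ : ℝ} (R : ScheduleRule d χ δ) (lam a b : ℝ)
    (Q : (n : ℕ) → (g : SpatialGraph d) → (σ₀ : Fin g.card → SignType) → (u₀ : Fin g.card) →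
      (σ : Fin g.card → SignType) → Prop) : Prop :=
  Tendsto (fun n : ℕ => law d lam n
      {ω | PhaseISatisfies R a b n (observed a b n ω)
        (Q n (observed a b n ω) (truth a b n ω))}) atTop (𝓝 1)

/-! ### Constants -/

/-- The condition on the block constant `χ`. -/
def BlockConstant (d : ℕ) (lam χ : ℝ) : Prop :=
  0 < 1 - 3 * Real.sqrt d * χ ^ (1 / (d : ℝ)) / 2 ∧
  (unitBallVol d + 1 / lam) / 2 ≤
    unitBallVol d * (1 - 3 * Real.sqrt d * χ ^ (1 / (d : ℝ)) / 2) ^ d ∧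
  0 < χ ∧ χ < ((if d = 1 then 1 else unitBallVol d) - 1 / lam) / 2

/-- `κ`, the maximal number of blocks that a visibility neighbourhood meets. -/
def kappa (d : ℕ) (χ : ℝ) : ℝ :=
  unitBallVol d * (1 + Real.sqrt d * χ ^ (1 / (d : ℝ))) ^ d / χ

/-! ### A real RAM

Finitely many named arrays of natural numbers and of real numbers, addition and truncated
subtraction of naturals, field operations and comparisons of reals, real constants, queries to
the adjacency matrix, branching, and loops whose number of rounds is fixed on entry. Every
operation takes one step. -/

namespace RAM

/-- Memory: entry `i` of array `x` is `nat x i`, respectively `real x i`. -/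
structure Mem where
  nat : ℕ → ℕ → ℕ
  real : ℕ → ℕ → ℝ

/-- Expressions with values in `ℕ`. -/
inductive NExpr where
  | const (c : ℕ)
  | read (x : ℕ) (i : NExpr)
  | add (e f : NExpr)
  | sub (e f : NExpr)
  | edge (e f : NExpr)

/-- Expressions with values in `ℝ`. -/
inductive RExpr where
  | const (c : ℝ)
  | read (x : ℕ) (i : NExpr)
  | ofNat (e : NExpr)
  | add (e f : RExpr)
  | sub (e f : RExpr)
  | mul (e f : RExpr)
  | div (e f : RExpr)

/-- Tests. -/
inductive Test where
  | natLe (e f : NExpr)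
  | realLe (e f : RExpr)

/-- Programs. -/
inductive Prog where
  | setNat (x : ℕ) (i e : NExpr)
  | setReal (x : ℕ) (i : NExpr) (e : RExpr)
  | seq (p q : Prog)
  | ite (t : Test) (p q : Prog)
  | loop (x : ℕ) (e : NExpr) (p : Prog)

open scoped Classical in
/-- Value of an expression; `E` is the adjacency relation of the input graph. -/
def NExpr.eval (E : ℕ → ℕ → Prop) (m : Mem) : NExpr → ℕ
  | const c => c
  | read x i => m.nat x (i.eval E m)
  | add e f => e.eval E m + f.eval E m
  | sub e f => e.eval E m - f.eval E m
  | edge e f => if E (e.eval E m) (f.eval E m) then 1 else 0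

/-- Number of operations in an expression. -/
def NExpr.cost : NExpr → ℕ
  | const _ => 1
  | read _ i => i.cost + 1
  | add e f => e.cost + f.cost + 1
  | sub e f => e.cost + f.cost + 1
  | edge e f => e.cost + f.cost + 1

/-- Value of a real expression. -/
def RExpr.eval (E : ℕ → ℕ → Prop) (m : Mem) : RExpr → ℝ
  | const c => c
  | read x i => m.real x (i.eval E m)
  | ofNat e => (e.eval E m : ℝ)
  | add e f => e.eval E m + f.eval E m
  | sub e f => e.eval E m - f.eval E m
  | mul e f => e.eval E m * f.eval E m
  | div e f => e.eval E m / f.eval E m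

/-- Number of operations in a real expression. -/
def RExpr.cost : RExpr → ℕ
  | const _ => 1
  | read _ i => i.cost + 1
  | ofNat e => e.cost + 1
  | add e f => e.cost + f.cost + 1
  | sub e f => e.cost + f.cost + 1
  | mul e f => e.cost + f.cost + 1
  | div e f => e.cost + f.cost + 1

/-- Truth of a test. -/
def Test.holds (E : ℕ → ℕ → Prop) (m : Mem) : Test → Prop
  | natLe e f => e.eval E m ≤ f.eval E m
  | realLe e f => e.eval E m ≤ f.eval E m

/-- Number of operations in a test. -/
def Test.cost : Test → ℕ
  | natLe e f => e.cost + f.cost + 1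
  | realLe e f => e.cost + f.cost + 1

/-- Write one entry of an array of naturals. -/
def Mem.setNat (m : Mem) (x i v : ℕ) : Mem :=
  { m with nat := Function.update m.nat x (Function.update (m.nat x) i v) }

/-- Write one entry of an array of reals. -/
def Mem.setReal (m : Mem) (x i : ℕ) (v : ℝ) : Mem :=
  { m with real := Function.update m.real x (Function.update (m.real x) i v) }

open scoped Classical in
/-- Final memory and number of steps. A loop evaluates its bound `k` once, and then runs its body
for the values `0, …, k - 1` of its counter, which is entry `0` of the array `x`. -/
def Prog.run (E : ℕ → ℕ → Prop) : Prog → Mem → Mem × ℕ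
  | setNat x i e, m => (m.setNat x (i.eval E m) (e.eval E m), i.cost + e.cost + 1)
  | setReal x i e, m => (m.setReal x (i.eval E m) (e.eval E m), i.cost + e.cost + 1)
  | seq p q, m => ((q.run E (p.run E m).1).1, (p.run E m).2 + (q.run E (p.run E m).1).2)
  | ite t p q, m =>
    if t.holds E m then ((p.run E m).1, t.cost + (p.run E m).2)
    else ((q.run E m).1, t.cost + (q.run E m).2)
  | loop x e p, m =>
    (List.range (e.eval E m)).foldl
      (fun s i => ((p.run E (s.1.setNat x 0 i)).1, s.2 + 1 + (p.run E (s.1.setNat x 0 i)).2))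
      (m, e.cost + 1)

end RAM

/-- The adjacency relation, on vertex numbers. -/
def SpatialGraph.edgeRel {d : ℕ} (g : SpatialGraph d) (i j : ℕ) : Prop :=
  ∃ (hi : i < g.card) (hj : j < g.card), g.graph.Adj ⟨i, hi⟩ ⟨j, hj⟩

open scoped Classical in
/-- Input memory. Array `0` of naturals holds `n` and the number of vertices. For `j < d`, array
`j` of reals holds the `j`-th coordinates of the vertices; array `d` of reals holds the side
length of the region and the visibility radius. All other entries are `0`. -/
def inputMem {d : ℕ} (n : ℕ) (g : SpatialGraph d) : RAM.Mem where
  nat x i := if x = 0 then (if i = 0 then n else if i = 1 then g.card else 0) else 0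
  real x i :=
    if hx : x < d then (if hi : i < g.card then g.pos ⟨i, hi⟩ ⟨x, hx⟩ else 0)
    else if x = d then (if i = 0 then sideLen d n else if i = 1 then radius d n else 0)
    else 0

/-- Some program carries out Phase I, with the schedules given by `R`, in a number of steps that
is at most polynomial in `n` and the number of vertices. Its output is a flag in array `1` of
naturals (`0` for `FAIL`, otherwise `1`), and the labels in array `d + 1` of reals. -/
def PolyTimePhaseI {d : ℕ} {χ δ : ℝ} (R : ScheduleRule d χ δ) (a b : ℝ) : Prop :=
  ∃ (P : RAM.Prog) (T : Polynomial ℕ), ∀ n : ℕ, 2 ≤ n → ∀ g : SpatialGraph d,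
    (∀ v, g.pos v ∈ region d n) →
      (P.run g.edgeRel (inputMem n g)).2 ≤ T.eval (n + g.card) ∧
      (¬ (visGraph n χ δ (assignment n χ g)).Connected →
        (P.run g.edgeRel (inputMem n g)).1.nat 1 0 = 0) ∧
      ∀ h : (visGraph n χ δ (assignment n χ g)).Connected,
        (P.run g.edgeRel (inputMem n g)).1.nat 1 0 = 1 ∧
        ∃ u₀ ∈ vertsIn (assignment n χ g) (R n g.card (assignment n χ g) h).root.1,
          ∀ v : Fin g.card, (P.run g.edgeRel (inputMem n g)).1.real (d + 1) v =
            ((phaseI g.graph a b (assignment n χ g) (R n g.card (assignment n χ g) h) u₀ v :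
              SignType) : ℝ)

end GSBM

end

/-! The probabilistic statements rest on two facts: the occupied blocks are connected, and errors do
not accumulate along the tree.

Connectivity. For small δ, a prescribed set of m blocks with mλχ > 1 is entirely vacant with
probability at most n^(-mc), where mc > 1 (`exists_vacancy_bound`). There are at most n blocks, so
with high probability no translate of finitely many such patterns is vacant. It remains to see that
this forces connectivity (`exists_patterns`). Let V be the set of lattice offsets at which blocks
are always visible. Comparing volumes, the condition on χ gives (|V| - 1)λχ > 1. In dimension at
least two, call a window bad if it has at least |V| - 1 vacant sites. In a window that is not bad,
most slices orthogonal to each axis are fully occupied, and full slices in different directions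
cross. An occupied cluster C near the centre that avoids them is trapped in a finite box. All of (C
+ V) \ C is then vacant, although |C + V| ≥ |C| + |V| - 1 for finite subsets of a torsion-free
group; this is a contradiction. Hence occupied sites are linked locally, and chains of windows link
them globally. In dimension one it is enough to exclude long vacant intervals.

Errors. Call a vertex atypical for a parent block if its number of neighbours in one true community
of that block is far from its mean. This notion involves the true labels and the edges only, not the
labels that the algorithm has assigned. If the parent block has at most M errors, and log n is large
compared with M, every vertex that is not atypical is labeled correctly, whichever vertices of the
parent are wrong. So M errors in the parent give at most M errors in the child as soon as each
ordered pair of visible blocks has at most M atypical vertices (`card_mistakes_le`). For M + 1 given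
vertices the edges into the parent community are independent, and Hoeffding's inequality bounds the
probability that all are atypical by a power of n with exponent proportional to M + 1
(`edgeLaw_atypical_le`). A large constant M therefore beats the union over pairs of blocks and over
sets of M + 1 vertices. Working with all pairs of blocks makes the estimate uniform in the tree. In
the root block common neighbours separate equal from unequal labels once the labels are nearly
balanced (`edgeLaw_common_le`). The root depends on the block configuration only, so a union over
O((log n)^2) pairs suffices.

Consequences. M errors per occupied block are o(n) in total, and Markov's inequality shows that o(n)
vertices lie outside the occupied blocks. A visibility neighbourhood meets asymptotically at most κ
blocks by a volume comparison, each with at most δ log n errors.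

The running time is a separate matter. A breadth-first search over vertices, instead of blocks, uses
nested loops of linear length on an unchanged input. Loop invariants show that its output satisfies
the local equations that characterize the Phase I labeling (`isPhaseILabeling_phaseI`). -/

noncomputable section

namespace GSBM
namespace RAM

/-! ### Programs: frames, cost, loops -/

@[simp] theorem Mem.setNat_nat_ne (m : Mem) {x y : ℕ} (i v : ℕ) (h : y ≠ x) :
    (m.setNat x i v).nat y = m.nat y := by
  simp [Mem.setNat, h]

@[simp] theorem Mem.setNat_nat_self (m : Mem) (x i v : ℕ) :
    (m.setNat x i v).nat x = Function.update (m.nat x) i v := by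
  simp [Mem.setNat]

@[simp] theorem Mem.setNat_real (m : Mem) (x i v : ℕ) : (m.setNat x i v).real = m.real := rfl

@[simp] theorem Mem.setReal_nat (m : Mem) (x i : ℕ) (v : ℝ) : (m.setReal x i v).nat = m.nat := rfl

@[simp] theorem Mem.setReal_real_ne (m : Mem) {x y : ℕ} (i : ℕ) (v : ℝ) (h : y ≠ x) :
    (m.setReal x i v).real y = m.real y := by
  simp [Mem.setReal, h]

@[simp] theorem Mem.setReal_real_self (m : Mem) (x i : ℕ) (v : ℝ) :
    (m.setReal x i v).real x = Function.update (m.real x) i v := by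
  simp [Mem.setReal]

theorem Mem.setNat_self (m : Mem) (x i : ℕ) : m.setNat x i (m.nat x i) = m := by
  cases m; simp [Mem.setNat]

/-- Arrays of naturals that a program may change. -/
def Prog.writesNat : Prog → Set ℕ
  | setNat x _ _ => {x}
  | setReal _ _ _ => ∅
  | seq p q => p.writesNat ∪ q.writesNat
  | ite _ p q => p.writesNat ∪ q.writesNat
  | loop x _ p => {x} ∪ p.writesNat

/-- Arrays of reals that a program may change. -/
def Prog.writesReal : Prog → Set ℕ
  | setNat _ _ _ => ∅
  | setReal x _ _ => {x}
  | seq p q => p.writesReal ∪ q.writesReal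
  | ite _ p q => p.writesReal ∪ q.writesReal
  | loop _ _ p => p.writesReal

/-- Memory after `k` rounds of a loop. -/
def loopMem (E : ℕ → ℕ → Prop) (x : ℕ) (p : Prog) (m : Mem) : ℕ → Mem
  | 0 => m
  | k + 1 => (p.run E ((loopMem E x p m k).setNat x 0 k)).1

theorem run_loop_fst (E : ℕ → ℕ → Prop) (x : ℕ) (e : NExpr) (p : Prog) (m : Mem) :
    ((Prog.loop x e p).run E m).1 = loopMem E x p m (e.eval E m) := by
  simp only [Prog.run]
  generalize e.eval E m = k
  induction k with
  | zero => simp [loopMem]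
  | succ k ih => rw [List.range_succ, List.foldl_append]; simp [loopMem, ih]

/-- The invariant speaks of the memory before the counter is written, so it must not depend on entry
`0` of the array `x`. -/
theorem loop_induction {E : ℕ → ℕ → Prop} {x : ℕ} {e : NExpr} {p : Prog} {m : Mem} {K : ℕ}
    (hK : e.eval E m = K) (I : ℕ → Mem → Prop) (h0 : I 0 m)
    (hs : ∀ i m', i < K → I i m' → I (i + 1) (p.run E (m'.setNat x 0 i)).1) :
    I K ((Prog.loop x e p).run E m).1 := by
  rw [run_loop_fst, hK]
  have : ∀ k ≤ K, I k (loopMem E x p m k) := by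
    intro k hk
    induction k with
    | zero => exact h0
    | succ k ih => exact hs k _ (by omega) (ih (by omega))
  exact this K le_rfl

/-- Frame rule: the set of written arrays is read off the syntax, so unchanged arrays can be tracked
without evaluating the program. -/
theorem run_nat_frame (E : ℕ → ℕ → Prop) (p : Prog) (m : Mem) {y : ℕ} (hy : y ∉ p.writesNat) :
    (p.run E m).1.nat y = m.nat y := by
  induction p generalizing m with
  | setNat x i e => simp only [Prog.writesNat, Set.mem_singleton_iff] at hy; simp [Prog.run, hy]
  | setReal x i e => simp [Prog.run]
  | seq p q ihp ihq =>
    simp only [Prog.writesNat, Set.mem_union, not_or] at hy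
    simp only [Prog.run]
    rw [ihq _ hy.2, ihp _ hy.1]
  | ite t p q ihp ihq =>
    simp only [Prog.writesNat, Set.mem_union, not_or] at hy
    simp only [Prog.run]
    split_ifs
    · exact ihp _ hy.1
    · exact ihq _ hy.2
  | loop x e p ih =>
    simp only [Prog.writesNat, Set.mem_union, not_or, Set.mem_singleton_iff] at hy
    refine loop_induction rfl (fun _ m' => m'.nat y = m.nat y) rfl fun i m' _ h => ?_
    rw [ih _ hy.2, Mem.setNat_nat_ne _ _ _ hy.1, h]

theorem run_real_frame (E : ℕ → ℕ → Prop) (p : Prog) (m : Mem) {y : ℕ} (hy : y ∉ p.writesReal) :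
    (p.run E m).1.real y = m.real y := by
  induction p generalizing m with
  | setNat x i e => simp [Prog.run]
  | setReal x i e => simp only [Prog.writesReal, Set.mem_singleton_iff] at hy; simp [Prog.run, hy]
  | seq p q ihp ihq =>
    simp only [Prog.writesReal, Set.mem_union, not_or] at hy
    simp only [Prog.run]
    rw [ihq _ hy.2, ihp _ hy.1]
  | ite t p q ihp ihq =>
    simp only [Prog.writesReal, Set.mem_union, not_or] at hy
    simp only [Prog.run]
    split_ifs
    · exact ihp _ hy.1
    · exact ihq _ hy.2
  | loop x e p ih =>
    simp only [Prog.writesReal] at hy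
    refine loop_induction rfl (fun _ m' => m'.real y = m.real y) rfl fun i m' _ h => ?_
    rw [ih _ hy, Mem.setNat_real, h]

/-- All loop bounds are linear in the two entries `0`, `1` of the input array `0`. -/
def Prog.LinearLoops : Prog → Prop
  | setNat _ _ _ => True
  | setReal _ _ _ => True
  | seq p q => p.LinearLoops ∧ q.LinearLoops
  | ite _ p q => p.LinearLoops ∧ q.LinearLoops
  | loop _ e p => (∃ C, ∀ E m, e.eval E m ≤ C * (m.nat 0 0 + m.nat 0 1 + 1)) ∧ p.LinearLoops

/-- A program with linear loop bounds that does not change its input runs in polynomial time. -/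
theorem exists_polynomial_cost (p : Prog) (h0 : 0 ∉ p.writesNat) (hp : p.LinearLoops) :
    ∃ T : Polynomial ℕ, ∀ E m, (p.run E m).2 ≤ T.eval (m.nat 0 0 + m.nat 0 1) := by
  induction p with
  | setNat x i e => exact ⟨Polynomial.C (i.cost + e.cost + 1), fun E m => by simp [Prog.run]⟩
  | setReal x i e => exact ⟨Polynomial.C (i.cost + e.cost + 1), fun E m => by simp [Prog.run]⟩
  | seq p q ihp ihq =>
    simp only [Prog.writesNat, Set.mem_union, not_or] at h0
    obtain ⟨T, hT⟩ := ihp h0.1 hp.1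
    obtain ⟨T', hT'⟩ := ihq h0.2 hp.2
    refine ⟨T + T', fun E m => ?_⟩
    have h1 := hT' E (p.run E m).1
    rw [run_nat_frame E p m h0.1] at h1
    simpa [Prog.run] using add_le_add (hT E m) h1
  | ite t p q ihp ihq =>
    simp only [Prog.writesNat, Set.mem_union, not_or] at h0
    obtain ⟨T, hT⟩ := ihp h0.1 hp.1
    obtain ⟨T', hT'⟩ := ihq h0.2 hp.2
    refine ⟨Polynomial.C t.cost + T + T', fun E m => ?_⟩
    have h1 := hT E m
    have h2 := hT' E m
    simp only [Prog.run, Polynomial.eval_add, Polynomial.eval_C]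
    split_ifs <;> simp only <;> omega
  | loop x e p ih =>
    simp only [Prog.writesNat, Set.mem_union, not_or, Set.mem_singleton_iff] at h0
    obtain ⟨⟨C, hC⟩, hp⟩ := hp
    obtain ⟨T, hT⟩ := ih h0.2 hp
    -- The number of rounds is at most C(z + 1), and each costs 1 + T(z), where z is the size of the
    -- input.
    refine ⟨Polynomial.C (e.cost + 1) + Polynomial.C C * (Polynomial.X + 1) * (1 + T),
      fun E m => ?_⟩
    set z := m.nat 0 0 + m.nat 0 1 with hz
    -- The input array survives every round, so the cost bound for the body is evaluated at the same
    -- z each time.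
    have key : ∀ k, (((List.range k).foldl (fun (s : Mem × ℕ) i =>
        ((p.run E (s.1.setNat x 0 i)).1, s.2 + 1 + (p.run E (s.1.setNat x 0 i)).2))
        (m, e.cost + 1)).1.nat 0 = m.nat 0) ∧
        ((List.range k).foldl (fun (s : Mem × ℕ) i =>
        ((p.run E (s.1.setNat x 0 i)).1, s.2 + 1 + (p.run E (s.1.setNat x 0 i)).2))
        (m, e.cost + 1)).2 ≤ e.cost + 1 + k * (1 + T.eval z) := by
      intro k
      induction k with
      | zero => simp
      | succ k ihk =>
        rw [List.range_succ, List.foldl_append]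
        simp only [List.foldl_cons, List.foldl_nil]
        refine ⟨?_, ?_⟩
        · rw [run_nat_frame E p _ h0.2, Mem.setNat_nat_ne _ _ _ h0.1, ihk.1]
        · have h1 := hT E ((((List.range k).foldl (fun (s : Mem × ℕ) i =>
            ((p.run E (s.1.setNat x 0 i)).1, s.2 + 1 + (p.run E (s.1.setNat x 0 i)).2))
            (m, e.cost + 1)).1).setNat x 0 k)
          rw [Mem.setNat_nat_ne _ _ _ h0.1, ihk.1, ← hz] at h1
          have h2 := ihk.2
          have : (k + 1) * (1 + T.eval z) = k * (1 + T.eval z) + 1 + T.eval z := by ring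
          omega
    have h1 := (key (e.eval E m)).2
    have h2 := Nat.mul_le_mul_right (1 + T.eval z) (hC E m)
    rw [← hz] at h2
    simp only [Prog.run, Polynomial.eval_add, Polynomial.eval_C, Polynomial.eval_mul,
      Polynomial.eval_X, Polynomial.eval_one]
    omega

/-- Conjunctions of tests and negated tests. -/
abbrev Clause := List (Bool × Test)

/-- Truth of a clause. -/
def Clause.holds (E : ℕ → ℕ → Prop) (m : Mem) (ts : Clause) : Prop :=
  ∀ t ∈ ts, (t.1 = true ↔ t.2.holds E m)

@[simp] theorem Clause.holds_nil (E : ℕ → ℕ → Prop) (m : Mem) :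
    Clause.holds E m [] ↔ True := by simp [Clause.holds]

@[simp] theorem Clause.holds_cons_true (E : ℕ → ℕ → Prop) (m : Mem) (t : Test) (ts : Clause) :
    Clause.holds E m ((true, t) :: ts) ↔ t.holds E m ∧ Clause.holds E m ts := by
  simp [Clause.holds]

@[simp] theorem Clause.holds_cons_false (E : ℕ → ℕ → Prop) (m : Mem) (t : Test) (ts : Clause) :
    Clause.holds E m ((false, t) :: ts) ↔ ¬ t.holds E m ∧ Clause.holds E m ts := by
  simp [Clause.holds]

/-- Branching on a clause. -/
def Prog.branch (p q : Prog) : Clause → Prog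
  | [] => p
  | (true, t) :: ts => .ite t (Prog.branch p q ts) q
  | (false, t) :: ts => .ite t q (Prog.branch p q ts)

theorem run_branch_pos {E : ℕ → ℕ → Prop} {m : Mem} {ts : Clause} (p q : Prog)
    (h : ts.holds E m) : ((Prog.branch p q ts).run E m).1 = (p.run E m).1 := by
  induction ts with
  | nil => rfl
  | cons t ts ih =>
    obtain ⟨b, t⟩ := t
    cases b
    · rw [Clause.holds_cons_false] at h
      simp [Prog.branch, Prog.run, h.1, ih h.2]
    · rw [Clause.holds_cons_true] at h
      simp [Prog.branch, Prog.run, h.1, ih h.2]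

theorem run_branch_neg {E : ℕ → ℕ → Prop} {m : Mem} {ts : Clause} (p q : Prog)
    (h : ¬ ts.holds E m) : ((Prog.branch p q ts).run E m).1 = (q.run E m).1 := by
  induction ts with
  | nil => simp at h
  | cons t ts ih =>
    obtain ⟨b, t⟩ := t
    cases b
    · rw [Clause.holds_cons_false] at h
      by_cases ht : t.holds E m
      · simp [Prog.branch, Prog.run, ht]
      · simp [Prog.branch, Prog.run, ht, ih (fun h' => h ⟨ht, h'⟩)]
    · rw [Clause.holds_cons_true] at h
      by_cases ht : t.holds E m
      · simp [Prog.branch, Prog.run, ht, ih (fun h' => h ⟨ht, h'⟩)]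
      · simp [Prog.branch, Prog.run, ht]

theorem writesNat_branch_subset (p q : Prog) (ts : Clause) :
    (Prog.branch p q ts).writesNat ⊆ p.writesNat ∪ q.writesNat := by
  induction ts with
  | nil => exact Set.subset_union_left
  | cons t ts ih =>
    obtain ⟨b, t⟩ := t
    cases b <;> simp only [Prog.branch, Prog.writesNat, Set.union_subset_iff] <;>
      simp [ih]

theorem writesReal_branch_subset (p q : Prog) (ts : Clause) :
    (Prog.branch p q ts).writesReal ⊆ p.writesReal ∪ q.writesReal := by
  induction ts with
  | nil => exact Set.subset_union_left
  | cons t ts ih =>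
    obtain ⟨b, t⟩ := t
    cases b <;> simp only [Prog.branch, Prog.writesReal, Set.union_subset_iff] <;>
      simp [ih]

theorem linearLoops_branch {p q : Prog} (hp : p.LinearLoops) (hq : q.LinearLoops) (ts : Clause) :
    (Prog.branch p q ts).LinearLoops := by
  induction ts with
  | nil => exact hp
  | cons t ts ih =>
    obtain ⟨b, t⟩ := t
    cases b
    · exact ⟨hq, ih⟩
    · exact ⟨ih, hq⟩

/-- The variable `x`: entry `0` of the array `x` of naturals. -/
abbrev NExpr.var (x : ℕ) : NExpr := .read x (.const 0)

/-- A program without effect on the variable `x`. -/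
abbrev Prog.skip (x : ℕ) : Prog := .setNat x (.const 0) (.var x)

@[simp] theorem run_skip (E : ℕ → ℕ → Prop) (x : ℕ) (m : Mem) :
    ((Prog.skip x).run E m).1 = m := by
  simp [Prog.run, NExpr.eval, Mem.setNat_self]

/-- Count in the variable `y` the values of the counter `x` for which a clause holds. -/
def Prog.count (x y : ℕ) (e : NExpr) (ts : Clause) : Prog :=
  .seq (.setNat y (.const 0) (.const 0))
    (.loop x e (.branch (.setNat y (.const 0) (.add (.var y) (.const 1))) (.skip y) ts))

theorem writesReal_count (x y : ℕ) (e : NExpr) (ts : Clause) :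
    (Prog.count x y e ts).writesReal = ∅ := by
  have := writesReal_branch_subset (.setNat y (.const 0) (.add (.var y) (.const 1))) (.skip y) ts
  simp only [Prog.writesReal, Set.union_self, Set.subset_empty_iff] at this
  simp [Prog.count, Prog.writesReal, this]

theorem linearLoops_count {x y : ℕ} {e : NExpr} {ts : Clause}
    (he : ∃ C, ∀ E m, e.eval E m ≤ C * (m.nat 0 0 + m.nat 0 1 + 1)) :
    (Prog.count x y e ts).LinearLoops :=
  ⟨trivial, he, linearLoops_branch (by trivial) (by trivial) ts⟩

open scoped Classical in
-- The clause may read any memory that differs from the initial one in `x` and `y` only. This is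
-- exactly what earlier rounds can have changed.
theorem run_count {E : ℕ → ℕ → Prop} {x y : ℕ} {e : NExpr} {ts : Clause} {m : Mem} {K : ℕ}
    (P : ℕ → Prop) (hxy : x ≠ y) (hK : e.eval E (m.setNat y 0 0) = K)
    (hP : ∀ i < K, ∀ m' : Mem, (∀ z, z ≠ x → z ≠ y → m'.nat z = m.nat z) → m'.real = m.real →
      m'.nat x 0 = i → (ts.holds E m' ↔ P i)) :
    ((Prog.count x y e ts).run E m).1.nat y 0 = ((Finset.range K).filter P).card := by
  simp only [Prog.count, Prog.run.eq_3, Prog.run.eq_1, NExpr.eval]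
  refine (loop_induction (K := K) hK (fun i m' =>
    (∀ z, z ≠ x → z ≠ y → m'.nat z = m.nat z) ∧ m'.real = m.real ∧
      m'.nat y 0 = ((Finset.range i).filter P).card) ?_ ?_).2.2
  · refine ⟨fun z _ h => by simp [h], rfl, by simp⟩
  · rintro i m' hi ⟨h1, h2, h3⟩
    have hh := hP i hi (m'.setNat x 0 i) (fun z hz hz' => by simp [hz, h1 z hz hz']) h2 (by simp)
    rw [Finset.range_add_one, Finset.filter_insert]
    by_cases h : P i
    · rw [run_branch_pos _ _ (hh.2 h)]
      simp only [h, if_true]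
      refine ⟨fun z hz hz' => by simp [Prog.run, hz, hz', h1 z hz hz'], h2, ?_⟩
      rw [Finset.card_insert_of_notMem (by simp)]
      simp [Prog.run, NExpr.eval, hxy.symm, h3]
    · rw [run_branch_neg _ _ (fun h' => h (hh.1 h')), run_skip]
      simp only [h, if_false]
      refine ⟨fun z hz hz' => by simp [hz, h1 z hz hz'], h2, by simp [hxy.symm, h3]⟩

/-- Store in the variable `y` the last value of the counter `x` for which a clause holds. -/
def Prog.last (x y : ℕ) (e : NExpr) (ts : Clause) : Prog :=
  .loop x e (.branch (.setNat y (.const 0) (.var x)) (.skip y) ts)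

theorem writesReal_last (x y : ℕ) (e : NExpr) (ts : Clause) :
    (Prog.last x y e ts).writesReal = ∅ := by
  have := writesReal_branch_subset (.setNat y (.const 0) (.var x)) (.skip y) ts
  simp only [Prog.writesReal, Set.union_self, Set.subset_empty_iff] at this
  simp [Prog.last, Prog.writesReal, this]

theorem linearLoops_last {x y : ℕ} {e : NExpr} {ts : Clause}
    (he : ∃ C, ∀ E m, e.eval E m ≤ C * (m.nat 0 0 + m.nat 0 1 + 1)) :
    (Prog.last x y e ts).LinearLoops :=
  ⟨he, linearLoops_branch (by trivial) (by trivial) ts⟩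

/-- Taking the last hit makes the choice of the program a definite mathematical object, which the
schedule can refer to. Without a hit the variable keeps its old value, so existence is assumed. -/
theorem run_last {E : ℕ → ℕ → Prop} {x y : ℕ} {e : NExpr} {ts : Clause} {m : Mem} {K : ℕ}
    (P : ℕ → Prop) (hxy : x ≠ y) (hK : e.eval E m = K)
    (hP : ∀ i < K, ∀ m' : Mem, (∀ z, z ≠ x → z ≠ y → m'.nat z = m.nat z) → m'.real = m.real →
      m'.nat x 0 = i → (ts.holds E m' ↔ P i)) (hex : ∃ i < K, P i) :
    ((Prog.last x y e ts).run E m).1.nat y 0 < K ∧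
      P (((Prog.last x y e ts).run E m).1.nat y 0) ∧
      ∀ i < K, P i → i ≤ ((Prog.last x y e ts).run E m).1.nat y 0 := by
  refine (loop_induction (E := E) (x := x)
    (p := .branch (.setNat y (.const 0) (.var x)) (.skip y) ts) (K := K) hK (fun i m' =>
    (∀ z, z ≠ x → z ≠ y → m'.nat z = m.nat z) ∧ m'.real = m.real ∧
      ((∃ j < i, P j) → m'.nat y 0 < i ∧ P (m'.nat y 0) ∧ ∀ j < i, P j → j ≤ m'.nat y 0))
    ?_ ?_).2.2 hex
  · exact ⟨fun _ _ _ => rfl, rfl, by simp⟩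
  · rintro i m' hi ⟨h1, h2, h3⟩
    have hh := hP i hi (m'.setNat x 0 i) (fun z hz hz' => by simp [hz, h1 z hz hz']) h2 (by simp)
    by_cases h : P i
    · rw [run_branch_pos _ _ (hh.2 h)]
      refine ⟨fun z hz hz' => by simp [Prog.run, hz, hz', h1 z hz hz'], h2, fun _ => ?_⟩
      simp only [Prog.run, NExpr.eval, Mem.setNat_nat_self, Function.update_self]
      exact ⟨by omega, h, fun j hj _ => by omega⟩
    · rw [run_branch_neg _ _ (fun h' => h (hh.1 h')), run_skip]
      refine ⟨fun z hz hz' => by simp [hz, h1 z hz hz'], h2, ?_⟩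
      rintro ⟨j, hj, hPj⟩
      rw [Mem.setNat_nat_ne _ _ _ hxy.symm]
      have hne : j ≠ i := fun hji => h (hji ▸ hPj)
      obtain ⟨h4, h5, h6⟩ := h3 ⟨j, by omega, hPj⟩
      refine ⟨by omega, h5, fun j' hj' hP' => h6 j' ?_ hP'⟩
      have : j' ≠ i := fun hji => h (hji ▸ hP')
      omega

/-- A loop whose round `i` sets entry `i` of the array `y` of naturals. -/
theorem run_loop_fillNat {E : ℕ → ℕ → Prop} {x y : ℕ} {e : NExpr} {p : Prog} {m : Mem} {K : ℕ}
    (val : ℕ → ℕ) (hxy : x ≠ y) (hK : e.eval E m = K)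
    (hp : ∀ i < K, ∀ m' : Mem, (∀ z, z ≠ x → z ≠ y → z ∉ p.writesNat → m'.nat z = m.nat z) →
      (∀ z, z ∉ p.writesReal → m'.real z = m.real z) → m'.nat x 0 = i →
      -- The body may read the array it is filling: entries below `i` are new and the others are
      -- still old. Breadth-first search updates its levels in place in this way.
      (m'.nat y = fun j => if j < i then val j else m.nat y j) →
      (p.run E m').1.nat y = Function.update (m'.nat y) i (val i)) :
    ((Prog.loop x e p).run E m).1.nat y = fun j => if j < K then val j else m.nat y j := by
  refine (loop_induction (E := E) (x := x) (p := p) (K := K) hK (fun i m' =>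
    (∀ z, z ≠ x → z ∉ p.writesNat → m'.nat z = m.nat z) ∧
    (∀ z, z ∉ p.writesReal → m'.real z = m.real z) ∧
    m'.nat y = fun j => if j < i then val j else m.nat y j) ?_ ?_).2.2
  · exact ⟨fun _ _ _ => rfl, fun _ _ => rfl, by simp⟩
  · rintro i m' hi ⟨h1, h2, h3⟩
    refine ⟨fun z hz hz' => ?_, fun z hz => ?_, ?_⟩
    · rw [run_nat_frame E p _ hz', Mem.setNat_nat_ne _ _ _ hz, h1 z hz hz']
    · rw [run_real_frame E p _ hz, Mem.setNat_real, h2 z hz]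
    · rw [hp i hi (m'.setNat x 0 i) (fun z hz _ hz' => by simp [hz, h1 z hz hz']) h2 (by simp)
        (by rw [Mem.setNat_nat_ne _ _ _ hxy.symm, h3]), Mem.setNat_nat_ne _ _ _ hxy.symm, h3]
      funext j
      by_cases hj : j = i
      · subst hj; simp
      · rw [Function.update_of_ne hj]
        have : j < i + 1 ↔ j < i := by omega
        simp [this]

/-- A loop whose round `i` sets entry `i` of the array `y` of reals. -/
theorem run_loop_fillReal {E : ℕ → ℕ → Prop} {x y : ℕ} {e : NExpr} {p : Prog} {m : Mem} {K : ℕ}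
    (val : ℕ → ℝ) (hK : e.eval E m = K)
    (hp : ∀ i < K, ∀ m' : Mem, (∀ z, z ≠ x → z ∉ p.writesNat → m'.nat z = m.nat z) →
      (∀ z, z ≠ y → z ∉ p.writesReal → m'.real z = m.real z) → m'.nat x 0 = i →
      (m'.real y = fun j => if j < i then val j else m.real y j) →
      (p.run E m').1.real y = Function.update (m'.real y) i (val i)) :
    ((Prog.loop x e p).run E m).1.real y = fun j => if j < K then val j else m.real y j := by
  refine (loop_induction (E := E) (x := x) (p := p) (K := K) hK (fun i m' =>
    (∀ z, z ≠ x → z ∉ p.writesNat → m'.nat z = m.nat z) ∧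
    (∀ z, z ∉ p.writesReal → m'.real z = m.real z) ∧
    m'.real y = fun j => if j < i then val j else m.real y j) ?_ ?_).2.2
  · exact ⟨fun _ _ _ => rfl, fun _ _ => rfl, by simp⟩
  · rintro i m' hi ⟨h1, h2, h3⟩
    refine ⟨fun z hz hz' => ?_, fun z hz => ?_, ?_⟩
    · rw [run_nat_frame E p _ hz', Mem.setNat_nat_ne _ _ _ hz, h1 z hz hz']
    · rw [run_real_frame E p _ hz, Mem.setNat_real, h2 z hz]
    · rw [hp i hi (m'.setNat x 0 i) (fun z hz hz' => by simp [hz, h1 z hz hz'])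
        (fun z _ hz => h2 z hz) (by simp) (by rw [Mem.setNat_real, h3]), Mem.setNat_real, h3]
      funext j
      by_cases hj : j = i
      · subst hj; simp
      · rw [Function.update_of_ne hj]
        have : j < i + 1 ↔ j < i := by omega
        simp [this]

end RAM
end GSBM

namespace GSBM

/-! ### Geometry of blocks -/

theorem sideLen_pos (d : ℕ) {n : ℕ} (hn : 2 ≤ n) : 0 < sideLen d n :=
  Real.rpow_pos_of_pos (by positivity) _

theorem log_pos_of_two_le {n : ℕ} (hn : 2 ≤ n) : 0 < Real.log n :=
  Real.log_pos (by exact_mod_cast (by omega : 1 < n))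

theorem radius_pos (d : ℕ) {n : ℕ} (hn : 2 ≤ n) : 0 < radius d n :=
  Real.rpow_pos_of_pos (log_pos_of_two_le hn) _

theorem sideLen_pow {d : ℕ} (hd : 0 < d) (n : ℕ) : sideLen d n ^ d = n := by
  rw [sideLen, one_div, Real.rpow_inv_natCast_pow (by positivity) hd.ne']

theorem radius_pow {d : ℕ} (hd : 0 < d) (n : ℕ) : radius d n ^ d = Real.log n := by
  rw [radius, one_div, Real.rpow_inv_natCast_pow (Real.log_natCast_nonneg n) hd.ne']

theorem blocksPerSide_eq {d n : ℕ} {χ : ℝ} (hχ : 0 < χ) :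
    blocksPerSide d n χ = ⌈sideLen d n / (χ ^ (1 / (d : ℝ)) * radius d n)⌉₊ := by
  rw [blocksPerSide, sideLen, radius, ← Real.mul_rpow hχ.le (Real.log_natCast_nonneg n),
    Real.div_rpow (by positivity) (mul_nonneg hχ.le (Real.log_natCast_nonneg n))]

theorem blocksPerSide_pos {d n : ℕ} {χ : ℝ} (hn : 2 ≤ n) (hχ : 0 < χ) :
    0 < blocksPerSide d n χ := by
  rw [blocksPerSide_eq hχ, Nat.ceil_pos]
  exact div_pos (sideLen_pos d hn) (mul_pos (Real.rpow_pos_of_pos hχ _) (radius_pos d hn))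

/-- Side length of a block. -/
def cellSide (d n : ℕ) (χ : ℝ) : ℝ := sideLen d n / blocksPerSide d n χ

theorem cellSide_pos {d n : ℕ} {χ : ℝ} (hn : 2 ≤ n) (hχ : 0 < χ) : 0 < cellSide d n χ :=
  div_pos (sideLen_pos d hn) (by exact_mod_cast blocksPerSide_pos hn hχ)

theorem blocksPerSide_mul_cellSide {d n : ℕ} {χ : ℝ} (hn : 2 ≤ n) (hχ : 0 < χ) :
    blocksPerSide d n χ * cellSide d n χ = sideLen d n := by
  have : (blocksPerSide d n χ : ℝ) ≠ 0 := by exact_mod_cast (blocksPerSide_pos hn hχ).ne'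
  rw [cellSide]; field_simp

theorem cellSide_le {d n : ℕ} {χ : ℝ} (hn : 2 ≤ n) (hχ : 0 < χ) :
    cellSide d n χ ≤ χ ^ (1 / (d : ℝ)) * radius d n := by
  have h1 := mul_pos (Real.rpow_pos_of_pos hχ (1 / (d : ℝ))) (radius_pos d hn)
  have h2 : sideLen d n / (χ ^ (1 / (d : ℝ)) * radius d n) ≤ blocksPerSide d n χ := by
    rw [blocksPerSide_eq hχ]; exact Nat.le_ceil _
  rw [cellSide, div_le_iff₀ (by exact_mod_cast blocksPerSide_pos hn hχ)]
  rw [div_le_iff₀ h1] at h2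
  linarith

theorem blockIndex_lt {d n : ℕ} {χ : ℝ} (hn : 2 ≤ n) (hχ : 0 < χ) (x : Fin d → ℝ) (j : Fin d) :
    blockIndex d n χ x j < blocksPerSide d n χ := by
  have := blocksPerSide_pos (d := d) hn hχ
  simp only [blockIndex]
  omega

theorem blockIndex_mul_le {d n : ℕ} {χ : ℝ} (hn : 2 ≤ n) (hχ : 0 < χ) {x : Fin d → ℝ}
    (hx : x ∈ region d n) (j : Fin d) :
    blockIndex d n χ x j * cellSide d n χ ≤ x j + sideLen d n / 2 := by
  have hs := cellSide_pos (d := d) hn hχ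
  have hx0 : 0 ≤ x j + sideLen d n / 2 := by linarith [(hx j).1]
  rw [← le_div_iff₀ hs]
  refine le_trans ?_ (Nat.floor_le (div_nonneg hx0 hs.le))
  exact_mod_cast min_le_left _ _

theorem le_blockIndex_mul {d n : ℕ} {χ : ℝ} (hn : 2 ≤ n) (hχ : 0 < χ) {x : Fin d → ℝ}
    (hx : x ∈ region d n) (j : Fin d) :
    x j + sideLen d n / 2 ≤ (blockIndex d n χ x j + 1) * cellSide d n χ := by
  have hs := cellSide_pos (d := d) hn hχ
  have hk := blocksPerSide_pos (d := d) hn hχ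
  have hL := blocksPerSide_mul_cellSide (d := d) hn hχ
  simp only [blockIndex]
  rcases min_choice ⌊(x j + sideLen d n / 2) / (sideLen d n / blocksPerSide d n χ)⌋₊
    (blocksPerSide d n χ - 1) with h | h <;> rw [h]
  -- If the floor is the minimum, the next multiple of the side bounds the point. Otherwise the
  -- block is the last one and the face of the region does.
  · rw [← div_le_iff₀ hs]
    exact (Nat.lt_floor_add_one _).le
  · rw [Nat.cast_sub hk]
    push_cast
    rw [sub_add_cancel, hL]
    linarith [(hx j).2]

/-- Offsets stay strictly below one, because a point on an upper face belongs to the next block. -/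
theorem mem_block_of_offset {d n : ℕ} {χ : ℝ} (hn : 2 ≤ n) (hχ : 0 < χ) {i : Fin d → ℕ}
    (hi : ∀ j, i j < blocksPerSide d n χ) {t : Fin d → ℝ} (ht0 : ∀ j, 0 ≤ t j)
    (ht1 : ∀ j, t j < 1) :
    (fun j => (i j + t j) * cellSide d n χ - sideLen d n / 2) ∈ block d n χ i := by
  have hs := cellSide_pos (d := d) hn hχ
  have hL := blocksPerSide_mul_cellSide (d := d) hn hχ
  refine ⟨fun j => ⟨?_, ?_⟩, ?_⟩
  · have : 0 ≤ (i j + t j) * cellSide d n χ :=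
      mul_nonneg (add_nonneg (Nat.cast_nonneg _) (ht0 j)) hs.le
    linarith
  · have h1 : (i j + t j : ℝ) ≤ blocksPerSide d n χ := by
      have : (i j : ℝ) + 1 ≤ blocksPerSide d n χ := by exact_mod_cast hi j
      linarith [ht1 j]
    have := mul_le_mul_of_nonneg_right h1 hs.le
    linarith
  · funext j
    have h1 : ((i j + t j) * cellSide d n χ - sideLen d n / 2 + sideLen d n / 2) /
        (sideLen d n / blocksPerSide d n χ) = i j + t j := by
      rw [sub_add_cancel]
      exact mul_div_cancel_right₀ _ hs.ne'
    have h2 : ⌊(i j + t j : ℝ)⌋₊ = i j := by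
      rw [Nat.floor_eq_iff (add_nonneg (Nat.cast_nonneg _) (ht0 j))]
      exact ⟨by linarith [ht0 j], by linarith [ht1 j]⟩
    simp only [blockIndex]
    rw [h1, h2]
    have := hi j
    omega

/-- Twice the supremum, in units of the block side, of the cyclic distance between points of the
intervals `a` and `b` of a circle that is divided into `k` intervals. -/
def cellExtent (k a b : ℕ) : ℕ :=
  min k (2 * (min (a - b + (b - a)) (k - (a - b + (b - a))) + 1))

theorem cast_natDist (a b : ℕ) : ((a - b + (b - a) : ℕ) : ℝ) = |(a : ℝ) - b| := by
  rcases le_total a b with h | h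
  · rw [Nat.sub_eq_zero_of_le h, zero_add, Nat.cast_sub h, abs_sub_comm, abs_of_nonneg]
    simpa using h
  · rw [Nat.sub_eq_zero_of_le h, add_zero, Nat.cast_sub h, abs_of_nonneg]
    simpa using h

theorem cast_cellExtent {k a b : ℕ} (ha : a < k) (hb : b < k) :
    (cellExtent k a b : ℝ) =
      min (k : ℝ) (2 * (min |(a : ℝ) - b| (k - |(a : ℝ) - b|) + 1)) := by
  have h := cast_natDist a b
  have hD : a - b + (b - a) ≤ k := by omega
  rw [cellExtent]
  generalize a - b + (b - a) = D at h hD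
  rw [← h]
  push_cast [Nat.cast_sub hD]
  rfl

/-- The difference |x - y| lies within s of |a - b|s, which bounds both arcs, and the shorter arc
never exceeds half the circle. These three bounds are the entries of the minimum in `cellExtent`. -/
theorem min_dist_le_extent {k a b : ℕ} {s x y : ℝ} (ha : a < k) (hb : b < k) (hs : 0 < s)
    (hx : a * s ≤ x) (hx' : x ≤ (a + 1) * s) (hy : b * s ≤ y) (hy' : y ≤ (b + 1) * s) :
    0 ≤ min |x - y| (k * s - |x - y|) ∧
      min |x - y| (k * s - |x - y|) ≤ s / 2 * cellExtent k a b := by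
  have ha' : (a : ℝ) + 1 ≤ k := by exact_mod_cast ha
  have hb' : (b : ℝ) + 1 ≤ k := by exact_mod_cast hb
  have h1 := mul_le_mul_of_nonneg_right ha' hs.le
  have h2 := mul_le_mul_of_nonneg_right hb' hs.le
  have h3 : 0 ≤ (a : ℝ) * s := by positivity
  have h4 : 0 ≤ (b : ℝ) * s := by positivity
  have hub : |x - y| ≤ (|(a : ℝ) - b| + 1) * s := by
    rw [abs_le]
    have e1 := mul_le_mul_of_nonneg_right (le_abs_self ((a : ℝ) - b)) hs.le
    have e2 := mul_le_mul_of_nonneg_right (neg_abs_le ((a : ℝ) - b)) hs.le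
    constructor <;> linarith
  have hlb : (|(a : ℝ) - b| - 1) * s ≤ |x - y| := by
    rcases abs_cases ((a : ℝ) - b) with ⟨h, _⟩ | ⟨h, _⟩ <;> rw [h]
    · have := le_abs_self (x - y); linarith
    · have := neg_abs_le (x - y); linarith
  refine ⟨le_min (abs_nonneg _) ?_, ?_⟩
  · rw [sub_nonneg, abs_le]; constructor <;> linarith
  rw [cast_cellExtent ha hb]
  have hhalf : min |x - y| (k * s - |x - y|) ≤ s / 2 * k := by
    rcases le_total |x - y| (s / 2 * k) with h | h
    · exact (min_le_left _ _).trans h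
    · exact (min_le_right _ _).trans (by linarith)
  rcases min_choice (k : ℝ) (2 * (min |(a : ℝ) - b| (k - |(a : ℝ) - b|) + 1)) with h | h <;> rw [h]
  · exact hhalf
  · rcases min_choice |(a : ℝ) - b| (k - |(a : ℝ) - b|) with h | h <;> rw [h]
    · exact (min_le_left _ _).trans (by linarith)
    · exact (min_le_right _ _).trans (by linarith)

/-- The extent is a supremum that need not be attained by half-open intervals, so it is approached
up to ε. -/
theorem exists_near_extent {k a b : ℕ} (ha : a < k) (hb : b < k) {ε : ℝ} (h0 : 0 < ε)
    (h1 : ε ≤ 1 / 2) : ∃ t t' : ℝ, 0 ≤ t ∧ t < 1 ∧ 0 ≤ t' ∧ t' < 1 ∧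
      (cellExtent k a b : ℝ) / 2 - ε ≤
        min |(a + t : ℝ) - (b + t')| (k - |(a + t : ℝ) - (b + t')|) := by
  wlog hab : b ≤ a generalizing a b
  · obtain ⟨t, t', h⟩ := this hb ha (by omega)
    refine ⟨t', t, h.2.2.1, h.2.2.2.1, h.1, h.2.1, ?_⟩
    rw [abs_sub_comm, cellExtent, add_comm (a - b)]
    exact h.2.2.2.2
  have hext := cast_cellExtent ha hb
  have hab' : (b : ℝ) ≤ a := by exact_mod_cast hab
  rw [abs_of_nonneg (by linarith)] at hext
  obtain ⟨m, hm⟩ : ∃ m : ℝ, m = (a : ℝ) - b := ⟨_, rfl⟩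
  have hm0 : 0 ≤ m := by linarith
  have hmk : m + 1 ≤ k := by
    have : (a : ℝ) + 1 ≤ k := by exact_mod_cast ha
    have : (0 : ℝ) ≤ b := by positivity
    linarith
  rw [← hm] at hext
  set X : ℝ := (cellExtent k a b : ℝ)
  have hX1 : X ≤ k := by rw [hext]; exact min_le_left _ _
  have hX2 : X ≤ 2 * (m + 1) := by
    rw [hext]; exact (min_le_right _ _).trans (by linarith [min_le_left m (k - m)])
  have hX3 : X ≤ 2 * (k - m + 1) := by
    rw [hext]; exact (min_le_right _ _).trans (by linarith [min_le_right m (k - m)])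
  -- A difference u of positions can be any number in [m - 1 + ε, m + 1 - ε]. The best choice is the
  -- point of this interval nearest to the antipodal value k/2.
  obtain ⟨u, hu1, hu2, hu3, hu4⟩ : ∃ u : ℝ, m - 1 + ε ≤ u ∧ u ≤ m + 1 - ε ∧ X / 2 - ε ≤ u ∧
      X / 2 - ε ≤ k - u := by
    rcases le_total (m + 1 - ε) (k / 2) with h | h
    · exact ⟨m + 1 - ε, by linarith, le_rfl, by linarith, by linarith⟩
    · rcases le_total (k / 2 : ℝ) (m - 1 + ε) with h' | h'
      · exact ⟨m - 1 + ε, le_rfl, by linarith, by linarith, by linarith⟩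
      · exact ⟨k / 2, h', h, by linarith, by linarith⟩
  have key : ∀ t t' : ℝ, t - t' = u - m →
      X / 2 - ε ≤ min |(a + t : ℝ) - (b + t')| (k - |(a + t : ℝ) - (b + t')|) := by
    intro t t' htt
    have : (a + t : ℝ) - (b + t') = u := by linarith
    rw [this, le_min_iff]
    refine ⟨hu3.trans (le_abs_self u), ?_⟩
    rcases abs_cases u with ⟨h, _⟩ | ⟨h, _⟩ <;> rw [h]
    · exact hu4
    · linarith
  rcases le_total 0 (u - m) with h | h
  · exact ⟨u - m, 0, h, by linarith, le_rfl, one_pos, key _ _ (by ring)⟩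
  · exact ⟨0, m - u, le_rfl, one_pos, by linarith, by linarith, key _ _ (by ring)⟩

/-- Visibility of blocks in terms of their coordinates. -/
theorem visible_iff {d n : ℕ} {χ : ℝ} (hn : 2 ≤ n) (hχ : 0 < χ) {i j : Fin d → ℕ}
    (hi : ∀ l, i l < blocksPerSide d n χ) (hj : ∀ l, j l < blocksPerSide d n χ) :
    Visible d n χ i j ↔
      ∑ l, (cellSide d n χ / 2 * cellExtent (blocksPerSide d n χ) (i l) (j l)) ^ 2 ≤
        radius d n ^ 2 := by
  have hs := cellSide_pos (d := d) hn hχ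
  have hr := radius_pos d hn
  have hL := blocksPerSide_mul_cellSide (d := d) hn hχ
  constructor
  · intro h
    have key : ∀ ε : ℝ, 0 < ε → ε ≤ 1 / 2 →
        ∑ l, (cellSide d n χ * ((cellExtent (blocksPerSide d n χ) (i l) (j l) : ℝ) / 2 - ε)) ^ 2 ≤
          radius d n ^ 2 := by
      intro ε h0 h1
      choose t t' ht0 ht1 ht0' ht1' htt using fun l => exists_near_extent (hi l) (hj l) h0 h1
      have h2 := h _ (mem_block_of_offset hn hχ hi ht0 ht1) _
        (mem_block_of_offset hn hχ hj ht0' ht1')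
      rw [torusDist, Real.sqrt_le_iff] at h2
      refine le_trans (Finset.sum_le_sum fun l _ => ?_) h2.2
      have hX : (1 : ℝ) ≤ cellExtent (blocksPerSide d n χ) (i l) (j l) := by
        have := hi l
        exact_mod_cast (by simp only [cellExtent]; omega :
          1 ≤ cellExtent (blocksPerSide d n χ) (i l) (j l))
      refine pow_le_pow_left₀ (mul_nonneg hs.le (by linarith)) ?_ 2
      refine (mul_le_mul_of_nonneg_left (htt l) hs.le).trans (le_of_eq ?_)
      rw [← hL, mul_min_of_nonneg _ _ hs.le]
      have e : (i l + t l) * cellSide d n χ - blocksPerSide d n χ * cellSide d n χ / 2 -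
          ((j l + t' l) * cellSide d n χ - blocksPerSide d n χ * cellSide d n χ / 2) =
          cellSide d n χ * ((i l + t l : ℝ) - (j l + t' l)) := by ring
      rw [e, abs_mul, abs_of_pos hs]
      congr 1
      ring
    -- Visibility only controls pairs inside the blocks. The bound at the extreme corners follows by
    -- letting ε tend to zero in a closed inequality.
    have hlim : Tendsto (fun ε : ℝ => ∑ l, (cellSide d n χ *
        ((cellExtent (blocksPerSide d n χ) (i l) (j l) : ℝ) / 2 - ε)) ^ 2) (𝓝[>] 0)
        (𝓝 (∑ l, (cellSide d n χ *
        ((cellExtent (blocksPerSide d n χ) (i l) (j l) : ℝ) / 2 - 0)) ^ 2)) := by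
      refine Tendsto.mono_left (Continuous.tendsto (by fun_prop) 0) nhdsWithin_le_nhds
    have := le_of_tendsto hlim (by
      filter_upwards [Ioc_mem_nhdsGT (show (0 : ℝ) < 1 / 2 by norm_num)] with ε hε
      exact key ε hε.1 hε.2)
    refine le_trans (le_of_eq (Finset.sum_congr rfl fun l _ => ?_)) this
    ring
  · intro h x hx y hy
    rw [torusDist, Real.sqrt_le_iff]
    refine ⟨hr.le, le_trans (Finset.sum_le_sum fun l _ => ?_) h⟩
    have hxl := blockIndex_mul_le hn hχ hx.1 l
    have hxu := le_blockIndex_mul hn hχ hx.1 l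
    have hyl := blockIndex_mul_le hn hχ hy.1 l
    have hyu := le_blockIndex_mul hn hχ hy.1 l
    rw [hx.2] at hxl hxu
    rw [hy.2] at hyl hyu
    have := min_dist_le_extent (hi l) (hj l) hs hxl hxu hyl hyu
    rw [hL, add_sub_add_right_eq_sub] at this
    exact pow_le_pow_left₀ this.1 this.2 2

end GSBM

namespace GSBM

/-! ### Spanning trees from parent maps -/

section ParentTree

variable {V : Type*} (H : SimpleGraph V) (root : V) (par : V → V)

/-- The graph whose edges join `v ≠ root` to `par v`. -/
def parentGraph : SimpleGraph V :=
  SimpleGraph.fromRel fun x y => y ≠ root ∧ x = par y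

variable {H root par}

theorem parentGraph_adj (hadj : ∀ v, v ≠ root → H.Adj (par v) v) {v : V} (hv : v ≠ root) :
    (parentGraph root par).Adj (par v) v := by
  rw [parentGraph, SimpleGraph.fromRel_adj]
  exact ⟨(hadj v hv).ne, Or.inl ⟨hv, rfl⟩⟩

theorem parentGraph_le (hadj : ∀ v, v ≠ root → H.Adj (par v) v) : parentGraph root par ≤ H := by
  intro x y h
  rw [parentGraph, SimpleGraph.fromRel_adj] at h
  rcases h.2 with ⟨h', rfl⟩ | ⟨h', rfl⟩
  · exact hadj _ h'
  · exact (hadj _ h').symm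

theorem parentGraph_exists_walk (hadj : ∀ v, v ≠ root → H.Adj (par v) v)
    (hdist : ∀ v, v ≠ root → H.dist root v = H.dist root (par v) + 1) (v : V) :
    ∃ p : (parentGraph root par).Walk root v, p.length = H.dist root v := by
  induction h : H.dist root v using Nat.strong_induction_on generalizing v with
  | _ m ih =>
    by_cases hv : v = root
    · subst hv
      exact ⟨.nil, by simpa using h⟩
    · have h1 := hdist v hv
      obtain ⟨p, hp⟩ := ih _ (by omega) (par v) rfl
      refine ⟨p.concat (parentGraph_adj hadj hv), ?_⟩
      rw [SimpleGraph.Walk.length_concat, hp]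
      omega

/-- A subgraph has distances at least as large, and following parents gives a walk of the original
length. -/
theorem parentGraph_dist (hadj : ∀ v, v ≠ root → H.Adj (par v) v)
    (hdist : ∀ v, v ≠ root → H.dist root v = H.dist root (par v) + 1) (v : V) :
    (parentGraph root par).dist root v = H.dist root v := by
  obtain ⟨p, hp⟩ := parentGraph_exists_walk hadj hdist v
  refine le_antisymm (hp ▸ SimpleGraph.dist_le p) ?_
  obtain ⟨q, hq⟩ := p.reachable.exists_walk_length_eq_dist
  rw [← hq, ← SimpleGraph.Walk.length_mapLe (parentGraph_le hadj) q]
  exact SimpleGraph.dist_le _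

/-- A connected graph is a tree if it has one edge fewer than vertices. Every edge here comes from
some v ≠ root, so there are at most |V| - 1 of them. -/
theorem parentGraph_isTree [Finite V] (hadj : ∀ v, v ≠ root → H.Adj (par v) v)
    (hdist : ∀ v, v ≠ root → H.dist root v = H.dist root (par v) + 1) :
    (parentGraph root par).IsTree := by
  have hc : (parentGraph root par).Connected :=
    (SimpleGraph.connected_iff_exists_forall_reachable _).2
      ⟨root, fun v => (parentGraph_exists_walk hadj hdist v).choose.reachable⟩
  refine SimpleGraph.isTree_iff_connected_and_card.2
    ⟨hc, le_antisymm ?_ hc.card_vert_le_card_edgeSet_add_one⟩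
  have hsub : (parentGraph root par).edgeSet ⊆ (fun v => s(par v, v)) '' {v | v ≠ root} := by
    intro e
    induction e using Sym2.ind with
    | _ x y =>
      intro h
      rw [SimpleGraph.mem_edgeSet, parentGraph, SimpleGraph.fromRel_adj] at h
      rcases h.2 with ⟨h', rfl⟩ | ⟨h', rfl⟩
      · exact ⟨y, h', rfl⟩
      · exact ⟨x, h', Sym2.eq_swap⟩
  have h1 : Nat.card (parentGraph root par).edgeSet ≤ ({v | v ≠ root} : Set V).ncard := by
    rw [Nat.card_coe_set_eq]
    exact (Set.ncard_le_ncard hsub (Set.toFinite _)).trans (Set.ncard_image_le (Set.toFinite _))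
  have h2 : ({v | v ≠ root} : Set V).ncard + 1 = Nat.card V := by
    have := Set.ncard_add_ncard_compl ({root} : Set V) (Set.toFinite _)
    rw [Set.ncard_singleton] at this
    rw [← this, add_comm]
    rfl
  omega

open scoped Classical in
/-- The schedule with a given parent map along which the distance to the root decreases. -/
def Schedule.ofParent [Finite V] (hadj : ∀ v, v ≠ root → H.Adj (par v) v)
    (hdist : ∀ v, v ≠ root → H.dist root v = H.dist root (par v) + 1) : Schedule H where
  tree := parentGraph root par
  tree_le := parentGraph_le hadj
  isTree := parentGraph_isTree hadj hdist
  root := root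
  parent := par
  parent_adj _ := parentGraph_adj hadj
  parent_dist v hv := by
    rw [parentGraph_dist hadj hdist, parentGraph_dist hadj hdist, hdist v hv]
  order := (Set.toFinite (Set.univ : Set V)).toFinset.toList.mergeSort
    fun v w => (parentGraph root par).dist root v ≤ (parentGraph root par).dist root w
  nodup := (List.mergeSort_perm _ _).nodup_iff.2 (Finset.nodup_toList _)
  complete v := by rw [(List.mergeSort_perm _ _).mem_iff]; simp
  byLevel := by
    have := List.pairwise_mergeSort
      (le := fun v w => decide ((parentGraph root par).dist root v ≤
        (parentGraph root par).dist root w))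
      (fun a b c h h' => by simp only [decide_eq_true_eq] at *; omega)
      (fun a b => by simp only [Bool.or_eq_true, decide_eq_true_eq]; omega)
      (Set.toFinite (Set.univ : Set V)).toFinset.toList
    simpa using this

end ParentTree

/-! ### The labeling of Phase I through local equations -/

section PhaseI

variable {N : ℕ} (G : SimpleGraph (Fin N)) (a b : ℝ)

open scoped Classical in
-- The new label reads the old labeling on the parent block only.
theorem propagate_apply_congr {S S' : Finset (Fin N)} {σ σ' : Fin N → SignType}
    (h : ∀ v ∈ S, σ v = σ' v) {u : Fin N} (hu : u ∈ S') :
    propagate G a b S S' σ u = propagate G a b S S' σ' u := by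
  have h1 : ∀ s, numLabel σ S s = numLabel σ' S s := fun s => by
    unfold numLabel
    congr 1
    exact Finset.filter_congr fun v hv => by rw [h v hv]
  have h2 : ∀ s, degPlus G σ S s u = degPlus G σ' S s u := fun s => by
    unfold degPlus
    congr 1
    exact Finset.filter_congr fun v hv => by rw [h v hv]
  simp only [propagate, hu, if_true, h1, h2]

theorem propagate_of_notMem {S S' : Finset (Fin N)} {σ : Fin N → SignType} {u : Fin N}
    (hu : u ∉ S') : propagate G a b S S' σ u = σ u := by
  simp [propagate, hu]

/-- The local equations of Phase I: a labeling is determined by the reference vertex in the root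
block, and by the labels of the parent block in all other occupied blocks. -/
structure IsPhaseILabeling {d n : ℕ} {χ δ : ℝ} (β : Fin N → Fin d → ℕ)
    (s : Schedule (visGraph n χ δ β)) (u₀ : Fin N) (σ : Fin N → SignType) : Prop where
  root : ∀ v ∈ vertsIn β s.root.1, σ v = pairwiseClassify G a b (vertsIn β s.root.1) u₀ v
  step : ∀ i, i ≠ s.root → ∀ v ∈ vertsIn β i.1,
    σ v = propagate G a b (vertsIn β (s.parent i).1) (vertsIn β i.1) σ v
  outside : ∀ v, ¬ Occupied n δ β (β v) → σ v = 0

theorem mem_vertsIn {d : ℕ} {β : Fin N → Fin d → ℕ} {i : Fin d → ℕ} {v : Fin N} :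
    v ∈ vertsIn β i ↔ β v = i := by simp [vertsIn]

open scoped Classical in
-- A vertex keeps its label unless its own block, different from the root, occurs in the list.
theorem foldl_propagate_apply {d n : ℕ} {χ δ : ℝ} {β : Fin N → Fin d → ℕ}
    {s : Schedule (visGraph n χ δ β)} (l : List {i : Fin d → ℕ // Occupied n δ β i})
    (σ : Fin N → SignType) (v : Fin N) (h : ∀ i ∈ l, i.1 = β v → i = s.root) :
    l.foldl (fun σ i => if i = s.root then σ
      else propagate G a b (vertsIn β (s.parent i).1) (vertsIn β i.1) σ) σ v = σ v := by
  induction l generalizing σ with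
  | nil => rfl
  | cons i l ih =>
    rw [List.foldl_cons, ih _ fun j hj => h j (List.mem_cons_of_mem _ hj)]
    split_ifs with hi
    · rfl
    · refine propagate_of_notMem G a b fun hv => hi (h i List.mem_cons_self ?_)
      exact (mem_vertsIn.1 hv).symm

open scoped Classical in
-- The order is cut at block i. Its parent has smaller level and so does not occur from i on: the
-- parent's labels are already final when i is treated, and those of i are final afterwards. This
-- replaces the fold by equations for the final labeling, so that the order matters no longer.
theorem isPhaseILabeling_phaseI {d n : ℕ} {χ δ : ℝ} {β : Fin N → Fin d → ℕ}
    (s : Schedule (visGraph n χ δ β)) (u₀ : Fin N) :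
    IsPhaseILabeling G a b β s u₀ (phaseI G a b β s u₀) where
  root v hv := by
    rw [phaseI, foldl_propagate_apply]
    · simp [hv]
    · intro i _ hi
      exact Subtype.ext (hi.trans (mem_vertsIn.1 hv))
  outside v hv := by
    rw [phaseI, foldl_propagate_apply]
    · have : v ∉ vertsIn β s.root.1 := fun h => hv (by rw [mem_vertsIn.1 h]; exact s.root.2)
      simp [this]
    · intro i _ hi
      exact absurd (hi ▸ i.2) hv
  step i hi v hv := by
    obtain ⟨l, l', hl⟩ := List.append_of_mem (s.complete i)
    have hnd := s.nodup
    have hlev := s.byLevel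
    rw [hl] at hnd hlev
    have hil : i ∉ l := fun h => by
      have := (List.nodup_append.1 hnd).2.2 i h i List.mem_cons_self
      exact this rfl
    have hil' : i ∉ l' := (List.nodup_cons.1 (List.nodup_append.1 hnd).2.1).1
    -- By the ordering, blocks after i have level at least that of i, while the level of the parent
    -- is smaller by one.
    have hpar : s.parent i ∉ i :: l' := by
      intro h
      have hd := s.parent_dist i hi
      rcases List.mem_cons.1 h with h | h
      · rw [h] at hd; omega
      · have := (List.pairwise_cons.1 (List.pairwise_append.1 hlev).2.1).1 _ h
        omega
    have hne : i.1 ≠ (s.parent i).1 := fun h => by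
      have hd := s.parent_dist i hi
      rw [← Subtype.ext h] at hd; omega
    set f := (fun (σ : Fin N → SignType) i => if i = s.root then σ
      else propagate G a b (vertsIn β (s.parent i).1) (vertsIn β i.1) σ) with hf
    set σ₀ : Fin N → SignType := fun v => if v ∈ vertsIn β s.root.1 then
      pairwiseClassify G a b (vertsIn β s.root.1) u₀ v else 0
    have hfin : phaseI G a b β s u₀ = l'.foldl f (f (l.foldl f σ₀) i) := by
      rw [phaseI, hl, List.foldl_append, List.foldl_cons]
    have h1 : phaseI G a b β s u₀ v =
        propagate G a b (vertsIn β (s.parent i).1) (vertsIn β i.1) (l.foldl f σ₀) v := by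
      rw [hfin, foldl_propagate_apply]
      · simp [hf, hi]
      · intro j hj hjv
        exact absurd ((Subtype.ext (hjv.trans (mem_vertsIn.1 hv)) : j = i) ▸ hj) hil'
    rw [h1]
    refine propagate_apply_congr G a b (fun w hw => Eq.symm ?_) hv
    rw [hfin, foldl_propagate_apply]
    · simp only [hf, hi, if_false]
      rw [propagate_of_notMem]
      intro hw'
      exact hne ((mem_vertsIn.1 hw').symm.trans (mem_vertsIn.1 hw))
    · intro j hj hjw
      exact absurd (List.mem_cons_of_mem _
        ((Subtype.ext (hjw.trans (mem_vertsIn.1 hw)) : j = s.parent i) ▸ hj)) hpar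

theorem Schedule.induction {V : Type*} {H : SimpleGraph V} (s : Schedule H) {P : V → Prop}
    (hroot : P s.root) (hstep : ∀ v, v ≠ s.root → P (s.parent v) → P v) (v : V) : P v := by
  induction h : s.tree.dist s.root v using Nat.strong_induction_on generalizing v with
  | _ m ih =>
    by_cases hv : v = s.root
    · rwa [hv]
    · have := s.parent_dist v hv
      exact hstep v hv (ih _ (by omega) _ rfl)

end PhaseI

end GSBM

namespace GSBM

/-! ### Breadth-first schedules -/

section BFS

variable {d N n : ℕ} {χ δ : ℝ} {β : Fin N → Fin d → ℕ}

/-- For positive δ an occupied block contains a vertex. All searches over blocks can therefore run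
over vertices, of which there are finitely many even though block coordinates are arbitrary
naturals. -/
theorem Occupied.exists_vertex (hδ : 0 < δ) {i : Fin d → ℕ} (h : Occupied n δ β i) :
    ∃ v, β v = i := by
  have h1 : (0 : ℝ) < (vertsIn β i).card :=
    lt_of_le_of_lt (mul_nonneg hδ.le (Real.log_natCast_nonneg n)) h
  obtain ⟨v, hv⟩ := Finset.card_pos.1 (by exact_mod_cast h1 : 0 < (vertsIn β i).card)
  exact ⟨v, mem_vertsIn.1 hv⟩

theorem finite_occupied (hδ : 0 < δ) : Finite {i : Fin d → ℕ // Occupied n δ β i} :=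
  Finite.of_injective (fun i => (i.2.exists_vertex hδ).choose) fun i j h => by
    have hi := (i.2.exists_vertex hδ).choose_spec
    have hj := (j.2.exists_vertex hδ).choose_spec
    simp only at h
    rw [h] at hi
    exact Subtype.ext (hi.symm.trans hj)

theorem card_occupied_le (hδ : 0 < δ) : Nat.card {i : Fin d → ℕ // Occupied n δ β i} ≤ N := by
  have := Nat.card_le_card_of_injective
    (fun i : {i : Fin d → ℕ // Occupied n δ β i} => (i.2.exists_vertex hδ).choose) fun i j h => by
      have hi := (i.2.exists_vertex hδ).choose_spec
      have hj := (j.2.exists_vertex hδ).choose_spec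
      simp only at h
      rw [h] at hi
      exact Subtype.ext (hi.symm.trans hj)
  simpa using this

/-- The vertex before v on a shortest walk from r. -/
theorem exists_adj_dist_eq {V : Type*} {H : SimpleGraph V} {r v : V} {t : ℕ}
    (h : H.Reachable r v) (hd : H.dist r v = t + 1) :
    ∃ w, H.Adj w v ∧ H.Reachable r w ∧ H.dist r w = t := by
  obtain ⟨p, hp⟩ := h.symm.exists_walk_length_eq_dist
  rw [SimpleGraph.dist_comm, hd] at hp
  cases p with
  | nil => simp at hp
  | @cons _ w _ hadj q =>
    rw [SimpleGraph.Walk.length_cons] at hp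
    have h1 : H.dist r w ≤ t := by
      rw [SimpleGraph.dist_comm]; exact (SimpleGraph.dist_le q).trans (by omega)
    refine ⟨w, hadj.symm, q.reachable.symm, le_antisymm h1 ?_⟩
    obtain ⟨p', hp'⟩ := q.reachable.symm.exists_walk_length_eq_dist
    have := SimpleGraph.dist_le (p'.concat hadj.symm)
    rw [SimpleGraph.Walk.length_concat] at this
    omega

open scoped Classical in
/-- The largest index with a given property. -/
def lastSat (P : Fin N → Prop) (h : ∃ v, P v) : Fin N :=
  (Finset.univ.filter P).max' (by obtain ⟨v, hv⟩ := h; exact ⟨v, by simpa using hv⟩)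

theorem lastSat_spec (P : Fin N → Prop) (h : ∃ v, P v) : P (lastSat P h) := by
  classical
  have := Finset.max'_mem (Finset.univ.filter P)
    (by obtain ⟨v, hv⟩ := h; exact ⟨v, by simpa using hv⟩)
  simpa [lastSat] using this

theorem lastSat_eq {P : Fin N → Prop} (h : ∃ v, P v) {v : Fin N} (hv : P v)
    (hmax : ∀ w, P w → w ≤ v) : v = lastSat P h := by
  classical
  exact le_antisymm (Finset.le_max' _ _ (by simpa using hv)) (hmax _ (lastSat_spec P h))

theorem exists_occupied_vertex (hδ : 0 < δ) (h : (visGraph n χ δ β).Connected) :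
    ∃ v, Occupied n δ β (β v) := by
  obtain ⟨i⟩ := h.nonempty
  obtain ⟨v, hv⟩ := i.2.exists_vertex hδ
  exact ⟨v, hv ▸ i.2⟩

/-- The block of the last vertex that lies in an occupied block. -/
def bfsRoot (hδ : 0 < δ) (h : (visGraph n χ δ β).Connected) :
    {i : Fin d → ℕ // Occupied n δ β i} :=
  ⟨β (lastSat _ (exists_occupied_vertex hδ h)), lastSat_spec _ (exists_occupied_vertex hδ h)⟩

/-- The vertex `u` lies in an occupied block that is visible from `i` and closer to `r`. -/
def IsBfsParent (r i : {i : Fin d → ℕ // Occupied n δ β i}) (χ : ℝ) (u : Fin N) : Prop :=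
  ∃ h : Occupied n δ β (β u),
    (visGraph n χ δ β).dist r ⟨β u, h⟩ + 1 = (visGraph n χ δ β).dist r i ∧
      Visible d n χ (β u) i.1

theorem exists_isBfsParent (hδ : 0 < δ) (h : (visGraph n χ δ β).Connected)
    {r i : {i : Fin d → ℕ // Occupied n δ β i}} (hi : i ≠ r) : ∃ u, IsBfsParent r i χ u := by
  have h0 : (visGraph n χ δ β).dist r i ≠ 0 := by
    rw [SimpleGraph.dist_ne_zero_iff_ne_and_reachable]; exact ⟨hi.symm, h.preconnected _ _⟩
  obtain ⟨t, ht⟩ := Nat.exists_eq_succ_of_ne_zero h0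
  obtain ⟨w, hw, _, hd⟩ := exists_adj_dist_eq (h.preconnected r i) ht
  obtain ⟨u, hu⟩ := w.2.exists_vertex hδ
  have hw' : (⟨β u, hu ▸ w.2⟩ : {i : Fin d → ℕ // Occupied n δ β i}) = w := Subtype.ext hu
  exact ⟨u, hu ▸ w.2, by rw [hw']; omega, by rw [hu]; exact hw.2⟩

open scoped Classical in
/-- The block of the last vertex in a visible occupied block that is closer to `r`. -/
def bfsParent (r i : {i : Fin d → ℕ // Occupied n δ β i}) (χ : ℝ) :
    {i : Fin d → ℕ // Occupied n δ β i} :=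
  -- The default `r` only makes the map total. Every block other than `r` has such a vertex when the
  -- graph is connected.
  if h : ∃ u, IsBfsParent r i χ u then ⟨β (lastSat _ h), (lastSat_spec _ h).choose⟩ else r

theorem bfsParent_dist (hδ : 0 < δ) (h : (visGraph n χ δ β).Connected)
    {r i : {i : Fin d → ℕ // Occupied n δ β i}} (hi : i ≠ r) :
    (visGraph n χ δ β).dist r i = (visGraph n χ δ β).dist r (bfsParent r i χ) + 1 := by
  have hex := exists_isBfsParent hδ h hi
  rw [bfsParent, dif_pos hex]
  exact (lastSat_spec _ hex).choose_spec.1.symm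

theorem bfsParent_adj (hδ : 0 < δ) (h : (visGraph n χ δ β).Connected)
    {r i : {i : Fin d → ℕ // Occupied n δ β i}} (hi : i ≠ r) :
    (visGraph n χ δ β).Adj (bfsParent r i χ) i := by
  have hd := bfsParent_dist hδ h hi
  refine ⟨fun h' => ?_, ?_⟩
  · rw [h'] at hd; omega
  · have hex := exists_isBfsParent hδ h hi
    rw [bfsParent, dif_pos hex]
    exact (lastSat_spec _ hex).choose_spec.2

/-- The breadth-first schedule. -/
def bfsSchedule (hδ : 0 < δ) (h : (visGraph n χ δ β).Connected) : Schedule (visGraph n χ δ β) :=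
  haveI := finite_occupied (n := n) (β := β) hδ
  Schedule.ofParent (root := bfsRoot hδ h) (par := fun i => bfsParent (bfsRoot hδ h) i χ)
    (fun _ hi => bfsParent_adj hδ h hi) (fun _ hi => bfsParent_dist hδ h hi)

/-- The rule that always selects the breadth-first schedule. -/
def bfsRule (d : ℕ) (χ : ℝ) {δ : ℝ} (hδ : 0 < δ) : ScheduleRule d χ δ :=
  fun _ _ _ h => bfsSchedule hδ h

open scoped Classical in
/-- The level of a vertex after `t` rounds of breadth-first search from the block `r`: one plus
the distance of its block if this is at most `t`, and `0` for vertices not yet found. -/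
def bfsLevel (r : {i : Fin d → ℕ // Occupied n δ β i}) (χ : ℝ) (t : ℕ) (u : Fin N) : ℕ :=
  if h : Occupied n δ β (β u) then
    if (visGraph n χ δ β).Reachable r ⟨β u, h⟩ ∧ (visGraph n χ δ β).dist r ⟨β u, h⟩ ≤ t then
      (visGraph n χ δ β).dist r ⟨β u, h⟩ + 1
    else 0
  else 0

variable {r : {i : Fin d → ℕ // Occupied n δ β i}}

/-- Level t + 1 is the same set of vertices in all rounds from t on. Hence a round that overwrites
levels in place does not disturb the frontier it reads. -/
theorem bfsLevel_eq_iff {t t' : ℕ} (h : t ≤ t') {u : Fin N} :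
    bfsLevel r χ t' u = t + 1 ↔ ∃ h : Occupied n δ β (β u),
      (visGraph n χ δ β).Reachable r ⟨β u, h⟩ ∧ (visGraph n χ δ β).dist r ⟨β u, h⟩ = t := by
  unfold bfsLevel
  split_ifs with h1 h2
  · simp only [Nat.add_right_cancel_iff, h1, exists_true_left, h2.1, true_and]
  · simp only [h1, exists_true_left]
    constructor
    · exact fun h => h.elim
    · rintro ⟨h3, h4⟩; exact absurd ⟨h3, h4.le.trans h⟩ h2
  · simp [h1]

theorem bfsLevel_zero (u : Fin N) : bfsLevel r χ 0 u = if β u = r.1 then 1 else 0 := by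
  unfold bfsLevel
  split_ifs with h1 h2 h3 h3 h3
  · have := h2.1.dist_eq_zero_iff.1 (by omega : (visGraph n χ δ β).dist r ⟨β u, h1⟩ = 0)
    rw [← this]; simp
  · have := h2.1.dist_eq_zero_iff.1 (by omega : (visGraph n χ δ β).dist r ⟨β u, h1⟩ = 0)
    exact absurd (congrArg Subtype.val this).symm h3
  · have : r = ⟨β u, h1⟩ := Subtype.ext h3.symm
    rw [← this] at h2
    exact absurd ⟨SimpleGraph.Reachable.refl _, by simp⟩ h2
  · rfl
  · exact absurd (h3 ▸ r.2) h1
  · rfl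

/-- The two alternatives are the two branches of the program for one round: a vertex is found
exactly when it is new, its block is occupied, and its block is visible from the frontier. -/
theorem bfsLevel_succ (hδ : 0 < δ) (t : ℕ) (v : Fin N) :
    (bfsLevel r χ t v = 0 ∧ Occupied n δ β (β v) ∧
      (∃ u, bfsLevel r χ t u = t + 1 ∧ Visible d n χ (β u) (β v)) ∧
        bfsLevel r χ (t + 1) v = t + 2) ∨
    (¬ (bfsLevel r χ t v = 0 ∧ Occupied n δ β (β v) ∧
      ∃ u, bfsLevel r χ t u = t + 1 ∧ Visible d n χ (β u) (β v)) ∧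
        bfsLevel r χ (t + 1) v = bfsLevel r χ t v) := by
  set H := visGraph n χ δ β with hH
  by_cases ho : Occupied n δ β (β v)
  swap
  · right; simp [bfsLevel, ho]
  by_cases h0 : bfsLevel r χ t v = 0
  swap
  · right
    refine ⟨fun h => h0 h.1, ?_⟩
    unfold bfsLevel at h0 ⊢
    simp only [ho, dif_pos] at h0 ⊢
    split_ifs at h0 with h1
    · rw [if_pos h1, if_pos ⟨h1.1, by omega⟩]
    · exact absurd rfl h0
  have hnot : ¬ (H.Reachable r ⟨β v, ho⟩ ∧ H.dist r ⟨β v, ho⟩ ≤ t) := by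
    intro h
    simp only [bfsLevel, ho, dif_pos] at h0
    rw [if_pos h] at h0
    omega
  by_cases hex : ∃ u, bfsLevel r χ t u = t + 1 ∧ Visible d n χ (β u) (β v)
  · left
    refine ⟨h0, ho, hex, ?_⟩
    obtain ⟨u, hu, hv⟩ := hex
    obtain ⟨hou, hru, hdu⟩ := (bfsLevel_eq_iff le_rfl).1 hu
    have hadj : H.Adj ⟨β u, hou⟩ ⟨β v, ho⟩ := by
      refine ⟨fun h => hnot ?_, hv⟩
      rw [← h]; exact ⟨hru, hdu.le⟩
    refine (bfsLevel_eq_iff le_rfl).2 ⟨ho, hru.trans hadj.reachable, ?_⟩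
    obtain ⟨p, hp⟩ := hru.exists_walk_length_eq_dist
    have h1 := SimpleGraph.dist_le (p.concat hadj)
    rw [SimpleGraph.Walk.length_concat, hp] at h1
    change H.dist r ⟨β v, ho⟩ ≤ _ at h1
    have h2 : ¬ H.dist r ⟨β v, ho⟩ ≤ t := fun h => hnot ⟨hru.trans hadj.reachable, h⟩
    have h3 : H.dist r ⟨β u, hou⟩ = t := hdu
    change H.dist r ⟨β v, ho⟩ = t + 1
    omega
  · right
    refine ⟨fun h => hex h.2.2, ?_⟩
    rw [h0]
    unfold bfsLevel
    rw [dif_pos ho, if_neg]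
    rintro ⟨h1, h2⟩
    have h3 : H.dist r ⟨β v, ho⟩ = t + 1 := by
      have : ¬ H.dist r ⟨β v, ho⟩ ≤ t := fun h => hnot ⟨h1, h⟩
      change H.dist r ⟨β v, ho⟩ ≤ t + 1 at h2
      omega
    obtain ⟨w, hw, hrw, hdw⟩ := exists_adj_dist_eq h1 h3
    obtain ⟨u, hu⟩ := w.2.exists_vertex hδ
    have hw' : (⟨β u, hu ▸ w.2⟩ : {i : Fin d → ℕ // Occupied n δ β i}) = w := Subtype.ext hu
    refine hex ⟨u, (bfsLevel_eq_iff le_rfl).2 ⟨hu ▸ w.2, ?_, ?_⟩, ?_⟩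
    · rw [hw']; exact hrw
    · rw [hw']; exact hdw
    · rw [hu]; exact hw.2

/-- A shortest path visits distinct occupied blocks, and each contains a vertex. So `N` rounds of
search are enough. -/
theorem dist_lt_of_reachable (hδ : 0 < δ) {i : {i : Fin d → ℕ // Occupied n δ β i}}
    (h : (visGraph n χ δ β).Reachable r i) : (visGraph n χ δ β).dist r i < N := by
  classical
  have := finite_occupied (n := n) (β := β) hδ
  have := Fintype.ofFinite {i : Fin d → ℕ // Occupied n δ β i}
  obtain ⟨p, hp, hl⟩ := h.exists_path_of_dist
  rw [← hl]
  refine hp.length_lt.trans_le ?_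
  rw [← Nat.card_eq_fintype_card]
  exact card_occupied_le hδ

theorem bfsLevel_final (hδ : 0 < δ) {u : Fin N} (hu : Occupied n δ β (β u))
    (h : (visGraph n χ δ β).Reachable r ⟨β u, hu⟩) :
    bfsLevel r χ N u = (visGraph n χ δ β).dist r ⟨β u, hu⟩ + 1 := by
  unfold bfsLevel
  rw [dif_pos hu, if_pos ⟨h, (dist_lt_of_reachable hδ h).le⟩]

theorem connected_iff_bfsLevel (hδ : 0 < δ) :
    (visGraph n χ δ β).Connected ↔
      ∀ u, Occupied n δ β (β u) → bfsLevel r χ N u ≠ 0 := by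
  constructor
  · intro h u hu
    rw [bfsLevel_final hδ hu (h.preconnected _ _)]
    omega
  · intro h
    refine (SimpleGraph.connected_iff_exists_forall_reachable _).2 ⟨r, fun w => ?_⟩
    obtain ⟨u, hu⟩ := w.2.exists_vertex hδ
    have hw' : (⟨β u, hu ▸ w.2⟩ : {i : Fin d → ℕ // Occupied n δ β i}) = w := Subtype.ext hu
    have h1 := h u (hu ▸ w.2)
    unfold bfsLevel at h1
    rw [dif_pos (hu ▸ w.2)] at h1
    split_ifs at h1 with h2
    · rw [← hw']; exact h2.1
    · exact absurd rfl h1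

end BFS

end GSBM

namespace GSBM
namespace RAM

/-! ### Loops over the vertices -/

/-- The number of vertices. -/
abbrev NExpr.verts : NExpr := .read 0 (.const 1)

theorem linear_verts : ∃ C, ∀ (E : ℕ → ℕ → Prop) m, NExpr.verts.eval E m ≤
    C * (m.nat 0 0 + m.nat 0 1 + 1) :=
  ⟨1, fun E m => by simp only [NExpr.eval]; omega⟩

open scoped Classical in
theorem card_filter_range_exists {N : ℕ} (Q : Fin N → Prop) :
    ((Finset.range N).filter fun i => ∃ h : i < N, Q ⟨i, h⟩).card =
      (Finset.univ.filter Q).card := by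
  rw [← Finset.card_map Fin.valEmbedding]
  congr 1
  ext i
  simp only [Finset.mem_filter, Finset.mem_range, Finset.mem_map, Finset.mem_univ, true_and,
    Fin.valEmbedding_apply]
  constructor
  · rintro ⟨_, h, hQ⟩; exact ⟨⟨i, h⟩, hQ, rfl⟩
  · rintro ⟨v, hQ, rfl⟩; exact ⟨v.2, v.2, hQ⟩

/-- `y ≠ 0` protects the input array, which holds the loop bound, when the result variable is
cleared. -/
theorem run_count_verts {E : ℕ → ℕ → Prop} {x y N : ℕ} {ts : Clause} {m : Mem}
    (Q : Fin N → Prop) [DecidablePred Q] (hxy : x ≠ y) (hy : y ≠ 0) (hN : m.nat 0 1 = N)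
    (hQ : ∀ (i : Fin N) (m' : Mem), (∀ z, z ≠ x → z ≠ y → m'.nat z = m.nat z) →
      m'.real = m.real → m'.nat x 0 = i → (ts.holds E m' ↔ Q i)) :
    ((Prog.count x y .verts ts).run E m).1.nat y 0 = (Finset.univ.filter Q).card := by
  classical
  refine Eq.trans ?_ ((card_filter_range_exists Q).trans (by congr))
  refine (run_count (K := N) (fun i => ∃ h : i < N, Q ⟨i, h⟩) hxy
    (by simp [NExpr.eval, hy.symm, hN]) fun i hi m' h1 h2 h3 => ?_).trans (by congr)
  rw [hQ ⟨i, hi⟩ m' h1 h2 h3]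
  simp [hi]

theorem run_last_verts {E : ℕ → ℕ → Prop} {x y N : ℕ} {ts : Clause} {m : Mem}
    (Q : Fin N → Prop) (hxy : x ≠ y) (hN : m.nat 0 1 = N)
    (hQ : ∀ (i : Fin N) (m' : Mem), (∀ z, z ≠ x → z ≠ y → m'.nat z = m.nat z) →
      m'.real = m.real → m'.nat x 0 = i → (ts.holds E m' ↔ Q i)) (hex : ∃ v, Q v) :
    ((Prog.last x y .verts ts).run E m).1.nat y 0 = lastSat Q hex := by
  obtain ⟨h1, ⟨h2, h3⟩, h4⟩ := run_last (E := E) (ts := ts) (m := m) (e := .verts) (K := N)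
    (fun i => ∃ h : i < N, Q ⟨i, h⟩) hxy
    (by simp [NExpr.eval, hN]) (fun i hi m' h1 h2 h3 => by rw [hQ ⟨i, hi⟩ m' h1 h2 h3]; simp [hi])
    (by obtain ⟨v, hv⟩ := hex; exact ⟨v, v.2, v.2, hv⟩)
  exact congrArg Fin.val (lastSat_eq hex h3 fun w hw => h4 w w.2 ⟨w.2, hw⟩)

theorem run_loop_verts_nat {E : ℕ → ℕ → Prop} {x y N : ℕ} {p : Prog} {m : Mem}
    (val : Fin N → ℕ) (hxy : x ≠ y) (hN : m.nat 0 1 = N)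
    (hp : ∀ (i : Fin N) (m' : Mem), (∀ z, z ≠ x → z ≠ y → z ∉ p.writesNat → m'.nat z = m.nat z) →
      (∀ z, z ∉ p.writesReal → m'.real z = m.real z) → m'.nat x 0 = i →
      (∀ j : Fin N, m'.nat y j = if j < i then val j else m.nat y j) →
      (p.run E m').1.nat y = Function.update (m'.nat y) i (val i)) (v : Fin N) :
    ((Prog.loop x .verts p).run E m).1.nat y v = val v := by
  have := run_loop_fillNat (E := E) (x := x) (y := y) (e := .verts) (p := p) (m := m) (K := N)
    (fun i => if h : i < N then val ⟨i, h⟩ else 0) hxy (by simp [NExpr.eval, hN])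
    (fun i hi m' h1 h2 h3 h4 => by
      rw [hp ⟨i, hi⟩ m' h1 h2 h3 (fun j => by rw [h4]; simp [Fin.lt_def])]
      simp [hi])
  rw [this]
  simp

theorem run_loop_verts_real {E : ℕ → ℕ → Prop} {x y N : ℕ} {p : Prog} {m : Mem}
    (val : Fin N → ℝ) (hN : m.nat 0 1 = N)
    (hp : ∀ (i : Fin N) (m' : Mem), (∀ z, z ≠ x → z ∉ p.writesNat → m'.nat z = m.nat z) →
      (∀ z, z ≠ y → z ∉ p.writesReal → m'.real z = m.real z) → m'.nat x 0 = i →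
      (∀ j : Fin N, m'.real y j = if j < i then val j else m.real y j) →
      (p.run E m').1.real y = Function.update (m'.real y) i (val i)) (v : Fin N) :
    ((Prog.loop x .verts p).run E m).1.real y v = val v := by
  have := run_loop_fillReal (E := E) (x := x) (y := y) (e := .verts) (p := p) (m := m) (K := N)
    (fun i => if h : i < N then val ⟨i, h⟩ else 0) (by simp [NExpr.eval, hN])
    (fun i hi m' h1 h2 h3 h4 => by
      rw [hp ⟨i, hi⟩ m' h1 h2 h3 (fun j => by rw [h4]; simp [Fin.lt_def])]
      simp [hi])
  rw [this]
  simp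

/-! ### Expressions and tests for blocks -/

/-- A multiple of an expression. -/
def NExpr.smul : ℕ → NExpr → NExpr
  | 0, _ => .const 0
  | c + 1, e => .add (NExpr.smul c e) e

theorem NExpr.eval_smul (E : ℕ → ℕ → Prop) (m : Mem) (c : ℕ) (e : NExpr) :
    (NExpr.smul c e).eval E m = c * e.eval E m := by
  induction c with
  | zero => simp [smul, eval]
  | succ c ih => simp only [smul, eval, ih]; ring

/-- A linear bound in the size of the input. -/
def NExpr.linear (C : ℕ) : NExpr := .smul C (.add (.add (.read 0 (.const 0)) .verts) (.const 1))

theorem NExpr.eval_linear (E : ℕ → ℕ → Prop) (m : Mem) (C : ℕ) :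
    (NExpr.linear C).eval E m = C * (m.nat 0 0 + m.nat 0 1 + 1) := by
  simp [linear, eval_smul, eval]

theorem linear_linear (C : ℕ) : ∃ C', ∀ (E : ℕ → ℕ → Prop) m, (NExpr.linear C).eval E m ≤
    C' * (m.nat 0 0 + m.nat 0 1 + 1) :=
  ⟨C, fun E m => (NExpr.eval_linear E m C).le⟩

/-- The power `e ^ j`. -/
def RExpr.pow (e : RExpr) : ℕ → RExpr
  | 0 => .const 1
  | j + 1 => .mul (RExpr.pow e j) e

theorem RExpr.eval_pow (E : ℕ → ℕ → Prop) (m : Mem) (e : RExpr) (j : ℕ) :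
    (RExpr.pow e j).eval E m = e.eval E m ^ j := by
  induction j with
  | zero => simp [pow, eval]
  | succ j ih => simp only [pow, eval, ih]; ring

/-- The minimum of two expressions. -/
def NExpr.min (e f : NExpr) : NExpr := .sub e (.sub e f)

theorem NExpr.eval_min (E : ℕ → ℕ → Prop) (m : Mem) (e f : NExpr) :
    (NExpr.min e f).eval E m = Min.min (e.eval E m) (f.eval E m) := by
  simp only [min, eval]; omega

/-- The absolute difference of the `j`-th block coordinates of two vertices. -/
def NExpr.coordDiff (j : ℕ) (e f : NExpr) : NExpr :=
  .add (.sub (.read (20 + j) e) (.read (20 + j) f)) (.sub (.read (20 + j) f) (.read (20 + j) e))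

/-- The sum of the absolute differences of the first `J` block coordinates. -/
def NExpr.coordDist (e f : NExpr) : ℕ → NExpr
  | 0 => .const 0
  | j + 1 => .add (NExpr.coordDist e f j) (.coordDiff j e f)

/-- Two vertices have the same block. -/
def Test.same (d : ℕ) (e f : NExpr) : Test := .natLe (.coordDist e f d) (.const 0)

/-- The extent of two blocks in direction `j`. -/
def NExpr.extent (j : ℕ) (e f : NExpr) : NExpr :=
  .min (.var 2) (.smul 2 (.add (.min (.coordDiff j e f) (.sub (.var 2) (.coordDiff j e f)))
    (.const 1)))

/-- The squared extent of two blocks in the first `J` directions. -/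
def RExpr.extentSq (d : ℕ) (e f : NExpr) : ℕ → RExpr
  | 0 => .const 0
  | j + 1 => .add (RExpr.extentSq d e f j)
      (.pow (.mul (.div (.read (d + 2) (.const 0)) (.const 2)) (.ofNat (.extent j e f))) 2)

/-- The blocks of two vertices are mutually visible. -/
def Test.visible (d : ℕ) (e f : NExpr) : Test :=
  .realLe (.extentSq d e f d) (.pow (.read d (.const 1)) 2)

/-- Truncated differences in both directions add up to the absolute difference, so equality of
blocks becomes a single comparison with zero. -/
theorem coordDist_le_zero (E : ℕ → ℕ → Prop) (m : Mem) (e f : NExpr) (J : ℕ) :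
    (NExpr.coordDist e f J).eval E m ≤ 0 ↔
      ∀ j < J, m.nat (20 + j) (e.eval E m) = m.nat (20 + j) (f.eval E m) := by
  induction J with
  | zero => simp [NExpr.coordDist, NExpr.eval]
  | succ J ih =>
    simp only [NExpr.coordDist, NExpr.eval, NExpr.coordDiff]
    rw [Nat.le_zero, Nat.add_eq_zero_iff, ← Nat.le_zero, ih]
    constructor
    · rintro ⟨h1, h2⟩ j hj
      rcases Nat.lt_succ_iff_lt_or_eq.1 hj with h | rfl
      · exact h1 j h
      · omega
    · intro h
      exact ⟨fun j hj => h j (by omega), by have := h J (by omega); omega⟩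

theorem eval_extentSq (E : ℕ → ℕ → Prop) (m : Mem) (d : ℕ) (e f : NExpr) (J : ℕ) :
    (RExpr.extentSq d e f J).eval E m = ∑ j ∈ Finset.range J,
      (m.real (d + 2) 0 / 2 * cellExtent (m.nat 2 0) (m.nat (20 + j) (e.eval E m))
        (m.nat (20 + j) (f.eval E m))) ^ 2 := by
  induction J with
  | zero => simp [RExpr.extentSq, RExpr.eval]
  | succ J ih =>
    rw [Finset.sum_range_succ, ← ih]
    simp only [RExpr.extentSq, RExpr.eval, RExpr.eval_pow, NExpr.extent, NExpr.eval_min,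
      NExpr.eval_smul, NExpr.eval, NExpr.coordDiff, cellExtent]

variable {d n : ℕ} {χ : ℝ} {g : SpatialGraph d}

/-- The memory holds the input and the grid of blocks. -/
structure Grid (n : ℕ) (χ : ℝ) (g : SpatialGraph d) (m : Mem) : Prop where
  verts : m.nat 0 1 = g.card
  rad : m.real d 1 = radius d n
  count : m.nat 2 0 = blocksPerSide d n χ
  side : m.real (d + 2) 0 = cellSide d n χ
  coord : ∀ (j : Fin d) (v : Fin g.card), m.nat (20 + j) v = assignment n χ g v j

/-- Memory layout. Natural arrays 0 (input), 2 (blocks per side) and 20 + j (block coordinates),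
with real arrays d and d + 2, form the grid and are not touched again. Arrays 3, 4, 5 are counters,
6 marks occupied vertices, 7 holds levels, 11 and 12 name a vertex of the root and of the parent
block, and 8, 9, 13 to 18 hold counts. Real array d + 1 holds the labels. -/
theorem Grid.congr {m m' : Mem} (h : Grid n χ g m)
    (h1 : ∀ z, z = 0 ∨ z = 2 ∨ 20 ≤ z → m'.nat z = m.nat z)
    (h2 : ∀ z, z = d ∨ z = d + 2 → m'.real z = m.real z) : Grid n χ g m' where
  verts := by rw [h1 0 (by simp)]; exact h.verts
  rad := by rw [h2 d (by simp)]; exact h.rad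
  count := by rw [h1 2 (by simp)]; exact h.count
  side := by rw [h2 (d + 2) (by simp)]; exact h.side
  coord j v := by rw [h1 _ (by simp)]; exact h.coord j v

theorem Grid.same_iff {E : ℕ → ℕ → Prop} {m : Mem} (h : Grid n χ g m) {e f : NExpr}
    {u v : Fin g.card} (he : e.eval E m = u) (hf : f.eval E m = v) :
    (Test.same d e f).holds E m ↔ assignment n χ g u = assignment n χ g v := by
  rw [Test.same, Test.holds]
  simp only [NExpr.eval]
  rw [coordDist_le_zero, he, hf, funext_iff]
  constructor
  · intro h' j; rw [← h.coord, ← h.coord]; exact h' j j.2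
  · intro h' j hj
    have := h' ⟨j, hj⟩
    rwa [← h.coord, ← h.coord] at this

theorem Grid.visible_iff {E : ℕ → ℕ → Prop} {m : Mem} (hn : 2 ≤ n) (hχ : 0 < χ)
    (h : Grid n χ g m) {e f : NExpr}
    {u v : Fin g.card} (he : e.eval E m = u) (hf : f.eval E m = v) :
    (Test.visible d e f).holds E m ↔
      Visible d n χ (assignment n χ g u) (assignment n χ g v) := by
  rw [GSBM.visible_iff hn hχ (i := assignment n χ g u) (j := assignment n χ g v)
    (fun l => blockIndex_lt hn hχ (g.pos u) l)
    (fun l => blockIndex_lt hn hχ (g.pos v) l), Test.visible,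
    Test.holds, eval_extentSq, RExpr.eval_pow, Finset.sum_range]
  simp only [RExpr.eval, NExpr.eval, he, hf, h.coord, h.rad, h.count, h.side]

end RAM
end GSBM

namespace GSBM
namespace RAM

/-! ### Frames of composite programs -/

theorem writesNat_branch_of_eq {p q : Prog} (h : p.writesNat = q.writesNat) (ts : Clause) :
    (Prog.branch p q ts).writesNat = p.writesNat := by
  induction ts with
  | nil => rfl
  | cons t ts ih =>
    obtain ⟨b, t⟩ := t
    cases b <;> simp [Prog.branch, Prog.writesNat, ih, h]

@[simp] theorem writesNat_count (x y : ℕ) (e : NExpr) (ts : Clause) :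
    (Prog.count x y e ts).writesNat = {x, y} := by
  simp only [Prog.count, Prog.writesNat]
  rw [writesNat_branch_of_eq (by rfl)]
  simp only [Prog.writesNat]
  ext z; simp

@[simp] theorem writesNat_last (x y : ℕ) (e : NExpr) (ts : Clause) :
    (Prog.last x y e ts).writesNat = {x, y} := by
  simp only [Prog.last, Prog.writesNat]
  rw [writesNat_branch_of_eq (by rfl)]
  simp only [Prog.writesNat]
  ext z; simp; tauto

attribute [simp] writesReal_count writesReal_last

@[simp] theorem notMem_writesNat_branch {p q : Prog} {z : ℕ} (hp : z ∉ p.writesNat)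
    (hq : z ∉ q.writesNat) (ts : Clause) : z ∉ (Prog.branch p q ts).writesNat := fun h => by
  rcases writesNat_branch_subset p q ts h with h | h
  · exact hp h
  · exact hq h

@[simp] theorem notMem_writesReal_branch {p q : Prog} {z : ℕ} (hp : z ∉ p.writesReal)
    (hq : z ∉ q.writesReal) (ts : Clause) : z ∉ (Prog.branch p q ts).writesReal := fun h => by
  rcases writesReal_branch_subset p q ts h with h | h
  · exact hp h
  · exact hq h

attribute [simp] Prog.writesNat Prog.writesReal

theorem notMem_writesNat_seq {p q : Prog} {z : ℕ} (hp : z ∉ p.writesNat)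
    (hq : z ∉ q.writesNat) : z ∉ (Prog.seq p q).writesNat := by simp [hp, hq]

theorem notMem_writesNat_loop {p : Prog} {x z : ℕ} {e : NExpr} (hx : z ≠ x)
    (hp : z ∉ p.writesNat) : z ∉ (Prog.loop x e p).writesNat := by simp [hx, hp]

theorem notMem_writesNat_setNat {x z : ℕ} {i e : NExpr} (hx : z ≠ x) :
    z ∉ (Prog.setNat x i e).writesNat := by simp [hx]

theorem notMem_writesNat_count {x y z : ℕ} {e : NExpr} {ts : Clause} (h : z ≠ x ∧ z ≠ y) :
    z ∉ (Prog.count x y e ts).writesNat := by simp [h]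

theorem notMem_writesNat_last {x y z : ℕ} {e : NExpr} {ts : Clause} (h : z ≠ x ∧ z ≠ y) :
    z ∉ (Prog.last x y e ts).writesNat := by simp [h]

theorem run_seq (E : ℕ → ℕ → Prop) (p q : Prog) (m : Mem) :
    ((Prog.seq p q).run E m).1 = (q.run E (p.run E m).1).1 := rfl

/-- The program does not change the input and the grid of blocks. -/
def Prog.KeepsGrid (d : ℕ) (p : Prog) : Prop :=
  (∀ z, z = 0 ∨ z = 2 ∨ 20 ≤ z → z ∉ p.writesNat) ∧ ∀ z, z ≠ d + 1 → z ∉ p.writesReal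

section

variable {d n : ℕ} {χ δ : ℝ} {g : SpatialGraph d} {E : ℕ → ℕ → Prop} {m : Mem}

theorem Grid.run {p : Prog} (hp : p.KeepsGrid d) (h : Grid n χ g m) :
    Grid n χ g (p.run E m).1 :=
  h.congr (fun z hz => run_nat_frame E p m (hp.1 z hz))
    fun z hz => run_real_frame E p m (hp.2 z (by omega))

theorem Grid.of_frame {p : Prog} (hp : p.KeepsGrid d) {m' : Mem} {x y w : ℕ}
    (h : Grid n χ g m) (hx : x ≠ 0 ∧ x ≠ 2 ∧ x < 20) (hy : y ≠ 0 ∧ y ≠ 2 ∧ y < 20)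
    (hw : w = d + 1)
    (h1 : ∀ z, z ≠ x → z ≠ y → z ∉ p.writesNat → m'.nat z = m.nat z)
    (h2 : ∀ z, z ≠ w → z ∉ p.writesReal → m'.real z = m.real z) : Grid n χ g m' :=
  h.congr (fun z hz => h1 z (by omega) (by omega) (hp.1 z hz))
    fun z hz => h2 z (by omega) (hp.2 z (by omega))

/-- The machine has no rounding. Floors and ceilings are obtained by counting the indices below
them. -/
theorem run_count_lt {x y : ℕ} {e : NExpr} {ts : Clause} {K B : ℕ} (hB : B ≤ K)
    (hxy : x ≠ y) (hK : e.eval E (m.setNat y 0 0) = K)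
    (hP : ∀ i < K, ∀ m' : Mem, (∀ z, z ≠ x → z ≠ y → m'.nat z = m.nat z) → m'.real = m.real →
      m'.nat x 0 = i → (ts.holds E m' ↔ i < B)) :
    ((Prog.count x y e ts).run E m).1.nat y 0 = B := by
  classical
  rw [run_count (fun i => i < B) hxy hK hP]
  conv_rhs => rw [← Finset.card_range B]
  congr 1
  ext i
  simp only [Finset.mem_filter, Finset.mem_range]
  omega

/-! ### The grid -/

/-- Compute the number of blocks per side. -/
def sizeProg (d C : ℕ) (χ : ℝ) : Prog :=
  .count 4 2 (.linear C) [(false, .realLe (.div (.read d (.const 0))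
    (.mul (.const (χ ^ (1 / (d : ℝ)))) (.read d (.const 1)))) (.ofNat (.var 4)))]

/-- Compute the `j`-th block coordinate of every vertex. -/
def coordProg (d C j : ℕ) : Prog :=
  .loop 3 .verts (.seq
    (.count 4 8 (.linear C) [(true, .natLe (.add (.var 4) (.const 2)) (.var 2)),
      (true, .realLe (.mul (.ofNat (.add (.var 4) (.const 1))) (.read (d + 2) (.const 0)))
        (.add (.read j (.var 3)) (.div (.read d (.const 0)) (.const 2))))])
    (.setNat (20 + j) (.var 3) (.var 8)))

/-- Compute the first `J` block coordinates of all vertices. -/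
def coordsProg (d C : ℕ) : ℕ → Prog
  | 0 => .setNat 8 (.const 0) (.const 0)
  | J + 1 => .seq (coordsProg d C J) (coordProg d C J)

/-- Compute the blocks of all vertices. -/
def gridProg (d C : ℕ) (χ : ℝ) : Prog :=
  .seq (sizeProg d C χ) (.seq
    (.setReal (d + 2) (.const 0) (.div (.read d (.const 0)) (.ofNat (.var 2))))
    (coordsProg d C d))

theorem run_sizeProg {C : ℕ} (hχ : 0 < χ) (hC : blocksPerSide d n χ ≤ C * (n + g.card + 1)) :
    ((sizeProg d C χ).run E (inputMem n g)).1.nat 2 0 = blocksPerSide d n χ := by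
  refine run_count_lt hC (by norm_num)
    (by rw [NExpr.eval_linear]; simp [inputMem]) fun i hi m' h1 h2 h3 => ?_
  simp only [Clause.holds_cons_false, Clause.holds_nil, and_true, Test.holds, RExpr.eval,
    NExpr.eval, h2, h3]
  -- The ceiling of x is the number of naturals i < x.
  rw [blocksPerSide_eq hχ, Nat.lt_ceil, not_le]
  simp [inputMem]

theorem run_coordProg {C j : ℕ} (hj : j < d) (hC : blocksPerSide d n χ ≤ C * (n + g.card + 1))
    (h0 : m.nat 0 0 = n) (hN : m.nat 0 1 = g.card)
    (hpos : ∀ v : Fin g.card, m.real j v = g.pos v ⟨j, hj⟩) (hL : m.real d 0 = sideLen d n)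
    (hk : m.nat 2 0 = blocksPerSide d n χ) (hs : m.real (d + 2) 0 = cellSide d n χ)
    (hs0 : 0 < cellSide d n χ) (v : Fin g.card) :
    ((coordProg d C j).run E m).1.nat (20 + j) v = assignment n χ g v ⟨j, hj⟩ := by
  refine run_loop_verts_nat (fun v => assignment n χ g v ⟨j, hj⟩) (by omega) hN
    (fun i m' h1 h2 h3 h4 => ?_) v
  rw [run_seq]
  have hr : m'.real = m.real := funext fun z => h2 z (by simp)
  have hz0 : m'.nat 0 = m.nat 0 := h1 0 (by norm_num) (by omega) (by simp; omega)
  have hz2 : m'.nat 2 = m.nat 2 := h1 2 (by norm_num) (by omega) (by simp; omega)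
  have hle : assignment n χ g i ⟨j, hj⟩ ≤ C * (n + g.card + 1) := by
    refine le_trans ?_ hC
    simp only [assignment, blockIndex]; omega
  have h := run_count_lt (E := E) (x := 4) (y := 8) (e := .linear C) (m := m') hle
    (ts := [(true, .natLe (.add (.var 4) (.const 2)) (.var 2)),
      (true, .realLe (.mul (.ofNat (.add (.var 4) (.const 1))) (.read (d + 2) (.const 0)))
        (.add (.read j (.var 3)) (.div (.read d (.const 0)) (.const 2))))]) (by norm_num)
    (by rw [NExpr.eval_linear]; simp [hz0, h0, hN]) (fun i' hi' m'' h1' h2' h3' => by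
      simp only [Clause.holds_cons_true, Clause.holds_nil, and_true, Test.holds, RExpr.eval,
        NExpr.eval, h2', h3', hr, hs, hL]
      -- The conditions i + 2 ≤ k and (i + 1)s ≤ x say that i is below both k - 1 and the floor,
      -- that is, below the block coordinate with its cut-off at the last block.
      rw [h1' 2 (by norm_num) (by norm_num), h1' 3 (by norm_num) (by norm_num), hz2, hk, h3, hpos]
      rw [← le_div_iff₀ hs0, ← Nat.le_floor_iff' (by omega), assignment, blockIndex, cellSide]
      omega)
  simp only [Prog.run.eq_1, NExpr.eval, h]
  rw [run_nat_frame E _ m' (by simp : 3 ∉ _), h3, Mem.setNat_nat_self,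
    run_nat_frame E _ m' (by simp; omega)]

theorem notMem_writesNat_coordsProg {C J z : ℕ} (hz : z ≠ 3 ∧ z ≠ 4 ∧ z ≠ 8)
    (hz' : z < 20 ∨ 20 + J ≤ z) : z ∉ (coordsProg d C J).writesNat := by
  induction J with
  | zero => simp [coordsProg, hz]
  | succ J ih =>
    simp only [coordsProg, coordProg, Prog.writesNat, Set.mem_union, not_or, writesNat_count,
      Set.mem_singleton_iff, Set.mem_insert_iff]
    exact ⟨ih (by omega), by omega, by omega, by omega⟩

theorem writesReal_coordsProg {C J : ℕ} : (coordsProg d C J).writesReal = ∅ := by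
  induction J with
  | zero => rfl
  | succ J ih => simp [coordsProg, coordProg, ih]

theorem run_coordsProg {C J : ℕ} (hJ : J ≤ d)
    (hC : blocksPerSide d n χ ≤ C * (n + g.card + 1))
    (h0 : m.nat 0 0 = n) (hN : m.nat 0 1 = g.card)
    (hpos : ∀ (j : Fin d) (v : Fin g.card), m.real j v = g.pos v j)
    (hL : m.real d 0 = sideLen d n)
    (hk : m.nat 2 0 = blocksPerSide d n χ) (hs : m.real (d + 2) 0 = cellSide d n χ)
    (hs0 : 0 < cellSide d n χ) (j : Fin d) (hj : j < J) (v : Fin g.card) :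
    ((coordsProg d C J).run E m).1.nat (20 + j) v = assignment n χ g v j := by
  induction J with
  | zero => omega
  | succ J ih =>
    rw [coordsProg, run_seq]
    have hr : ((coordsProg d C J).run E m).1.real = m.real :=
      funext fun z => run_real_frame E _ m (by simp [writesReal_coordsProg])
    rcases Nat.lt_succ_iff_lt_or_eq.1 hj with h | h
    · rw [run_nat_frame E (coordProg d C J) _ (by simp [coordProg]; omega), ih (by omega) h]
    · subst h
      exact run_coordProg (j := j) (d := d) hJ hC
        (by rw [run_nat_frame E _ m (notMem_writesNat_coordsProg (by omega) (by omega)), h0])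
        (by rw [run_nat_frame E _ m (notMem_writesNat_coordsProg (by omega) (by omega)), hN])
        (by rw [hr]; exact hpos j) (by rw [hr]; exact hL)
        (by rw [run_nat_frame E _ m (notMem_writesNat_coordsProg (by omega) (by omega)), hk])
        (by rw [hr]; exact hs) hs0 v

theorem run_gridProg {C : ℕ} (hn : 2 ≤ n) (hχ : 0 < χ)
    (hC : blocksPerSide d n χ ≤ C * (n + g.card + 1)) :
    Grid n χ g ((gridProg d C χ).run E (inputMem n g)).1 := by
  have hk := run_sizeProg (E := E) hχ hC
  rw [gridProg, run_seq, run_seq]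
  set m1 := ((sizeProg d C χ).run E (inputMem n g)).1 with hm1
  set m2 := ((Prog.setReal (d + 2) (.const 0)
    (.div (.read d (.const 0)) (.ofNat (.var 2)))).run E m1).1 with hm2
  have hr1 : m1.real = (inputMem n g).real :=
    funext fun z => run_real_frame E _ _ (by simp [sizeProg])
  have hn1 : m1.nat 0 = (inputMem n g).nat 0 := run_nat_frame E _ _ (by simp [sizeProg])
  have hn2 : m2.nat = m1.nat := by rw [hm2]; rfl
  have hs : m2.real (d + 2) 0 = cellSide d n χ := by
    rw [hm2]
    simp only [Prog.run, RExpr.eval, NExpr.eval, hk, hr1, Mem.setReal_real_self,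
      Function.update_self, cellSide]
    simp [inputMem]
  have hr2 : ∀ z, z ≠ d + 2 → m2.real z = (inputMem n g).real z := fun z hz => by
    rw [hm2, run_real_frame E _ m1 (by simpa using hz), hr1]
  have hr3 : ((coordsProg d C d).run E m2).1.real = m2.real :=
      funext fun z => run_real_frame E _ m2 (by simp [writesReal_coordsProg])
  have hcoord := run_coordsProg (E := E) (m := m2) (g := g) le_rfl hC
    (by rw [hn2, hn1]; simp [inputMem])
    (by rw [hn2, hn1]; simp [inputMem]) (fun j v => by rw [hr2 _ (by omega)]; simp [inputMem])
    (by rw [hr2 _ (by omega)]; simp [inputMem]) (by rw [hn2, hk]) hs (cellSide_pos hn hχ)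
  exact {
    verts := by
      rw [run_nat_frame E _ m2 (notMem_writesNat_coordsProg (by omega) (by omega)), hn2, hn1]
      simp [inputMem]
    rad := by rw [hr3, hr2 _ (by omega)]; simp [inputMem]
    count := by
      rw [run_nat_frame E _ m2 (notMem_writesNat_coordsProg (by omega) (by omega)), hn2, hk]
    side := by rw [hr3, hs]
    coord := fun j v => hcoord j j.2 v }

/-- Uses x^(1/d) ≤ 1 + x and log n ≥ log 2. A linear bound is needed because loop bounds are linear
in the input. -/
theorem blocksPerSide_le_linear (d : ℕ) {χ : ℝ} (hχ : 0 < χ) :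
    ∃ C : ℕ, ∀ n : ℕ, 2 ≤ n → ∀ N : ℕ, blocksPerSide d n χ ≤ C * (n + N + 1) := by
  refine ⟨⌈1 / (χ * Real.log 2)⌉₊ + 1, fun n hn N => ?_⟩
  have hl2 : 0 < Real.log 2 := Real.log_pos (by norm_num)
  have hl : Real.log 2 ≤ Real.log n := Real.log_le_log (by norm_num) (by exact_mod_cast hn)
  have hln := log_pos_of_two_le hn
  rw [blocksPerSide, Nat.ceil_le]
  have h1 : (n : ℝ) / (χ * Real.log n) ≤ n * ⌈1 / (χ * Real.log 2)⌉₊ := by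
    have : (n : ℝ) / (χ * Real.log n) ≤ n * (1 / (χ * Real.log 2)) := by
      rw [div_eq_mul_one_div]
      gcongr
    exact this.trans (mul_le_mul_of_nonneg_left (Nat.le_ceil _) (by positivity))
  have h2 : ((n : ℝ) / (χ * Real.log n)) ^ (1 / (d : ℝ)) ≤ 1 + n / (χ * Real.log n) := by
    have hx : 0 ≤ (n : ℝ) / (χ * Real.log n) := by positivity
    have he : 1 / (d : ℝ) ≤ 1 := by
      rcases Nat.eq_zero_or_pos d with h | h
      · simp [h]
      · rw [div_le_one (by exact_mod_cast h)]; exact_mod_cast h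
    have := Real.rpow_le_rpow hx (by linarith : (n : ℝ) / (χ * Real.log n) ≤
      1 + n / (χ * Real.log n)) (by positivity : 0 ≤ 1 / (d : ℝ))
    refine this.trans ?_
    exact (Real.rpow_le_rpow_of_exponent_le (by linarith) he).trans (by rw [Real.rpow_one])
  push_cast
  have h3 : (0 : ℝ) ≤ ⌈1 / (χ * Real.log 2)⌉₊ := by positivity
  have h4 : (0 : ℝ) ≤ N := by positivity
  have h5 : (0 : ℝ) ≤ n := by positivity
  nlinarith [mul_nonneg h3 h4]

end

end RAM
end GSBM

namespace GSBM
namespace RAM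

/-! ### Occupied blocks and breadth-first search -/

/-- Mark the vertices in occupied blocks in array `6`. -/
def occProg (d : ℕ) (δ : ℝ) : Prog :=
  .loop 3 .verts (.seq (.count 4 8 .verts [(true, .same d (.var 4) (.var 3))])
    (.branch (.setNat 6 (.var 3) (.const 1)) (.setNat 6 (.var 3) (.const 0))
      [(false, .realLe (.ofNat (.var 8)) (.mul (.const δ) (.pow (.read d (.const 1)) d)))]))

/-- The vertices in the root block have level `1`, all others level `0` (array `7`). -/
def levelInitProg (d : ℕ) : Prog :=
  .loop 3 .verts (.branch (.setNat 7 (.var 3) (.const 1)) (.setNat 7 (.var 3) (.const 0))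
    [(true, .same d (.var 3) (.var 11))])

/-- One round of breadth-first search. -/
def roundProg (d : ℕ) : Prog :=
  .loop 3 .verts (.seq
    (.count 4 8 .verts [(true, .natLe (.read 7 (.var 4)) (.add (.var 5) (.const 1))),
      (true, .natLe (.add (.var 5) (.const 1)) (.read 7 (.var 4))),
      (true, .visible d (.var 4) (.var 3))])
    (.branch (.setNat 7 (.var 3) (.add (.var 5) (.const 2)))
      (.setNat 7 (.var 3) (.read 7 (.var 3)))
      [(true, .natLe (.read 7 (.var 3)) (.const 0)), (true, .natLe (.const 1) (.read 6 (.var 3))),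
        (true, .natLe (.const 1) (.var 8))]))

/-- Breadth-first search. -/
def bfsProg (d : ℕ) : Prog := .loop 5 .verts (roundProg d)

variable {d n : ℕ} {χ δ : ℝ} {g : SpatialGraph d} {E : ℕ → ℕ → Prop} {m : Mem}

open scoped Classical in
theorem run_occProg (hd : 0 < d) (hG : Grid n χ g m) (v : Fin g.card) :
    ((occProg d δ).run E m).1.nat 6 v =
      if Occupied n δ (assignment n χ g) (assignment n χ g v) then 1 else 0 := by
  refine run_loop_verts_nat (fun v => if Occupied n δ (assignment n χ g) (assignment n χ g v)
    then 1 else 0) (by norm_num) hG.verts (fun i m' h1 h2 h3 _ => ?_) v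
  have hG' : Grid n χ g m' := hG.congr (fun z hz => h1 z (by omega) (by omega)
    (notMem_writesNat_seq (notMem_writesNat_count (by omega)) (notMem_writesNat_branch
      (notMem_writesNat_setNat (by omega)) (notMem_writesNat_setNat (by omega)) _)))
      fun z hz => h2 z (by simp)
  rw [run_seq]
  set m1 := ((Prog.count 4 8 .verts [(true, .same d (.var 4) (.var 3))]).run E m').1 with hm1
  have hc : m1.nat 8 0 = (vertsIn (assignment n χ g) (assignment n χ g i)).card := by
    rw [hm1, run_count_verts (fun u => assignment n χ g u = assignment n χ g i) (by norm_num)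
      (by norm_num) hG'.verts]
    · rfl
    · intro u m'' h1' h2' h3'
      have hG'' : Grid n χ g m'' := hG'.congr (fun z hz => h1' z (by omega) (by omega))
        fun z hz => by rw [h2']
      simp only [Clause.holds_cons_true, Clause.holds_nil, and_true]
      exact hG''.same_iff (u := u) (v := i) h3'
        (by simp only [NExpr.eval]; rw [h1' 3 (by norm_num) (by norm_num), h3])
  have h31 : m1.nat 3 0 = i := by rw [hm1, run_nat_frame E _ m' (by simp), h3]
  have h61 : m1.nat 6 = m'.nat 6 := by rw [hm1, run_nat_frame E _ m' (by simp)]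
  have hrad : m1.real d 1 = radius d n := by
    rw [hm1, run_real_frame E _ m' (by simp), hG'.rad]
  have hiff : Clause.holds E m1 [(false, .realLe (.ofNat (.var 8))
      (.mul (.const δ) (.pow (.read d (.const 1)) d)))] ↔
      Occupied n δ (assignment n χ g) (assignment n χ g i) := by
    -- There is no logarithm among the operations; log n is the d-th power of the radius.
    simp only [Clause.holds_cons_false, Clause.holds_nil, and_true, Test.holds, RExpr.eval,
      RExpr.eval_pow, NExpr.eval, hc, hrad, radius_pow hd, not_le]
    rfl
  by_cases h : Occupied n δ (assignment n χ g) (assignment n χ g i)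
  · rw [run_branch_pos _ _ (hiff.2 h)]
    simp [Prog.run, NExpr.eval, h31, h61, h]
  · rw [run_branch_neg _ _ (fun h' => h (hiff.1 h'))]
    simp [Prog.run, NExpr.eval, h31, h61, h]

theorem run_levelInitProg (hG : Grid n χ g m) {w : Fin g.card} (hw : m.nat 11 0 = w)
    {r : {i // Occupied n δ (assignment n χ g) i}} (hr : assignment n χ g w = r.1)
    (v : Fin g.card) :
    ((levelInitProg d).run E m).1.nat 7 v = bfsLevel r χ 0 v := by
  refine run_loop_verts_nat (fun v => bfsLevel r χ 0 v) (by norm_num) hG.verts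
    (fun i m' h1 h2 h3 _ => ?_) v
  have hG' : Grid n χ g m' := hG.congr (fun z hz => h1 z (by omega) (by omega)
    (notMem_writesNat_branch (by simp; omega) (by simp; omega) _))
    fun z hz => h2 z (notMem_writesReal_branch (by simp) (by simp) _)
  have hiff : Clause.holds E m' [(true, .same d (.var 3) (.var 11))] ↔
      assignment n χ g i = r.1 := by
    simp only [Clause.holds_cons_true, Clause.holds_nil, and_true]
    rw [hG'.same_iff (e := .var 3) (f := .var 11) (u := i) (v := w) h3 ?_, hr]
    simp only [NExpr.eval]
    rw [h1 11 (by norm_num) (by norm_num) (by simp), hw]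
  rw [bfsLevel_zero]
  by_cases h : assignment n χ g i = r.1
  · rw [run_branch_pos _ _ (hiff.2 h), if_pos h]
    simp [Prog.run, NExpr.eval, h3]
  · rw [run_branch_neg _ _ (fun h' => h (hiff.1 h')), if_neg h]
    simp [Prog.run, NExpr.eval, h3]

open scoped Classical in
theorem run_roundProg (hn : 2 ≤ n) (hχ : 0 < χ) (hδ : 0 < δ) (hG : Grid n χ g m)
    (hocc : ∀ v : Fin g.card, m.nat 6 v =
      if Occupied n δ (assignment n χ g) (assignment n χ g v) then 1 else 0)
    {r : {i // Occupied n δ (assignment n χ g) i}} {t : ℕ} (ht : m.nat 5 0 = t)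
    (hlev : ∀ v : Fin g.card, m.nat 7 v = bfsLevel r χ t v) (v : Fin g.card) :
    ((roundProg d).run E m).1.nat 7 v = bfsLevel r χ (t + 1) v := by
  refine run_loop_verts_nat (fun v => bfsLevel r χ (t + 1) v) (by norm_num) hG.verts
    (fun i m' h1 h2 h3 h4 => ?_) v
  have hG' : Grid n χ g m' := hG.congr (fun z hz => h1 z (by omega) (by omega)
    (notMem_writesNat_seq (notMem_writesNat_count (by omega)) (notMem_writesNat_branch
      (notMem_writesNat_setNat (by omega)) (notMem_writesNat_setNat (by omega)) _)))
      fun z hz => h2 z (by simp)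
  have h5' : m'.nat 5 0 = t := by rw [h1 5 (by norm_num) (by norm_num) (by simp), ht]
  have h6' : m'.nat 6 = m.nat 6 := h1 6 (by norm_num) (by norm_num) (by simp)
  have h7' : m'.nat 7 i = bfsLevel r χ t i := by rw [h4, if_neg (lt_irrefl _), hlev]
  rw [run_seq]
  set m1 := ((Prog.count 4 8 .verts [(true, .natLe (.read 7 (.var 4)) (.add (.var 5) (.const 1))),
      (true, .natLe (.add (.var 5) (.const 1)) (.read 7 (.var 4))),
      (true, .visible d (.var 4) (.var 3))]).run E m').1 with hm1
  have hc : m1.nat 8 0 = (Finset.univ.filter fun u => bfsLevel r χ t u = t + 1 ∧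
      Visible d n χ (assignment n χ g u) (assignment n χ g i)).card := by
    rw [hm1]
    refine run_count_verts (fun u => bfsLevel r χ t u = t + 1 ∧
      Visible d n χ (assignment n χ g u) (assignment n χ g i)) (by norm_num) (by norm_num)
      hG'.verts fun u m'' h1' h2' h3' => ?_
    have hG'' : Grid n χ g m'' := hG'.congr (fun z hz => h1' z (by omega) (by omega))
      fun z hz => by rw [h2']
    simp only [Clause.holds_cons_true, Clause.holds_nil, and_true]
    rw [hG''.visible_iff hn hχ (e := .var 4) (f := .var 3) (u := u) (v := i) h3'
        (by simp only [NExpr.eval]; rw [h1' 3 (by norm_num) (by norm_num), h3]), ← and_assoc]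
    refine and_congr_left fun _ => ?_
    simp only [Test.holds, NExpr.eval, h3', h1' 7 (by norm_num) (by norm_num),
      h1' 5 (by norm_num) (by norm_num), h5', h4]
    -- The frontier is read while levels are being overwritten. A vertex already treated in this
    -- round carries its level of round t + 1, but it belongs to level t + 1 exactly if it did
    -- before.
    rw [← le_antisymm_iff]
    split_ifs
    · rw [bfsLevel_eq_iff (by omega), bfsLevel_eq_iff le_rfl]
    · rw [hlev]
  have h31 : m1.nat 3 0 = i := by rw [hm1, run_nat_frame E _ m' (by simp), h3]
  have h51 : m1.nat 5 0 = t := by rw [hm1, run_nat_frame E _ m' (by simp), h5']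
  have h61 : m1.nat 6 i = if Occupied n δ (assignment n χ g) (assignment n χ g i)
    then 1 else 0 := by rw [hm1, run_nat_frame E _ m' (by simp), h6', hocc]
  have h71 : m1.nat 7 = m'.nat 7 := by rw [hm1, run_nat_frame E _ m' (by simp)]
  have hiff : Clause.holds E m1 [(true, .natLe (.read 7 (.var 3)) (.const 0)),
      (true, .natLe (.const 1) (.read 6 (.var 3))), (true, .natLe (.const 1) (.var 8))] ↔
      bfsLevel r χ t i = 0 ∧ Occupied n δ (assignment n χ g) (assignment n χ g i) ∧
        ∃ u, bfsLevel r χ t u = t + 1 ∧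
          Visible d n χ (assignment n χ g u) (assignment n χ g i) := by
    simp only [Clause.holds_cons_true, Clause.holds_nil, and_true, Test.holds, NExpr.eval, h31,
      h61, h71, hc, h7', Nat.le_zero]
    refine and_congr_right fun _ => and_congr ?_ ?_
    · split_ifs with h <;> simp [h]
    · rw [Nat.one_le_iff_ne_zero, Finset.card_ne_zero]
      simp [Finset.Nonempty]
  rcases bfsLevel_succ (r := r) (χ := χ) hδ t i with ⟨ha, hb, hc', hval⟩ | ⟨hnot, hval⟩
  · rw [run_branch_pos _ _ (hiff.2 ⟨ha, hb, hc'⟩), hval]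
    simp [Prog.run, NExpr.eval, h31, h51, h71]
  · rw [run_branch_neg _ _ (fun h' => hnot (hiff.1 h')), hval, ← h7', ← h71]
    simp [Prog.run, NExpr.eval, h31]

theorem keepsGrid_roundProg : (roundProg d).KeepsGrid d := by
  constructor
  · intro z hz
    simp only [roundProg, Prog.writesNat, Set.mem_union, not_or, writesNat_count,
      Set.mem_singleton_iff, Set.mem_insert_iff]
    exact ⟨by omega, by omega, notMem_writesNat_branch (by simp; omega) (by simp; omega) _⟩
  · intro z _
    simp only [roundProg, Prog.writesReal, Set.mem_union, not_or, writesReal_count]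
    exact ⟨by simp, notMem_writesReal_branch (by simp) (by simp) _⟩

theorem notMem_writesNat_roundProg {z : ℕ} (h : z ≠ 3 ∧ z ≠ 4 ∧ z ≠ 7 ∧ z ≠ 8) :
    z ∉ (roundProg d).writesNat := by
  simp only [roundProg, Prog.writesNat, Set.mem_union, not_or, writesNat_count,
    Set.mem_singleton_iff, Set.mem_insert_iff]
  exact ⟨by omega, by omega, notMem_writesNat_branch (by simp; omega) (by simp; omega) _⟩

open scoped Classical in
theorem run_bfsProg (hn : 2 ≤ n) (hχ : 0 < χ) (hδ : 0 < δ) (hG : Grid n χ g m)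
    (hocc : ∀ v : Fin g.card, m.nat 6 v =
      if Occupied n δ (assignment n χ g) (assignment n χ g v) then 1 else 0)
    {r : {i // Occupied n δ (assignment n χ g) i}}
    (hlev : ∀ v : Fin g.card, m.nat 7 v = bfsLevel r χ 0 v) (v : Fin g.card) :
    ((bfsProg d).run E m).1.nat 7 v = bfsLevel r χ g.card v := by
  refine (loop_induction (K := g.card) (by simp [NExpr.eval, hG.verts]) (fun t m' =>
    Grid n χ g m' ∧ m'.nat 6 = m.nat 6 ∧
      ∀ v : Fin g.card, m'.nat 7 v = bfsLevel r χ t v) ⟨hG, rfl, hlev⟩ ?_).2.2 v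
  rintro t m' _ ⟨hG', h6, h7⟩
  have hG1 : Grid n χ g (m'.setNat 5 0 t) := hG'.congr
    (fun z hz => Mem.setNat_nat_ne _ _ _ (by omega)) fun z _ => rfl
  refine ⟨hG1.run keepsGrid_roundProg, ?_, ?_⟩
  · rw [run_nat_frame E _ _ (notMem_writesNat_roundProg (by norm_num)),
      Mem.setNat_nat_ne _ _ _ (by norm_num), h6]
  · refine run_roundProg hn hχ hδ hG1 (fun v => ?_) (by simp) (fun v => ?_)
    · rw [Mem.setNat_nat_ne _ _ _ (by norm_num), h6, hocc]
    · rw [Mem.setNat_nat_ne _ _ _ (by norm_num), h7]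

end RAM
end GSBM

namespace GSBM
namespace RAM

/-! ### Labeling -/

/-- Set the label of the current vertex. -/
abbrev putProg (d : ℕ) (c : ℝ) : Prog := .setReal (d + 1) (.var 3) (.const c)

/-- Keep the label of the current vertex. -/
abbrev keepProg (d : ℕ) : Prog := .setReal (d + 1) (.var 3) (.read (d + 1) (.var 3))

/-- Label the current vertex of the root block, if it belongs to it. -/
def classifyProg (d : ℕ) (a b : ℝ) : Prog :=
  .seq (.count 4 8 .verts [(true, .same d (.var 4) (.var 11)),
      (true, .natLe (.const 2) (.add (.edge (.var 11) (.var 4)) (.edge (.var 3) (.var 4))))])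
    (.branch (.branch (putProg d 1) (.branch (putProg d 1) (putProg d (-1))
          [(false, .realLe (.ofNat (.var 8)) (.div (.mul (.const ((a + b) ^ 2))
            (.sub (.ofNat (.var 13)) (.const 2))) (.const 4)))])
        [(true, .natLe (.var 3) (.var 11)), (true, .natLe (.var 11) (.var 3))])
      (keepProg d) [(true, .same d (.var 3) (.var 11))])

/-- Label the root block. -/
def rootLabelProg (d : ℕ) (a b : ℝ) : Prog :=
  .seq (.count 4 13 .verts [(true, .same d (.var 4) (.var 11))])
    (.loop 3 .verts (classifyProg d a b))

/-- Tests for the vertices of the parent block that are labeled `1`. -/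
abbrev plusTests (d : ℕ) (ts : Clause) : Clause :=
  (true, .same d (.var 4) (.var 12)) ::
    (true, .realLe (.const 1) (.read (d + 1) (.var 4))) :: ts

/-- Tests for the vertices of the parent block that are labeled `-1`. -/
abbrev minusTests (d : ℕ) (ts : Clause) : Clause :=
  (true, .same d (.var 4) (.var 12)) ::
    (true, .realLe (.read (d + 1) (.var 4)) (.const (-1))) :: ts

/-- The threshold for the number of neighbours. -/
abbrev threshold (a b : ℝ) (x : ℕ) : RExpr :=
  .div (.mul (.const (a + b)) (.ofNat (.var x))) (.const 2)

/-- Choose a label from the counts in the variables `14` to `17`. -/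
def decideProg (d : ℕ) (a b : ℝ) : Prog :=
  .branch
    (.branch (putProg d 1) (.branch (putProg d 1) (putProg d (-1))
        [(false, .realLe (.const b) (.const a)),
          (false, .realLe (threshold a b 14) (.ofNat (.var 16)))])
      [(false, .realLe (.const a) (.const b)),
        (true, .realLe (threshold a b 14) (.ofNat (.var 16)))])
    (.branch (putProg d (-1)) (.branch (putProg d (-1)) (putProg d 1)
        [(false, .realLe (.const b) (.const a)),
          (false, .realLe (threshold a b 15) (.ofNat (.var 17)))])
      [(false, .realLe (.const a) (.const b)),
        (true, .realLe (threshold a b 15) (.ofNat (.var 17)))])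
    [(true, .natLe (.var 15) (.var 14))]

/-- Find a vertex of the parent block. -/
def parentProg (d : ℕ) : Prog :=
  .last 4 12 .verts [(true, .natLe (.const 1) (.read 7 (.var 4))),
    (true, .natLe (.add (.read 7 (.var 4)) (.const 1)) (.read 7 (.var 3))),
    (true, .natLe (.read 7 (.var 3)) (.add (.read 7 (.var 4)) (.const 1))),
    (true, .visible d (.var 4) (.var 3))]

/-- Label the current vertex with the help of the parent block. -/
def propagateProg (d : ℕ) (a b : ℝ) : Prog :=
  .seq (parentProg d)
  (.seq (.count 4 14 .verts (plusTests d []))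
  (.seq (.count 4 15 .verts (minusTests d []))
  (.seq (.count 4 16 .verts (plusTests d [(true, .natLe (.const 1) (.edge (.var 3) (.var 4)))]))
  (.seq (.count 4 17 .verts (minusTests d [(true, .natLe (.const 1) (.edge (.var 3) (.var 4)))]))
    (decideProg d a b)))))

/-- Label the vertices of a level. -/
def levelProg (d : ℕ) (a b : ℝ) : Prog :=
  .loop 3 .verts (.branch (propagateProg d a b) (keepProg d)
    [(true, .natLe (.read 7 (.var 3)) (.add (.var 5) (.const 2))),
      (true, .natLe (.add (.var 5) (.const 2)) (.read 7 (.var 3)))])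

variable {d n : ℕ} {χ δ : ℝ} {g : SpatialGraph d} {m : Mem} {a b : ℝ}

theorem edgeRel_iff (u v : Fin g.card) : g.edgeRel u v ↔ g.graph.Adj u v := by
  simp [SpatialGraph.edgeRel]

theorem one_le_signType_iff (s : SignType) : (1 : ℝ) ≤ (s : ℝ) ↔ s = 1 := by
  cases s <;> simp

theorem signType_le_neg_one_iff (s : SignType) : (s : ℝ) ≤ -1 ↔ s = -1 := by
  cases s <;> simp

theorem run_put {E : ℕ → ℕ → Prop} {v : ℕ} (h : m.nat 3 0 = v) (c : ℝ) :
    ((putProg d c).run E m).1.real (d + 1) = Function.update (m.real (d + 1)) v c := by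
  simp [Prog.run, NExpr.eval, RExpr.eval, h]

theorem run_keep {E : ℕ → ℕ → Prop} :
    ((keepProg d).run E m).1.real (d + 1) = m.real (d + 1) := by
  simp [Prog.run, NExpr.eval, RExpr.eval]

open scoped Classical in
theorem run_branch_real {E : ℕ → ℕ → Prop} (p q : Prog) (ts : Clause) :
    ((Prog.branch p q ts).run E m).1.real (d + 1) =
      if ts.holds E m then (p.run E m).1.real (d + 1) else (q.run E m).1.real (d + 1) := by
  split_ifs with h
  · rw [run_branch_pos _ _ h]
  · rw [run_branch_neg _ _ h]

theorem run_classifyProg (hG : Grid n χ g m) {w v : Fin g.card} (hw : m.nat 11 0 = w)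
    (h13 : m.nat 13 0 = (vertsIn (assignment n χ g) (assignment n χ g w)).card)
    (hv : m.nat 3 0 = v) :
    ((classifyProg d a b).run g.edgeRel m).1.real (d + 1) = Function.update (m.real (d + 1)) v
      (if assignment n χ g v = assignment n χ g w then
        ((pairwiseClassify g.graph a b (vertsIn (assignment n χ g) (assignment n χ g w)) w v :
          SignType) : ℝ) else m.real (d + 1) v) := by
  classical
  rw [classifyProg, run_seq]
  set m1 := ((Prog.count 4 8 .verts [(true, .same d (.var 4) (.var 11)),
      (true, .natLe (.const 2) (.add (.edge (.var 11) (.var 4)) (.edge (.var 3) (.var 4))))]).run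
        g.edgeRel m).1 with hm1
  have hc : m1.nat 8 0 = (Finset.univ.filter fun u => assignment n χ g u = assignment n χ g w ∧
      g.graph.Adj w u ∧ g.graph.Adj v u).card := by
    rw [hm1]
    refine run_count_verts _ (by norm_num) (by norm_num) hG.verts fun u m'' h1' h2' h3' => ?_
    have hG'' : Grid n χ g m'' := hG.congr (fun z hz => h1' z (by omega) (by omega))
      fun z hz => by rw [h2']
    have h11 : m''.nat 11 0 = w := by rw [h1' 11 (by norm_num) (by norm_num), hw]
    have h33 : m''.nat 3 0 = v := by rw [h1' 3 (by norm_num) (by norm_num), hv]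
    simp only [Clause.holds_cons_true, Clause.holds_nil, and_true]
    rw [hG''.same_iff (e := .var 4) (f := .var 11) (u := u) (v := w) h3' h11]
    refine and_congr_right fun _ => ?_
    simp only [Test.holds, NExpr.eval, h3', h11, h33, edgeRel_iff]
    split_ifs with ha hb hb <;> simp [ha, hb]
  have hG1 : Grid n χ g m1 := hG.congr (fun z hz => run_nat_frame _ _ m (by simp; omega))
    fun z hz => run_real_frame _ _ m (by simp)
  have h31 : m1.nat 3 0 = v := by rw [hm1, run_nat_frame _ _ m (by simp), hv]
  have h111 : m1.nat 11 0 = w := by rw [hm1, run_nat_frame _ _ m (by simp), hw]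
  have h131 : m1.nat 13 0 = (vertsIn (assignment n χ g) (assignment n χ g w)).card := by
    rw [hm1, run_nat_frame _ _ m (by simp), h13]
  have hr1 : m1.real = m.real := funext fun z => run_real_frame _ _ m (by simp)
  simp only [run_branch_real, run_put h31, run_keep, Clause.holds_cons_true,
    Clause.holds_cons_false, Clause.holds_nil, and_true]
  rw [hG1.same_iff (e := .var 3) (f := .var 11) (u := v) (v := w) h31 h111]
  simp only [Test.holds, NExpr.eval, RExpr.eval, h31, h111, h131, hc, hr1]
  by_cases hvw : assignment n χ g v = assignment n χ g w
  swap
  · simp [hvw]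
  simp only [hvw, if_true, pairwiseClassify]
  by_cases hvw' : v = w
  · simp [hvw']
  have hne : ¬ ((v : ℕ) ≤ w ∧ (w : ℕ) ≤ v) := fun h => hvw' (Fin.ext (by omega))
  simp only [hne, hvw', if_false, not_le]
  -- The program does not exclude the two vertices themselves. No vertex is adjacent to itself, so
  -- neither is a common neighbour.
  have hcard : (Finset.univ.filter fun u => assignment n χ g u = assignment n χ g w ∧
      g.graph.Adj w u ∧ g.graph.Adj v u) =
      (vertsIn (assignment n χ g) (assignment n χ g w) \ {v, w}).filter
        fun u => g.graph.Adj w u ∧ g.graph.Adj v u := by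
    ext u
    simp only [Finset.mem_filter, Finset.mem_univ, true_and, Finset.mem_sdiff, mem_vertsIn,
      Finset.mem_insert, Finset.mem_singleton]
    constructor
    · rintro ⟨h1, h2, h3⟩
      refine ⟨⟨h1, ?_⟩, h2, h3⟩
      rintro (rfl | rfl)
      · exact h3.ne rfl
      · exact h2.ne rfl
    · rintro ⟨⟨h1, _⟩, h2⟩; exact ⟨h1, h2⟩
  rw [hcard]
  split_ifs <;> simp

/-! ### Frames of the labeling programs -/

theorem keepsGrid_put (c : ℝ) : (putProg d c).KeepsGrid d :=
  ⟨fun z _ => by simp, fun z hz => by simpa using hz⟩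

theorem keepsGrid_keep : (keepProg d).KeepsGrid d :=
  ⟨fun z _ => by simp, fun z hz => by simpa using hz⟩

theorem keepsGrid_count {x y : ℕ} {e : NExpr} {ts : Clause} (hx : x ≠ 0 ∧ x ≠ 2 ∧ x < 20)
    (hy : y ≠ 0 ∧ y ≠ 2 ∧ y < 20) : (Prog.count x y e ts).KeepsGrid d :=
  ⟨fun z hz => by simp; omega, fun z _ => by simp⟩

theorem keepsGrid_last {x y : ℕ} {e : NExpr} {ts : Clause} (hx : x ≠ 0 ∧ x ≠ 2 ∧ x < 20)
    (hy : y ≠ 0 ∧ y ≠ 2 ∧ y < 20) : (Prog.last x y e ts).KeepsGrid d :=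
  ⟨fun z hz => by simp; omega, fun z _ => by simp⟩

theorem keepsGrid_setNat {x : ℕ} {i e : NExpr} (hx : x ≠ 0 ∧ x ≠ 2 ∧ x < 20) :
    (Prog.setNat x i e).KeepsGrid d :=
  ⟨fun z hz => by simp; omega, fun z _ => by simp⟩

theorem Prog.KeepsGrid.seq {p q : Prog} (hp : p.KeepsGrid d) (hq : q.KeepsGrid d) :
    (Prog.seq p q).KeepsGrid d :=
  ⟨fun z hz => by simp [hp.1 z hz, hq.1 z hz], fun z hz => by simp [hp.2 z hz, hq.2 z hz]⟩

theorem Prog.KeepsGrid.branch {p q : Prog} (hp : p.KeepsGrid d) (hq : q.KeepsGrid d)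
    (ts : Clause) : (Prog.branch p q ts).KeepsGrid d :=
  ⟨fun z hz => notMem_writesNat_branch (hp.1 z hz) (hq.1 z hz) ts,
    fun z hz => notMem_writesReal_branch (hp.2 z hz) (hq.2 z hz) ts⟩

theorem Prog.KeepsGrid.loop {p : Prog} {x : ℕ} {e : NExpr} (hx : x ≠ 0 ∧ x ≠ 2 ∧ x < 20)
    (hp : p.KeepsGrid d) : (Prog.loop x e p).KeepsGrid d :=
  ⟨fun z hz => by simp [hp.1 z hz]; omega, fun z hz => by simp [hp.2 z hz]⟩

theorem keepsGrid_classifyProg : (classifyProg d a b).KeepsGrid d :=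
  .seq (keepsGrid_count (by norm_num) (by norm_num))
    (.branch (.branch (keepsGrid_put _) (.branch (keepsGrid_put _) (keepsGrid_put _) _) _)
      keepsGrid_keep _)

theorem keepsGrid_decideProg : (decideProg d a b).KeepsGrid d :=
  .branch (.branch (keepsGrid_put _) (.branch (keepsGrid_put _) (keepsGrid_put _) _) _)
    (.branch (keepsGrid_put _) (.branch (keepsGrid_put _) (keepsGrid_put _) _) _) _

theorem keepsGrid_propagateProg : (propagateProg d a b).KeepsGrid d :=
  .seq (keepsGrid_last (by norm_num) (by norm_num))
  (.seq (keepsGrid_count (by norm_num) (by norm_num))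
  (.seq (keepsGrid_count (by norm_num) (by norm_num))
  (.seq (keepsGrid_count (by norm_num) (by norm_num))
  (.seq (keepsGrid_count (by norm_num) (by norm_num)) keepsGrid_decideProg))))

theorem keepsGrid_levelProg : (levelProg d a b).KeepsGrid d :=
  .loop (by norm_num) (.branch keepsGrid_propagateProg keepsGrid_keep _)

theorem notMem_writesNat_decideProg {z : ℕ} : z ∉ (decideProg d a b).writesNat :=
  notMem_writesNat_branch (notMem_writesNat_branch (by simp) (notMem_writesNat_branch
    (by simp) (by simp) _) _) (notMem_writesNat_branch (by simp) (notMem_writesNat_branch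
    (by simp) (by simp) _) _) _

theorem notMem_writesNat_classifyProg {z : ℕ} (h : z ≠ 4 ∧ z ≠ 8) :
    z ∉ (classifyProg d a b).writesNat :=
  notMem_writesNat_seq (notMem_writesNat_count h) (notMem_writesNat_branch
    (notMem_writesNat_branch (by simp) (notMem_writesNat_branch (by simp) (by simp) _) _)
    (by simp) _)

theorem notMem_writesNat_propagateProg {z : ℕ}
    (h : z ≠ 4 ∧ z ≠ 12 ∧ z ≠ 14 ∧ z ≠ 15 ∧ z ≠ 16 ∧ z ≠ 17) :
    z ∉ (propagateProg d a b).writesNat :=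
  notMem_writesNat_seq (notMem_writesNat_last (by omega))
  (notMem_writesNat_seq (notMem_writesNat_count (by omega))
  (notMem_writesNat_seq (notMem_writesNat_count (by omega))
  (notMem_writesNat_seq (notMem_writesNat_count (by omega))
  (notMem_writesNat_seq (notMem_writesNat_count (by omega)) notMem_writesNat_decideProg))))

theorem notMem_writesNat_levelProg {z : ℕ}
    (h : z ≠ 3 ∧ z ≠ 4 ∧ z ≠ 12 ∧ z ≠ 14 ∧ z ≠ 15 ∧ z ≠ 16 ∧ z ≠ 17) :
    z ∉ (levelProg d a b).writesNat :=
  notMem_writesNat_loop (by omega) (notMem_writesNat_branch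
    (notMem_writesNat_propagateProg (by omega)) (by simp) _)

theorem run_rootLabelProg (hG : Grid n χ g m) {w : Fin g.card} (hw : m.nat 11 0 = w)
    (h0 : ∀ v : Fin g.card, m.real (d + 1) v = 0) (v : Fin g.card) :
    ((rootLabelProg d a b).run g.edgeRel m).1.real (d + 1) v =
      if assignment n χ g v = assignment n χ g w then
        ((pairwiseClassify g.graph a b (vertsIn (assignment n χ g) (assignment n χ g w)) w v :
          SignType) : ℝ) else 0 := by
  rw [rootLabelProg, run_seq]
  set m1 := ((Prog.count 4 13 .verts [(true, .same d (.var 4) (.var 11))]).run g.edgeRel m).1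
    with hm1
  have hG1 : Grid n χ g m1 := hG.run (keepsGrid_count (by norm_num) (by norm_num))
  have h13 : m1.nat 13 0 = (vertsIn (assignment n χ g) (assignment n χ g w)).card := by
    rw [hm1, run_count_verts (fun u => assignment n χ g u = assignment n χ g w) (by norm_num)
      (by norm_num) hG.verts]
    · rfl
    · intro u m'' h1' h2' h3'
      have hG'' : Grid n χ g m'' := hG.congr (fun z hz => h1' z (by omega) (by omega))
        fun z hz => by rw [h2']
      simp only [Clause.holds_cons_true, Clause.holds_nil, and_true]
      exact hG''.same_iff (u := u) (v := w) h3'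
        (by simp only [NExpr.eval]; rw [h1' 11 (by norm_num) (by norm_num), hw])
  have hr1 : m1.real = m.real := funext fun z => run_real_frame _ _ m (by simp)
  have h111 : m1.nat 11 0 = w := by rw [hm1, run_nat_frame _ _ m (by simp), hw]
  refine run_loop_verts_real (fun v => if assignment n χ g v = assignment n χ g w then
        ((pairwiseClassify g.graph a b (vertsIn (assignment n χ g) (assignment n χ g w)) w v :
          SignType) : ℝ) else 0) hG1.verts (fun i m' h1 h2 h3 h4 => ?_) v
  have hG' : Grid n χ g m' := hG1.of_frame (x := 3) (y := 3) keepsGrid_classifyProg (by norm_num)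
    (by norm_num) rfl (fun z hz _ => h1 z hz) h2
  rw [run_classifyProg hG' (w := w) (v := i)
    (by rw [h1 11 (by norm_num) (notMem_writesNat_classifyProg (by norm_num)), h111])
    (by rw [h1 13 (by norm_num) (notMem_writesNat_classifyProg (by norm_num)), h13]) h3]
  rw [h4 i, if_neg (lt_irrefl _), hr1, h0]

theorem run_decideProg {E : ℕ → ℕ → Prop} {G : SimpleGraph (Fin g.card)}
    {S S' : Finset (Fin g.card)} {σ : Fin g.card → SignType} {v : Fin g.card} (hv : v ∈ S')
    (h3 : m.nat 3 0 = v) (h14 : m.nat 14 0 = numLabel σ S 1)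
    (h15 : m.nat 15 0 = numLabel σ S (-1)) (h16 : m.nat 16 0 = degPlus G σ S 1 v)
    (h17 : m.nat 17 0 = degPlus G σ S (-1) v) :
    ((decideProg d a b).run E m).1.real (d + 1) = Function.update (m.real (d + 1)) v
      ((propagate G a b S S' σ v : SignType) : ℝ) := by
  simp only [decideProg, run_branch_real, run_put h3, Clause.holds_cons_true,
    Clause.holds_cons_false, Clause.holds_nil, and_true, Test.holds, NExpr.eval, RExpr.eval, h14,
    h15, h16, h17, propagate, hv, if_true, not_le]
  split_ifs <;> simp

theorem bfsLevel_card {β : Fin g.card → Fin d → ℕ} (hδ : 0 < δ)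
    (hconn : (visGraph n χ δ β).Connected) {r : {i // Occupied n δ β i}} {u : Fin g.card}
    (h : Occupied n δ β (β u)) :
    bfsLevel r χ g.card u = (visGraph n χ δ β).dist r ⟨β u, h⟩ + 1 :=
  bfsLevel_final hδ h (hconn.preconnected _ _)

/-- Since levels are one plus the distance for occupied vertices and zero for the others, the tests
on levels express exactly that a vertex is a breadth-first parent; the last hit is then the vertex
chosen by the schedule. -/
theorem run_parentProg {E : ℕ → ℕ → Prop} (hn : 2 ≤ n) (hχ : 0 < χ) (hδ : 0 < δ)
    (hconn : (visGraph n χ δ (assignment n χ g)).Connected) (hG : Grid n χ g m)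
    {r : {i // Occupied n δ (assignment n χ g) i}}
    (hlev : ∀ v : Fin g.card, m.nat 7 v = bfsLevel r χ g.card v) {v : Fin g.card}
    (hv : m.nat 3 0 = v) (ho : Occupied n δ (assignment n χ g) (assignment n χ g v))
    (hne : (⟨_, ho⟩ : {i // Occupied n δ (assignment n χ g) i}) ≠ r) :
    ∃ w : Fin g.card, ((parentProg d).run E m).1.nat 12 0 = w ∧
      assignment n χ g w = (bfsParent r ⟨_, ho⟩ χ).1 := by
  have hex := exists_isBfsParent hδ hconn hne
  refine ⟨lastSat _ hex, ?_, by rw [bfsParent, dif_pos hex]⟩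
  refine run_last_verts _ (by norm_num) hG.verts (fun u m' h1 h2 h3 => ?_) hex
  have hG' : Grid n χ g m' := hG.congr (fun z hz => h1 z (by omega) (by omega))
    fun z hz => by rw [h2]
  have h33 : m'.nat 3 0 = v := by rw [h1 3 (by norm_num) (by norm_num), hv]
  simp only [Clause.holds_cons_true, Clause.holds_nil, and_true]
  rw [hG'.visible_iff hn hχ (e := .var 4) (f := .var 3) (u := u) (v := v) h3 h33]
  simp only [Test.holds, NExpr.eval, h3, h33, h1 7 (by norm_num) (by norm_num), hlev,
    bfsLevel_card hδ hconn ho, IsBfsParent]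
  by_cases hu : Occupied n δ (assignment n χ g) (assignment n χ g u)
  · simp only [hu, exists_true_left, bfsLevel_card hδ hconn hu]
    rw [← and_assoc, ← and_assoc]
    refine and_congr_left fun _ => ?_
    omega
  · have : bfsLevel r χ g.card u = 0 := by simp [bfsLevel, hu]
    simp [hu, this]

theorem run_propagateProg (hn : 2 ≤ n) (hχ : 0 < χ) (hδ : 0 < δ)
    (hconn : (visGraph n χ δ (assignment n χ g)).Connected) (hG : Grid n χ g m)
    {r : {i // Occupied n δ (assignment n χ g) i}}
    (hlev : ∀ v : Fin g.card, m.nat 7 v = bfsLevel r χ g.card v) {v : Fin g.card}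
    (hv : m.nat 3 0 = v) (ho : Occupied n δ (assignment n χ g) (assignment n χ g v))
    (hne : (⟨_, ho⟩ : {i // Occupied n δ (assignment n χ g) i}) ≠ r)
    {σ : Fin g.card → SignType}
    (hσ : ∀ u, assignment n χ g u = (bfsParent r ⟨_, ho⟩ χ).1 → m.real (d + 1) u = (σ u : ℝ)) :
    ((propagateProg d a b).run g.edgeRel m).1.real (d + 1) = Function.update (m.real (d + 1)) v
      ((propagate g.graph a b (vertsIn (assignment n χ g) (bfsParent r ⟨_, ho⟩ χ).1)
        (vertsIn (assignment n χ g) (assignment n χ g v)) σ v : SignType) : ℝ) := by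
  classical
  obtain ⟨w, hw, hpar⟩ := run_parentProg (E := g.edgeRel) hn hχ hδ hconn hG hlev hv ho hne
  have hwr : (Prog.run g.edgeRel (parentProg d) m).1.real = m.real :=
    funext fun z => run_real_frame _ _ _ (by simp [parentProg])
  have hw3 : (Prog.run g.edgeRel (parentProg d) m).1.nat 3 0 = v := by
    rw [run_nat_frame _ _ _ (by simp [parentProg]), hv]
  have hGw : Grid n χ g (Prog.run g.edgeRel (parentProg d) m).1 :=
    hG.run (keepsGrid_last (by norm_num) (by norm_num))
  rw [propagateProg, run_seq]
  generalize (Prog.run g.edgeRel (parentProg d) m).1 = m0 at hw hwr hw3 hGw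
  rw [← hwr] at hσ ⊢
  rw [← hpar] at hσ ⊢
  -- One statement covers the four counts: each runs in a memory that still has the current vertex,
  -- the parent vertex, the grid and all real arrays.
  have key : ∀ (y : ℕ) (ts : Clause) (Q : Fin g.card → Prop) [DecidablePred Q] (m1 : Mem),
      y ≠ 0 ∧ y ≠ 2 ∧ y ≠ 3 ∧ y ≠ 4 ∧ y ≠ 12 ∧ y < 20 →
      (∀ z, z = 3 ∨ z = 12 → m1.nat z = m0.nat z) → m1.real = m0.real → Grid n χ g m1 →
      (∀ (u : Fin g.card) (m' : Mem), Grid n χ g m' → m'.nat 3 0 = v → m'.nat 12 0 = w →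
        m'.nat 4 0 = u → m'.real = m0.real → (ts.holds g.edgeRel m' ↔ Q u)) →
      (Prog.run g.edgeRel (.count 4 y .verts ts) m1).1.nat y 0 = (Finset.univ.filter Q).card := by
    intro y ts Q _ m1 hy h1 h2 hG1 hQ
    refine run_count_verts Q (by omega) (by omega) hG1.verts fun u m' h1' h2' h3' => ?_
    refine hQ u m' (hG1.congr (fun z hz => h1' z (by omega) (by omega)) fun z _ => by rw [h2'])
      ?_ ?_ h3' (by rw [h2', h2])
    · rw [h1' 3 (by norm_num) (by omega), h1 3 (by simp), hw3]
    · rw [h1' 12 (by norm_num) (by omega), h1 12 (by simp), hw]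
  have hplus : ∀ (u : Fin g.card) (m' : Mem) (ts : Clause), Grid n χ g m' → m'.nat 12 0 = w →
        m'.nat 4 0 = u → m'.real = m0.real → (Clause.holds g.edgeRel m' (plusTests d ts) ↔
          (assignment n χ g u = assignment n χ g w ∧ σ u = 1) ∧ ts.holds g.edgeRel m') := by
    intro u m' ts hG' h12 h4 hr
    rw [plusTests, Clause.holds_cons_true, Clause.holds_cons_true,
      hG'.same_iff (e := .var 4) (f := .var 12) (u := u) (v := w) h4 h12, and_assoc]
    refine and_congr_right fun h => and_congr_left fun _ => ?_
    simp only [Test.holds, RExpr.eval, NExpr.eval, h4, hr, hσ u h, one_le_signType_iff]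
  have hminus : ∀ (u : Fin g.card) (m' : Mem) (ts : Clause), Grid n χ g m' → m'.nat 12 0 = w →
        m'.nat 4 0 = u → m'.real = m0.real → (Clause.holds g.edgeRel m' (minusTests d ts) ↔
          (assignment n χ g u = assignment n χ g w ∧ σ u = -1) ∧ ts.holds g.edgeRel m') := by
    intro u m' ts hG' h12 h4 hr
    rw [minusTests, Clause.holds_cons_true, Clause.holds_cons_true,
      hG'.same_iff (e := .var 4) (f := .var 12) (u := u) (v := w) h4 h12, and_assoc]
    refine and_congr_right fun h => and_congr_left fun _ => ?_
    simp only [Test.holds, RExpr.eval, NExpr.eval, h4, hr, hσ u h, signType_le_neg_one_iff]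
  have hedge : ∀ (u : Fin g.card) (m' : Mem), m'.nat 3 0 = v → m'.nat 4 0 = u →
      (Clause.holds g.edgeRel m' [(true, .natLe (.const 1) (.edge (.var 3) (.var 4)))] ↔
        g.graph.Adj v u) := by
    intro u m' h3 h4
    simp only [Clause.holds_cons_true, Clause.holds_nil, and_true, Test.holds, NExpr.eval, h3, h4,
      edgeRel_iff]
    split_ifs with h <;> simp [h]
  have hnum : ∀ s, numLabel σ (vertsIn (assignment n χ g) (assignment n χ g w)) s =
      (Finset.univ.filter fun u => assignment n χ g u = assignment n χ g w ∧ σ u = s).card := by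
    intro s; rw [numLabel, vertsIn, Finset.filter_filter]
  have hdeg : ∀ s, degPlus g.graph σ (vertsIn (assignment n χ g) (assignment n χ g w)) s v =
      (Finset.univ.filter fun u => (assignment n χ g u = assignment n χ g w ∧ σ u = s) ∧
        g.graph.Adj v u).card := by
    intro s; rw [degPlus, vertsIn, Finset.filter_filter]; simp only [and_assoc]
  rw [run_seq, run_seq, run_seq, run_seq]
  set m1 := (Prog.run g.edgeRel (.count 4 14 .verts (plusTests d [])) m0).1 with hm1
  set m2 := (Prog.run g.edgeRel (.count 4 15 .verts (minusTests d [])) m1).1 with hm2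
  set m3 := (Prog.run g.edgeRel (.count 4 16 .verts
    (plusTests d [(true, .natLe (.const 1) (.edge (.var 3) (.var 4)))])) m2).1 with hm3
  set m4 := (Prog.run g.edgeRel (.count 4 17 .verts
    (minusTests d [(true, .natLe (.const 1) (.edge (.var 3) (.var 4)))])) m3).1 with hm4
  have f1 : ∀ z, z ≠ 4 → z ≠ 14 → m1.nat z = m0.nat z := fun z h h' =>
    run_nat_frame _ _ _ (notMem_writesNat_count ⟨h, h'⟩)
  have f2 : ∀ z, z ≠ 4 → z ≠ 15 → m2.nat z = m1.nat z := fun z h h' =>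
    run_nat_frame _ _ _ (notMem_writesNat_count ⟨h, h'⟩)
  have f3 : ∀ z, z ≠ 4 → z ≠ 16 → m3.nat z = m2.nat z := fun z h h' =>
    run_nat_frame _ _ _ (notMem_writesNat_count ⟨h, h'⟩)
  have f4 : ∀ z, z ≠ 4 → z ≠ 17 → m4.nat z = m3.nat z := fun z h h' =>
    run_nat_frame _ _ _ (notMem_writesNat_count ⟨h, h'⟩)
  have r1 : m1.real = m0.real := funext fun z => run_real_frame _ _ _ (by simp)
  have r2 : m2.real = m0.real := (funext fun z => run_real_frame _ _ _ (by simp)).trans r1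
  have r3 : m3.real = m0.real := (funext fun z => run_real_frame _ _ _ (by simp)).trans r2
  have r4 : m4.real = m0.real := (funext fun z => run_real_frame _ _ _ (by simp)).trans r3
  have g1 : Grid n χ g m1 := hGw.run (keepsGrid_count (by norm_num) (by norm_num))
  have g2 : Grid n χ g m2 := g1.run (keepsGrid_count (by norm_num) (by norm_num))
  have g3 : Grid n χ g m3 := g2.run (keepsGrid_count (by norm_num) (by norm_num))
  have c1 : m1.nat 14 0 = numLabel σ (vertsIn (assignment n χ g) (assignment n χ g w)) 1 := by
    rw [hnum]
    exact key 14 _ _ m0 (by norm_num) (fun _ _ => rfl) rfl hGw fun u m' hG' _ h12 h4 hr => by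
      rw [hplus u m' [] hG' h12 h4 hr]; simp
  have c2 : m2.nat 15 0 = numLabel σ (vertsIn (assignment n χ g) (assignment n χ g w)) (-1) := by
    rw [hnum]
    exact key 15 _ _ m1 (by norm_num) (fun z hz => f1 z (by omega) (by omega)) r1 g1
      fun u m' hG' _ h12 h4 hr => by rw [hminus u m' [] hG' h12 h4 hr]; simp
  have c3 : m3.nat 16 0 =
      degPlus g.graph σ (vertsIn (assignment n χ g) (assignment n χ g w)) 1 v := by
    rw [hdeg]
    exact key 16 _ _ m2 (by norm_num) (fun z hz => by
      rw [f2 z (by omega) (by omega), f1 z (by omega) (by omega)]) r2 g2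
      fun u m' hG' h3' h12 h4 hr => by rw [hplus u m' _ hG' h12 h4 hr, hedge u m' h3' h4]
  have c4 : m4.nat 17 0 =
      degPlus g.graph σ (vertsIn (assignment n χ g) (assignment n χ g w)) (-1) v := by
    rw [hdeg]
    exact key 17 _ _ m3 (by norm_num) (fun z hz => by
      rw [f3 z (by omega) (by omega), f2 z (by omega) (by omega),
        f1 z (by omega) (by omega)]) r3 g3
      fun u m' hG' h3' h12 h4 hr => by rw [hminus u m' _ hG' h12 h4 hr, hedge u m' h3' h4]
  rw [run_decideProg (E := g.edgeRel) (m := m4) (mem_vertsIn.2 rfl) _ _ _ _ c4, r4]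
  · rw [f4 3 (by norm_num) (by norm_num), f3 3 (by norm_num) (by norm_num),
      f2 3 (by norm_num) (by norm_num), f1 3 (by norm_num) (by norm_num), hw3]
  · rw [f4 14 (by norm_num) (by norm_num), f3 14 (by norm_num) (by norm_num),
      f2 14 (by norm_num) (by norm_num), c1]
  · rw [f4 15 (by norm_num) (by norm_num), f3 15 (by norm_num) (by norm_num), c2]
  · rw [f4 16 (by norm_num) (by norm_num), c3]

end RAM
end GSBM

namespace GSBM
namespace RAM

/-! ### The whole program -/

/-- Write the output flag. -/
def flagProg : Prog :=
  .branch (.setNat 1 (.const 0) (.const 1)) (.setNat 1 (.const 0) (.const 0))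
    [(true, .natLe (.const 1) (.var 9)), (true, .natLe (.var 18) (.const 0))]

/-- Search the visibility graph, with a root block in an occupied block if there is one. -/
def searchProg (d : ℕ) (δ : ℝ) : Prog :=
  .seq (occProg d δ)
  (.seq (.count 4 9 .verts [(true, .natLe (.const 1) (.read 6 (.var 4)))])
  (.seq (.last 4 11 .verts [(true, .natLe (.const 1) (.read 6 (.var 4)))])
  (.seq (levelInitProg d)
  (.seq (bfsProg d)
  (.seq (.count 4 18 .verts [(true, .natLe (.const 1) (.read 6 (.var 4))),
    (true, .natLe (.read 7 (.var 4)) (.const 0))])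
  flagProg)))))

/-- Label all vertices. -/
def labelProg (d : ℕ) (a b : ℝ) : Prog :=
  .seq (rootLabelProg d a b) (.loop 5 .verts (levelProg d a b))

/-- Phase I. -/
def phaseIProg (d C : ℕ) (χ δ a b : ℝ) : Prog :=
  .seq (gridProg d C χ) (.seq (searchProg d δ) (labelProg d a b))

variable {d n : ℕ} {χ δ : ℝ} {g : SpatialGraph d} {m : Mem} {a b : ℝ}

/-- Level t + 2 is distance t + 1 from the root. Labels can be written in place, since vertices of
this level read only their parents' blocks at level t + 1, which the loop leaves unchanged. -/
theorem run_levelProg (hn : 2 ≤ n) (hχ : 0 < χ) (hδ : 0 < δ)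
    (hconn : (visGraph n χ δ (assignment n χ g)).Connected) (hG : Grid n χ g m)
    (hlev : ∀ v : Fin g.card, m.nat 7 v = bfsLevel (bfsRoot hδ hconn) χ g.card v)
    {u₀ : Fin g.card} {σ : Fin g.card → SignType}
    (hσ : IsPhaseILabeling g.graph a b _ (bfsSchedule hδ hconn) u₀ σ) {t : ℕ}
    (ht : m.nat 5 0 = t)
    (hlab : ∀ v : Fin g.card, m.real (d + 1) v =
      if 1 ≤ bfsLevel (bfsRoot hδ hconn) χ g.card v ∧
        bfsLevel (bfsRoot hδ hconn) χ g.card v ≤ t + 1 then ((σ v : SignType) : ℝ) else 0)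
    (v : Fin g.card) :
    ((levelProg d a b).run g.edgeRel m).1.real (d + 1) v =
      if 1 ≤ bfsLevel (bfsRoot hδ hconn) χ g.card v ∧
        bfsLevel (bfsRoot hδ hconn) χ g.card v ≤ t + 2 then ((σ v : SignType) : ℝ) else 0 := by
  set r := bfsRoot hδ hconn with hr
  refine run_loop_verts_real (fun v => if 1 ≤ bfsLevel r χ g.card v ∧
        bfsLevel r χ g.card v ≤ t + 2 then ((σ v : SignType) : ℝ) else 0) hG.verts
    (fun i m' h1 h2 h3 h4 => ?_) v
  have hframe : ∀ z, z ≠ 4 ∧ z ≠ 12 ∧ z ≠ 14 ∧ z ≠ 15 ∧ z ≠ 16 ∧ z ≠ 17 → z ≠ 3 →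
      m'.nat z = m.nat z := fun z hz hz' => h1 z hz'
        (notMem_writesNat_branch (notMem_writesNat_propagateProg hz) (by simp) _)
  have hG' : Grid n χ g m' := hG.of_frame (x := 3) (y := 3)
    (Prog.KeepsGrid.branch keepsGrid_propagateProg keepsGrid_keep _) (by norm_num)
    (by norm_num) rfl (fun z hz _ => h1 z hz) h2
  have h7 : ∀ v : Fin g.card, m'.nat 7 v = bfsLevel r χ g.card v := fun v => by
    rw [hframe 7 (by norm_num) (by norm_num), hlev]
  have h5 : m'.nat 5 0 = t := by rw [hframe 5 (by norm_num) (by norm_num), ht]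
  have hiff : Clause.holds g.edgeRel m'
      [(true, .natLe (.read 7 (.var 3)) (.add (.var 5) (.const 2))),
      (true, .natLe (.add (.var 5) (.const 2)) (.read 7 (.var 3)))] ↔
      bfsLevel r χ g.card i = t + 2 := by
    simp only [Clause.holds_cons_true, Clause.holds_nil, and_true, Test.holds, NExpr.eval, h3, h5,
      h7]
    omega
  rw [run_branch_real]
  by_cases hi : bfsLevel r χ g.card i = t + 2
  swap
  · rw [if_neg (fun h => hi (hiff.1 h)), run_keep]
    have : m'.real (d + 1) i = if 1 ≤ bfsLevel r χ g.card i ∧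
        bfsLevel r χ g.card i ≤ t + 2 then ((σ i : SignType) : ℝ) else 0 := by
      rw [h4, if_neg (lt_irrefl _), hlab]
      congr 1
      apply propext
      omega
    rw [← this, Function.update_eq_self]
  rw [if_pos (hiff.2 hi), if_pos (by omega)]
  have ho : Occupied n δ (assignment n χ g) (assignment n χ g i) := by
    by_contra h
    simp [bfsLevel, h] at hi
  have hd := bfsLevel_card hδ hconn (r := r) ho
  have hne : (⟨_, ho⟩ : {i // Occupied n δ (assignment n χ g) i}) ≠ r := by
    intro h
    rw [h, SimpleGraph.dist_self] at hd
    omega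
  rw [run_propagateProg hn hχ hδ hconn hG' h7 h3 ho hne (σ := σ)]
  · congr 2
    exact (hσ.step ⟨_, ho⟩ hne i (mem_vertsIn.2 rfl)).symm
  · intro u hu
    have hou : Occupied n δ (assignment n χ g) (assignment n χ g u) := hu ▸ (bfsParent r _ χ).2
    have hdu := bfsLevel_card hδ hconn (r := r) hou
    have hpd := bfsParent_dist hδ hconn hne
    have : (⟨_, hou⟩ : {i // Occupied n δ (assignment n χ g) i}) = bfsParent r ⟨_, ho⟩ χ :=
      Subtype.ext hu
    rw [this] at hdu
    rw [h4, hlab]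
    split_ifs <;> first | rfl | omega

theorem run_labelProg (hn : 2 ≤ n) (hχ : 0 < χ) (hδ : 0 < δ)
    (hconn : (visGraph n χ δ (assignment n χ g)).Connected) (hG : Grid n χ g m)
    (hlev : ∀ v : Fin g.card, m.nat 7 v = bfsLevel (bfsRoot hδ hconn) χ g.card v)
    {u₀ : Fin g.card} (hu : m.nat 11 0 = u₀)
    (hu' : assignment n χ g u₀ = (bfsRoot hδ hconn).1)
    (h0 : ∀ v : Fin g.card, m.real (d + 1) v = 0) (v : Fin g.card) :
    ((labelProg d a b).run g.edgeRel m).1.real (d + 1) v =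
      ((phaseI g.graph a b (assignment n χ g) (bfsSchedule hδ hconn) u₀ v : SignType) : ℝ) := by
  have hσ := isPhaseILabeling_phaseI g.graph a b (bfsSchedule hδ hconn) u₀
  set σ := phaseI g.graph a b (assignment n χ g) (bfsSchedule hδ hconn) u₀
  have hroot := run_rootLabelProg (a := a) (b := b) hG hu h0
  -- Level one is the root block, so labeling the root block establishes the invariant at t = 0.
  have hlevel1 : ∀ v, (1 ≤ bfsLevel (bfsRoot hδ hconn) χ g.card v ∧
      bfsLevel (bfsRoot hδ hconn) χ g.card v ≤ 0 + 1) ↔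
        assignment n χ g v = assignment n χ g u₀ := by
    intro v
    have h1 : bfsLevel (bfsRoot hδ hconn) χ g.card v = 0 + 1 ↔
        bfsLevel (bfsRoot hδ hconn) χ 0 v = 0 + 1 := by
      rw [bfsLevel_eq_iff (Nat.zero_le _), bfsLevel_eq_iff le_rfl]
    rw [bfsLevel_zero] at h1
    rw [hu']
    split_ifs at h1 with h
    · simp only [h, iff_true]; omega
    · have h2 : ¬ bfsLevel (bfsRoot hδ hconn) χ g.card v = 0 + 1 :=
        fun h' => absurd (h1.1 h') (by norm_num)
      simp only [h, iff_false]; omega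
  have hroot' : ∀ v : Fin g.card, ((rootLabelProg d a b).run g.edgeRel m).1.real (d + 1) v =
      if 1 ≤ bfsLevel (bfsRoot hδ hconn) χ g.card v ∧
        bfsLevel (bfsRoot hδ hconn) χ g.card v ≤ 0 + 1 then ((σ v : SignType) : ℝ) else 0 := by
    intro v
    rw [hroot]
    simp only [hlevel1]
    split_ifs with h
    · rw [hσ.root v (mem_vertsIn.2 (h.trans hu')), hu']
      rfl
    · rfl
  have hGroot : Grid n χ g ((rootLabelProg d a b).run g.edgeRel m).1 :=
    hG.run (.seq (keepsGrid_count (by norm_num) (by norm_num))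
      (.loop (by norm_num) keepsGrid_classifyProg))
  have h7 : ((rootLabelProg d a b).run g.edgeRel m).1.nat 7 = m.nat 7 :=
    run_nat_frame _ _ _ (notMem_writesNat_seq (notMem_writesNat_count (by norm_num))
      (notMem_writesNat_loop (by norm_num) (notMem_writesNat_classifyProg (by norm_num))))
  rw [labelProg, run_seq]
  have hfin := (loop_induction (E := g.edgeRel) (x := 5) (e := .verts) (p := levelProg d a b)
    (m := ((rootLabelProg d a b).run g.edgeRel m).1) (K := g.card)
    (by simp [NExpr.eval, hGroot.verts]) (fun t m' =>
    Grid n χ g m' ∧ m'.nat 7 = m.nat 7 ∧ ∀ v : Fin g.card, m'.real (d + 1) v =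
      if 1 ≤ bfsLevel (bfsRoot hδ hconn) χ g.card v ∧
        bfsLevel (bfsRoot hδ hconn) χ g.card v ≤ t + 1 then ((σ v : SignType) : ℝ) else 0)
    ⟨hGroot, h7, hroot'⟩ ?_).2.2 v
  · rw [hfin]
    by_cases ho : Occupied n δ (assignment n χ g) (assignment n χ g v)
    · have h1 := bfsLevel_card hδ hconn (r := bfsRoot hδ hconn) ho
      have h2 := dist_lt_of_reachable hδ (hconn.preconnected (bfsRoot hδ hconn) ⟨_, ho⟩)
      rw [if_pos (by omega)]
    · rw [hσ.outside v ho]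
      split_ifs <;> simp
  · rintro t m' _ ⟨hG', h7', hlab⟩
    have hG1 : Grid n χ g (m'.setNat 5 0 t) := hG'.congr
      (fun z hz => Mem.setNat_nat_ne _ _ _ (by omega)) fun z _ => rfl
    refine ⟨hG1.run keepsGrid_levelProg, ?_, ?_⟩
    · rw [run_nat_frame _ _ _ (notMem_writesNat_levelProg (by norm_num)),
        Mem.setNat_nat_ne _ _ _ (by norm_num), h7']
    · exact run_levelProg hn hχ hδ hconn hG1 (fun v => by
        rw [Mem.setNat_nat_ne _ _ _ (by norm_num), h7', hlev]) hσ (by simp) hlab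

theorem run_searchProg (hd : 0 < d) (hn : 2 ≤ n) (hχ : 0 < χ) (hδ : 0 < δ) (hG : Grid n χ g m) :
    (¬ (visGraph n χ δ (assignment n χ g)).Connected →
      ((searchProg d δ).run g.edgeRel m).1.nat 1 0 = 0) ∧
    ∀ hconn : (visGraph n χ δ (assignment n χ g)).Connected,
      ((searchProg d δ).run g.edgeRel m).1.nat 1 0 = 1 ∧
      (∀ v : Fin g.card, ((searchProg d δ).run g.edgeRel m).1.nat 7 v =
        bfsLevel (bfsRoot hδ hconn) χ g.card v) ∧
      ∃ u₀ : Fin g.card, ((searchProg d δ).run g.edgeRel m).1.nat 11 0 = u₀ ∧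
        assignment n χ g u₀ = (bfsRoot hδ hconn).1 := by
  classical
  set E := g.edgeRel
  simp only [searchProg, run_seq]
  generalize hm1 : ((occProg d δ).run E m).1 = m1
  generalize hm2 :
    (Prog.run E (.count 4 9 .verts [(true, .natLe (.const 1) (.read 6 (.var 4)))]) m1).1 = m2
  generalize hm3 :
    (Prog.run E (.last 4 11 .verts [(true, .natLe (.const 1) (.read 6 (.var 4)))]) m2).1 = m3
  generalize hm4 : (Prog.run E (levelInitProg d) m3).1 = m4
  generalize hm5 : (Prog.run E (bfsProg d) m4).1 = m5
  generalize hm6 : (Prog.run E (.count 4 18 .verts [(true, .natLe (.const 1) (.read 6 (.var 4))),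
    (true, .natLe (.read 7 (.var 4)) (.const 0))]) m5).1 = m6
  have hk1 : (occProg d δ).KeepsGrid d := .loop (by norm_num)
    (.seq (keepsGrid_count (by norm_num) (by norm_num)) (.branch (keepsGrid_setNat (by norm_num))
      (keepsGrid_setNat (by norm_num)) _))
  have hk4 : (levelInitProg d).KeepsGrid d := .loop (by norm_num)
    (.branch (keepsGrid_setNat (by norm_num)) (keepsGrid_setNat (by norm_num)) _)
  have g1 : Grid n χ g m1 := hm1 ▸ hG.run hk1
  have g2 : Grid n χ g m2 := hm2 ▸ g1.run (keepsGrid_count (by norm_num) (by norm_num))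
  have g3 : Grid n χ g m3 := hm3 ▸ g2.run (keepsGrid_last (by norm_num) (by norm_num))
  have g4 : Grid n χ g m4 := hm4 ▸ g3.run hk4
  have g5 : Grid n χ g m5 := hm5 ▸ g4.run (.loop (by norm_num) keepsGrid_roundProg)
  have f2 : ∀ z, z ≠ 4 → z ≠ 9 → m2.nat z = m1.nat z := fun z h h' => hm2 ▸
    run_nat_frame _ _ _ (notMem_writesNat_count ⟨h, h'⟩)
  have f3 : ∀ z, z ≠ 4 → z ≠ 11 → m3.nat z = m2.nat z := fun z h h' => hm3 ▸
    run_nat_frame _ _ _ (notMem_writesNat_last ⟨h, h'⟩)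
  have f4 : ∀ z, z ≠ 3 → z ≠ 7 → m4.nat z = m3.nat z := fun z h h' => hm4 ▸
    run_nat_frame _ _ _ (notMem_writesNat_loop h (notMem_writesNat_branch
      (notMem_writesNat_setNat h') (notMem_writesNat_setNat h') _))
  have f5 : ∀ z, z ≠ 3 → z ≠ 4 → z ≠ 5 → z ≠ 7 → z ≠ 8 → m5.nat z = m4.nat z :=
    fun z h h' h'' h3 h4 => hm5 ▸ run_nat_frame _ _ _ (notMem_writesNat_loop h''
      (notMem_writesNat_roundProg ⟨h, h', h3, h4⟩))
  have f6 : ∀ z, z ≠ 4 → z ≠ 18 → m6.nat z = m5.nat z := fun z h h' => hm6 ▸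
    run_nat_frame _ _ _ (notMem_writesNat_count ⟨h, h'⟩)
  have f7 : ∀ z, z ≠ 1 → (flagProg.run E m6).1.nat z = m6.nat z := fun z h =>
    run_nat_frame _ _ _ (notMem_writesNat_branch
      (notMem_writesNat_setNat h) (notMem_writesNat_setNat h) _)
  have hocc : ∀ v : Fin g.card, m1.nat 6 v =
      if Occupied n δ (assignment n χ g) (assignment n χ g v) then 1 else 0 :=
    hm1 ▸ run_occProg hd hG
  have hq : ∀ (m0 m' : Mem) (u : Fin g.card), m0.nat 6 = m1.nat 6 → m'.nat 6 = m0.nat 6 →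
      m'.nat 4 0 = u → ((Test.natLe (.const 1) (.read 6 (.var 4))).holds E m' ↔
        Occupied n δ (assignment n χ g) (assignment n χ g u)) := by
    intro m0 m' u h h' h4
    simp only [Test.holds, NExpr.eval, h4, h', h, hocc]
    split_ifs with h <;> simp [h]
  have h9 : m6.nat 9 0 = (Finset.univ.filter fun u => Occupied n δ (assignment n χ g)
      (assignment n χ g u)).card := by
    rw [f6 9 (by norm_num) (by norm_num), f5 9 (by norm_num) (by norm_num) (by norm_num)
      (by norm_num) (by norm_num), f4 9 (by norm_num) (by norm_num),
      f3 9 (by norm_num) (by norm_num), ← hm2]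
    refine run_count_verts _ (by norm_num) (by norm_num) g1.verts fun u m' h1 h2 h3 => ?_
    simpa using hq m1 m' u rfl (h1 6 (by norm_num) (by norm_num)) h3
  have hflag : (flagProg.run E m6).1.nat 1 0 = if 1 ≤ m6.nat 9 0 ∧ m6.nat 18 0 = 0 then 1
      else 0 := by
    rw [flagProg]
    split_ifs with h
    · rw [run_branch_pos _ _ (by simpa [Test.holds, NExpr.eval] using h)]
      simp [Prog.run, NExpr.eval]
    · rw [run_branch_neg _ _ (by simpa [Test.holds, NExpr.eval] using h)]
      simp [Prog.run, NExpr.eval]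
  rw [hflag]
  by_cases hex : ∃ v, Occupied n δ (assignment n χ g) (assignment n χ g v)
  swap
  · have h0 : ¬ 1 ≤ m6.nat 9 0 := by
      rw [h9]
      push Not at hex
      simp [hex]
    refine ⟨fun _ => by simp [h0], fun hconn => absurd (exists_occupied_vertex hδ hconn) hex⟩
  have h11 : m3.nat 11 0 = lastSat _ hex :=
    hm3 ▸ run_last_verts _ (by norm_num) g2.verts (fun u m' h1 h2 h3 => by
      simpa using hq m2 m' u (f2 6 (by norm_num) (by norm_num))
        (h1 6 (by norm_num) (by norm_num)) h3) hex
  set r : {i // Occupied n δ (assignment n χ g) i} :=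
    ⟨assignment n χ g (lastSat _ hex), lastSat_spec _ hex⟩ with hr
  have h4 : ∀ v : Fin g.card, m4.nat 7 v = bfsLevel r χ 0 v :=
    hm4 ▸ run_levelInitProg g3 h11 rfl
  have h46 : m4.nat 6 = m1.nat 6 := by
    rw [f4 6 (by norm_num) (by norm_num), f3 6 (by norm_num) (by norm_num),
      f2 6 (by norm_num) (by norm_num)]
  have h5 : ∀ v : Fin g.card, m5.nat 7 v = bfsLevel r χ g.card v :=
    hm5 ▸ run_bfsProg hn hχ hδ g4 (fun v => by rw [h46, hocc]) h4
  have h56 : m5.nat 6 = m1.nat 6 := by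
    rw [f5 6 (by norm_num) (by norm_num) (by norm_num) (by norm_num) (by norm_num), h46]
  have h18 : m6.nat 18 0 = (Finset.univ.filter fun u => Occupied n δ (assignment n χ g)
      (assignment n χ g u) ∧ bfsLevel r χ g.card u = 0).card := by
    rw [← hm6]
    refine run_count_verts _ (by norm_num) (by norm_num) g5.verts fun u m' h1 h2 h3 => ?_
    simp only [Clause.holds_cons_true, Clause.holds_nil, and_true,
      hq m5 m' u h56 (h1 6 (by norm_num) (by norm_num)) h3]
    refine and_congr_right fun _ => ?_
    simp [Test.holds, NExpr.eval, h3, h1 7 (by norm_num) (by norm_num), h5]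
  -- The graph is connected if and only if it has a vertex and the search leaves no occupied vertex
  -- at level zero. The first condition is tested separately because without occupied blocks the
  -- root variable is meaningless.
  have hiff : (1 ≤ m6.nat 9 0 ∧ m6.nat 18 0 = 0) ↔
      (visGraph n χ δ (assignment n χ g)).Connected := by
    rw [connected_iff_bfsLevel (r := r) hδ, h9, h18, Finset.card_eq_zero,
      Finset.filter_eq_empty_iff, Nat.one_le_iff_ne_zero, Finset.card_ne_zero]
    constructor
    · rintro ⟨_, h⟩ u hu h'
      exact h (Finset.mem_univ u) ⟨hu, h'⟩
    · intro h
      obtain ⟨v, hv⟩ := hex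
      exact ⟨⟨v, by simpa using hv⟩, fun u _ hu => h u hu.1 hu.2⟩
  refine ⟨fun h => by rw [if_neg (fun h' => h (hiff.1 h'))], fun hconn => ⟨?_, ?_, ?_⟩⟩
  · rw [if_pos (hiff.2 hconn)]
  · intro v
    rw [f7 7 (by norm_num), f6 7 (by norm_num) (by norm_num), h5]
    rfl
  · refine ⟨lastSat _ hex, ?_, rfl⟩
    rw [f7 11 (by norm_num), f6 11 (by norm_num) (by norm_num), f5 11 (by norm_num) (by norm_num)
      (by norm_num) (by norm_num) (by norm_num), f4 11 (by norm_num) (by norm_num), h11]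

/-! ### Frames and loop bounds of the whole program -/

theorem writesReal_searchProg : (searchProg d δ).writesReal = ∅ := by
  ext z
  simp only [Set.mem_empty_iff_false, iff_false]
  simp only [searchProg, Prog.writesReal, Set.mem_union, not_or, writesReal_count,
    writesReal_last, occProg, levelInitProg, bfsProg, roundProg, flagProg]
  refine ⟨⟨by simp, ?_⟩, by simp, by simp, ?_, ⟨by simp, ?_⟩, by simp, ?_⟩ <;>
    exact notMem_writesReal_branch (by simp) (by simp) _

theorem keepsGrid_searchProg : (searchProg d δ).KeepsGrid d :=
  .seq (.loop (by norm_num) (.seq (keepsGrid_count (by norm_num) (by norm_num))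
    (.branch (keepsGrid_setNat (by norm_num)) (keepsGrid_setNat (by norm_num)) _)))
  (.seq (keepsGrid_count (by norm_num) (by norm_num))
  (.seq (keepsGrid_last (by norm_num) (by norm_num))
  (.seq (.loop (by norm_num)
    (.branch (keepsGrid_setNat (by norm_num)) (keepsGrid_setNat (by norm_num)) _))
  (.seq (.loop (by norm_num) keepsGrid_roundProg)
  (.seq (keepsGrid_count (by norm_num) (by norm_num))
    (.branch (keepsGrid_setNat (by norm_num)) (keepsGrid_setNat (by norm_num)) _))))))

theorem keepsGrid_labelProg : (labelProg d a b).KeepsGrid d :=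
  .seq (.seq (keepsGrid_count (by norm_num) (by norm_num))
    (.loop (by norm_num) keepsGrid_classifyProg)) (.loop (by norm_num) keepsGrid_levelProg)

theorem linearLoops_coordsProg {C J : ℕ} : (coordsProg d C J).LinearLoops := by
  induction J with
  | zero => trivial
  | succ J ih => exact ⟨ih, linear_verts, linearLoops_count (linear_linear C), trivial⟩

theorem linearLoops_decideProg : (decideProg d a b).LinearLoops :=
  linearLoops_branch (linearLoops_branch (by trivial) (linearLoops_branch (by trivial)
    (by trivial) _) _) (linearLoops_branch (by trivial) (linearLoops_branch (by trivial)
    (by trivial) _) _) _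

theorem linearLoops_phaseIProg {C : ℕ} : (phaseIProg d C χ δ a b).LinearLoops := by
  have hc : ∀ {x y : ℕ} {ts : Clause}, (Prog.count x y .verts ts).LinearLoops :=
    linearLoops_count linear_verts
  have hl : ∀ {x y : ℕ} {ts : Clause}, (Prog.last x y .verts ts).LinearLoops :=
    linearLoops_last linear_verts
  refine ⟨⟨linearLoops_count (linear_linear C), trivial, linearLoops_coordsProg⟩,
    ⟨⟨linear_verts, hc, linearLoops_branch (by trivial) (by trivial) _⟩, hc, hl,
      ⟨linear_verts, linearLoops_branch (by trivial) (by trivial) _⟩,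
      ⟨linear_verts, linear_verts, hc, linearLoops_branch (by trivial) (by trivial) _⟩, hc,
      linearLoops_branch (by trivial) (by trivial) _⟩,
    ⟨hc, linear_verts, hc, linearLoops_branch (linearLoops_branch (by trivial)
      (linearLoops_branch (by trivial) (by trivial) _) _) (by trivial) _⟩,
    linear_verts, linear_verts, linearLoops_branch (p := propagateProg d a b)
      (by exact ⟨hl, hc, hc, hc, hc, linearLoops_decideProg⟩) (by trivial) _⟩

end RAM

open RAM in
/-- Phase I with breadth-first schedules runs in polynomial time. -/
theorem polyTimePhaseI_bfsRule {d : ℕ} (hd : 0 < d) {χ δ : ℝ} (hχ : 0 < χ) (hδ : 0 < δ)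
    (a b : ℝ) : PolyTimePhaseI (bfsRule d χ hδ) a b := by
  obtain ⟨C, hC⟩ := blocksPerSide_le_linear d hχ
  have hgrid0 : 0 ∉ (gridProg d C χ).writesNat :=
    notMem_writesNat_seq (notMem_writesNat_count (by norm_num))
      (notMem_writesNat_seq (by simp) (notMem_writesNat_coordsProg (by norm_num) (by norm_num)))
  obtain ⟨T, hT⟩ := exists_polynomial_cost (phaseIProg d C χ δ a b)
    (notMem_writesNat_seq hgrid0 (notMem_writesNat_seq (keepsGrid_searchProg.1 0 (by simp))
      (keepsGrid_labelProg.1 0 (by simp)))) linearLoops_phaseIProg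
  refine ⟨phaseIProg d C χ δ a b, T, fun n hn g hpos => ⟨?_, ?_⟩⟩
  · have := hT g.edgeRel (inputMem n g)
    simpa [inputMem] using this
  have hG : Grid n χ g ((gridProg d C χ).run g.edgeRel (inputMem n g)).1 :=
    run_gridProg hn hχ (hC n hn g.card)
  have hreal : ((gridProg d C χ).run g.edgeRel (inputMem n g)).1.real (d + 1) = fun _ => 0 := by
    rw [run_real_frame _ _ _ (by simp [gridProg, sizeProg, writesReal_coordsProg])]
    funext i
    simp [inputMem]
  simp only [phaseIProg, run_seq]
  set m1 := ((gridProg d C χ).run g.edgeRel (inputMem n g)).1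
  obtain ⟨h1, h2⟩ := run_searchProg hd hn hχ hδ hG
  set m2 := ((searchProg d δ).run g.edgeRel m1).1 with hm2
  have hG2 : Grid n χ g m2 := hG.run keepsGrid_searchProg
  have hf1 : ((labelProg d a b).run g.edgeRel m2).1.nat 1 = m2.nat 1 :=
    run_nat_frame _ _ _ (notMem_writesNat_seq (notMem_writesNat_seq
      (notMem_writesNat_count (by norm_num)) (notMem_writesNat_loop (by norm_num)
        (notMem_writesNat_classifyProg (by norm_num)))) (notMem_writesNat_loop (by norm_num)
        (notMem_writesNat_levelProg (by norm_num))))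
  rw [hf1]
  refine ⟨h1, fun hconn => ?_⟩
  obtain ⟨h3, h4, u₀, h5, h6⟩ := h2 hconn
  refine ⟨h3, u₀, mem_vertsIn.2 h6, fun v => ?_⟩
  exact run_labelProg hn hχ hδ hconn hG2 h4 h5 h6 (fun v => by
    rw [hm2, run_real_frame _ _ _ (by simp [writesReal_searchProg]), hreal]) v

end GSBM

namespace GSBM

/-! ### Volumes of balls and unit cubes -/

theorem volume_ball_coords {d : ℕ} (c : Fin d → ℝ) {R : ℝ} (hR : 0 < R) :
    volume {x : Fin d → ℝ | ∑ j, (x j - c j) ^ 2 < R ^ 2} =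
      ENNReal.ofReal (unitBallVol d * R ^ d) := by
  have h1 : {x : Fin d → ℝ | ∑ j, (x j - c j) ^ 2 < R ^ 2} =
      (WithLp.toLp 2) ⁻¹' Metric.ball (WithLp.toLp 2 c : EuclideanSpace ℝ (Fin d)) R := by
    ext x
    simp only [Set.mem_ofPred_eq, Set.mem_preimage, Metric.mem_ball, EuclideanSpace.dist_eq,
      Real.dist_eq, sq_abs]
    rw [Real.sqrt_lt' hR]
  rw [h1, (PiLp.volume_preserving_toLp (Fin d)).measure_preimage
    Metric.isOpen_ball.measurableSet.nullMeasurableSet, Measure.addHaar_ball_of_pos _ _ hR,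
    finrank_euclideanSpace_fin, unitBallVol, mul_comm, ENNReal.ofReal_mul ENNReal.toReal_nonneg,
    ENNReal.ofReal_toReal measure_ball_lt_top.ne]

theorem volume_cell {d : ℕ} (m : Fin d → ℤ) :
    volume {x : Fin d → ℝ | ∀ j, ⌊x j⌋ = m j} = 1 := by
  have : {x : Fin d → ℝ | ∀ j, ⌊x j⌋ = m j} =
      Set.univ.pi fun j => Set.Ico (m j : ℝ) (m j + 1) := by
    ext x; simp [Int.floor_eq_iff]
  rw [this, Real.volume_pi_Ico]
  simp

theorem measurableSet_cell {d : ℕ} (m : Fin d → ℤ) :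
    MeasurableSet {x : Fin d → ℝ | ∀ j, ⌊x j⌋ = m j} := by
  rw [Set.ofPred_forall]
  exact MeasurableSet.iInter fun j => (Int.measurable_floor.comp (measurable_pi_apply j))
    (measurableSet_singleton (m j))

theorem unitBallVol_nonneg (d : ℕ) : 0 ≤ unitBallVol d := ENNReal.toReal_nonneg

theorem unitBallVol_pos (d : ℕ) : 0 < unitBallVol d :=
  ENNReal.toReal_pos (Metric.measure_ball_pos _ _ one_pos).ne' measure_ball_lt_top.ne

/-- If the cells with indices in `F` cover a ball, then there are at least as many of them as the
volume of the ball says. -/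
theorem volume_le_card {d : ℕ} (c : Fin d → ℝ) {R : ℝ} (hR : 0 < R) (F : Finset (Fin d → ℤ))
    (h : ∀ x : Fin d → ℝ, ∑ j, (x j - c j) ^ 2 < R ^ 2 → (fun j => ⌊x j⌋) ∈ F) :
    unitBallVol d * R ^ d ≤ F.card := by
  have h1 : {x : Fin d → ℝ | ∑ j, (x j - c j) ^ 2 < R ^ 2} ⊆
      ⋃ m ∈ F, {x : Fin d → ℝ | ∀ j, ⌊x j⌋ = m j} := fun x hx => by
    simp only [Set.mem_iUnion]
    exact ⟨_, h x hx, fun j => rfl⟩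
  have h2 := (measure_mono h1).trans (measure_biUnion_finset_le (μ := volume) F _)
  rw [volume_ball_coords c hR] at h2
  simp only [volume_cell, Finset.sum_const, nsmul_eq_mul, mul_one] at h2
  rw [← ENNReal.ofReal_natCast] at h2
  exact (ENNReal.ofReal_le_ofReal_iff (Nat.cast_nonneg _)).1 h2

/-- If a ball contains the cells with indices in `F`, then there are at most as many of them as
the volume of the ball says. -/
theorem card_le_volume {d : ℕ} (c : Fin d → ℝ) {R : ℝ} (hR : 0 < R) (F : Finset (Fin d → ℤ))
    (h : ∀ x : Fin d → ℝ, (fun j => ⌊x j⌋) ∈ F → ∑ j, (x j - c j) ^ 2 < R ^ 2) :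
    (F.card : ℝ) ≤ unitBallVol d * R ^ d := by
  have h1 : ⋃ m ∈ F, {x : Fin d → ℝ | ∀ j, ⌊x j⌋ = m j} ⊆
      {x : Fin d → ℝ | ∑ j, (x j - c j) ^ 2 < R ^ 2} := fun x hx => by
    simp only [Set.mem_iUnion] at hx
    obtain ⟨m, hm, hx⟩ := hx
    exact h x (by rwa [show (fun j => ⌊x j⌋) = m from funext hx])
  have h2 := measure_mono (μ := volume) h1
  rw [volume_ball_coords c hR, measure_biUnion_finset _ fun m _ => measurableSet_cell m] at h2
  · simp only [volume_cell, Finset.sum_const, nsmul_eq_mul, mul_one] at h2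
    rw [← ENNReal.ofReal_natCast] at h2
    exact (ENNReal.ofReal_le_ofReal_iff
      (mul_nonneg (unitBallVol_nonneg d) (pow_nonneg hR.le d))).1 h2
  · intro m _ m' _ hne
    refine Set.disjoint_left.2 fun x hx hx' => hne (funext fun j => ?_)
    rw [← hx j, hx' j]

/-! ### Visible offsets -/

/-- Offsets between blocks that are visible to each other, when the ratio between visibility
radius and side of a block is at least `ρ`. -/
def offsets (d : ℕ) (ρ : ℝ) : Finset (Fin d → ℤ) :=
  {m ∈ Fintype.piFinset fun _ => Finset.Icc (-(⌊ρ⌋₊ : ℤ)) ⌊ρ⌋₊ |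
    ∑ j, (|(m j : ℝ)| + 1) ^ 2 ≤ ρ ^ 2}

theorem mem_offsets {d : ℕ} {ρ : ℝ} (hρ : 0 ≤ ρ) {m : Fin d → ℤ} :
    m ∈ offsets d ρ ↔ ∑ j, (|(m j : ℝ)| + 1) ^ 2 ≤ ρ ^ 2 := by
  rw [offsets, Finset.mem_filter, and_iff_right_iff_imp]
  intro h
  rw [Fintype.mem_piFinset]
  intro j
  have h1 : (|(m j : ℝ)| + 1) ^ 2 ≤ ρ ^ 2 :=
    (Finset.single_le_sum (f := fun j => (|(m j : ℝ)| + 1) ^ 2) (fun i _ => by positivity)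
      (Finset.mem_univ j)).trans h
  have h2 : |(m j : ℝ)| + 1 ≤ ρ := (pow_le_pow_iff_left₀ (by positivity) hρ (by norm_num)).1 h1
  have h3 : (m j).natAbs ≤ ⌊ρ⌋₊ := by
    rw [Nat.le_floor_iff hρ]
    have : ((m j).natAbs : ℝ) = |(m j : ℝ)| := by simp
    linarith
  rw [Finset.mem_Icc]
  omega

theorem neg_mem_offsets {d : ℕ} {ρ : ℝ} (hρ : 0 ≤ ρ) {m : Fin d → ℤ} (h : m ∈ offsets d ρ) :
    -m ∈ offsets d ρ := by
  rw [mem_offsets hρ] at *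
  simpa using h

theorem offsets_le {d : ℕ} {ρ : ℝ} {m : Fin d → ℤ} (h : m ∈ offsets d ρ) (j : Fin d) :
    |m j| ≤ ⌊ρ⌋₊ := by
  rw [offsets, Finset.mem_filter, Fintype.mem_piFinset] at h
  have := Finset.mem_Icc.1 (h.1 j)
  rw [abs_le]
  exact this

theorem unit_mem_offsets {d : ℕ} {ρ : ℝ} (hρ : 2 * Real.sqrt d ≤ ρ) {m : Fin d → ℤ}
    (h : ∀ j, |m j| ≤ 1) : m ∈ offsets d ρ := by
  rw [mem_offsets (le_trans (by positivity) hρ)]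
  have h1 : ∀ j, (|(m j : ℝ)| + 1) ^ 2 ≤ 4 := fun j => by
    have : |(m j : ℝ)| ≤ 1 := by exact_mod_cast h j
    nlinarith [abs_nonneg (m j : ℝ)]
  refine (Finset.sum_le_sum fun j _ => h1 j).trans ?_
  have h2 := pow_le_pow_left₀ (by positivity) hρ 2
  rw [mul_pow, Real.sq_sqrt (Nat.cast_nonneg d)] at h2
  simp only [Finset.sum_const, Finset.card_univ, Fintype.card_fin, nsmul_eq_mul]
  linarith

/-- If x lies in the ball of radius ρ - 3√d/2 about (1/2, …, 1/2), the integer part of x is an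
offset: rounding costs 1/2 in each coordinate and the definition of offsets adds 1, and the vector
with all entries 3/2 has norm 3√d/2. -/
theorem volume_le_card_offsets {d : ℕ} {ρ : ℝ} (hρ : 3 * Real.sqrt d / 2 < ρ) :
    unitBallVol d * (ρ - 3 * Real.sqrt d / 2) ^ d ≤ (offsets d ρ).card := by
  have hρ0 : 0 ≤ ρ := le_trans (by positivity) hρ.le
  refine volume_le_card (fun _ => 1 / 2) (sub_pos.2 hρ) _ fun x hx => ?_
  rw [mem_offsets hρ0]
  have h1 : ∀ j, |((⌊x j⌋ : ℤ) : ℝ)| + 1 ≤ |x j - 1 / 2| + 3 / 2 := fun j => by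
    have := Int.floor_le (x j)
    have := Int.lt_floor_add_one (x j)
    have : |((⌊x j⌋ : ℤ) : ℝ) - (x j - 1 / 2)| ≤ 1 / 2 := by
      rw [abs_le]; constructor <;> linarith
    have h3 := abs_sub_abs_le_abs_sub ((⌊x j⌋ : ℤ) : ℝ) (x j - 1 / 2)
    linarith
  set D := ρ - 3 * Real.sqrt d / 2
  set u : EuclideanSpace ℝ (Fin d) := WithLp.toLp 2 fun j => |x j - 1 / 2|
  set v : EuclideanSpace ℝ (Fin d) := WithLp.toLp 2 fun _ => 3 / 2
  have hu : ‖u‖ ≤ D := by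
    rw [EuclideanSpace.norm_eq, Real.sqrt_le_left (sub_pos.2 hρ).le]
    simpa [u, sq_abs] using hx.le
  have hv : ‖v‖ = 3 * Real.sqrt d / 2 := by
    rw [EuclideanSpace.norm_eq]
    simp only [v, Real.norm_eq_abs, sq_abs, Finset.sum_const, Finset.card_univ, Fintype.card_fin,
      nsmul_eq_mul]
    rw [Real.sqrt_mul (Nat.cast_nonneg d), Real.sqrt_sq (by norm_num)]
    ring
  have huv : ‖u + v‖ ≤ ρ := (norm_add_le u v).trans (by rw [hv]; simp only [D] at hu; linarith)
  rw [EuclideanSpace.norm_eq, Real.sqrt_le_left hρ0] at huv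
  refine le_trans (Finset.sum_le_sum fun j _ => ?_) huv
  simp only [u, v, PiLp.add_apply, Real.norm_eq_abs, sq_abs]
  exact pow_le_pow_left₀ (by positivity) (h1 j) 2

/-- The block with given integer coordinates, on the torus. -/
def wrap {d : ℕ} (k : ℕ) (z : Fin d → ℤ) : Fin d → ℕ := fun j => (z j % k).toNat

theorem wrap_lt {d k : ℕ} (hk : 0 < k) (z : Fin d → ℤ) (j : Fin d) : wrap k z j < k := by
  have h1 := Int.emod_lt_of_pos (z j) (by exact_mod_cast hk : (0 : ℤ) < k)
  have h2 := Int.emod_nonneg (z j) (by exact_mod_cast hk.ne' : (k : ℤ) ≠ 0)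
  simp only [wrap]
  omega

theorem cast_wrap {d k : ℕ} (hk : 0 < k) (z : Fin d → ℤ) (j : Fin d) :
    (wrap k z j : ℤ) = z j % k :=
  Int.toNat_of_nonneg (Int.emod_nonneg (z j) (by exact_mod_cast hk.ne' : (k : ℤ) ≠ 0))

theorem wrap_natCast {d k : ℕ} {i : Fin d → ℕ} (hi : ∀ j, i j < k) :
    wrap k (fun j => (i j : ℤ)) = i := by
  funext j
  simp only [wrap]
  rw [Int.emod_eq_of_lt (by positivity) (by exact_mod_cast hi j)]
  simp

theorem wrap_eq_wrap_iff {d k : ℕ} (hk : 0 < k) {z z' : Fin d → ℤ} :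
    wrap k z = wrap k z' ↔ ∀ j, (k : ℤ) ∣ z j - z' j := by
  constructor
  · intro h j
    have := congrArg (fun n : ℕ => (n : ℤ)) (congrFun h j)
    simp only [cast_wrap hk] at this
    exact Int.ModEq.dvd this.symm
  · intro h
    funext j
    have : z j % k = z' j % k := (Int.modEq_iff_dvd.2 (h j)).symm
    simp only [wrap, this]

/-- The cyclic distance of two residues is at most the distance of any two integer representatives.
-/
theorem cellExtent_wrap_le {d k : ℕ} (hk : 0 < k) (z z' : Fin d → ℤ) (j : Fin d) :
    (cellExtent k (wrap k z j) (wrap k z' j) : ℝ) ≤ 2 * (|(((z - z') j : ℤ) : ℝ)| + 1) := by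
  have h1 := wrap_lt hk z j
  have h2 := wrap_lt hk z' j
  have e1 := cast_wrap hk z j
  have e2 := cast_wrap hk z' j
  have hd1 := Int.emod_add_mul_ediv (z j) k
  have hd2 := Int.emod_add_mul_ediv (z' j) k
  rw [← e1] at hd1
  rw [← e2] at hd2
  generalize wrap k z j = a at *
  generalize wrap k z' j = b at *
  generalize z j / (k : ℤ) = q at *
  generalize z' j / (k : ℤ) = q' at *
  have key : min (a - b + (b - a)) (k - (a - b + (b - a))) ≤ (z j - z' j).natAbs := by
    have : z j - z' j = ((a : ℤ) - b) + k * (q - q') := by rw [← hd1, ← hd2]; ring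
    rw [this]
    rcases lt_trichotomy (q - q') 0 with h | h | h
    · have : (k : ℤ) * (q - q') ≤ -k := by nlinarith
      omega
    · rw [h]; omega
    · have : (k : ℤ) ≤ k * (q - q') := by nlinarith
      omega
  have h3 : cellExtent k a b ≤ 2 * ((z j - z' j).natAbs + 1) := by
    rw [cellExtent]
    refine (min_le_right _ _).trans ?_
    omega
  have h4 : ((z j - z' j).natAbs : ℝ) = |((z j - z' j : ℤ) : ℝ)| := by simp
  rw [Pi.sub_apply, ← h4]
  exact_mod_cast h3

theorem visible_wrap {d n : ℕ} {χ : ℝ} (hn : 2 ≤ n) (hχ : 0 < χ) {z z' : Fin d → ℤ}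
    (h : z - z' ∈ offsets d (χ ^ (1 / (d : ℝ)))⁻¹) :
    Visible d n χ (wrap (blocksPerSide d n χ) z) (wrap (blocksPerSide d n χ) z') := by
  have hk := blocksPerSide_pos (d := d) hn hχ
  have hs := cellSide_pos (d := d) hn hχ
  have hr := radius_pos d hn
  have hc := Real.rpow_pos_of_pos hχ (1 / (d : ℝ))
  rw [mem_offsets (inv_nonneg.2 hc.le)] at h
  rw [visible_iff hn hχ (wrap_lt hk z) (wrap_lt hk z')]
  have h1 : ∑ l, (cellSide d n χ / 2 * cellExtent (blocksPerSide d n χ)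
      (wrap (blocksPerSide d n χ) z l) (wrap (blocksPerSide d n χ) z' l)) ^ 2 ≤
      ∑ l, cellSide d n χ ^ 2 * (|((z - z') l : ℝ)| + 1) ^ 2 := by
    refine Finset.sum_le_sum fun l _ => ?_
    rw [← mul_pow]
    refine pow_le_pow_left₀ (by positivity) ?_ 2
    have := mul_le_mul_of_nonneg_left (cellExtent_wrap_le hk z z' l) (half_pos hs).le
    calc _ ≤ _ := this
      _ = _ := by ring
  refine h1.trans ?_
  rw [← Finset.mul_sum]
  refine (mul_le_mul_of_nonneg_left h (by positivity)).trans ?_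
  rw [← mul_pow]
  refine pow_le_pow_left₀ (by positivity) ?_ 2
  -- Rounding up the number of blocks makes them smaller than χ^(1/d) times the radius, so offsets
  -- defined with the ratio χ^(-1/d) remain visible for every n.
  rw [mul_inv_le_iff₀ hc, mul_comm]
  exact cellSide_le hn hχ

end GSBM

namespace GSBM

/-! ### Connectivity of site percolation on the lattice with few vacant sites -/

section Lattice

open scoped Pointwise

variable {d : ℕ}

/-- A step between occupied sites. -/
def LatticeStep (V : Finset (Fin d → ℤ)) (occ : (Fin d → ℤ) → Prop) (x y : Fin d → ℤ) : Prop :=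
  occ x ∧ occ y ∧ y - x ∈ V

/-- Sites that can be reached by steps between occupied sites. -/
def Linked (V : Finset (Fin d → ℤ)) (occ : (Fin d → ℤ) → Prop) :
    (Fin d → ℤ) → (Fin d → ℤ) → Prop :=
  Relation.ReflTransGen (LatticeStep V occ)

variable {V : Finset (Fin d → ℤ)} {occ : (Fin d → ℤ) → Prop}

theorem Linked.symm (hV : ∀ v ∈ V, -v ∈ V) {x y : Fin d → ℤ} (h : Linked V occ x y) :
    Linked V occ y x := by
  induction h with
  | refl => exact .refl
  | tail _ h ih => exact .head ⟨h.2.1, h.1, by rw [← neg_sub]; exact hV _ h.2.2⟩ ih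

/-- In the box of radius `D` about `y`, all sites with `i`-th coordinate `t` are occupied. -/
def FullSlice (occ : (Fin d → ℤ) → Prop) (y : Fin d → ℤ) (D : ℤ) (i : Fin d) (t : ℤ) : Prop :=
  |t - y i| ≤ D ∧ ∀ z : Fin d → ℤ, (∀ j, |z j - y j| ≤ D) → z i = t → occ z

variable {y : Fin d → ℤ} {D : ℤ} {m : ℕ}

/-- Each slice that is not full contains a vacant site, and different slices contain different ones.
-/
theorem card_lt_of_not_fullSlice
    (H : ∀ A : Finset (Fin d → ℤ), (∀ z ∈ A, (∀ j, |z j - y j| ≤ D) ∧ ¬ occ z) → A.card < m)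
    (i : Fin d) (T : Finset ℤ) (hT : ∀ t ∈ T, |t - y i| ≤ D ∧ ¬ FullSlice occ y D i t) :
    T.card < m := by
  have h : ∀ t ∈ T, ∃ z : Fin d → ℤ, (∀ j, |z j - y j| ≤ D) ∧ z i = t ∧ ¬ occ z := by
    intro t ht
    have := (hT t ht).2
    simp only [FullSlice, not_and, not_forall] at this
    obtain ⟨z, h1, h2, h3⟩ := this (hT t ht).1
    exact ⟨z, h1, h2, h3⟩
  choose! f hf using h
  have hinj : Set.InjOn f T := fun t ht t' ht' h => by
    rw [← (hf t ht).2.1, ← (hf t' ht').2.1, h]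
  classical
  rw [← Finset.card_image_of_injOn hinj]
  refine H _ fun z hz => ?_
  obtain ⟨t, ht, rfl⟩ := Finset.mem_image.1 hz
  exact ⟨(hf t ht).1, (hf t ht).2.2⟩

/-- Among `m * ρ` consecutive slices there are `ρ` consecutive ones that are full. -/
theorem exists_fullSlices
    (H : ∀ A : Finset (Fin d → ℤ), (∀ z ∈ A, (∀ j, |z j - y j| ≤ D) ∧ ¬ occ z) → A.card < m)
    (i : Fin d) {ρ : ℕ} {c : ℤ} (hc : y i - D ≤ c) (hc' : c + m * ρ ≤ y i + D + 1) :
    ∃ t, c ≤ t ∧ t + ρ ≤ c + m * ρ ∧ ∀ u, t ≤ u → u < t + ρ → FullSlice occ y D i u := by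
  by_contra! hcon
  -- Cut the slices into m groups of ρ. If no group is full, the m non-full slices lie in different
  -- groups and are distinct, which contradicts the count.
  have h : ∀ g ∈ Finset.range m, ∃ u, c + g * ρ ≤ u ∧ u < c + g * ρ + ρ ∧
      ¬ FullSlice occ y D i u := by
    intro g hg
    have hg' : ((g : ℤ) + 1) * ρ ≤ m * ρ :=
      mul_le_mul_of_nonneg_right (by exact_mod_cast Finset.mem_range.1 hg) (by positivity)
    have hg0 : (0 : ℤ) ≤ g * ρ := by positivity
    exact hcon (c + g * ρ) (by linarith) (by linarith)
  choose! f hf using h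
  have hmono : ∀ g g', g < g' → g' < m → f g < f g' := by
    intro g g' hgg hg'
    have h1 := hf g (Finset.mem_range.2 (hgg.trans hg'))
    have h2 := hf g' (Finset.mem_range.2 hg')
    have h3 : ((g : ℤ) + 1) * ρ ≤ g' * ρ :=
      mul_le_mul_of_nonneg_right (by exact_mod_cast hgg) (by positivity)
    linarith
  have hinj : Set.InjOn f (Finset.range m) := by
    intro g hg g' hg' hfg
    simp only [Finset.coe_range, Set.mem_Iio] at hg hg'
    rcases lt_trichotomy g g' with h | h | h
    · have := hmono g g' h hg'; omega
    · exact h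
    · have := hmono g' g h hg; omega
  have := card_lt_of_not_fullSlice H i ((Finset.range m).image f) fun t ht => by
    obtain ⟨g, hg, rfl⟩ := Finset.mem_image.1 ht
    have h1 := hf g hg
    have hg' : ((g : ℤ) + 1) * ρ ≤ m * ρ :=
      mul_le_mul_of_nonneg_right (by exact_mod_cast Finset.mem_range.1 hg) (by positivity)
    have hg0 : (0 : ℤ) ≤ g * ρ := by positivity
    refine ⟨abs_le.2 ⟨by linarith, by linarith⟩, h1.2.2⟩
  rw [Finset.card_image_of_injOn hinj, Finset.card_range] at this
  exact lt_irrefl _ this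

/-- Sites in a full slice are linked to each other. -/
theorem linked_of_fullSlice (hV : ∀ v : Fin d → ℤ, (∀ j, |v j| ≤ 1) → v ∈ V) {i : Fin d} {t : ℤ}
    (hf : FullSlice occ y D i t) {p q : Fin d → ℤ} (hp : ∀ j, |p j - y j| ≤ D)
    (hq : ∀ j, |q j - y j| ≤ D) (hpi : p i = t) (hqi : q i = t) : Linked V occ p q := by
  obtain ⟨N, hN⟩ : ∃ N : ℕ, ∀ j, |p j - q j| ≤ N := by
    refine ⟨∑ j, (p j - q j).natAbs, fun j => ?_⟩
    have : (p j - q j).natAbs ≤ ∑ l, (p l - q l).natAbs :=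
      Finset.single_le_sum (f := fun j => (p j - q j).natAbs) (fun _ _ => Nat.zero_le _)
      (Finset.mem_univ j)
    rw [Int.abs_eq_natAbs]; exact_mod_cast this
  induction N generalizing p with
  | zero =>
    have : p = q := funext fun j => by
      have := hN j
      simp only [CharP.cast_eq_zero, abs_nonpos_iff] at this
      omega
    rw [this]
    exact .refl
  | succ N ih =>
    -- Move every coordinate by at most one towards q. The move is a step of sup norm at most one,
    -- it stays in the window, and it stays in the slice because p and q agree in direction i.
    set p' : Fin d → ℤ := fun j => p j + (q j - p j).sign with hp'
    have hcase : ∀ j, p j = q j ∧ p' j = p j ∨ p j < q j ∧ p' j = p j + 1 ∨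
        q j < p j ∧ p' j = p j - 1 := by
      intro j
      rcases lt_trichotomy (p j) (q j) with h | h | h
      · right; left; exact ⟨h, by simp [hp', Int.sign_eq_one_of_pos (sub_pos.2 h)]⟩
      · left; exact ⟨h, by simp [hp', h]⟩
      · right; right
        exact ⟨h, by simp only [hp', Int.sign_eq_neg_one_of_neg (sub_neg.2 h)]; ring⟩
    have hp'W : ∀ j, |p' j - y j| ≤ D := fun j => by
      have h1 := abs_le.1 (hp j)
      have h2 := abs_le.1 (hq j)
      rw [abs_le]
      rcases hcase j with ⟨h, h'⟩ | ⟨h, h'⟩ | ⟨h, h'⟩ <;> rw [h'] <;> omega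
    have hp'i : p' i = t := by
      rcases hcase i with ⟨h, h'⟩ | ⟨h, h'⟩ | ⟨h, h'⟩ <;> omega
    refine .head ⟨hf.2 p hp hpi, hf.2 p' hp'W hp'i, hV _ fun j => ?_⟩ (ih hp'W hp'i fun j => ?_)
    · rw [Pi.sub_apply, abs_le]
      rcases hcase j with ⟨h, h'⟩ | ⟨h, h'⟩ | ⟨h, h'⟩ <;> rw [h'] <;> omega
    · have h1 := abs_le.1 (hN j)
      push_cast at h1
      rw [abs_le]
      rcases hcase j with ⟨h, h'⟩ | ⟨h, h'⟩ | ⟨h, h'⟩ <;> rw [h'] <;> omega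

/-- In dimension at least two, all occupied sites near the centre of a large box are linked to
each other, if fewer than `|V| - 1` sites of the box are vacant. -/
theorem exists_linked_of_window (hd : ∀ i : Fin d, ∃ j, j ≠ i) [Nonempty (Fin d)]
    (hV : ∀ v : Fin d → ℤ, (∀ j, |v j| ≤ 1) → v ∈ V) {ρ : ℕ} (hρ : ∀ v ∈ V, ∀ j, |v j| ≤ ρ)
    {R : ℤ} (hR : 0 ≤ R) (hD : D = R + (V.card - 1 : ℕ) * ρ)
    (H : ∀ A : Finset (Fin d → ℤ), (∀ z ∈ A, (∀ j, |z j - y j| ≤ D) ∧ ¬ occ z) →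
      A.card < V.card - 1) :
    ∃ c, ∀ x, occ x → (∀ j, |x j - y j| ≤ R) → Linked V occ x c := by
  classical
  have hρ1 : 1 ≤ ρ := by
    have := hρ 1 (hV 1 fun j => by simp) (Classical.arbitrary _)
    simpa using this
  set m := V.card - 1 with hm
  -- In each direction there is, on either side of the central box, a slab of ρ consecutive full
  -- slices. No step can jump over a slab.
  choose tp hp1 hp2 hp3 using fun i => exists_fullSlices H i (ρ := ρ) (c := y i + R + 1)
    (by have : (0 : ℤ) ≤ m * ρ := by positivity
        linarith) (by linarith)
  choose tn hn1 hn2 hn3 using fun i => exists_fullSlices H i (ρ := ρ) (c := y i - D)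
    le_rfl (by
      have : (0 : ℤ) ≤ m * ρ := by positivity
      linarith)
  have hV0 : (0 : Fin d → ℤ) ∈ V := hV 0 fun j => by simp
  have hmρ : (0 : ℤ) ≤ m * ρ := by positivity
  -- Slices in direction i and in another direction j cross: move inside the first until all other
  -- coordinates are those of `tp`, then correct coordinate i inside the slice of direction j. This
  -- is where two dimensions are needed.
  have hcorner : ∀ f : Fin d → ℤ, (∀ j, |f j - y j| ≤ D) → ∀ i, FullSlice occ y D i (f i) →
      Linked V occ f tp := by
    intro f hf i hfi
    obtain ⟨j, hj⟩ := hd i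
    have htp : ∀ l, |tp l - y l| ≤ D := fun l => by
      have := hp1 l; have := hp2 l
      rw [abs_le]; constructor <;> linarith
    have hg : ∀ l, |Function.update tp i (f i) l - y l| ≤ D := fun l => by
      by_cases h : l = i
      · subst h; simpa using hf l
      · simpa [h] using htp l
    exact (linked_of_fullSlice hV hfi hf hg rfl (by simp)).trans
      (linked_of_fullSlice hV (hp3 j (tp j) le_rfl (by omega)) hg htp (by simp [hj]) rfl)
  refine ⟨tp, fun x hx hxR => ?_⟩
  by_contra hcon
  have hav : ∀ f, Linked V occ x f → (∀ j, |f j - y j| ≤ D) → ∀ i, ¬ FullSlice occ y D i (f i) :=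
    fun f hf hW i hi => hcon (hf.trans (hcorner f hW i hi))
  have hnear : ∀ z, (∀ i, tn i + ρ ≤ z i ∧ z i < tp i) → ∀ v ∈ V, ∀ j, |(z + v) j - y j| ≤ D := by
    intro z hz v hv j
    have h1 := abs_le.1 (hρ v hv j)
    have h2 := hz j
    have h3 := hp2 j
    have h4 := hn1 j
    rw [Pi.add_apply, abs_le]
    constructor <;> linarith
  -- If x is not linked to `tp`, its cluster never meets a full slice. A step that left the inner
  -- box would land in a slab, so the cluster remains in the box.
  have hQ : ∀ z, Linked V occ x z → ∀ i, tn i + ρ ≤ z i ∧ z i < tp i := by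
    intro z hz
    induction hz with
    | refl =>
      intro i
      have h1 := abs_le.1 (hxR i)
      have h2 := hp1 i
      have h3 := hn2 i
      constructor <;> linarith
    | @tail z z' hxz hstep ih =>
      have hz' : z + (z' - z) = z' := by abel
      have hW := hnear z ih _ hstep.2.2
      rw [hz'] at hW
      have hxz' : Linked V occ x z' := hxz.tail hstep
      intro i
      have h1 := abs_le.1 (hρ _ hstep.2.2 i)
      rw [Pi.sub_apply] at h1
      have h2 := ih i
      by_contra hi
      refine hav z' hxz' hW i ?_
      by_cases h : tn i + ρ ≤ z' i
      · exact hp3 i _ (by omega) (by omega)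
      · exact hn3 i _ (by omega) (by omega)
  set C : Finset (Fin d → ℤ) :=
    {z ∈ Fintype.piFinset fun i => Finset.Ico (tn i + ρ) (tp i) | Linked V occ x z} with hC
  have hmemC : ∀ z, z ∈ C ↔ Linked V occ x z := fun z => by
    simp only [hC, Finset.mem_filter, Fintype.mem_piFinset, Finset.mem_Ico, and_iff_right_iff_imp]
    exact hQ z
  have hxC : x ∈ C := (hmemC x).2 .refl
  -- The trapped cluster is finite, so adding V enlarges it by at least |V| - 1 sites. All of them
  -- are vacant sites of the window, and there are too few of those.
  have hcd := cauchy_davenport_of_isAddTorsionFree (s := C) (t := V) ⟨x, hxC⟩ ⟨0, hV0⟩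
  have hsub : C ⊆ C + V := fun z hz => by
    rw [← add_zero z]; exact Finset.add_mem_add hz hV0
  have hA := H ((C + V) \ C) fun z hz => by
    rw [Finset.mem_sdiff] at hz
    obtain ⟨⟨c, hc, v, hv, rfl⟩, hz⟩ := And.imp_left Finset.mem_add.1 hz
    have hcl := (hmemC c).1 hc
    refine ⟨hnear c (hQ c hcl) v hv, fun ho => hz ((hmemC _).2 ?_)⟩
    have hoc : occ c := by
      rcases Relation.ReflTransGen.cases_tail hcl with h | ⟨w, _, h⟩
      · rwa [h]
      · exact h.2.1
    exact hcl.tail ⟨hoc, ho, by simpa using hv⟩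
  rw [Finset.card_sdiff_of_subset hsub] at hA
  omega

/-- A row of |V| - 1 consecutive sites cannot be entirely vacant. -/
theorem exists_near_of_windows [Nonempty (Fin d)] (hpos : 0 < V.card) {ρ : ℕ}
    (H : ∀ (y : Fin d → ℤ) (A : Finset (Fin d → ℤ)),
      (∀ z ∈ A, (∀ j, |z j - y j| ≤ (V.card : ℤ) + (V.card - 1 : ℕ) * ρ) ∧ ¬ occ z) →
        A.card < V.card - 1) (y : Fin d → ℤ) :
    ∃ w, occ w ∧ ∀ j, |w j - y j| ≤ (V.card : ℤ) - 1 := by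
  classical
  by_contra! hcon
  have i : Fin d := Classical.arbitrary _
  have := H y ((Finset.range (V.card - 1)).image fun s : ℕ => Function.update y i (y i + s))
    fun z hz => by
      obtain ⟨s, hs, rfl⟩ := Finset.mem_image.1 hz
      rw [Finset.mem_range] at hs
      have hb : ∀ j, |Function.update y i (y i + s) j - y j| ≤ (V.card : ℤ) - 1 := fun j => by
        by_cases h : j = i
        · subst h
          rw [Function.update_self, add_sub_cancel_left, abs_of_nonneg (by positivity)]
          omega
        · rw [Function.update_of_ne h, sub_self, abs_zero]
          omega
      refine ⟨fun j => (hb j).trans ?_, fun ho => ?_⟩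
      · have : (0 : ℤ) ≤ (V.card - 1 : ℕ) * ρ := by positivity
        linarith
      · obtain ⟨j, hj⟩ := hcon _ ho
        exact absurd (hb j) (not_le.2 hj)
  rw [Finset.card_image_of_injective, Finset.card_range] at this
  · exact lt_irrefl _ this
  · intro s s' h
    have := congrFun h i
    simpa using this

/-- Move the centre of the window from x to x' in steps of sup norm at most one. Near each centre
there is an occupied site at distance at most |V| - 1, so the sites found for consecutive centres
lie in the central box of a common window. -/
theorem linked_of_windows (hd : ∀ i : Fin d, ∃ j, j ≠ i) [Nonempty (Fin d)]
    (hneg : ∀ v ∈ V, -v ∈ V) (hV : ∀ v : Fin d → ℤ, (∀ j, |v j| ≤ 1) → v ∈ V) {ρ : ℕ}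
    (hρ : ∀ v ∈ V, ∀ j, |v j| ≤ ρ)
    (H : ∀ (y : Fin d → ℤ) (A : Finset (Fin d → ℤ)),
      (∀ z ∈ A, (∀ j, |z j - y j| ≤ (V.card : ℤ) + (V.card - 1 : ℕ) * ρ) ∧ ¬ occ z) →
        A.card < V.card - 1) {x x' : Fin d → ℤ} (hx : occ x) (hx' : occ x') :
    Linked V occ x x' := by
  classical
  have hwin : ∀ (y p q : Fin d → ℤ), occ p → occ q → (∀ j, |p j - y j| ≤ V.card) →
      (∀ j, |q j - y j| ≤ V.card) → Linked V occ p q := by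
    intro y p q hp hq hpy hqy
    obtain ⟨c, hc⟩ := exists_linked_of_window hd hV hρ (Nat.cast_nonneg _) rfl (H y)
    exact (hc p hp hpy).trans ((hc q hq hqy).symm hneg)
  have hnear := exists_near_of_windows (Finset.card_pos.2 ⟨0, hV 0 fun j => by simp⟩) H
  obtain ⟨N, hN⟩ : ∃ N : ℕ, ∀ j, |x' j - x j| ≤ N := by
    refine ⟨∑ j, (x' j - x j).natAbs, fun j => ?_⟩
    have : (x' j - x j).natAbs ≤ ∑ l, (x' l - x l).natAbs :=
      Finset.single_le_sum (f := fun j => (x' j - x j).natAbs) (fun _ _ => Nat.zero_le _)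
      (Finset.mem_univ j)
    rw [Int.abs_eq_natAbs]; exact_mod_cast this
  have key : ∀ (N : ℕ) (z : Fin d → ℤ), (∀ j, |z j - x j| ≤ N) → ∀ w, occ w →
      (∀ j, |w j - z j| ≤ V.card) → Linked V occ x w := by
    intro N
    induction N with
    | zero =>
      intro z hz w hw hwz
      have : z = x := funext fun j => by
        have := hz j
        simp only [CharP.cast_eq_zero, abs_nonpos_iff] at this
        omega
      subst this
      exact hwin z z w hx hw (fun j => by simp) hwz
    | succ N ih =>
      intro z hz w hw hwz
      set z' : Fin d → ℤ := fun j => z j + (x j - z j).sign with hz'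
      have hcase : ∀ j, |z' j - x j| ≤ N ∧ |z' j - z j| ≤ 1 := by
        intro j
        have h1 := abs_le.1 (hz j)
        push_cast at h1
        rw [abs_le, abs_le]
        rcases lt_trichotomy (z j) (x j) with h | h | h
        · have : z' j = z j + 1 := by simp [hz', Int.sign_eq_one_of_pos (sub_pos.2 h)]
          omega
        · have : z' j = z j := by simp [hz', h]
          omega
        · have : z' j = z j - 1 := by
            simp only [hz', Int.sign_eq_neg_one_of_neg (sub_neg.2 h)]; ring
          omega
      obtain ⟨w', hw', hb⟩ := hnear z'
      refine (ih z' (fun j => (hcase j).1) w' hw' fun j => (hb j).trans (by omega)).trans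
        (hwin z w' w hw' hw (fun j => ?_) hwz)
      have h1 := abs_le.1 (hb j)
      have h2 := abs_le.1 (hcase j).2
      rw [abs_le]
      omega
  exact key N x' hN x' hx' fun j => by simp

/-- In dimension one, occupied sites are linked if there are no long vacant intervals. -/
theorem linked_of_intervals {V : Finset (Fin 1 → ℤ)} {occ : (Fin 1 → ℤ) → Prop} {q : ℕ}
    (hneg : ∀ v ∈ V, -v ∈ V) (hV : ∀ v : Fin 1 → ℤ, |v 0| ≤ q → v ∈ V)
    (H : ∀ y : Fin 1 → ℤ, ∃ t : ℕ, t < q ∧ occ (y + fun _ => (t : ℤ))) {x x' : Fin 1 → ℤ}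
    (hx : occ x) (hx' : occ x') : Linked V occ x x' := by
  have key : ∀ (N : ℕ) (x x' : Fin 1 → ℤ), occ x → occ x' → 0 ≤ x' 0 - x 0 → x' 0 - x 0 ≤ N →
      Linked V occ x x' := by
    intro N
    induction N with
    | zero =>
      intro x x' _ _ h0 h1
      have : x = x' := funext fun j => by
        rw [Subsingleton.elim j 0]
        push_cast at h1
        omega
      rw [this]
      exact .refl
    | succ N ih =>
      intro x x' hx hx' h0 h1
      push_cast at h1
      by_cases hq : x' 0 - x 0 ≤ q
      · exact .single ⟨hx, hx', hV _ (by rw [Pi.sub_apply, abs_of_nonneg h0]; exact hq)⟩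
      · obtain ⟨t, ht, ho⟩ := H (x + 1)
        have e : (x + 1 + (fun _ => (t : ℤ)) : Fin 1 → ℤ) 0 = x 0 + 1 + t := rfl
        refine .head ⟨hx, ho, hV _ ?_⟩ (ih _ x' ho hx' (by omega) (by omega))
        rw [Pi.sub_apply, e, abs_of_nonneg (by omega)]
        omega
  rcases le_total 0 (x' 0 - x 0) with h | h
  · exact key _ x x' hx hx' h (Int.self_le_toNat _)
  · exact (key _ x' x hx' hx (by omega) (Int.self_le_toNat _)).symm hneg

end Lattice

end GSBM

/-! ### Vacant patterns, connectivity of the visibility graph, and block asymptotics -/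

namespace GSBM

theorem BlockConstant.pos {d : ℕ} {lam χ : ℝ} (h : BlockConstant d lam χ) : 0 < χ := h.2.2.1

theorem rpow_inv_pow {d : ℕ} (hd : 0 < d) {χ : ℝ} (hχ : 0 < χ) : (χ ^ (1 / (d : ℝ))) ^ d = χ := by
  rw [one_div, Real.rpow_inv_natCast_pow hχ.le hd.ne']

/-- The volume bound gives χ|V| ≥ (ν_d + 1/λ)/2. Subtracting χ < (ν_d - 1/λ)/2 leaves χ(|V| - 1) >
1/λ. -/
theorem lt_mul_card_offsets {d : ℕ} (hd : 2 ≤ d) {lam χ : ℝ} (hlam : 0 < lam)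
    (h : BlockConstant d lam χ) :
    1 < ((offsets d (χ ^ (1 / (d : ℝ)))⁻¹).card - 1 : ℝ) * (lam * χ) := by
  obtain ⟨h1, h2, hχ, h4⟩ := h
  rw [if_neg (by omega)] at h4
  have hc := Real.rpow_pos_of_pos hχ (1 / (d : ℝ))
  have hcd := rpow_inv_pow (by omega : 0 < d) hχ
  set c := χ ^ (1 / (d : ℝ)) with hcdef
  have e1 : c⁻¹ - 3 * Real.sqrt d / 2 = c⁻¹ * (1 - 3 * Real.sqrt d * c / 2) := by field_simp
  have hv := volume_le_card_offsets (d := d) (ρ := c⁻¹) (by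
    have := mul_pos (inv_pos.2 hc) h1
    rw [← e1] at this; linarith)
  rw [e1, mul_pow, inv_pow, hcd] at hv
  have h5 : (unitBallVol d + 1 / lam) / 2 ≤ χ * (offsets d c⁻¹).card := by
    refine h2.trans ?_
    have := mul_le_mul_of_nonneg_left hv hχ.le
    have e2 : χ * (unitBallVol d * (χ⁻¹ * (1 - 3 * Real.sqrt d * c / 2) ^ d)) =
      unitBallVol d * (1 - 3 * Real.sqrt d * c / 2) ^ d := by field_simp
    linarith
  have h6 : 1 / lam < χ * ((offsets d c⁻¹).card - 1) := by linarith
  rw [div_lt_iff₀ hlam] at h6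
  linarith

/-- Ensures that all offsets of sup norm at most one are available. The condition on χ forces t^d >
1/2 for t = 1 - 3√d χ^(1/d)/2, hence t > 7/10, as d ≥ 2 and t ≤ 1. -/
theorem two_mul_sqrt_le {d : ℕ} (hd : 2 ≤ d) {lam χ : ℝ} (hlam : 0 < lam)
    (h : BlockConstant d lam χ) : 2 * Real.sqrt d ≤ (χ ^ (1 / (d : ℝ)))⁻¹ := by
  obtain ⟨h1, h2, hχ, -⟩ := h
  have hc := Real.rpow_pos_of_pos hχ (1 / (d : ℝ))
  set c := χ ^ (1 / (d : ℝ)) with hcdef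
  have hν := unitBallVol_pos d
  have h3 : 0 < 1 / lam := by positivity
  have hs : 0 ≤ Real.sqrt d * c := by positivity
  set t := 1 - 3 * Real.sqrt d * c / 2 with ht
  have ht1 : t ≤ 1 := by rw [ht]; linarith
  have h4 : t ^ d ≤ t ^ 2 := pow_le_pow_of_le_one h1.le ht1 hd
  have h5 : 1 / 2 < t ^ 2 := by
    by_contra hcon
    have := mul_le_mul_of_nonneg_left (h4.trans (not_lt.1 hcon)) hν.le
    linarith
  have h6 : 7 / 10 < t := by nlinarith
  rw [← one_div, le_div_iff₀ hc]
  linarith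

/-- There are finitely many patterns of vacant blocks, each of large total volume, such that the
occupied blocks are linked to each other if none of the patterns occurs. -/
theorem exists_patterns {d : ℕ} {lam χ : ℝ}
    (hlam : (d = 1 ∧ 1 < lam) ∨ (2 ≤ d ∧ 1 < lam * unitBallVol d)) (hχ : BlockConstant d lam χ) :
    ∃ (m D : ℕ) (P : Finset (Finset (Fin d → ℤ))), 1 < m * (lam * χ) ∧
      (∀ A ∈ P, A.card = m ∧ ∀ z ∈ A, ∀ j, |z j| ≤ D) ∧
      ∀ occ : (Fin d → ℤ) → Prop, (∀ y, ∀ A ∈ P, ∃ z ∈ A, occ (y + z)) →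
        (∃ x, occ x) ∧ ∀ x x', occ x → occ x' →
          Linked (offsets d (χ ^ (1 / (d : ℝ)))⁻¹) occ x x' := by
  have hc := Real.rpow_pos_of_pos hχ.pos (1 / (d : ℝ))
  have hρ0 := inv_nonneg.2 hc.le
  rcases hlam with ⟨rfl, hlam⟩ | ⟨hd, hlam⟩
  · obtain ⟨-, -, h3, h4⟩ := hχ
    simp only [if_true, Nat.cast_one, div_one, Real.rpow_one] at h4 hρ0 ⊢
    have hfl := Nat.lt_floor_add_one (χ⁻¹)
    have hflp : 1 ≤ ⌊χ⁻¹⌋₊ := by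
      rw [Nat.one_le_floor_iff, one_le_inv₀ h3]
      have h5 : 0 < 1 / lam := one_div_pos.2 (one_pos.trans hlam)
      have h6 : (1 - 1 / lam) / 2 ≤ 1 := by
        generalize 1 / lam = e at h5 ⊢
        linarith
      exact h4.le.trans h6
    -- Blocks at distance at most q are visible, since q + 1 ≤ 1/χ. From (q + 2)χ > 1 and 2χ < 1 -
    -- 1/λ one gets qλχ > 1, so q vacant blocks in a row are unlikely.
    set q := ⌊χ⁻¹⌋₊ - 1 with hq
    have hq' : (q : ℝ) = ⌊χ⁻¹⌋₊ - 1 := by rw [hq, Nat.cast_sub hflp, Nat.cast_one]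
    have hinj : Function.Injective fun (t : ℕ) (_ : Fin 1) => (t : ℤ) := fun s t h => by
      simpa using congrFun h 0
    refine ⟨q, q, {(Finset.range q).map ⟨_, hinj⟩}, ?_, ?_, fun occ hocc => ?_⟩
    · have h5 : 1 < (q + 2) * χ := by
        have : χ⁻¹ < q + 2 := by rw [hq']; linarith
        rwa [← div_lt_iff₀ h3, one_div]
      have h6 : 1 / lam < q * χ := by linarith
      rw [div_lt_iff₀ (by linarith)] at h6
      linarith
    · intro A hA
      rw [Finset.mem_singleton] at hA
      subst hA
      refine ⟨by simp, fun z hz j => ?_⟩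
      simp only [Finset.mem_map, Finset.mem_range, Function.Embedding.coeFn_mk] at hz
      obtain ⟨t, ht, rfl⟩ := hz
      rw [abs_of_nonneg (by positivity)]
      exact Int.ofNat_le.2 ht.le
    · have H : ∀ y : Fin 1 → ℤ, ∃ t : ℕ, t < q ∧ occ (y + fun _ => (t : ℤ)) := by
        intro y
        obtain ⟨z, hz, ho⟩ := hocc y _ (Finset.mem_singleton_self _)
        simp only [Finset.mem_map, Finset.mem_range, Function.Embedding.coeFn_mk] at hz
        obtain ⟨t, ht, rfl⟩ := hz
        exact ⟨t, ht, ho⟩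
      refine ⟨⟨_, (H 0).choose_spec.2⟩, fun x x' hx hx' => linked_of_intervals (q := q)
        (fun v hv => neg_mem_offsets hρ0 hv) (fun v hv => ?_) H hx hx'⟩
      rw [mem_offsets hρ0, Fin.sum_univ_one]
      refine pow_le_pow_left₀ (by positivity) ?_ 2
      have h7 : |(v 0 : ℝ)| ≤ q := by exact_mod_cast hv
      have := Nat.floor_le hρ0
      linarith
  · have hlam0 : 0 < lam := pos_of_mul_pos_left (one_pos.trans hlam) (unitBallVol_nonneg d)
    have hmain := lt_mul_card_offsets hd hlam0 hχ
    have hunit : ∀ v : Fin d → ℤ, (∀ j, |v j| ≤ 1) → v ∈ offsets d (χ ^ (1 / (d : ℝ)))⁻¹ :=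
      fun v hv => unit_mem_offsets (two_mul_sqrt_le hd hlam0 hχ) hv
    have hle : ∀ v ∈ offsets d (χ ^ (1 / (d : ℝ)))⁻¹, ∀ j, |v j| ≤ ⌊(χ ^ (1 / (d : ℝ)))⁻¹⌋₊ :=
      fun v hv j => offsets_le hv j
    have hneg : ∀ v ∈ offsets d (χ ^ (1 / (d : ℝ)))⁻¹, -v ∈ offsets d (χ ^ (1 / (d : ℝ)))⁻¹ :=
      fun v hv => neg_mem_offsets hρ0 hv
    set V := offsets d (χ ^ (1 / (d : ℝ)))⁻¹
    set ρ := ⌊(χ ^ (1 / (d : ℝ)))⁻¹⌋₊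
    have hpos : 0 < V.card := Finset.card_pos.2 ⟨0, hunit 0 fun j => by simp⟩
    have : Nonempty (Fin d) := ⟨⟨0, by omega⟩⟩
    have : Nontrivial (Fin d) := Fin.nontrivial_iff_two_le.2 hd
    set D : ℕ := V.card + (V.card - 1) * ρ with hD
    -- The patterns are all sets of |V| - 1 sites in the window about the origin.
    refine ⟨V.card - 1, D, Finset.powersetCard (V.card - 1)
      (Fintype.piFinset fun _ => Finset.Icc (-(D : ℤ)) D), ?_, ?_, fun occ hocc => ?_⟩
    · rw [Nat.cast_sub hpos, Nat.cast_one]; exact hmain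
    · intro A hA
      rw [Finset.mem_powersetCard] at hA
      refine ⟨hA.2, fun z hz j => ?_⟩
      have := Fintype.mem_piFinset.1 (hA.1 hz) j
      rw [abs_le]
      exact Finset.mem_Icc.1 this
    · have H : ∀ (y : Fin d → ℤ) (A : Finset (Fin d → ℤ)),
          (∀ z ∈ A, (∀ j, |z j - y j| ≤ (V.card : ℤ) + (V.card - 1 : ℕ) * ρ) ∧ ¬ occ z) →
            A.card < V.card - 1 := by
        intro y A hA
        by_contra! hcon
        obtain ⟨B, hBA, hB⟩ := Finset.exists_subset_card_eq hcon
        obtain ⟨z, hz, ho⟩ := hocc y (B.map (Equiv.subRight y).toEmbedding) (by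
          rw [Finset.mem_powersetCard]
          refine ⟨fun z hz => ?_, by rw [Finset.card_map, hB]⟩
          obtain ⟨w, hw, rfl⟩ := Finset.mem_map.1 hz
          rw [Fintype.mem_piFinset]
          intro j
          have := abs_le.1 ((hA w (hBA hw)).1 j)
          rw [Finset.mem_Icc, hD]
          push_cast at *
          exact this)
        obtain ⟨w, hw, rfl⟩ := Finset.mem_map.1 hz
        refine (hA w (hBA hw)).2 ?_
        simpa using ho
      obtain ⟨w, hw, -⟩ := exists_near_of_windows hpos H 0
      exact ⟨⟨w, hw⟩, fun x x' hx hx' =>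
        linked_of_windows (fun i => exists_ne i) hneg hunit hle H hx hx'⟩

theorem Occupied.lt_blocksPerSide {d n N : ℕ} {χ δ : ℝ} {β : Fin N → Fin d → ℕ} (hδ : 0 < δ)
    (hβ : ∀ v j, β v j < blocksPerSide d n χ) {i : Fin d → ℕ} (hi : Occupied n δ β i) (j : Fin d) :
    i j < blocksPerSide d n χ := by
  obtain ⟨v, rfl⟩ := hi.exists_vertex hδ
  exact hβ v j

/-- Links live on the lattice with periodic occupation; reducing coordinates modulo the number of
blocks turns them into walks in the visibility graph. -/
theorem visGraph_connected {d n N : ℕ} {χ δ : ℝ} {β : Fin N → Fin d → ℕ} (hn : 2 ≤ n)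
    (hχ : 0 < χ) (hδ : 0 < δ) (hβ : ∀ v j, β v j < blocksPerSide d n χ)
    (hne : ∃ x, Occupied n δ β (wrap (blocksPerSide d n χ) x))
    (hlink : ∀ x x', Occupied n δ β (wrap (blocksPerSide d n χ) x) →
      Occupied n δ β (wrap (blocksPerSide d n χ) x') →
      Linked (offsets d (χ ^ (1 / (d : ℝ)))⁻¹)
        (fun z => Occupied n δ β (wrap (blocksPerSide d n χ) z)) x x') :
    (visGraph n χ δ β).Connected := by
  have key : ∀ x x' (hx : Occupied n δ β (wrap (blocksPerSide d n χ) x))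
      (hx' : Occupied n δ β (wrap (blocksPerSide d n χ) x')),
      (visGraph n χ δ β).Reachable ⟨_, hx⟩ ⟨_, hx'⟩ := by
    intro x x' hx hx'
    have h := hlink x x' hx hx'
    induction h with
    | refl => exact .refl _
    | @tail z z' _ h ih =>
      refine (ih h.1).trans ?_
      by_cases he : (⟨_, h.1⟩ : {i // Occupied n δ β i}) = ⟨_, hx'⟩
      · rw [he]
      · refine SimpleGraph.Adj.reachable ⟨he, visible_wrap hn hχ ?_⟩
        rw [← neg_sub]
        exact neg_mem_offsets (by positivity) h.2.2
  obtain ⟨x, hx⟩ := hne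
  refine (SimpleGraph.connected_iff _).2 ⟨?_, ⟨⟨_, hx⟩⟩⟩
  rintro ⟨i, hi⟩ ⟨j, hj⟩
  have hi' := wrap_natCast (hi.lt_blocksPerSide hδ hβ)
  have hj' := wrap_natCast (hj.lt_blocksPerSide hδ hβ)
  have := key _ _ (hi'.symm ▸ hi) (hj'.symm ▸ hj)
  simp only [hi', hj'] at this
  exact this

/-! ### Asymptotics of the block size -/

section Asymptotics

variable {d : ℕ} {χ : ℝ}

theorem tendsto_log_div_nat : Tendsto (fun n : ℕ => Real.log n / n) atTop (𝓝 0) := by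
  have := Real.isLittleO_log_id_atTop.tendsto_div_nhds_zero
  exact this.comp tendsto_natCast_atTop_atTop

theorem tendsto_radius_div_sideLen (hd : 0 < d) :
    Tendsto (fun n : ℕ => radius d n / sideLen d n) atTop (𝓝 0) := by
  have h1 : (0 : ℝ) < 1 / d := by positivity
  have h2 := tendsto_log_div_nat.rpow_const (p := 1 / (d : ℝ)) (Or.inr h1.le)
  rw [Real.zero_rpow h1.ne'] at h2
  refine h2.congr fun n => ?_
  rw [radius, sideLen, Real.div_rpow (Real.log_natCast_nonneg n) (Nat.cast_nonneg n)]

theorem radius_div_cellSide_le {n : ℕ} (hn : 2 ≤ n) (hχ : 0 < χ) :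
    radius d n / cellSide d n χ ≤ (χ ^ (1 / (d : ℝ)))⁻¹ + radius d n / sideLen d n := by
  have hc := Real.rpow_pos_of_pos hχ (1 / (d : ℝ))
  have hr := radius_pos d hn
  have hL := sideLen_pos d hn
  have hk : (blocksPerSide d n χ : ℝ) ≤ sideLen d n / (χ ^ (1 / (d : ℝ)) * radius d n) + 1 := by
    rw [blocksPerSide_eq hχ]
    exact (Nat.ceil_lt_add_one (by positivity)).le
  rw [cellSide, div_div_eq_mul_div]
  calc radius d n * blocksPerSide d n χ / sideLen d n
      ≤ radius d n * (sideLen d n / (χ ^ (1 / (d : ℝ)) * radius d n) + 1) / sideLen d n := by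
        gcongr
    _ = _ := by field_simp

theorem tendsto_radius_div_cellSide (hd : 0 < d) (hχ : 0 < χ) :
    Tendsto (fun n : ℕ => radius d n / cellSide d n χ) atTop (𝓝 (χ ^ (1 / (d : ℝ)))⁻¹) := by
  have hc := Real.rpow_pos_of_pos hχ (1 / (d : ℝ))
  have h := (tendsto_radius_div_sideLen hd).const_add ((χ ^ (1 / (d : ℝ)))⁻¹)
  rw [add_zero] at h
  refine tendsto_of_tendsto_of_tendsto_of_le_of_le' tendsto_const_nhds h ?_ ?_
  · filter_upwards [eventually_ge_atTop 2] with n hn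
    rw [le_div_iff₀ (cellSide_pos hn hχ), inv_mul_le_iff₀ hc]
    exact cellSide_le hn hχ
  · filter_upwards [eventually_ge_atTop 2] with n hn
    exact radius_div_cellSide_le hn hχ

/-- Rounding the number of blocks is harmless: the block volume is asymptotic to χ log n. The bound
above by χ log n holds for every n ≥ 2. -/
theorem tendsto_volume_block (hd : 0 < d) (hχ : 0 < χ) :
    Tendsto (fun n : ℕ => cellSide d n χ ^ d / Real.log n) atTop (𝓝 χ) := by
  have hc := Real.rpow_pos_of_pos hχ (1 / (d : ℝ))
  have h := ((tendsto_radius_div_cellSide hd hχ).inv₀ (inv_pos.2 hc).ne').pow d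
  rw [inv_inv, rpow_inv_pow hd hχ] at h
  refine h.congr fun n => ?_
  rw [inv_div, div_pow, radius_pow hd]

theorem cellSide_pow_mul {n : ℕ} (hd : 0 < d) (hn : 2 ≤ n) (hχ : 0 < χ) :
    (blocksPerSide d n χ : ℝ) ^ d * cellSide d n χ ^ d = n := by
  rw [← mul_pow, blocksPerSide_mul_cellSide hn hχ, sideLen_pow hd]

theorem cellSide_pow_le {n : ℕ} (hd : 0 < d) (hn : 2 ≤ n) (hχ : 0 < χ) :
    cellSide d n χ ^ d ≤ χ * Real.log n := by
  refine (pow_le_pow_left₀ (cellSide_pos hn hχ).le (cellSide_le hn hχ) d).trans ?_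
  rw [mul_pow, rpow_inv_pow hd hχ, radius_pow hd]

theorem tendsto_log_nat : Tendsto (fun n : ℕ => Real.log n) atTop atTop :=
  Real.tendsto_log_atTop.comp tendsto_natCast_atTop_atTop

theorem tendsto_blocksPerSide (hd : 0 < d) (hχ : 0 < χ) :
    Tendsto (fun n : ℕ => blocksPerSide d n χ) atTop atTop := by
  have hc := Real.rpow_pos_of_pos hχ (1 / (d : ℝ))
  have h1 : Tendsto (fun n : ℕ => (radius d n / sideLen d n)⁻¹) atTop atTop := by
    refine Tendsto.inv_tendsto_nhdsGT_zero ?_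
    rw [tendsto_nhdsWithin_iff]
    refine ⟨tendsto_radius_div_sideLen hd, ?_⟩
    filter_upwards [eventually_ge_atTop 2] with n hn
    exact div_pos (radius_pos d hn) (sideLen_pos d hn)
  rw [← tendsto_natCast_atTop_iff (R := ℝ)]
  refine tendsto_atTop_mono' _ ?_ (h1.const_mul_atTop (inv_pos.2 hc))
  filter_upwards [eventually_ge_atTop 2] with n hn
  rw [blocksPerSide_eq hχ]
  refine le_trans (le_of_eq ?_) (Nat.le_ceil _)
  rw [inv_div, mul_comm (χ ^ _), ← div_div, div_eq_inv_mul _ (χ ^ _)]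

end Asymptotics

/-! ### Blocks that meet a visibility neighbourhood -/

/-- Choose the representative of y modulo the circle for which the cyclic distance to x is an
ordinary distance. The index of its interval moves by a multiple of k. -/
theorem exists_torus_lift {k : ℕ} {s x y : ℝ} {i : ℕ} (hy : i * s ≤ y)
    (hy' : y ≤ (i + 1) * s) :
    ∃ m : ℤ, ∃ y' : ℝ, (k : ℤ) ∣ m - i ∧ m * s ≤ y' ∧ y' ≤ (m + 1) * s ∧
      |x - y'| ≤ |min |x - y| (k * s - |x - y|)| := by
  rcases le_total |x - y| (k * s - |x - y|) with h | h
  · refine ⟨i, y, by simp, by simpa using hy, by simpa using hy', ?_⟩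
    rw [min_eq_left h, abs_abs]
  · rw [min_eq_right h]
    rcases le_total y x with h' | h'
    · refine ⟨i + k, y + k * s, by simp, ?_, ?_, ?_⟩
      · push_cast; linarith
      · push_cast; linarith
      · rw [abs_of_nonneg (sub_nonneg.2 h'), abs_sub_comm]
        exact le_of_eq (congrArg _ (by ring))
    · refine ⟨i - k, y - k * s, ?_, ?_, ?_, ?_⟩
      · simp
      · push_cast; linarith
      · push_cast; linarith
      · rw [abs_of_nonpos (sub_nonpos.2 h')]
        exact le_of_eq (congrArg _ (by ring))

/-- Lift the blocks from the torus to the lattice and divide by their side. Each unit cell meets, up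
to closure, the ball of radius r/s about x and has diameter √d, so all cells lie in the ball of
radius R; distinct blocks have distinct lifts. -/
theorem card_near_blocks_le {d n : ℕ} {χ : ℝ} (hn : 2 ≤ n) (hχ : 0 < χ) {x : Fin d → ℝ}
    {F : Finset (Fin d → ℕ)}
    (hF : ∀ i ∈ F, ∃ y ∈ region d n, blockIndex d n χ y = i ∧ torusDist d n x y ≤ radius d n)
    {R : ℝ} (hR : radius d n / cellSide d n χ + Real.sqrt d < R) :
    (F.card : ℝ) ≤ unitBallVol d * R ^ d := by
  classical
  have hs := cellSide_pos (d := d) hn hχ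
  have hr := radius_pos d hn
  have hL := blocksPerSide_mul_cellSide (d := d) hn hχ
  have hk := blocksPerSide_pos (d := d) hn hχ
  set s := cellSide d n χ
  set k := blocksPerSide d n χ
  have hR0 : 0 < R := lt_of_le_of_lt (by positivity) hR
  have hlift : ∀ i ∈ F, ∃ m : Fin d → ℤ, (∀ j, (k : ℤ) ∣ m j - i j) ∧ ∃ y : Fin d → ℝ,
      (∀ j, m j * s ≤ y j ∧ y j ≤ (m j + 1) * s) ∧
        ∑ j, ((x j + sideLen d n / 2) - y j) ^ 2 ≤ radius d n ^ 2 := by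
    intro i hi
    obtain ⟨y, hy, hyi, hxy⟩ := hF i hi
    choose m y' h1 h2 h3 h4 using fun j => exists_torus_lift (k := k) (i := i j)
      (x := x j + sideLen d n / 2) (y := y j + sideLen d n / 2)
      (by rw [← hyi]; exact blockIndex_mul_le hn hχ hy j)
      (by rw [← hyi]; exact le_blockIndex_mul hn hχ hy j)
    refine ⟨m, h1, y', fun j => ⟨h2 j, h3 j⟩, ?_⟩
    rw [torusDist, Real.sqrt_le_left hr.le] at hxy
    refine (Finset.sum_le_sum fun j _ => ?_).trans hxy
    have := h4 j
    rw [hL, add_sub_add_right_eq_sub] at this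
    exact sq_le_sq.2 this
  choose! m hm y hy hxy using hlift
  have hinj : Set.InjOn m F := by
    intro i hi i' hi' h
    have hlt : ∀ i ∈ F, ∀ j, i j < k := fun i hi j => by
      obtain ⟨y, -, rfl, -⟩ := hF i hi
      exact blockIndex_lt hn hχ y j
    rw [← wrap_natCast (hlt i hi), ← wrap_natCast (hlt i' hi'), wrap_eq_wrap_iff hk]
    intro j
    have h1 := hm i hi j
    have h2 := hm i' hi' j
    rw [h] at h1
    have := dvd_sub h2 h1
    rwa [sub_sub_sub_cancel_left] at this
  rw [← Finset.card_image_of_injOn hinj]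
  refine card_le_volume (fun j => (x j + sideLen d n / 2) / s) hR0 _ fun p hp => ?_
  obtain ⟨i, hi, hip⟩ := Finset.mem_image.1 hp
  set u : EuclideanSpace ℝ (Fin d) := WithLp.toLp 2 fun j => p j - y i j / s
  set v : EuclideanSpace ℝ (Fin d) := WithLp.toLp 2 fun j => (y i j - (x j + sideLen d n / 2)) / s
  have hu : ‖u‖ ≤ Real.sqrt d := by
    rw [EuclideanSpace.norm_eq]
    refine Real.sqrt_le_sqrt ?_
    have : ∀ j, ‖u j‖ ^ 2 ≤ 1 := fun j => by
      have h1 := hy i hi j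
      have h2 : ⌊p j⌋ = m i j := (congrFun hip j).symm
      have h3 := Int.floor_eq_iff.1 h2
      rw [← le_div_iff₀ hs, ← div_le_iff₀ hs] at h1
      rw [Real.norm_eq_abs, sq_abs, sq_le_one_iff_abs_le_one]
      simp only [u]
      rw [abs_le]
      constructor <;> linarith
    refine (Finset.sum_le_sum fun j _ => this j).trans ?_
    simp
  have hv : ‖v‖ ≤ radius d n / s := by
    rw [EuclideanSpace.norm_eq, Real.sqrt_le_left (by positivity)]
    simp only [v, Real.norm_eq_abs, sq_abs, div_pow]
    rw [← Finset.sum_div]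
    refine div_le_div_of_nonneg_right (le_trans (le_of_eq ?_) (hxy i hi)) (by positivity)
    exact Finset.sum_congr rfl fun j _ => by ring
  have huv : ‖u + v‖ < R := by
    have := norm_add_le u v
    linarith
  rw [EuclideanSpace.norm_eq, Real.sqrt_lt' hR0] at huv
  refine lt_of_le_of_lt (le_of_eq ?_) huv
  refine Finset.sum_congr rfl fun j _ => ?_
  simp only [u, v, PiLp.add_apply, Real.norm_eq_abs, sq_abs]
  congr 1
  ring

theorem kappa_pos (d : ℕ) {χ : ℝ} (hχ : 0 < χ) : 0 < kappa d χ :=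
  div_pos (mul_pos (unitBallVol_pos d) (pow_pos (add_pos_of_pos_of_nonneg one_pos
    (mul_nonneg (Real.sqrt_nonneg _) (Real.rpow_pos_of_pos hχ _).le)) _)) hχ

/-- Asymptotically, a visibility neighbourhood meets at most `κ` blocks. -/
theorem eventually_card_near_blocks_le {d : ℕ} (hd : 0 < d) {χ : ℝ} (hχ : 0 < χ) {K : ℝ}
    (hK : kappa d χ < K) :
    ∀ᶠ n : ℕ in atTop, ∀ (x : Fin d → ℝ) (F : Finset (Fin d → ℕ)),
      (∀ i ∈ F, ∃ y ∈ region d n, blockIndex d n χ y = i ∧ torusDist d n x y ≤ radius d n) →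
        (F.card : ℝ) ≤ K := by
  have hc := Real.rpow_pos_of_pos hχ (1 / (d : ℝ))
  have hκ : kappa d χ = unitBallVol d * ((χ ^ (1 / (d : ℝ)))⁻¹ + Real.sqrt d) ^ d := by
    have : (χ ^ (1 / (d : ℝ)))⁻¹ + Real.sqrt d =
        (1 + Real.sqrt d * χ ^ (1 / (d : ℝ))) / χ ^ (1 / (d : ℝ)) := by field_simp
    rw [kappa, this, div_pow, rpow_inv_pow hd hχ, mul_div_assoc]
  -- The summand 1/(n + 1) provides the strict inequality required of the radius and vanishes in the
  -- limit.
  have hlim : Tendsto (fun n : ℕ => unitBallVol d *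
      (radius d n / cellSide d n χ + Real.sqrt d + 1 / (n + 1 : ℝ)) ^ d) atTop
      (𝓝 (kappa d χ)) := by
    rw [hκ, ← add_zero ((χ ^ (1 / (d : ℝ)))⁻¹ + Real.sqrt d)]
    exact ((((tendsto_radius_div_cellSide hd hχ).add_const _).add
      tendsto_one_div_add_atTop_nhds_zero_nat).pow d).const_mul _
  filter_upwards [eventually_ge_atTop 2, hlim.eventually_lt_const hK] with n hn h x F hF
  refine (card_near_blocks_le hn hχ hF (lt_add_of_pos_right _ ?_)).trans h.le
  positivity

/-- Block constants exist. -/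
theorem exists_blockConstant {d : ℕ} {lam : ℝ}
    (hlam : (d = 1 ∧ 1 < lam) ∨ (2 ≤ d ∧ 1 < lam * unitBallVol d)) :
    ∃ χ, BlockConstant d lam χ := by
  have hd : 0 < d := by omega
  have hν := unitBallVol_pos d
  have hlam0 : 0 < lam := by
    rcases hlam with ⟨_, h⟩ | ⟨_, h⟩
    · linarith
    · exact pos_of_mul_pos_left (one_pos.trans h) hν.le
  -- In dimension one the last condition on χ involves 1 in place of ν_1 = 2. The value is needed to
  -- see that λ > 1 also satisfies the volume condition.
  have hν1 : d = 1 → unitBallVol d = 2 := by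
    rintro rfl
    rw [unitBallVol, EuclideanSpace.volume_ball]
    simp only [Fintype.card_fin]
    have : Real.sqrt Real.pi ^ 1 / Real.Gamma ((1 : ℕ) / 2 + 1) = 2 := by
      rw [Nat.cast_one, Real.Gamma_add_one (by norm_num), Real.Gamma_one_half_eq, pow_one]
      have := Real.sqrt_pos.2 Real.pi_pos
      field_simp
    rw [this]
    simp
  have h1 : 0 < ((if d = 1 then 1 else unitBallVol d) - 1 / lam) / 2 := by
    split_ifs with h
    · have : 1 < lam := by
        rcases hlam with ⟨_, h'⟩ | ⟨h', _⟩
        · exact h'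
        · omega
      have := (div_lt_one hlam0).2 this
      linarith
    · have h' : 1 < lam * unitBallVol d := by
        rcases hlam with ⟨h', _⟩ | ⟨_, h'⟩
        · exact absurd h' h
        · exact h'
      have : 1 / lam < unitBallVol d := by rw [div_lt_iff₀ hlam0]; linarith
      linarith
  have h2 : (unitBallVol d + 1 / lam) / 2 < unitBallVol d := by
    split_ifs at h1 with h
    · rw [hν1 h]; linarith
    · linarith
  have hroot : Tendsto (fun χ : ℝ => χ ^ (1 / (d : ℝ))) (𝓝[>] 0) (𝓝 0) := by
    have h3 : (0 : ℝ) < 1 / d := by positivity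
    have := (Real.continuousAt_rpow_const 0 (1 / (d : ℝ)) (Or.inr h3.le)).tendsto
    rw [Real.zero_rpow h3.ne'] at this
    exact this.mono_left nhdsWithin_le_nhds
  have hlin : Tendsto (fun χ : ℝ => 1 - 3 * Real.sqrt d * χ ^ (1 / (d : ℝ)) / 2) (𝓝[>] 0)
      (𝓝 1) := by
    have := ((hroot.const_mul (3 * Real.sqrt d)).div_const 2).const_sub 1
    simpa using this
  have hpow : Tendsto (fun χ : ℝ => unitBallVol d *
      (1 - 3 * Real.sqrt d * χ ^ (1 / (d : ℝ)) / 2) ^ d) (𝓝[>] 0) (𝓝 (unitBallVol d)) := by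
    have := (hlin.pow d).const_mul (unitBallVol d)
    simpa using this
  obtain ⟨χ, hχ1, hχ2, hχ3⟩ := ((hlin.eventually_const_lt one_pos).and
    ((hpow.eventually_const_lt h2).and (Ioo_mem_nhdsGT h1))).exists
  exact ⟨χ, hχ1, hχ2.le, hχ3.1, hχ3.2⟩

end GSBM

namespace GSBM

/-! ### Tools from probability -/

section Probability

/-- Bound the outer measure of a set in a product space by conditioning on a discrete function of
the first factor. -/
theorem prod_le_tsum_fibers {α β γ : Type*} [MeasurableSpace α] [MeasurableSpace β] [Countable γ]
    (μ : Measure α) (ν : Measure β) [SFinite ν] (f : α → γ) (S : Set (α × β))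
    (E : γ → Set β) (h : ∀ x y, (x, y) ∈ S → y ∈ E (f x)) :
    μ.prod ν S ≤ ∑' c, μ (f ⁻¹' {c}) * ν (E c) := by
  have hsub : S ⊆ ⋃ c, (f ⁻¹' {c}) ×ˢ E c := by
    rintro ⟨x, y⟩ hxy
    exact Set.mem_iUnion.2 ⟨f x, rfl, h x y hxy⟩
  refine (measure_mono hsub).trans ((measure_iUnion_le _).trans (le_of_eq ?_))
  simp only [Measure.prod_prod]

/-- Conditioning on a countable statistic of the first factor. Only outer measure is used for the
event, so measurability of the events about schedules is never an issue. -/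
theorem prod_le_of_fibers {α β γ : Type*} [MeasurableSpace α] [MeasurableSpace β] [Countable γ]
    [MeasurableSpace γ] [MeasurableSingletonClass γ]
    (μ : Measure α) [IsProbabilityMeasure μ] (ν : Measure β) [SFinite ν] {f : α → γ}
    (hf : Measurable f) (S : Set (α × β)) {ε : ENNReal}
    (h : ∀ c, ν {y | ∃ x, f x = c ∧ (x, y) ∈ S} ≤ ε) : μ.prod ν S ≤ ε := by
  refine (prod_le_tsum_fibers μ ν f S (fun c => {y | ∃ x, f x = c ∧ (x, y) ∈ S})
    fun x y hxy => ⟨x, rfl, hxy⟩).trans ?_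
  have h1 : ∑' c, μ (f ⁻¹' {c}) = 1 := by
    rw [← measure_iUnion (fun c c' hc => Set.disjoint_left.2 fun x hx hx' => hc (hx.symm.trans hx'))
      fun c => hf (measurableSet_singleton c), ← measure_univ (μ := μ)]
    congr 1
    ext x
    simp
  calc ∑' c, μ (f ⁻¹' {c}) * ν {y | ∃ x, f x = c ∧ (x, y) ∈ S}
      ≤ ∑' c, μ (f ⁻¹' {c}) * ε := ENNReal.tsum_le_tsum fun c => mul_le_mul_right (h c) _
    _ = ε := by rw [ENNReal.tsum_mul_right, h1, one_mul]

/-- Events that depend on disjoint sets of coordinates are independent. -/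
theorem iIndepSet_cylinders {ι κ : Type*} {X : ι → Type*} [∀ i, MeasurableSpace (X i)]
    (μ : ∀ i, Measure (X i)) [∀ i, IsProbabilityMeasure (μ i)] {S : κ → Finset ι}
    (hS : Pairwise fun w w' => Disjoint (S w) (S w')) {t : ∀ i, Set (X i)}
    (ht : ∀ i, MeasurableSet (t i)) :
    iIndepSet (fun w => {x | ∀ e ∈ S w, x e ∈ t e}) (Measure.infinitePi μ) := by
  classical
  have hpi : ∀ s : Finset ι, {x : ∀ i, X i | ∀ e ∈ s, x e ∈ t e} = Set.pi s t := fun s => rfl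
  rw [iIndepSet_iff_meas_biInter]
  · intro s
    have : ⋂ w ∈ s, {x : ∀ i, X i | ∀ e ∈ S w, x e ∈ t e} = Set.pi (s.biUnion S) t := by
      ext x
      simp only [Set.mem_iInter, Set.mem_ofPred_eq, Set.mem_pi, Finset.coe_biUnion,
        Set.mem_iUnion, Finset.mem_coe]
      exact ⟨fun h e ⟨w, hw, he⟩ => h w hw e he, fun h w hw e he => h e ⟨w, hw, he⟩⟩
    rw [this, Measure.infinitePi_pi _ fun i _ => ht i,
      Finset.prod_biUnion fun w _ w' _ h => hS h]
    refine Finset.prod_congr rfl fun w _ => ?_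
    rw [hpi, Measure.infinitePi_pi _ fun i _ => ht i]
  · intro w
    rw [hpi]
    exact MeasurableSet.pi (Finset.countable_toSet _) fun i _ => ht i

theorem infinitePi_cylinder {ι : Type*} {X : ι → Type*} [∀ i, MeasurableSpace (X i)]
    (μ : ∀ i, Measure (X i)) [∀ i, IsProbabilityMeasure (μ i)] (s : Finset ι)
    {t : ∀ i, Set (X i)} (ht : ∀ i, MeasurableSet (t i)) :
    (Measure.infinitePi μ).real {x | ∀ e ∈ s, x e ∈ t e} = ∏ e ∈ s, (μ e).real (t e) := by
  have hpi : {x : ∀ i, X i | ∀ e ∈ s, x e ∈ t e} = Set.pi s t := rfl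
  rw [hpi, measureReal_def, Measure.infinitePi_pi _ fun i _ => ht i, ENNReal.toReal_prod]
  rfl

theorem measurableSet_cylinder {ι : Type*} {X : ι → Type*} [∀ i, MeasurableSpace (X i)]
    (s : Finset ι) {t : ∀ i, Set (X i)} (ht : ∀ i, MeasurableSet (t i)) :
    MeasurableSet {x : ∀ i, X i | ∀ e ∈ s, x e ∈ t e} :=
  MeasurableSet.pi (Finset.countable_toSet _) fun i _ => ht i

/-- Markov's inequality for the number of events that occur; measurability is not needed. -/
theorem measure_card_ge_le {Ω ι : Type*} [MeasurableSpace Ω]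
    {μ : Measure Ω} (s : Finset ι) (A : ι → Set Ω) (S : Set Ω) {c : ENNReal}
    (hc : c ≠ 0) (hc' : c ≠ ⊤)
    (hS : ∀ x ∈ S, ∃ F : Finset ι, F ⊆ s ∧ c ≤ F.card ∧ ∀ i ∈ F, x ∈ A i) :
    μ S ≤ (∑ i ∈ s, μ (A i)) / c := by
  have h1 : S ⊆ {x | c ≤ ∑ i ∈ s, (toMeasurable μ (A i)).indicator (fun _ => (1 : ENNReal)) x} := by
    intro x hx
    obtain ⟨F, hF, hcF, h⟩ := hS x hx
    refine hcF.trans (le_trans (le_of_eq ?_) (Finset.sum_le_sum_of_subset hF))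
    rw [Finset.sum_congr rfl fun i hi => Set.indicator_of_mem (subset_toMeasurable μ _ (h i hi)) _]
    simp
  refine (measure_mono h1).trans ((meas_ge_le_lintegral_div ?_ hc hc').trans ?_)
  · exact (Finset.measurable_sum _ fun i _ => measurable_const.indicator
      (measurableSet_toMeasurable μ _)).aemeasurable
  · rw [lintegral_finsetSum _ fun i _ => measurable_const.indicator
      (measurableSet_toMeasurable μ _)]
    refine ENNReal.div_le_div_right (le_of_eq (Finset.sum_congr rfl fun i _ => ?_)) _
    rw [lintegral_indicator_const (measurableSet_toMeasurable μ _), one_mul, measure_toMeasurable]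

/-! ### Hoeffding and Chernoff bounds for independent indicators -/

variable {Ω κ : Type*} [MeasurableSpace Ω] {μ : Measure Ω} [IsProbabilityMeasure μ]
  {E : κ → Set Ω}

/-- Hoeffding's inequality for signed sums of indicators. -/
theorem hoeffding_indicator (hE : ∀ w, MeasurableSet (E w)) (hind : iIndepSet E μ) (s : Finset κ)
    {ε : κ → ℝ} (hε : ∀ w, ε w = 1 ∨ ε w = -1) {t : ℝ} (ht : 0 ≤ t) :
    μ.real {x | t ≤ ∑ w ∈ s, ε w * ((E w).indicator (fun _ => (1 : ℝ)) x - μ.real (E w))} ≤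
      Real.exp (-2 * t ^ 2 / s.card) := by
  have h1 := hind.iIndepFun_indicator (β := ℝ) (m := inferInstance)
  have h2 := h1.comp (fun w y => ε w * (y - μ.real (E w))) fun w => by fun_prop
  have hsub : ∀ w, HasSubgaussianMGF
      (fun x => ε w * ((E w).indicator (fun _ => (1 : ℝ)) x - μ.real (E w))) (1 / 4) μ := by
    intro w
    have hb : ∀ᵐ x ∂μ, (E w).indicator (fun _ => (1 : ℝ)) x ∈ Set.Icc (0 : ℝ) 1 :=
      ae_of_all _ fun x => by by_cases h : x ∈ E w <;> simp [h]
    have h3 := hasSubgaussianMGF_of_mem_Icc (μ := μ)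
      ((measurable_const.indicator (hE w)).aemeasurable) hb
    rw [integral_indicator_const _ (hE w), smul_eq_mul, mul_one] at h3
    -- A variable in [0, 1] is sub-Gaussian with variance proxy 1/4, and a sign does not change
    -- this. The sum over s then has proxy |s|/4.
    have h4 : ((‖(1 : ℝ) - 0‖₊ / 2) ^ 2 : NNReal) = 1 / 4 := by
      ext; norm_num
    rw [h4] at h3
    rcases hε w with h | h
    · simpa [h] using h3
    · have := h3.neg
      rw [h]
      convert this using 1
      funext x
      simp
  have h5 := HasSubgaussianMGF.measure_sum_ge_le_of_iIndepFun h2 (s := s)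
    (c := fun _ => 1 / 4) (fun w _ => hsub w) ht
  refine h5.trans (le_of_eq ?_)
  congr 1
  simp only [Finset.sum_const, nsmul_eq_mul]
  push_cast
  rcases eq_or_ne (s.card : ℝ) 0 with h | h
  · simp [h]
  · field_simp
    ring

/-- Two-sided version. -/
theorem hoeffding_indicator_abs (hE : ∀ w, MeasurableSet (E w)) (hind : iIndepSet E μ)
    (s : Finset κ) {t : ℝ} (ht : 0 ≤ t) :
    μ {x | t ≤ |∑ w ∈ s, ((E w).indicator (fun _ => (1 : ℝ)) x - μ.real (E w))|} ≤
      ENNReal.ofReal (2 * Real.exp (-2 * t ^ 2 / s.card)) := by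
  have h1 := hoeffding_indicator hE hind s (ε := fun _ => 1) (fun _ => Or.inl rfl) ht
  have h2 := hoeffding_indicator hE hind s (ε := fun _ => -1) (fun _ => Or.inr rfl) ht
  have hsub : {x | t ≤ |∑ w ∈ s, ((E w).indicator (fun _ => (1 : ℝ)) x - μ.real (E w))|} ⊆
      {x | t ≤ ∑ w ∈ s, 1 * ((E w).indicator (fun _ => (1 : ℝ)) x - μ.real (E w))} ∪
      {x | t ≤ ∑ w ∈ s, (-1) * ((E w).indicator (fun _ => (1 : ℝ)) x - μ.real (E w))} := by
    intro x hx
    rcases le_abs.1 (Set.mem_ofPred_eq ▸ hx : t ≤ |_|) with h | h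
    · left; simpa using h
    · right; rw [Set.mem_ofPred_eq, ← Finset.mul_sum]; linarith
  refine (measure_mono hsub).trans ((measure_union_le _ _).trans ?_)
  rw [two_mul, ENNReal.ofReal_add (Real.exp_nonneg _) (Real.exp_nonneg _)]
  refine add_le_add ?_ ?_
  · rw [← ofReal_measureReal]; exact ENNReal.ofReal_le_ofReal h1
  · rw [← ofReal_measureReal]; exact ENNReal.ofReal_le_ofReal h2

theorem mgf_indicator {A : Set Ω} (hA : MeasurableSet A) (θ : ℝ) :
    mgf (A.indicator fun _ => (1 : ℝ)) μ θ = 1 + μ.real A * (Real.exp θ - 1) := by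
  have : (fun x => Real.exp (θ * A.indicator (fun _ => (1 : ℝ)) x)) =
      fun x => 1 + A.indicator (fun _ => Real.exp θ - 1) x := by
    funext x
    by_cases h : x ∈ A <;> simp [h]
  rw [mgf, this, integral_add (integrable_const _)
    ((integrable_const _).indicator hA), integral_indicator_const _ hA]
  simp

theorem integrable_exp_sum_indicator (hE : ∀ w, MeasurableSet (E w)) (s : Finset κ) (θ : ℝ) :
    Integrable (fun x => Real.exp (θ * (∑ w ∈ s, (E w).indicator fun _ => (1 : ℝ)) x)) μ := by
  refine integrable_exp_mul_of_mem_Icc (a := (0 : ℝ)) (b := s.card)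
    (X := ∑ w ∈ s, (E w).indicator fun _ => (1 : ℝ)) ?_ (ae_of_all _ fun x => ?_)
  · have hm : Measurable (∑ w ∈ s, (E w).indicator fun _ => (1 : ℝ)) := by
      have := Finset.measurable_sum s (f := fun w => (E w).indicator fun _ => (1 : ℝ))
        fun w _ => measurable_const.indicator (hE w)
      convert this using 1
      ext x
      simp [Finset.sum_apply]
    exact hm.aemeasurable
  · rw [Finset.sum_apply]
    have : ∀ w, (E w).indicator (fun _ => (1 : ℝ)) x ∈ Set.Icc (0 : ℝ) 1 := fun w => by
      by_cases h : x ∈ E w <;> simp [h]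
    refine ⟨Finset.sum_nonneg fun w _ => (this w).1, ?_⟩
    refine (Finset.sum_le_sum fun w _ => (this w).2).trans ?_
    simp

theorem mgf_sum_indicator (hE : ∀ w, MeasurableSet (E w)) (hind : iIndepSet E μ) {p : ℝ}
    (hp : ∀ w, μ.real (E w) = p) (s : Finset κ) (θ : ℝ) :
    mgf (∑ w ∈ s, (E w).indicator fun _ => (1 : ℝ)) μ θ =
      (1 + p * (Real.exp θ - 1)) ^ s.card := by
  rw [(hind.iIndepFun_indicator (β := ℝ) (m := inferInstance)).mgf_sum
    fun w => measurable_const.indicator (hE w)]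
  simp [mgf_indicator (hE _), hp]

theorem chernoff_le (hE : ∀ w, MeasurableSet (E w)) (hind : iIndepSet E μ) {p : ℝ}
    (hp : ∀ w, μ.real (E w) = p) (s : Finset κ) {θ : ℝ} (hθ : θ ≤ 0) (c : ℝ) :
    μ.real {x | ∑ w ∈ s, (E w).indicator (fun _ => (1 : ℝ)) x ≤ c} ≤
      Real.exp (-θ * c) * (1 + p * (Real.exp θ - 1)) ^ s.card := by
  have := measure_le_le_exp_mul_mgf (μ := μ) c hθ (integrable_exp_sum_indicator hE s θ)
  rw [mgf_sum_indicator hE hind hp] at this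
  simpa using this

theorem chernoff_ge (hE : ∀ w, MeasurableSet (E w)) (hind : iIndepSet E μ) {p : ℝ}
    (hp : ∀ w, μ.real (E w) = p) (s : Finset κ) {θ : ℝ} (hθ : 0 ≤ θ) (c : ℝ) :
    μ.real {x | c ≤ ∑ w ∈ s, (E w).indicator (fun _ => (1 : ℝ)) x} ≤
      Real.exp (-θ * c) * (1 + p * (Real.exp θ - 1)) ^ s.card := by
  have := measure_ge_le_exp_mul_mgf (μ := μ) c hθ (integrable_exp_sum_indicator hE s θ)
  rw [mgf_sum_indicator hE hind hp] at this
  simpa using this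

/-- The generating function of the Poisson distribution. It turns a Chernoff bound for a fixed
number of vertices into one for a Poisson number. -/
theorem tsum_poisson_mul_pow (r : NNReal) {C q : ℝ} (hC : 0 ≤ C) (hq : 0 ≤ q) :
    ∑' N, poissonMeasure r {N} * ENNReal.ofReal (C * q ^ N) =
      ENNReal.ofReal (C * Real.exp (r * (q - 1))) := by
  have h1 : ∀ N : ℕ, poissonMeasure r {N} * ENNReal.ofReal (C * q ^ N) =
      ENNReal.ofReal (C * Real.exp (-r) * ((r * q) ^ N / N.factorial)) := by
    intro N
    rw [poissonMeasure_singleton, ← ENNReal.ofReal_mul (by positivity)]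
    congr 1
    rw [mul_pow]
    ring
  simp_rw [h1]
  have h2 : HasSum (fun N : ℕ => C * Real.exp (-r) * ((r * q) ^ N / N.factorial))
      (C * Real.exp (-r) * Real.exp (r * q)) := by
    have := NormedSpace.expSeries_div_hasSum_exp (r * q : ℝ)
    rw [← Real.exp_eq_exp_ℝ] at this
    exact this.mul_left _
  rw [← ENNReal.ofReal_tsum_of_nonneg (fun N => by positivity) h2.summable, h2.tsum_eq, mul_assoc,
    ← Real.exp_add]
  congr 3
  ring

theorem tendsto_measure_one_of_bad {Ω : ℕ → Type*} [∀ n, MeasurableSpace (Ω n)]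
    (μ : ∀ n, Measure (Ω n)) [∀ n, IsProbabilityMeasure (μ n)] (good bad : ∀ n, Set (Ω n))
    (h : ∀ᶠ n in atTop, (bad n)ᶜ ⊆ good n) (h0 : Tendsto (fun n => μ n (bad n)) atTop (𝓝 0)) :
    Tendsto (fun n => μ n (good n)) atTop (𝓝 1) := by
  have h1 : Tendsto (fun n => 1 - μ n (bad n)) atTop (𝓝 1) := by
    have := ENNReal.Tendsto.sub (tendsto_const_nhds (x := (1 : ENNReal))) h0 (Or.inl (by simp))
    simpa using this
  refine tendsto_of_tendsto_of_tendsto_of_le_of_le' h1 tendsto_const_nhds ?_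
    (Eventually.of_forall fun n => prob_le_one)
  filter_upwards [h] with n hn
  rw [tsub_le_iff_right, ← measure_univ (μ := μ n), ← Set.union_compl_self (bad n), Set.union_comm]
  exact (measure_union_le _ _).trans (add_le_add_left (measure_mono hn) _)

end Probability

end GSBM

namespace GSBM

/-! ### Numbers of vertices in unions of blocks -/

instance (d : ℕ) (lam : ℝ) (n : ℕ) : IsProbabilityMeasure (law d lam n) := by
  unfold law; infer_instance

variable {d n : ℕ} {χ : ℝ}

/-- The block of the point of the region that is given by a point of the unit cube. -/
def cellOf (n : ℕ) (χ : ℝ) (u : Fin d → unitInterval) : Fin d → ℕ :=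
  blockIndex d n χ fun j => sideLen d n * ((u j : ℝ) - 1 / 2)

theorem cellOf_apply (hn : 2 ≤ n) (u : Fin d → unitInterval) (j : Fin d) :
    cellOf n χ u j =
      min ⌊(blocksPerSide d n χ : ℝ) * u j⌋₊ (blocksPerSide d n χ - 1) := by
  have hL := sideLen_pos d hn
  have : (sideLen d n * ((u j : ℝ) - 1 / 2) + sideLen d n / 2) /
      (sideLen d n / blocksPerSide d n χ) = blocksPerSide d n χ * u j := by
    rw [div_div_eq_mul_div]
    field_simp
    ring
  rw [cellOf, blockIndex, this]

theorem cellOf_lt (hn : 2 ≤ n) (hχ : 0 < χ) (u : Fin d → unitInterval) (j : Fin d) :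
    cellOf n χ u j < blocksPerSide d n χ := blockIndex_lt hn hχ _ j

theorem location_mem_region (ω : Sample d) (i : ℕ) : location n ω i ∈ region d n := by
  intro j
  have h0 := (ω.2.1 i j).2.1
  have h1 := (ω.2.1 i j).2.2
  have hL : 0 ≤ sideLen d n := Real.rpow_nonneg (Nat.cast_nonneg n) _
  simp only [location]
  constructor <;> nlinarith

theorem measurable_cellOf (hn : 2 ≤ n) : Measurable (cellOf (d := d) n χ) := by
  refine measurable_pi_lambda _ fun j => ?_
  simp only [cellOf_apply hn]
  refine Measurable.min ?_ measurable_const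
  refine Nat.measurable_floor.comp ?_
  exact measurable_const.mul (measurable_subtype_coe.comp (measurable_pi_apply j))

/-- The set lies between a half-open and a closed interval of length 1/k; the last block also
contains the endpoint. -/
theorem volume_floor_eq {k z : ℕ} (hz : z < k) :
    volume {v : unitInterval | min ⌊(k : ℝ) * v⌋₊ (k - 1) = z} = ENNReal.ofReal (1 / k) := by
  have hk : (0 : ℝ) < k := by exact_mod_cast (by omega : 0 < k)
  have hz1 : (z : ℝ) + 1 ≤ k := by exact_mod_cast hz
  have hz0 : (0 : ℝ) ≤ z := Nat.cast_nonneg z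
  set x : unitInterval := ⟨z / k, by positivity, by rw [div_le_one hk]; linarith⟩ with hx
  set y : unitInterval := ⟨(z + 1) / k, by positivity, by rw [div_le_one hk]; linarith⟩ with hy
  have hxy : (y : ℝ) - x = 1 / k := by simp only [hx, hy]; ring
  refine le_antisymm ?_ ?_
  · rw [← hxy, ← unitInterval.volume_Icc]
    refine measure_mono fun v hv => ?_
    rw [Set.mem_ofPred_eq] at hv
    have hv0 : (0 : ℝ) ≤ k * v := mul_nonneg hk.le v.2.1
    constructor
    · change (z / k : ℝ) ≤ v
      rw [div_le_iff₀ hk, mul_comm]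
      refine le_trans ?_ (Nat.floor_le hv0)
      exact_mod_cast (by omega : z ≤ ⌊(k : ℝ) * v⌋₊)
    · change (v : ℝ) ≤ (z + 1) / k
      rw [le_div_iff₀ hk, mul_comm]
      by_cases h : ⌊(k : ℝ) * v⌋₊ = z
      · rw [← h]; exact (Nat.lt_floor_add_one _).le
      · have h1 : k = z + 1 := by omega
        have h2 : (k : ℝ) = z + 1 := by exact_mod_cast h1
        rw [← h2]
        exact mul_le_of_le_one_right hk.le v.2.2
  · rw [← hxy, ← unitInterval.volume_Ico]
    refine measure_mono fun v hv => ?_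
    have h1 : (z / k : ℝ) ≤ v := hv.1
    have h2 : (v : ℝ) < (z + 1) / k := hv.2
    rw [div_le_iff₀ hk, mul_comm] at h1
    rw [lt_div_iff₀ hk, mul_comm] at h2
    have : ⌊(k : ℝ) * v⌋₊ = z := by
      rw [Nat.floor_eq_iff (mul_nonneg hk.le v.2.1)]
      exact ⟨h1, h2⟩
    rw [Set.mem_ofPred_eq, this]
    omega

theorem volume_cellOf_eq (hn : 2 ≤ n) {z : Fin d → ℕ} (hz : ∀ j, z j < blocksPerSide d n χ) :
    volume {u : Fin d → unitInterval | cellOf n χ u = z} =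
      ENNReal.ofReal (1 / (blocksPerSide d n χ : ℝ) ^ d) := by
  have : {u : Fin d → unitInterval | cellOf n χ u = z} = Set.univ.pi fun j =>
      {v : unitInterval | min ⌊(blocksPerSide d n χ : ℝ) * v⌋₊ (blocksPerSide d n χ - 1) =
        z j} := by
    ext u
    simp [funext_iff, cellOf_apply hn]
  rw [this, volume_pi_pi]
  simp only [volume_floor_eq (hz _), Finset.prod_const, Finset.card_univ, Fintype.card_fin]
  rw [← ENNReal.ofReal_pow (by positivity), one_div_pow]

theorem volume_cellOf_mem (hn : 2 ≤ n) {A : Finset (Fin d → ℕ)}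
    (hA : ∀ z ∈ A, ∀ j, z j < blocksPerSide d n χ) :
    (volume : Measure (Fin d → unitInterval)).real {u | cellOf n χ u ∈ A} =
      A.card / (blocksPerSide d n χ : ℝ) ^ d := by
  have : {u : Fin d → unitInterval | cellOf n χ u ∈ A} = ⋃ z ∈ A, {u | cellOf n χ u = z} := by
    ext u; simp
  rw [measureReal_def, this, measure_biUnion_finset]
  · rw [Finset.sum_congr rfl fun z hz => volume_cellOf_eq hn (hA z hz), Finset.sum_const,
      nsmul_eq_mul, ENNReal.toReal_mul, ENNReal.toReal_natCast,
      ENNReal.toReal_ofReal (by positivity), mul_one_div]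
  · exact fun z _ z' _ h => Set.disjoint_left.2 fun u hu hu' => h (hu.symm.trans hu')
  · exact fun z _ => measurable_cellOf hn (measurableSet_singleton z)

/-- The number of vertices in the blocks of `A`. -/
def blockCount (n : ℕ) (χ : ℝ) (ω : Sample d) (A : Finset (Fin d → ℕ)) : ℕ :=
  (Finset.univ.filter fun v : Fin ω.1 => cellOf n χ (ω.2.1 v) ∈ A).card

theorem blockCount_eq_sum (ω : Sample d) (A : Finset (Fin d → ℕ)) :
    (blockCount n χ ω A : ℝ) = ∑ i ∈ Finset.range ω.1,
      ({x : ℕ → Fin d → unitInterval | ∀ e ∈ ({i} : Finset ℕ),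
        x e ∈ {u | cellOf n χ u ∈ A}}).indicator (fun _ => (1 : ℝ)) ω.2.1 := by
  rw [blockCount, Finset.card_filter, Nat.cast_sum, Finset.sum_range]
  refine Finset.sum_congr rfl fun v _ => ?_
  simp [Set.indicator_apply]

theorem law_le_tsum {lam : ℝ} (P : ℕ → (ℕ → Fin d → unitInterval) → Prop) :
    law d lam n {ω | P ω.1 ω.2.1} ≤ ∑' N, poissonMeasure (lam * n).toNNReal {N} *
      (Measure.infinitePi fun _ : ℕ => (volume : Measure (Fin d → unitInterval))) {x | P N x} := by
  refine (prod_le_tsum_fibers _ _ id _ (fun N => {x | P N x} ×ˢ Set.univ) ?_).trans ?_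
  · intro N y h
    exact ⟨h, trivial⟩
  · refine ENNReal.tsum_le_tsum fun N => ?_
    rw [Measure.prod_prod, measure_univ, mul_one, Set.preimage_id]

/-! ### Chernoff bounds for the number of vertices in a set of blocks -/

section Counts

variable {lam : ℝ} {A : Finset (Fin d → ℕ)}

/-- For N vertices the count is a sum of N independent indicators, and averaging over the Poisson
variable N replaces (1 + x)^N by exp(λnx). Both tails share this argument. -/
theorem law_count_bound (hn : 2 ≤ n) (hlam : 0 < lam) (hA : ∀ z ∈ A, ∀ j, z j < blocksPerSide d n χ)
    (P : ℝ → Prop) {θ C : ℝ} (hC : 0 ≤ C)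
    (h : ∀ N : ℕ, (Measure.infinitePi fun _ : ℕ => (volume : Measure (Fin d → unitInterval))).real
      {x | P (∑ i ∈ Finset.range N, ({x : ℕ → Fin d → unitInterval | ∀ e ∈ ({i} : Finset ℕ),
        x e ∈ {u | cellOf n χ u ∈ A}}).indicator (fun _ => (1 : ℝ)) x)} ≤
        C * (1 + A.card / (blocksPerSide d n χ : ℝ) ^ d * (Real.exp θ - 1)) ^ N) :
    law d lam n {ω | P (blockCount n χ ω A)} ≤ ENNReal.ofReal (C * Real.exp
      (lam * n * (A.card / (blocksPerSide d n χ : ℝ) ^ d * (Real.exp θ - 1)))) := by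
  have hp := volume_cellOf_mem hn hA
  have hp1 : (A.card / (blocksPerSide d n χ : ℝ) ^ d) ≤ 1 := by
    rw [← hp]; exact measureReal_le_one
  have hp0 : 0 ≤ (A.card / (blocksPerSide d n χ : ℝ) ^ d) := by positivity
  have hq : 0 ≤ 1 + A.card / (blocksPerSide d n χ : ℝ) ^ d * (Real.exp θ - 1) := by
    nlinarith [Real.exp_pos θ]
  simp only [blockCount_eq_sum]
  refine (law_le_tsum (lam := lam) (n := n) fun N x => P (∑ i ∈ Finset.range N,
    ({x : ℕ → Fin d → unitInterval | ∀ e ∈ ({i} : Finset ℕ),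
        x e ∈ {u | cellOf n χ u ∈ A}}).indicator (fun _ => (1 : ℝ)) x)).trans ?_
  refine (ENNReal.tsum_le_tsum fun N => mul_le_mul_right (b := _) (c :=
    ENNReal.ofReal (C * (1 + A.card / (blocksPerSide d n χ : ℝ) ^ d * (Real.exp θ - 1)) ^ N))
      ?_ _).trans ?_
  · rw [← ofReal_measureReal]
    exact ENNReal.ofReal_le_ofReal (h N)
  · rw [tsum_poisson_mul_pow _ hC hq, Real.coe_toNNReal _ (by positivity), add_sub_cancel_left]

theorem iIndepSet_cellOf (hn : 2 ≤ n) (A : Finset (Fin d → ℕ)) :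
    iIndepSet (fun i : ℕ => {x : ℕ → Fin d → unitInterval | ∀ e ∈ ({i} : Finset ℕ),
        x e ∈ {u | cellOf n χ u ∈ A}})
      (Measure.infinitePi fun _ : ℕ => (volume : Measure (Fin d → unitInterval))) :=
  iIndepSet_cylinders _ (fun i j h => by simpa using h)
    fun _ => measurable_cellOf hn (Finset.measurableSet A)

theorem law_count_le (hn : 2 ≤ n) (hlam : 0 < lam) (hA : ∀ z ∈ A, ∀ j, z j < blocksPerSide d n χ)
    {θ : ℝ} (hθ : θ ≤ 0) (c : ℝ) :
    law d lam n {ω | (blockCount n χ ω A : ℝ) ≤ c} ≤ ENNReal.ofReal (Real.exp (-θ * c) * Real.exp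
      (lam * n * (A.card / (blocksPerSide d n χ : ℝ) ^ d * (Real.exp θ - 1)))) := by
  refine law_count_bound hn hlam hA (fun y => y ≤ c) (Real.exp_nonneg _) fun N => ?_
  have := chernoff_le (fun i => measurableSet_cylinder _ fun _ =>
    measurable_cellOf hn (Finset.measurableSet A)) (iIndepSet_cellOf hn A)
    (p := A.card / (blocksPerSide d n χ : ℝ) ^ d)
    (fun i => by
      rw [infinitePi_cylinder _ _ fun _ => measurable_cellOf hn (Finset.measurableSet A)]
      rw [Finset.prod_singleton]
      exact volume_cellOf_mem hn hA) (Finset.range N) hθ c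
  rwa [Finset.card_range] at this

theorem law_count_ge (hn : 2 ≤ n) (hlam : 0 < lam) (hA : ∀ z ∈ A, ∀ j, z j < blocksPerSide d n χ)
    {θ : ℝ} (hθ : 0 ≤ θ) (c : ℝ) :
    law d lam n {ω | c ≤ (blockCount n χ ω A : ℝ)} ≤ ENNReal.ofReal (Real.exp (-θ * c) * Real.exp
      (lam * n * (A.card / (blocksPerSide d n χ : ℝ) ^ d * (Real.exp θ - 1)))) := by
  refine law_count_bound hn hlam hA (fun y => c ≤ y) (Real.exp_nonneg _) fun N => ?_
  have := chernoff_ge (fun i => measurableSet_cylinder _ fun _ =>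
    measurable_cellOf hn (Finset.measurableSet A)) (iIndepSet_cellOf hn A)
    (p := A.card / (blocksPerSide d n χ : ℝ) ^ d)
    (fun i => by
      rw [infinitePi_cylinder _ _ fun _ => measurable_cellOf hn (Finset.measurableSet A)]
      rw [Finset.prod_singleton]
      exact volume_cellOf_mem hn hA) (Finset.range N) hθ c
  rwa [Finset.card_range] at this

end Counts

end GSBM

namespace GSBM

/-! ### Typical block configurations -/

/-- The blocks of the vertices. -/
def cells {d : ℕ} (n : ℕ) (χ : ℝ) (ω : Sample d) : Fin ω.1 → Fin d → ℕ :=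
  fun v => cellOf n χ (ω.2.1 v.val)

/-- Coordinates of all blocks. -/
def gridBlocks (d k : ℕ) : Finset (Fin d → ℕ) := Fintype.piFinset fun _ => Finset.range k

theorem mem_gridBlocks {d k : ℕ} {z : Fin d → ℕ} : z ∈ gridBlocks d k ↔ ∀ j, z j < k := by
  simp [gridBlocks]

theorem card_gridBlocks (d k : ℕ) : (gridBlocks d k).card = k ^ d := by simp [gridBlocks]

theorem tendsto_exp_neg_log {c : ℝ} (hc : 0 < c) :
    Tendsto (fun n : ℕ => Real.exp (-(c * Real.log n))) atTop (𝓝 0) :=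
  Real.tendsto_exp_neg_atTop_nhds_zero.comp (tendsto_log_nat.const_mul_atTop hc)

theorem tendsto_zero_of_eventually_le_ofReal {f : ℕ → ENNReal} {g : ℕ → ℝ}
    (h : ∀ᶠ n in atTop, f n ≤ ENNReal.ofReal (g n)) (hg : Tendsto g atTop (𝓝 0)) :
    Tendsto f atTop (𝓝 0) := by
  have h1 := ENNReal.tendsto_ofReal hg
  rw [ENNReal.ofReal_zero] at h1
  exact tendsto_of_tendsto_of_tendsto_of_le_of_le' tendsto_const_nhds h1
    (Eventually.of_forall fun _ => zero_le) h

theorem measure_le_of_cover {Ω ι : Type*} [MeasurableSpace Ω] (μ : Measure Ω) (s : Finset ι)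
    (A : ι → Set Ω) {S : Set Ω} (hS : ∀ x ∈ S, ∃ i ∈ s, x ∈ A i) {C ε : ℝ} (hC : (s.card : ℝ) ≤ C)
    (hε : 0 ≤ ε) (h : ∀ i ∈ s, μ (A i) ≤ ENNReal.ofReal ε) : μ S ≤ ENNReal.ofReal (C * ε) := by
  have h1 : S ⊆ ⋃ i ∈ s, A i := fun x hx => by
    obtain ⟨i, hi, hx⟩ := hS x hx
    exact Set.mem_biUnion hi hx
  refine (measure_mono h1).trans ((measure_biUnion_finset_le s A).trans
    ((Finset.sum_le_sum h).trans ?_))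
  rw [Finset.sum_const, nsmul_eq_mul, ← ENNReal.ofReal_natCast,
    ← ENNReal.ofReal_mul (Nat.cast_nonneg _)]
  exact ENNReal.ofReal_le_ofReal (mul_le_mul_of_nonneg_right hC hε)

variable {d : ℕ} {χ lam : ℝ}

theorem blockCount_eq_sum_card (n : ℕ) (ω : Sample d) (A : Finset (Fin d → ℕ)) :
    blockCount n χ ω A = ∑ z ∈ A, (vertsIn (cells n χ ω) z).card := by
  rw [blockCount, Finset.card_eq_sum_card_fiberwise (f := cells n χ ω) (t := A)]
  · refine Finset.sum_congr rfl fun z hz => ?_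
    rw [Finset.filter_filter, vertsIn]
    congr 1
    ext v
    simp only [Finset.mem_filter, Finset.mem_univ, true_and]
    exact ⟨fun h => h.2, fun h => ⟨by rw [show cellOf n χ (ω.2.1 v) = z from h]; exact hz, h⟩⟩
  · intro v hv
    simpa [cells] using hv

theorem blockCount_singleton (n : ℕ) (ω : Sample d) (z : Fin d → ℕ) :
    blockCount n χ ω {z} = (vertsIn (cells n χ ω) z).card := by
  rw [blockCount_eq_sum_card, Finset.sum_singleton]

theorem blockCount_gridBlocks {n : ℕ} (hn : 2 ≤ n) (hχ : 0 < χ) (ω : Sample d) :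
    blockCount n χ ω (gridBlocks d (blocksPerSide d n χ)) = ω.1 := by
  rw [blockCount, Finset.filter_true_of_mem fun v _ => mem_gridBlocks.2 (cellOf_lt hn hχ _)]
  simp

theorem count_exponent (hd : 0 < d) {n : ℕ} (hn : 2 ≤ n) (hχ : 0 < χ) (A : Finset (Fin d → ℕ))
    (e : ℝ) : lam * n * (A.card / (blocksPerSide d n χ : ℝ) ^ d * e) =
      A.card * (lam * cellSide d n χ ^ d * e) := by
  have hk : (0 : ℝ) < (blocksPerSide d n χ : ℝ) ^ d :=
    pow_pos (by exact_mod_cast blocksPerSide_pos hn hχ) d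
  rw [← cellSide_pow_mul hd hn hχ]
  field_simp

theorem eventually_card_blocks_le (hd : 0 < d) (hχ : 0 < χ) :
    ∀ᶠ n : ℕ in atTop, ((blocksPerSide d n χ : ℝ) ^ d) * (χ / 2 * Real.log n) ≤ n ∧
      ((blocksPerSide d n χ : ℝ) ^ d) ≤ n := by
  have h1 := (tendsto_volume_block hd hχ).eventually_const_lt (half_lt_self hχ)
  have h2 := (tendsto_log_nat.const_mul_atTop (half_pos hχ)).eventually_ge_atTop 1
  filter_upwards [h1, h2, eventually_ge_atTop 2] with n h1 h2 hn
  have hlog := log_pos_of_two_le hn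
  rw [lt_div_iff₀ hlog] at h1
  have hk : (0 : ℝ) ≤ (blocksPerSide d n χ : ℝ) ^ d := by positivity
  have h3 : ((blocksPerSide d n χ : ℝ) ^ d) * (χ / 2 * Real.log n) ≤ n := by
    conv_rhs => rw [← cellSide_pow_mul hd hn hχ]
    exact mul_le_mul_of_nonneg_left h1.le hk
  exact ⟨h3, by nlinarith⟩

/-- Vacant blocks are unlikely. -/
theorem exists_vacancy_bound (hd : 0 < d) (hχ : 0 < χ) (hlam : 0 < lam) {m : ℕ}
    (hm : 1 < m * (lam * χ)) :
    ∃ δ₀ : ℝ, 0 < δ₀ ∧ ∃ c : ℝ, 0 < c ∧ 1 < m * c ∧ ∀ δ : ℝ, δ < δ₀ →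
      ∀ᶠ n : ℕ in atTop, ∀ A : Finset (Fin d → ℕ), (∀ z ∈ A, ∀ j, z j < blocksPerSide d n χ) →
        law d lam n {ω | ∀ z ∈ A, ¬ Occupied n δ (cells n χ ω) z} ≤
          ENNReal.ofReal (Real.exp (-(A.card * c * Real.log n))) := by
  have hm0 : (0 : ℝ) < m := by
    rcases Nat.eq_zero_or_pos m with h | h
    · rw [h] at hm; simp at hm; linarith
    · exact_mod_cast h
  set g := m * (lam * χ) with hg
  -- τ < 1 is chosen with gτ² > 1. It is used twice: block volumes are at least χτ log n for large
  -- n, and the Chernoff parameter θ satisfies e^θ = 1 - τ.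
  set τ := (1 + 1 / g) / 2 with hτ
  have hg1 : 1 / g < 1 := (div_lt_one (by linarith)).2 hm
  have hg0 : 0 < 1 / g := by positivity
  have hτ0 : 0 < τ := by rw [hτ]; generalize 1 / g = e at hg0 ⊢; linarith
  have hτ1 : τ < 1 := by rw [hτ]; generalize 1 / g = e at hg1 ⊢; linarith
  have hgτ : 1 < g * τ ^ 2 := by
    have : g * τ ^ 2 = (g + 1) ^ 2 / (4 * g) := by
      rw [hτ]; field_simp; ring
    rw [this, lt_div_iff₀ (by linarith)]
    nlinarith
  set θ := Real.log (1 - τ) with hθ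
  have hexp : Real.exp θ = 1 - τ := Real.exp_log (by linarith)
  have hθ0 : θ < 0 := Real.log_neg (by linarith) (by linarith)
  -- The exponent per block is at most -θδ log n - (gτ²/m) log n. The bound on δ makes the first
  -- term at most (gτ² - 1)/(2m) log n, which leaves the rate c = (gτ² + 1)/(2m) with mc > 1.
  refine ⟨(g * τ ^ 2 - 1) / (2 * m * (-θ)), div_pos (by linarith) (by nlinarith),
    (g * τ ^ 2 + 1) / (2 * m), by positivity, ?_, fun δ hδ => ?_⟩
  · rw [mul_div_assoc', lt_div_iff₀ (by positivity)]
    nlinarith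
  have h1 := (tendsto_volume_block hd hχ).eventually_const_lt
    (show χ * τ < χ by nlinarith)
  filter_upwards [h1, eventually_ge_atTop 2] with n h1 hn A hA
  have hlog := log_pos_of_two_le hn
  rw [lt_div_iff₀ hlog] at h1
  refine (measure_mono ?_).trans ((law_count_le hn hlam hA hθ0.le
    (A.card * (δ * Real.log n))).trans (ENNReal.ofReal_le_ofReal ?_))
  · intro ω hω
    rw [Set.mem_ofPred_eq, blockCount_eq_sum_card]
    push_cast
    refine (Finset.sum_le_sum (g := fun _ => δ * Real.log n) fun z hz => ?_).trans ?_
    · exact not_lt.1 (hω z hz)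
    · simp
  rw [← Real.exp_add, count_exponent hd hn hχ, hexp]
  refine Real.exp_le_exp.2 ?_
  have h2 : -θ * δ ≤ (g * τ ^ 2 - 1) / (2 * m) := by
    have h3 : (g * τ ^ 2 - 1) / (2 * m * (-θ)) = (g * τ ^ 2 - 1) / (2 * m) / (-θ) := by
      rw [div_div]
    rw [h3, lt_div_iff₀ (by linarith)] at hδ
    linarith
  have h3 : lam * (χ * τ * Real.log n) * τ ≤ lam * cellSide d n χ ^ d * τ := by
    have := mul_le_mul_of_nonneg_left h1.le hlam.le
    exact mul_le_mul_of_nonneg_right this hτ0.le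
  have h4 := mul_le_mul_of_nonneg_right h2 hlog.le
  have h5 : (g * τ ^ 2 - 1) / (2 * m) * Real.log n - lam * (χ * τ * Real.log n) * τ =
      -((g * τ ^ 2 + 1) / (2 * m) * Real.log n) := by
    rw [hg]; field_simp; ring
  have h6 := mul_le_mul_of_nonneg_left (a := (A.card : ℝ)) (b := -θ * δ * Real.log n +
    lam * cellSide d n χ ^ d * (1 - τ - 1)) (c := -((g * τ ^ 2 + 1) / (2 * m) * Real.log n))
    (by linarith) (Nat.cast_nonneg _)
  calc _ = A.card * (-θ * δ * Real.log n + lam * cellSide d n χ ^ d * (1 - τ - 1)) := by ring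
    _ ≤ _ := h6
    _ = _ := by ring

theorem wrap_add_wrap {k : ℕ} (hk : 0 < k) (y z : Fin d → ℤ) :
    wrap k ((fun j => (wrap k y j : ℤ)) + z) = wrap k (y + z) := by
  rw [wrap_eq_wrap_iff hk]
  intro j
  rw [Pi.add_apply, Pi.add_apply, add_sub_add_right_eq_sub, cast_wrap hk]
  exact (Int.mod_modEq _ _).symm.dvd

theorem wrap_injOn {k D : ℕ} (hk : 2 * D < k) (y : Fin d → ℤ) {A : Finset (Fin d → ℤ)}
    (hA : ∀ z ∈ A, ∀ j, |z j| ≤ D) : Set.InjOn (fun z => wrap k (y + z)) A := by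
  intro z hz z' hz' h
  rw [wrap_eq_wrap_iff (by omega)] at h
  funext j
  have h1 := h j
  rw [Pi.add_apply, Pi.add_apply, add_sub_add_left_eq_sub] at h1
  have h2 := abs_le.1 (hA z hz j)
  have h3 := abs_le.1 (hA z' hz' j)
  have h4 : |z j - z' j| < k := by rw [abs_lt]; constructor <;> omega
  have := Int.eq_zero_of_abs_lt_dvd h1 h4
  omega

/-- With high probability, none of finitely many patterns of vacant blocks occurs. -/
theorem tendsto_vacant_pattern (hd : 0 < d) (hχ : 0 < χ) {m D : ℕ} {c δ : ℝ} (hmc : 1 < m * c)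
    (hvac : ∀ᶠ n : ℕ in atTop, ∀ A : Finset (Fin d → ℕ),
      (∀ z ∈ A, ∀ j, z j < blocksPerSide d n χ) →
        law d lam n {ω | ∀ z ∈ A, ¬ Occupied n δ (cells n χ ω) z} ≤
          ENNReal.ofReal (Real.exp (-(A.card * c * Real.log n))))
    {P : Finset (Finset (Fin d → ℤ))} (hP : ∀ A ∈ P, A.card = m ∧ ∀ z ∈ A, ∀ j, |z j| ≤ D) :
    Tendsto (fun n : ℕ => law d lam n {ω | ∃ y : Fin d → ℤ, ∃ A ∈ P, ∀ z ∈ A,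
      ¬ Occupied n δ (cells n χ ω) (wrap (blocksPerSide d n χ) (y + z))}) atTop (𝓝 0) := by
  have hlim : Tendsto (fun n : ℕ => P.card * Real.exp (-((m * c - 1) * Real.log n))) atTop
      (𝓝 0) := by
    simpa using (tendsto_exp_neg_log (sub_pos.2 hmc)).const_mul (P.card : ℝ)
  refine tendsto_zero_of_eventually_le_ofReal ?_ hlim
  filter_upwards [hvac, eventually_card_blocks_le hd hχ, eventually_ge_atTop 2,
    (tendsto_blocksPerSide hd hχ).eventually_gt_atTop (2 * D)] with n hvac hcard hn hkD
  have hk := blocksPerSide_pos (d := d) hn hχ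
  have hn0 : (0 : ℝ) < n := by positivity
  -- Translates matter only modulo the number of blocks, so there are at most n of them. For k > 2D
  -- a pattern does not overlap itself on the torus and keeps its m distinct blocks.
  have hmain := measure_le_of_cover (law d lam n)
    (gridBlocks d (blocksPerSide d n χ) ×ˢ P)
    (fun p => {ω | ∀ z ∈ p.2.image fun z => wrap (blocksPerSide d n χ)
      ((fun j => (p.1 j : ℤ)) + z), ¬ Occupied n δ (cells n χ ω) z})
    (S := {ω | ∃ y : Fin d → ℤ, ∃ A ∈ P, ∀ z ∈ A,
      ¬ Occupied n δ (cells n χ ω) (wrap (blocksPerSide d n χ) (y + z))})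
    (C := n * P.card) (ε := Real.exp (-(m * c * Real.log n))) ?_ ?_ (Real.exp_nonneg _) ?_
  · refine hmain.trans (ENNReal.ofReal_le_ofReal (le_of_eq ?_))
    have : Real.exp (-((m * c - 1) * Real.log n)) = n * Real.exp (-(m * c * Real.log n)) := by
      rw [← Real.exp_log hn0, ← Real.exp_add, Real.exp_log hn0]
      congr 1; ring
    rw [this]; ring
  · rintro ω ⟨y, A, hA, hω⟩
    refine ⟨(wrap (blocksPerSide d n χ) y, A), Finset.mem_product.2
      ⟨mem_gridBlocks.2 (wrap_lt hk y), hA⟩, fun z hz => ?_⟩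
    obtain ⟨w, hw, rfl⟩ := Finset.mem_image.1 hz
    rw [wrap_add_wrap hk]
    exact hω w hw
  · rw [Finset.card_product, card_gridBlocks]
    push_cast
    exact mul_le_mul_of_nonneg_right hcard.2 (Nat.cast_nonneg _)
  · rintro ⟨y, A⟩ hyA
    have hA := (Finset.mem_product.1 hyA).2
    refine (hvac _ fun z hz => ?_).trans (le_of_eq ?_)
    · obtain ⟨w, _, rfl⟩ := Finset.mem_image.1 hz
      exact wrap_lt hk _
    · rw [Finset.card_image_of_injOn (wrap_injOn hkD _ (hP A hA).2), (hP A hA).1]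

/-- With high probability, no block is very full. -/
theorem tendsto_crowded_block (hd : 0 < d) (hχ : 0 < χ) (hlam : 0 < lam) :
    Tendsto (fun n : ℕ => law d lam n {ω | ∃ z : Fin d → ℕ,
      (lam * χ * (Real.exp 1 - 1) + 2) * Real.log n < ((vertsIn (cells n χ ω) z).card : ℝ)})
      atTop (𝓝 0) := by
  have hlim : Tendsto (fun n : ℕ => Real.exp (-(1 * Real.log n))) atTop (𝓝 0) :=
    tendsto_exp_neg_log one_pos
  refine tendsto_zero_of_eventually_le_ofReal ?_ hlim
  filter_upwards [eventually_card_blocks_le hd hχ, eventually_ge_atTop 2] with n hcard hn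
  have hlog := log_pos_of_two_le hn
  have hn0 : (0 : ℝ) < n := by positivity
  have he : 0 < Real.exp 1 - 1 := by linarith [Real.add_one_le_exp 1]
  -- With θ = 1 the expected count contributes at most λχ(e - 1) log n. The extra 2 log n gives
  -- n^(-2) per block and n^(-1) after the union over at most n blocks.
  have hmain := measure_le_of_cover (law d lam n) (gridBlocks d (blocksPerSide d n χ))
    (fun z => {ω | (lam * χ * (Real.exp 1 - 1) + 2) * Real.log n ≤ (blockCount n χ ω {z} : ℝ)})
    (S := {ω | ∃ z : Fin d → ℕ, (lam * χ * (Real.exp 1 - 1) + 2) * Real.log n <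
      ((vertsIn (cells n χ ω) z).card : ℝ)})
    (C := n) (ε := Real.exp (-(2 * Real.log n))) ?_ ?_ (Real.exp_nonneg _) ?_
  · refine hmain.trans (ENNReal.ofReal_le_ofReal (le_of_eq ?_))
    rw [← Real.exp_log hn0, ← Real.exp_add, Real.exp_log hn0]
    congr 1; ring
  · rintro ω ⟨z, hz⟩
    rw [← blockCount_singleton] at hz
    refine ⟨z, mem_gridBlocks.2 ?_, hz.le⟩
    rw [blockCount_singleton] at hz
    have h0 : 0 < (vertsIn (cells n χ ω) z).card := by
      have : 0 < (lam * χ * (Real.exp 1 - 1) + 2) * Real.log n := by positivity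
      exact_mod_cast this.trans hz
    obtain ⟨v, hv⟩ := Finset.card_pos.1 h0
    rw [mem_vertsIn] at hv
    rw [← hv]
    exact cellOf_lt hn hχ _
  · rw [card_gridBlocks]
    exact_mod_cast hcard.2
  · intro z hz
    refine (law_count_ge hn hlam (A := {z}) (fun z' hz' => by
      rw [Finset.mem_singleton] at hz'; subst hz'; exact mem_gridBlocks.1 hz)
      zero_le_one _).trans (ENNReal.ofReal_le_ofReal ?_)
    rw [← Real.exp_add, count_exponent hd hn hχ]
    refine Real.exp_le_exp.2 ?_
    have := mul_le_mul_of_nonneg_left (mul_le_mul_of_nonneg_right (cellSide_pow_le hd hn hχ) he.le)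
      hlam.le
    simp only [Finset.card_singleton, Nat.cast_one, one_mul]
    nlinarith

theorem law_card_le {n : ℕ} (hn : 2 ≤ n) (hχ : 0 < χ) (hlam : 0 < lam) {θ : ℝ} (hθ : θ ≤ 0)
    (c : ℝ) : law d lam n {ω | (ω.1 : ℝ) ≤ c} ≤
      ENNReal.ofReal (Real.exp (-θ * c + lam * n * (Real.exp θ - 1))) := by
  have h := law_count_le (d := d) hn hlam (A := gridBlocks d (blocksPerSide d n χ))
    (fun z hz => mem_gridBlocks.1 hz) hθ c
  simp only [blockCount_gridBlocks hn hχ] at h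
  refine h.trans (le_of_eq ?_)
  have hk : (0 : ℝ) < (blocksPerSide d n χ : ℝ) ^ d :=
    pow_pos (by exact_mod_cast blocksPerSide_pos hn hχ) d
  rw [card_gridBlocks, Nat.cast_pow, div_self hk.ne', one_mul, Real.exp_add]

theorem law_card_ge {n : ℕ} (hn : 2 ≤ n) (hχ : 0 < χ) (hlam : 0 < lam) {θ : ℝ} (hθ : 0 ≤ θ)
    (c : ℝ) : law d lam n {ω | c ≤ (ω.1 : ℝ)} ≤
      ENNReal.ofReal (Real.exp (-θ * c + lam * n * (Real.exp θ - 1))) := by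
  have h := law_count_ge (d := d) hn hlam (A := gridBlocks d (blocksPerSide d n χ))
    (fun z hz => mem_gridBlocks.1 hz) hθ c
  simp only [blockCount_gridBlocks hn hχ] at h
  refine h.trans (le_of_eq ?_)
  have hk : (0 : ℝ) < (blocksPerSide d n χ : ℝ) ^ d :=
    pow_pos (by exact_mod_cast blocksPerSide_pos hn hχ) d
  rw [card_gridBlocks, Nat.cast_pow, div_self hk.ne', one_mul, Real.exp_add]

theorem tendsto_exp_neg_mul_nat {c : ℝ} (hc : 0 < c) :
    Tendsto (fun n : ℕ => Real.exp (-(c * n))) atTop (𝓝 0) :=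
  Real.tendsto_exp_neg_atTop_nhds_zero.comp
    (tendsto_natCast_atTop_atTop.const_mul_atTop hc)

/-- With high probability, the number of vertices is of order `n`. -/
theorem tendsto_card_le (hlam : 0 < lam) :
    Tendsto (fun n : ℕ => law d lam n {ω | (ω.1 : ℝ) ≤ lam * n / 2}) atTop (𝓝 0) := by
  have he : Real.exp (-1) < 1 / 2 := by
    rw [Real.exp_neg, one_div]
    exact inv_strictAnti₀ two_pos (by linarith [Real.exp_one_gt_d9])
  refine tendsto_zero_of_eventually_le_ofReal ?_ (tendsto_exp_neg_mul_nat
    (c := lam * (1 / 2 - Real.exp (-1))) (mul_pos hlam (by linarith)))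
  filter_upwards [eventually_ge_atTop 2] with n hn
  refine (law_card_le hn one_pos hlam (by norm_num : (-1 : ℝ) ≤ 0) _).trans
    (ENNReal.ofReal_le_ofReal (Real.exp_le_exp.2 (le_of_eq ?_)))
  ring

theorem tendsto_card_ge (hlam : 0 < lam) :
    Tendsto (fun n : ℕ => law d lam n {ω | 3 * lam * n ≤ (ω.1 : ℝ)}) atTop (𝓝 0) := by
  refine tendsto_zero_of_eventually_le_ofReal ?_ (tendsto_exp_neg_mul_nat hlam)
  filter_upwards [eventually_ge_atTop 2] with n hn
  refine (law_card_ge hn one_pos hlam zero_le_one _).trans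
    (ENNReal.ofReal_le_ofReal (Real.exp_le_exp.2 ?_))
  have he := Real.exp_one_lt_d9
  have : 0 < lam * n := by positivity
  nlinarith

/-- With high probability, few vertices are outside the occupied blocks. -/
theorem tendsto_outside (hd : 0 < d) (hχ : 0 < χ) {c δ : ℝ} (hc : 0 < c) (hδ : 0 < δ)
    (hvac : ∀ᶠ n : ℕ in atTop, ∀ A : Finset (Fin d → ℕ),
      (∀ z ∈ A, ∀ j, z j < blocksPerSide d n χ) →
        law d lam n {ω | ∀ z ∈ A, ¬ Occupied n δ (cells n χ ω) z} ≤
          ENNReal.ofReal (Real.exp (-(A.card * c * Real.log n)))) {ε : ℝ} (hε : 0 < ε) :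
    Tendsto (fun n : ℕ => law d lam n {ω | ∃ F : Finset (Fin ω.1),
      (∀ v ∈ F, ¬ Occupied n δ (cells n χ ω) (cells n χ ω v)) ∧ ε * n ≤ F.card}) atTop (𝓝 0) := by
  classical
  have hlim : Tendsto (fun n : ℕ => 2 * δ / (χ * ε) * Real.exp (-(c * Real.log n))) atTop
      (𝓝 0) := by
    simpa using (tendsto_exp_neg_log hc).const_mul (2 * δ / (χ * ε))
  refine tendsto_zero_of_eventually_le_ofReal ?_ hlim
  filter_upwards [hvac, eventually_card_blocks_le hd hχ, eventually_ge_atTop 2] with n hvac hcard hn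
  have hlog := log_pos_of_two_le hn
  have hn0 : (0 : ℝ) < n := by positivity
  have hK : 0 < ε * n / (δ * Real.log n) := by positivity
  -- A vacant block holds at most δ log n vertices, so εn outside vertices require εn/(δ log n)
  -- vacant blocks. Their expected number is at most of order n^(1 - c)/log n, and Markov's
  -- inequality applies.
  refine (measure_card_ge_le (gridBlocks d (blocksPerSide d n χ))
    (fun z => {ω | ¬ Occupied n δ (cells n χ ω) z}) _
    (c := ENNReal.ofReal (ε * n / (δ * Real.log n))) (by simpa using hK) ENNReal.ofReal_ne_top
    ?_).trans ?_
  · rintro ω ⟨F, hF, hFc⟩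
    refine ⟨F.image (cells n χ ω), fun z hz => ?_, ?_, fun z hz => ?_⟩
    · obtain ⟨v, _, rfl⟩ := Finset.mem_image.1 hz
      exact mem_gridBlocks.2 (cellOf_lt hn hχ _)
    · rw [← ENNReal.ofReal_natCast]
      refine ENNReal.ofReal_le_ofReal ?_
      rw [div_le_iff₀ (by positivity)]
      refine hFc.trans ?_
      rw [Finset.card_eq_sum_card_image (cells n χ ω) F]
      push_cast
      refine (Finset.sum_le_sum (g := fun _ => δ * Real.log n) fun z hz => ?_).trans (by simp)
      obtain ⟨v, hv, rfl⟩ := Finset.mem_image.1 hz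
      refine le_trans ?_ (not_lt.1 (hF v hv))
      exact_mod_cast Finset.card_le_card fun w hw => mem_vertsIn.2 (Finset.mem_filter.1 hw).2
    · obtain ⟨v, hv, rfl⟩ := Finset.mem_image.1 hz
      exact hF v hv
  · have h1 : ∀ z ∈ gridBlocks d (blocksPerSide d n χ),
        law d lam n {ω | ¬ Occupied n δ (cells n χ ω) z} ≤
          ENNReal.ofReal (Real.exp (-(c * Real.log n))) := by
      intro z hz
      have := hvac {z} (fun z' hz' => by
        rw [Finset.mem_singleton] at hz'; subst hz'; exact mem_gridBlocks.1 hz)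
      simpa using this
    refine (ENNReal.div_le_div_right (Finset.sum_le_sum h1) _).trans ?_
    rw [Finset.sum_const, nsmul_eq_mul, card_gridBlocks, ← ENNReal.ofReal_natCast,
      ← ENNReal.ofReal_mul (Nat.cast_nonneg _), ← ENNReal.ofReal_div_of_pos hK]
    refine ENNReal.ofReal_le_ofReal ?_
    push_cast
    rw [div_le_iff₀ hK]
    have h2 : (blocksPerSide d n χ : ℝ) ^ d ≤ 2 * n / (χ * Real.log n) := by
      rw [le_div_iff₀ (by positivity)]
      linarith [hcard.1]
    refine (mul_le_mul_of_nonneg_right h2 (Real.exp_nonneg _)).trans (le_of_eq ?_)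
    field_simp

end GSBM

namespace GSBM

/-! ### Phase I makes few mistakes in typical graphs -/

section Deterministic

open scoped Classical

variable {N : ℕ} (G : SimpleGraph (Fin N)) (a b : ℝ)

/-- The vertices of `S'` whose number of neighbours with label `t` in `S` is atypical. -/
def atypical (ℓ : Fin N → SignType) (S : Finset (Fin N)) (t : SignType) (S' : Finset (Fin N)) :
    Finset (Fin N) :=
  S'.filter fun u => |a - b| / 4 * numLabel ℓ S t ≤
    |(degPlus G ℓ S t u : ℝ) - (if ℓ u = t then a else b) * numLabel ℓ S t|

variable {G a b}

theorem card_filter_le_add {σ τ : Fin N → SignType} (S : Finset (Fin N)) (s : SignType)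
    (R : Fin N → Prop) :
    (S.filter fun v => σ v = s ∧ R v).card ≤
      (S.filter fun v => τ v = s ∧ R v).card + (S.filter fun v => σ v ≠ τ v).card := by
  refine (Finset.card_le_card fun v hv => ?_).trans (Finset.card_union_le _ _)
  simp only [Finset.mem_union, Finset.mem_filter] at hv ⊢
  by_cases h : σ v = τ v
  · exact Or.inl ⟨hv.1, h ▸ hv.2.1, hv.2.2⟩
  · exact Or.inr ⟨hv.1, h⟩

theorem abs_degPlus_sub_le {σ τ : Fin N → SignType} (S : Finset (Fin N)) (s : SignType)
    (u : Fin N) {M : ℕ} (hM : (S.filter fun v => σ v ≠ τ v).card ≤ M) :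
    |(degPlus G σ S s u : ℝ) - degPlus G τ S s u| ≤ M := by
  have h1 := card_filter_le_add (σ := σ) (τ := τ) S s fun v => G.Adj u v
  have h2 := card_filter_le_add (σ := τ) (τ := σ) S s fun v => G.Adj u v
  have h3 : (S.filter fun v => τ v ≠ σ v) = S.filter fun v => σ v ≠ τ v :=
    Finset.filter_congr fun v _ => ne_comm
  rw [h3] at h2
  have h4 : degPlus G σ S s u ≤ degPlus G τ S s u + M := h1.trans (by rw [degPlus]; omega)
  have h5 : degPlus G τ S s u ≤ degPlus G σ S s u + M := h2.trans (by rw [degPlus]; omega)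
  rw [abs_le]
  constructor
  · have : (degPlus G τ S s u : ℝ) ≤ degPlus G σ S s u + M := by exact_mod_cast h5
    linarith
  · have : (degPlus G σ S s u : ℝ) ≤ degPlus G τ S s u + M := by exact_mod_cast h4
    linarith

theorem abs_numLabel_sub_le {σ τ : Fin N → SignType} (S : Finset (Fin N)) (s : SignType)
    {M : ℕ} (hM : (S.filter fun v => σ v ≠ τ v).card ≤ M) :
    |(numLabel σ S s : ℝ) - numLabel τ S s| ≤ M := by
  have h1 := card_filter_le_add (σ := σ) (τ := τ) S s fun _ => True
  have h2 := card_filter_le_add (σ := τ) (τ := σ) S s fun _ => True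
  have h3 : (S.filter fun v => τ v ≠ σ v) = S.filter fun v => σ v ≠ τ v :=
    Finset.filter_congr fun v _ => ne_comm
  rw [h3] at h2
  simp only [and_true] at h1 h2
  have h4 : numLabel σ S s ≤ numLabel τ S s + M := h1.trans (by rw [numLabel]; omega)
  have h5 : numLabel τ S s ≤ numLabel σ S s + M := h2.trans (by rw [numLabel]; omega)
  rw [abs_le]
  constructor
  · have : (numLabel τ S s : ℝ) ≤ numLabel σ S s + M := by exact_mod_cast h5
    linarith
  · have : (numLabel σ S s : ℝ) ≤ numLabel τ S s + M := by exact_mod_cast h4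
    linarith

/-- The threshold is midway between am and bm. With the true count m' the margin is |a - b|m'/2;
typicality uses up less than half of it. Replacing D' and m' by the observed values costs at most M
+ (a + b)M/2 ≤ 2M, which is at most the other half. -/
theorem threshold_correct {m m' D D' M : ℝ} (ha : a ∈ Set.Icc (0 : ℝ) 1)
    (hb : b ∈ Set.Icc (0 : ℝ) 1) (hm : |m - m'| ≤ M) (hD : |D - D'| ≤ M)
    (hM : 8 * M ≤ |a - b| * m') {p : ℝ} (hp : |D' - p * m'| < |a - b| / 4 * m') :
    (b < a → (p = a → (a + b) * m / 2 ≤ D) ∧ (p = b → D < (a + b) * m / 2)) ∧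
    (a < b → (p = a → D < (a + b) * m / 2) ∧ (p = b → (a + b) * m / 2 ≤ D)) := by
  obtain ⟨ha0, ha1⟩ := ha
  obtain ⟨hb0, hb1⟩ := hb
  rw [abs_le] at hm hD
  rw [abs_lt] at hp
  have hM0 : 0 ≤ M := by linarith
  have h1 : (a + b) * m ≤ (a + b) * m' + 2 * M := by nlinarith
  have h2 : (a + b) * m' ≤ (a + b) * m + 2 * M := by nlinarith
  constructor
  · intro h
    rw [abs_of_pos (sub_pos.2 h)] at hM hp
    constructor <;> rintro rfl <;> nlinarith
  · intro h
    rw [abs_of_neg (sub_neg.2 h)] at hM hp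
    constructor <;> rintro rfl <;> nlinarith

theorem propagate_eq_one_or {S S' : Finset (Fin N)} {σ : Fin N → SignType} {u : Fin N}
    (hu : u ∈ S') : propagate G a b S S' σ u = 1 ∨ propagate G a b S S' σ u = -1 := by
  simp only [propagate, hu, if_true]
  split_ifs <;> simp

theorem pairwiseClassify_eq_one_or {S : Finset (Fin N)} {u₀ u : Fin N} :
    pairwiseClassify G a b S u₀ u = 1 ∨ pairwiseClassify G a b S u₀ u = -1 := by
  simp only [pairwiseClassify]
  split_ifs <;> simp

theorem numLabel_mul {ℓ : Fin N → SignType} {g : SignType} (hg : g = 1 ∨ g = -1)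
    (S : Finset (Fin N)) (s : SignType) :
    numLabel (fun v => g * ℓ v) S s = numLabel ℓ S (g * s) := by
  unfold numLabel
  congr 1
  refine Finset.filter_congr fun v _ => ?_
  have : ∀ x : SignType, g * x = s ↔ x = g * s := by
    rcases hg with rfl | rfl <;> revert s <;> decide
  exact this (ℓ v)

theorem degPlus_mul {ℓ : Fin N → SignType} {g : SignType} (hg : g = 1 ∨ g = -1)
    (S : Finset (Fin N)) (s : SignType) (u : Fin N) :
    degPlus G (fun v => g * ℓ v) S s u = degPlus G ℓ S (g * s) u := by
  unfold degPlus
  congr 1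
  refine Finset.filter_congr fun v _ => ?_
  have : ∀ x : SignType, g * x = s ↔ x = g * s := by
    rcases hg with rfl | rfl <;> revert s <;> decide
  rw [this (ℓ v)]

theorem numLabel_add {σ : Fin N → SignType} {S : Finset (Fin N)}
    (hσ : ∀ v ∈ S, σ v = 1 ∨ σ v = -1) :
    (numLabel σ S 1 : ℝ) + numLabel σ S (-1) = S.card := by
  have : numLabel σ S 1 + numLabel σ S (-1) = S.card := by
    unfold numLabel
    rw [← Finset.card_filter_add_card_filter_not (s := S) (fun v => σ v = 1)]
    congr 1
    congr 1
    refine Finset.filter_congr fun v hv => ?_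
    rcases hσ v hv with h | h <;> rw [h] <;> decide
  exact_mod_cast this

/-- The more frequent label in `S`. -/
def majority (σ : Fin N → SignType) (S : Finset (Fin N)) : SignType :=
  if numLabel σ S (-1) ≤ numLabel σ S 1 then 1 else -1

theorem majority_eq_one_or (σ : Fin N → SignType) (S : Finset (Fin N)) :
    majority σ S = 1 ∨ majority σ S = -1 := by
  unfold majority
  split_ifs <;> simp

theorem half_card_le_majority {σ : Fin N → SignType} {S : Finset (Fin N)}
    (hσ : ∀ v ∈ S, σ v = 1 ∨ σ v = -1) : (S.card : ℝ) / 2 ≤ numLabel σ S (majority σ S) := by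
  have h := numLabel_add hσ
  unfold majority
  split_ifs with h'
  · have : (numLabel σ S (-1) : ℝ) ≤ numLabel σ S 1 := by exact_mod_cast h'
    linarith
  · have : (numLabel σ S 1 : ℝ) ≤ numLabel σ S (-1) := by exact_mod_cast (not_le.1 h').le
    linarith

/-- The majority label has at least half of the block, and at most a quarter of L is mislabeled. So
the threshold test is run against a true community of order log n. -/
theorem quarter_le_numLabel {S : Finset (Fin N)} {σ ℓ : Fin N → SignType} {g : SignType}
    {M : ℕ} {L : ℝ} (hg : g = 1 ∨ g = -1) (hσ : ∀ v ∈ S, σ v = 1 ∨ σ v = -1)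
    (hS : L < S.card) (hL : 4 * M ≤ L) (hM : (S.filter fun v => σ v ≠ g * ℓ v).card ≤ M) :
    L / 4 ≤ numLabel ℓ S (g * majority σ S) := by
  have hm := abs_numLabel_sub_le S (majority σ S) hM
  rw [numLabel_mul hg] at hm
  have h1 := (abs_le.1 hm).2
  have h2 := half_card_le_majority hσ
  linarith

/-- Typical vertices are labeled correctly if the parent block is almost correct. -/
theorem propagate_eq {S S' : Finset (Fin N)} {σ ℓ : Fin N → SignType} {g : SignType} {u : Fin N}
    {M : ℕ} (ha : a ∈ Set.Icc (0 : ℝ) 1) (hb : b ∈ Set.Icc (0 : ℝ) 1) (hab : a ≠ b)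
    (hℓ : ∀ v, ℓ v = 1 ∨ ℓ v = -1) (hg : g = 1 ∨ g = -1)
    (hL : 8 * M ≤ |a - b| * numLabel ℓ S (g * majority σ S))
    (hM : (S.filter fun v => σ v ≠ g * ℓ v).card ≤ M)
    (hu : u ∈ S') (htyp : u ∉ atypical G a b ℓ S (g * majority σ S) S') :
    propagate G a b S S' σ u = g * ℓ u := by
  have key : ∀ s, majority σ S = s →
      (b < a → (ℓ u = g * s → (a + b) * numLabel σ S s / 2 ≤ degPlus G σ S s u) ∧
        (ℓ u ≠ g * s → (degPlus G σ S s u : ℝ) < (a + b) * numLabel σ S s / 2)) ∧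
      (a < b → (ℓ u = g * s → (degPlus G σ S s u : ℝ) < (a + b) * numLabel σ S s / 2) ∧
        (ℓ u ≠ g * s → (a + b) * numLabel σ S s / 2 ≤ degPlus G σ S s u)) := by
    intro s hs
    subst hs
    have hm := abs_numLabel_sub_le S (majority σ S) hM
    have hD := abs_degPlus_sub_le (G := G) S (majority σ S) u hM
    rw [numLabel_mul hg] at hm
    rw [degPlus_mul hg] at hD
    rw [atypical, Finset.mem_filter, not_and, not_le] at htyp
    have := threshold_correct ha hb hm hD hL (htyp hu)
    by_cases hℓu : ℓ u = g * majority σ S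
    · rw [if_pos hℓu] at this
      exact ⟨fun h => ⟨fun _ => (this.1 h).1 rfl, fun h' => absurd hℓu h'⟩,
        fun h => ⟨fun _ => (this.2 h).1 rfl, fun h' => absurd hℓu h'⟩⟩
    · rw [if_neg hℓu] at this
      exact ⟨fun h => ⟨fun h' => absurd h' hℓu, fun _ => (this.1 h).2 rfl⟩,
        fun h => ⟨fun h' => absurd h' hℓu, fun _ => (this.2 h).2 rfl⟩⟩
  have hval : ∀ s, (s = 1 ∨ s = -1) → (ℓ u = g * s → g * ℓ u = s) ∧
      (ℓ u ≠ g * s → g * ℓ u = -s) := by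
    intro s hs
    have := hℓ u
    generalize ℓ u = x at this
    rcases hg with rfl | rfl <;> rcases hs with rfl | rfl <;> rcases this with rfl | rfl <;> decide
  simp only [propagate, hu, if_true]
  rcases lt_or_gt_of_ne hab with hlt | hlt
  · simp only [hlt, not_lt.2 hlt.le, true_and, false_and, if_false]
    by_cases hmaj : numLabel σ S (-1) ≤ numLabel σ S 1
    · have k := (key 1 (by simp [majority, hmaj])).2 hlt
      rw [if_pos hmaj]
      by_cases hx : ℓ u = g * 1
      · rw [if_pos (k.1 hx), (hval 1 (Or.inl rfl)).1 hx]
      · rw [if_neg (not_lt.2 (k.2 hx)), (hval 1 (Or.inl rfl)).2 hx]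
    · have k := (key (-1) (by simp [majority, hmaj])).2 hlt
      rw [if_neg hmaj]
      by_cases hx : ℓ u = g * -1
      · rw [if_pos (k.1 hx), (hval (-1) (Or.inr rfl)).1 hx]
      · rw [if_neg (not_lt.2 (k.2 hx)), (hval (-1) (Or.inr rfl)).2 hx]; rfl
  · simp only [hlt, not_lt.2 hlt.le, true_and, false_and, if_false]
    by_cases hmaj : numLabel σ S (-1) ≤ numLabel σ S 1
    · have k := (key 1 (by simp [majority, hmaj])).1 hlt
      rw [if_pos hmaj]
      by_cases hx : ℓ u = g * 1
      · rw [if_pos (k.1 hx), (hval 1 (Or.inl rfl)).1 hx]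
      · rw [if_neg (not_le.2 (k.2 hx)), (hval 1 (Or.inl rfl)).2 hx]
    · have k := (key (-1) (by simp [majority, hmaj])).1 hlt
      rw [if_neg hmaj]
      by_cases hx : ℓ u = g * -1
      · rw [if_pos (k.1 hx), (hval (-1) (Or.inr rfl)).1 hx]
      · rw [if_neg (not_le.2 (k.2 hx)), (hval (-1) (Or.inr rfl)).2 hx]; rfl

/-- The number of common neighbours in `S` of two vertices. -/
def commonNeighbors (G : SimpleGraph (Fin N)) (S : Finset (Fin N)) (u₀ u : Fin N) : ℕ :=
  ((S \ {u, u₀}).filter fun v => G.Adj u₀ v ∧ G.Adj u v).card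

/-- If common neighbours detect equal labels in the root block, and all pairs of visible blocks
have few atypical vertices, then Phase I makes few mistakes in every occupied block. -/
theorem card_mistakes_le {d n : ℕ} {χ δ : ℝ} {β : Fin N → Fin d → ℕ}
    (s : Schedule (visGraph n χ δ β)) {u₀ : Fin N} {ℓ : Fin N → SignType} {M : ℕ}
    (ha : a ∈ Set.Icc (0 : ℝ) 1) (hb : b ∈ Set.Icc (0 : ℝ) 1) (hab : a ≠ b)
    (hℓ : ∀ v, ℓ v = 1 ∨ ℓ v = -1)
    (hroot : ∀ u ∈ vertsIn β s.root.1, u ≠ u₀ → (ℓ u = ℓ u₀ ↔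
      (a + b) ^ 2 * (((vertsIn β s.root.1).card : ℝ) - 2) / 4 <
        commonNeighbors G (vertsIn β s.root.1) u₀ u))
    (hstep : ∀ i j : {i // Occupied n δ β i}, (visGraph n χ δ β).Adj i j → ∀ t, (t = 1 ∨ t = -1) →
      δ * Real.log n / 4 ≤ numLabel ℓ (vertsIn β i.1) t →
        (atypical G a b ℓ (vertsIn β i.1) t (vertsIn β j.1)).card ≤ M)
    (hlarge : 32 * M ≤ |a - b| * (δ * Real.log n)) (i : {i // Occupied n δ β i}) :
    (mistakes ℓ (phaseI G a b β s u₀) u₀ ∩ vertsIn β i.1).card ≤ M := by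
  have hσ := isPhaseILabeling_phaseI G a b s u₀
  set σ := phaseI G a b β s u₀
  have hpm : ∀ i : {i // Occupied n δ β i}, ∀ v ∈ vertsIn β i.1, σ v = 1 ∨ σ v = -1 := by
    intro i v hv
    by_cases hi : i = s.root
    · subst hi
      rw [hσ.root v hv]
      exact pairwiseClassify_eq_one_or
    · rw [hσ.step i hi v hv]
      exact propagate_eq_one_or hv
  refine s.induction (P := fun i => (mistakes ℓ σ u₀ ∩ vertsIn β i.1).card ≤ M) ?_ ?_ i
  · rw [Finset.card_eq_zero.2]
    · exact Nat.zero_le _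
    · refine Finset.eq_empty_of_forall_notMem fun v hv => ?_
      rw [Finset.mem_inter, mistakes, Finset.mem_filter] at hv
      refine hv.1.2 ?_
      rw [hσ.root v hv.2, pairwiseClassify]
      by_cases h : v = u₀
      · subst h
        rw [if_pos rfl]
        rcases hℓ v with h | h <;> rw [h] <;> rfl
      · rw [if_neg h]
        have := hroot v hv.2 h
        rw [commonNeighbors] at this
        split_ifs with hc
        · rw [this.2 hc]
          rcases hℓ u₀ with h | h <;> rw [h] <;> rfl
        · have hne : ℓ v ≠ ℓ u₀ := fun h' => hc (this.1 h')
          have h1 := hℓ u₀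
          have h2 := hℓ v
          generalize ℓ u₀ = x at *
          generalize ℓ v = y at *
          rcases h1 with rfl | rfl <;> rcases h2 with rfl | rfl <;>
            first | rfl | exact absurd rfl hne
  · intro j hj ih
    have hadj := s.tree_le (s.parent_adj j hj)
    have hSM : ((vertsIn β (s.parent j).1).filter fun v => σ v ≠ ℓ u₀ * ℓ v).card ≤ M := by
      refine (Finset.card_le_card fun v hv => ?_).trans ih
      rw [Finset.mem_filter] at hv
      rw [Finset.mem_inter, mistakes, Finset.mem_filter]
      exact ⟨⟨Finset.mem_univ _, hv.2⟩, hv.1⟩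
    have hL : δ * Real.log n < (vertsIn β (s.parent j).1).card := (s.parent j).2
    have hab0 : 0 < |a - b| := abs_pos.2 (sub_ne_zero.2 hab)
    have hab1 : |a - b| ≤ 1 := by
      rw [abs_le]; constructor <;> linarith [ha.1, ha.2, hb.1, hb.2]
    have hL0 : 0 ≤ δ * Real.log n := by
      by_contra h
      have h1 : |a - b| * (δ * Real.log n) < 0 := mul_neg_of_pos_of_neg hab0 (not_le.1 h)
      have h2 : (0 : ℝ) ≤ 32 * M := by positivity
      linarith
    -- From 32M ≤ |a - b|δ log n and |a - b| ≤ 1. The same hypothesis gives 8M ≤ |a - b|m' for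
    -- communities of size m' ≥ δ log n/4.
    have hM4 : 4 * (M : ℝ) ≤ δ * Real.log n := by nlinarith
    have hq := quarter_le_numLabel (hℓ u₀) (hpm (s.parent j)) hL hM4 hSM
    have ht : ℓ u₀ * majority σ (vertsIn β (s.parent j).1) = 1 ∨
        ℓ u₀ * majority σ (vertsIn β (s.parent j).1) = -1 := by
      rcases hℓ u₀ with h | h <;>
        rcases majority_eq_one_or σ (vertsIn β (s.parent j).1) with h' | h' <;> rw [h, h'] <;> decide
    -- Every mistake in the child is an atypical vertex for the parent, so the bound M is passed on
    -- without growth.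
    refine (Finset.card_le_card fun v hv => ?_).trans (hstep _ _ hadj _ ht hq)
    rw [Finset.mem_inter, mistakes, Finset.mem_filter] at hv
    by_contra hv'
    refine hv.1.2 ?_
    rw [hσ.step j hj v hv.2]
    refine propagate_eq ha hb hab hℓ (hℓ u₀) ?_ hSM hv.2 hv'
    nlinarith

end Deterministic

end GSBM

namespace GSBM

/-! ### Concentration of edge counts -/

section Edges

/-- Edge probabilities for given labels. -/
def edgeProb (a b : ℝ) (L : ℕ → SignType) : Sym2 ℕ → ℝ :=
  Sym2.lift ⟨fun i j => if L i = L j then a else b, fun i j => by simp only [eq_comm]⟩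

@[simp] theorem edgeProb_mk (a b : ℝ) (L : ℕ → SignType) (i j : ℕ) :
    edgeProb a b L s(i, j) = if L i = L j then a else b := rfl

/-- The graph without the distance constraint. -/
def edgeGraph (a b : ℝ) (L : ℕ → SignType) (X : Sym2 ℕ → unitInterval) (N : ℕ) :
    SimpleGraph (Fin N) where
  Adj i j := i ≠ j ∧ (X s((i : ℕ), (j : ℕ)) : ℝ) < edgeProb a b L s((i : ℕ), (j : ℕ))
  symm := ⟨fun i j h => ⟨h.1.symm, by rw [Sym2.eq_swap]; exact h.2⟩⟩
  loopless := ⟨fun _ h => h.1 rfl⟩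

/-- The distribution of the edge variables. -/
abbrev edgeLaw : Measure (Sym2 ℕ → unitInterval) :=
  Measure.infinitePi fun _ : Sym2 ℕ => (volume : Measure unitInterval)

theorem volume_lt {p : ℝ} (hp : p ∈ Set.Icc (0 : ℝ) 1) :
    (volume : Measure unitInterval).real {x | (x : ℝ) < p} = p := by
  have : {x : unitInterval | (x : ℝ) < p} = Set.Iio ⟨p, hp⟩ := rfl
  rw [this, measureReal_def, unitInterval.volume_Iio, ENNReal.toReal_ofReal hp.1]

theorem measurableSet_lt_const (p : ℝ) : MeasurableSet {x : unitInterval | (x : ℝ) < p} :=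
  measurableSet_lt measurable_subtype_coe measurable_const

variable {a b : ℝ} {L : ℕ → SignType}

theorem edgeProb_mem (ha : a ∈ Set.Icc (0 : ℝ) 1) (hb : b ∈ Set.Icc (0 : ℝ) 1) (e : Sym2 ℕ) :
    edgeProb a b L e ∈ Set.Icc (0 : ℝ) 1 := by
  induction e using Sym2.ind with
  | _ i j =>
    rw [edgeProb_mk]
    split_ifs
    · exact ha
    · exact hb

/-- All edges of `F` are present. -/
def edgeEvent (a b : ℝ) (L : ℕ → SignType) (F : Finset (Sym2 ℕ)) : Set (Sym2 ℕ → unitInterval) :=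
  {X | ∀ e ∈ F, X e ∈ {x : unitInterval | (x : ℝ) < edgeProb a b L e}}

theorem measurableSet_edgeEvent (F : Finset (Sym2 ℕ)) : MeasurableSet (edgeEvent a b L F) :=
  measurableSet_cylinder F fun _ => measurableSet_lt_const _

theorem edgeLaw_edgeEvent (ha : a ∈ Set.Icc (0 : ℝ) 1) (hb : b ∈ Set.Icc (0 : ℝ) 1)
    (F : Finset (Sym2 ℕ)) : edgeLaw.real (edgeEvent a b L F) = ∏ e ∈ F, edgeProb a b L e := by
  rw [edgeEvent, infinitePi_cylinder _ _ fun _ => measurableSet_lt_const _]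
  exact Finset.prod_congr rfl fun e _ => volume_lt (edgeProb_mem ha hb e)

theorem iIndepSet_edgeEvent {κ : Type*} {S : κ → Finset (Sym2 ℕ)}
    (hS : Pairwise fun w w' => Disjoint (S w) (S w')) :
    iIndepSet (fun w => edgeEvent a b L (S w)) edgeLaw :=
  iIndepSet_cylinders _ hS fun _ => measurableSet_lt_const _

variable {N : ℕ}

open scoped Classical in
/-- Many vertices are simultaneously atypical with small probability. -/
theorem edgeLaw_atypical_le (ha : a ∈ Set.Icc (0 : ℝ) 1) (hb : b ∈ Set.Icc (0 : ℝ) 1)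
    {S S' : Finset (Fin N)} (hdisj : Disjoint S S') (t : SignType) {T : Finset (Fin N)}
    (hT : T ⊆ S') :
    edgeLaw {X | T ⊆ atypical (edgeGraph a b L X N) a b (fun v => L v) S t S'} ≤
      ENNReal.ofReal (2 ^ T.card * Real.exp (-2 * (|a - b| / 4) ^ 2 * T.card *
        numLabel (fun v : Fin N => L v) S t)) := by
  set m := numLabel (fun v : Fin N => L v) S t with hm
  set St := S.filter fun v : Fin N => L v = t with hSt
  have hmSt : St.card = m := by rw [hm, numLabel, hSt]
  -- Empty sets outside S' × S make the family pairwise disjoint on all pairs, so independence holds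
  -- without restricting the index type. Disjointness of S and S' prevents a pair from appearing in
  -- both orders.
  set F : Fin N × Fin N → Finset (Sym2 ℕ) := fun p =>
    if p.1 ∈ S' ∧ p.2 ∈ S then {s((p.1 : ℕ), (p.2 : ℕ))} else ∅ with hF
  have hFd : Pairwise fun w w' => Disjoint (F w) (F w') := by
    rintro ⟨u, v⟩ ⟨u', v'⟩ hne
    simp only [hF]
    split_ifs with h h'
    · rw [Finset.disjoint_singleton]
      intro he
      rw [Sym2.eq_iff] at he
      rcases he with ⟨h1, h2⟩ | ⟨h1, h2⟩
      · exact hne (Prod.ext (Fin.ext h1) (Fin.ext h2))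
      · have : u = v' := Fin.ext h1
        subst this
        exact Finset.disjoint_left.1 hdisj h'.2 h.1
    all_goals simp
  have hmeas : ∀ w, MeasurableSet (edgeEvent a b L (F w)) := fun w => measurableSet_edgeEvent _
  have hind := iIndepSet_edgeEvent (a := a) (b := b) (L := L) hFd
  -- row sums
  have hrow : ∀ X, ∀ u ∈ S', (degPlus (edgeGraph a b L X N) (fun v => L v) S t u : ℝ) -
      (if L u = t then a else b) * m = ∑ v ∈ St,
        ((edgeEvent a b L (F (u, v))).indicator (fun _ => (1 : ℝ)) X -
          edgeLaw.real (edgeEvent a b L (F (u, v)))) := by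
    intro X u hu
    rw [Finset.sum_sub_distrib]
    congr 1
    · rw [degPlus, ← Finset.filter_filter, Finset.card_filter, Nat.cast_sum]
      refine Finset.sum_congr rfl fun v hv => ?_
      have hvS : v ∈ S := (Finset.mem_filter.1 hv).1
      have huv : u ≠ v := fun h => Finset.disjoint_left.1 hdisj hvS (h ▸ hu)
      simp [Set.indicator_apply, edgeEvent, hF, hu, hvS, edgeGraph, huv]
    · rw [← hmSt, mul_comm, ← nsmul_eq_mul, ← Finset.sum_const]
      refine Finset.sum_congr rfl fun v hv => ?_
      have hvS : v ∈ S := (Finset.mem_filter.1 hv).1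
      have hvt : L v = t := (Finset.mem_filter.1 hv).2
      rw [edgeLaw_edgeEvent ha hb]
      simp [hF, hu, hvS, hvt]
  have hγ : 0 ≤ |a - b| / 4 := by positivity
  -- Each row sum is large in absolute value with one of two signs. For each of the 2^|T| sign
  -- patterns the signed total over T × St is at least |T| times the threshold, and Hoeffding's
  -- inequality applies to |T|·m independent edges.
  refine (measure_le_of_cover edgeLaw (Finset.univ : Finset (T → Bool)) (fun s =>
    {X | T.card * (|a - b| / 4 * m) ≤ ∑ w ∈ T ×ˢ St,
      (if h : w.1 ∈ T then (if s ⟨w.1, h⟩ then 1 else -1) else 1) *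
        ((edgeEvent a b L (F w)).indicator (fun _ => (1 : ℝ)) X -
          edgeLaw.real (edgeEvent a b L (F w)))}) (C := 2 ^ T.card)
    (ε := Real.exp (-2 * (|a - b| / 4) ^ 2 * T.card * m)) ?_ ?_ (Real.exp_nonneg _) ?_).trans
      le_rfl
  · intro X hX
    refine ⟨fun u => decide (0 ≤ ∑ v ∈ St,
        ((edgeEvent a b L (F (u.1, v))).indicator (fun _ => (1 : ℝ)) X -
          edgeLaw.real (edgeEvent a b L (F (u.1, v))))), Finset.mem_univ _, ?_⟩
    rw [Set.mem_ofPred_eq, Finset.sum_product, ← nsmul_eq_mul, ← Finset.sum_const]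
    refine Finset.sum_le_sum fun u hu => ?_
    have h1 := (Finset.mem_filter.1 (hX hu)).2
    rw [hrow X u (hT hu)] at h1
    simp only [hu, dif_pos, decide_eq_true_eq]
    rw [← Finset.mul_sum]
    split_ifs with h
    · rwa [one_mul, ← abs_of_nonneg h]
    · rwa [neg_one_mul, ← abs_of_neg (not_le.1 h)]
  · simp
  · intro s _
    have h := hoeffding_indicator hmeas hind (T ×ˢ St)
      (ε := fun w => if h : w.1 ∈ T then (if s ⟨w.1, h⟩ then 1 else -1) else 1)
      (fun w => by split_ifs <;> simp) (t := T.card * (|a - b| / 4 * m)) (by positivity)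
    rw [← ofReal_measureReal]
    refine ENNReal.ofReal_le_ofReal (h.trans (Real.exp_le_exp.2 (le_of_eq ?_)))
    rw [Finset.card_product, hmSt]
    push_cast
    rcases eq_or_ne ((T.card : ℝ) * m) 0 with h0 | h0
    · rw [h0, div_zero]
      have : -2 * (|a - b| / 4) ^ 2 * T.card * m = -2 * (|a - b| / 4) ^ 2 * (T.card * m) := by ring
      rw [this, h0, mul_zero]
    · field_simp

/-- The labels in `S` are balanced up to the fraction `ζ`. -/
def Balanced (ℓ : Fin N → SignType) (S : Finset (Fin N)) (ζ : ℝ) : Prop :=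
  ∀ t, (t = 1 ∨ t = -1) → |(numLabel ℓ S t : ℝ) - S.card / 2| ≤ ζ * S.card

/-- For a balanced block the mean (a² + b²)w/2 exceeds (a + b)²w/4 by (a - b)²w/4. Imbalance costs
at most 2|a - b|(ζ(w + 2) + 2), and with ζ = |a - b|/32 this is at most half of the excess as soon
as |a - b|w ≥ 66. -/
theorem common_threshold {a b w x ζ : ℝ} (ha : a ∈ Set.Icc (0 : ℝ) 1)
    (hb : b ∈ Set.Icc (0 : ℝ) 1) (hζ : ζ = |a - b| / 32)
    (hx : |x - w / 2| ≤ ζ * (w + 2) + 2) (hw : 66 ≤ |a - b| * w) :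
    (a + b) ^ 2 * w / 4 + (a - b) ^ 2 * w / 8 ≤ a ^ 2 * x + b ^ 2 * (w - x) := by
  obtain ⟨ha0, ha1⟩ := ha
  obtain ⟨hb0, hb1⟩ := hb
  set D := |a - b| with hD
  have hD0 : 0 ≤ D := abs_nonneg _
  have hD1 : D ≤ 1 := by rw [hD, abs_le]; constructor <;> linarith
  have hsq : (a - b) ^ 2 = D ^ 2 := (sq_abs _).symm
  have hw0 : 0 ≤ w := by
    by_contra h
    have : D * w ≤ 0 := mul_nonpos_of_nonneg_of_nonpos hD0 (not_le.1 h).le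
    linarith
  have h1 : a ^ 2 * x + b ^ 2 * (w - x) - (a + b) ^ 2 * w / 4 =
      (a - b) ^ 2 * w / 4 + (a - b) * (a + b) * (x - w / 2) := by ring
  have h2 : |(a - b) * (a + b) * (x - w / 2)| ≤ D * 2 * (ζ * (w + 2) + 2) := by
    rw [abs_mul, abs_mul]
    refine mul_le_mul (mul_le_mul_of_nonneg_left ?_ hD0) hx (abs_nonneg _) (by positivity)
    rw [abs_le]; constructor <;> linarith
  have h3 := (abs_le.1 h2).1
  rw [hsq] at *
  rw [hζ] at h3
  nlinarith [mul_le_mul_of_nonneg_left hw hD0, mul_le_mul_of_nonneg_left hD1 hD0]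

open scoped Classical in
/-- Common neighbours detect equal labels with high probability. -/
theorem edgeLaw_common_le (ha : a ∈ Set.Icc (0 : ℝ) 1) (hb : b ∈ Set.Icc (0 : ℝ) 1)
    {S : Finset (Fin N)} (hbal : Balanced (fun v : Fin N => L v) S (|a - b| / 32))
    (hL : ∀ i, L i = 1 ∨ L i = -1)
    (hS : 66 ≤ |a - b| * (S.card - 2 : ℝ)) {u₀ u : Fin N} (hu₀ : u₀ ∈ S) (hu : u ∈ S)
    (hne : u ≠ u₀) :
    edgeLaw {X | ¬ (L u = L u₀ ↔ (a + b) ^ 2 * ((S.card : ℝ) - 2) / 4 <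
      commonNeighbors (edgeGraph a b L X N) S u₀ u)} ≤
      ENNReal.ofReal (2 * Real.exp (-((a - b) ^ 4 / 32 * (S.card - 2)))) := by
  set W := S \ {u, u₀} with hW
  have hWcard : (W.card : ℝ) = S.card - 2 := by
    have h1 : ({u, u₀} : Finset (Fin N)) ⊆ S := by
      intro v hv
      rcases Finset.mem_insert.1 hv with rfl | hv
      · exact hu
      · rw [Finset.mem_singleton.1 hv]; exact hu₀
    have h2 := Finset.card_sdiff_add_card_eq_card h1
    rw [Finset.card_pair hne] at h2
    rw [← h2]; push_cast; ring
  rw [← hWcard] at hS ⊢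
  have hmemW : ∀ v, v ∈ W → v ∈ S ∧ v ≠ u ∧ v ≠ u₀ := fun v hv => by
    simpa [hW, not_or] using hv
  -- A common neighbour v needs both edges to v. Different v use disjoint pairs of edges, so the
  -- events are independent.
  set F : Fin N → Finset (Sym2 ℕ) := fun v =>
    if v ∈ W then {s((u₀ : ℕ), (v : ℕ)), s((u : ℕ), (v : ℕ))} else ∅ with hF
  have hval : ∀ {i j : Fin N}, i ≠ j → (i : ℕ) ≠ j := fun h h' => h (Fin.ext h')
  have hFd : Pairwise fun v v' => Disjoint (F v) (F v') := by
    intro v v' hvv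
    simp only [hF]
    split_ifs with h h'
    · obtain ⟨-, h1, h2⟩ := hmemW v h
      obtain ⟨-, h3, h4⟩ := hmemW v' h'
      have e1 := hval h1
      have e2 := hval h2
      have e3 := hval h3
      have e4 := hval h4
      have e5 := hval hvv
      rw [Finset.disjoint_left]
      intro e he he'
      simp only [Finset.mem_insert, Finset.mem_singleton] at he he'
      rcases he with rfl | rfl <;> rcases he' with he' | he' <;> rw [Sym2.eq_iff] at he' <;> omega
    all_goals simp
  have hmeas : ∀ w, MeasurableSet (edgeEvent a b L (F w)) := fun w => measurableSet_edgeEvent _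
  have hind := iIndepSet_edgeEvent (a := a) (b := b) (L := L) hFd
  have hD : 0 < |a - b| := by
    by_contra h
    have h0 : |a - b| = 0 := le_antisymm (not_lt.1 h) (abs_nonneg _)
    rw [h0] at hS
    linarith
  have hw0 : 0 < (W.card : ℝ) := by
    by_contra h
    have : |a - b| * W.card ≤ 0 := mul_nonpos_of_nonneg_of_nonpos hD.le (not_lt.1 h)
    linarith
  have hcount : ∀ X, (commonNeighbors (edgeGraph a b L X N) S u₀ u : ℝ) =
      ∑ v ∈ W, (edgeEvent a b L (F v)).indicator (fun _ => (1 : ℝ)) X := by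
    intro X
    rw [commonNeighbors, Finset.card_filter, Nat.cast_sum]
    refine Finset.sum_congr rfl fun v hv => ?_
    obtain ⟨-, h1, h2⟩ := hmemW v hv
    simp [Set.indicator_apply, edgeEvent, hF, hv, edgeGraph, h1.symm, h2.symm]
  have hprob : ∀ v ∈ W, edgeLaw.real (edgeEvent a b L (F v)) =
      (if L u₀ = L v then a else b) * (if L u = L v then a else b) := by
    intro v hv
    obtain ⟨-, h1, h2⟩ := hmemW v hv
    have hne' : s((u₀ : ℕ), (v : ℕ)) ≠ s((u : ℕ), (v : ℕ)) := by
      rw [Ne, Sym2.eq_iff]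
      have := hval hne
      have := hval h2
      omega
    rw [edgeLaw_edgeEvent ha hb]
    simp only [hF, hv, if_true]
    rw [Finset.prod_pair hne', edgeProb_mk, edgeProb_mk]
  -- Equal labels give a mean above the threshold by (a - b)²w/8. Unequal labels give ab per vertex
  -- whatever the label of v, which is (a - b)²/4 below (a + b)²/4. A deviation smaller than (a -
  -- b)²w/8 therefore cannot lead to a wrong decision.
  have hmean : (L u = L u₀ → (a + b) ^ 2 * W.card / 4 + (a - b) ^ 2 * W.card / 8 ≤
        ∑ v ∈ W, edgeLaw.real (edgeEvent a b L (F v))) ∧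
      (L u ≠ L u₀ → ∑ v ∈ W, edgeLaw.real (edgeEvent a b L (F v)) =
        (a + b) ^ 2 * W.card / 4 - (a - b) ^ 2 * W.card / 4) := by
    constructor
    · intro h
      have h1 : ∑ v ∈ W, edgeLaw.real (edgeEvent a b L (F v)) =
          a ^ 2 * (W.filter fun v : Fin N => L v = L u₀).card +
            b ^ 2 * (W.card - (W.filter fun v : Fin N => L v = L u₀).card) := by
        have h2 : (W.card : ℝ) - (W.filter fun v : Fin N => L v = L u₀).card =
            (W.filter fun v : Fin N => ¬ L v = L u₀).card := by
          rw [← Finset.card_filter_add_card_filter_not (s := W) (fun v : Fin N => L v = L u₀)]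
          push_cast; ring
        rw [h2, ← Finset.sum_filter_add_sum_filter_not W fun v : Fin N => L v = L u₀]
        congr 1
        · rw [Finset.sum_congr rfl (g := fun _ => a ^ 2) fun v hv => ?_, Finset.sum_const,
            nsmul_eq_mul, mul_comm]
          rw [Finset.mem_filter] at hv
          rw [hprob v hv.1, h, if_pos hv.2.symm, sq]
        · rw [Finset.sum_congr rfl (g := fun _ => b ^ 2) fun v hv => ?_, Finset.sum_const,
            nsmul_eq_mul, mul_comm]
          rw [Finset.mem_filter] at hv
          rw [hprob v hv.1, h, if_neg (fun h' => hv.2 h'.symm), sq]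
      rw [h1]
      refine common_threshold ha hb rfl ?_ hS
      have h3 := abs_le.1 (hbal (L u₀) (hL u₀))
      have h4 : (W.filter fun v : Fin N => L v = L u₀).card ≤
          numLabel (fun v : Fin N => L v) S (L u₀) :=
        Finset.card_le_card (Finset.filter_subset_filter _ Finset.sdiff_subset)
      have h5 : numLabel (fun v : Fin N => L v) S (L u₀) ≤
          (W.filter fun v : Fin N => L v = L u₀).card + 2 := by
        rw [numLabel]
        refine (Finset.card_le_card (t := (W.filter fun v : Fin N => L v = L u₀) ∪ {u, u₀})
          fun v hv => ?_).trans ((Finset.card_union_le _ _).trans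
            (Nat.add_le_add_left (Finset.card_le_two) _))
        rw [Finset.mem_filter] at hv
        by_cases hv' : v ∈ ({u, u₀} : Finset (Fin N))
        · exact Finset.mem_union_right _ hv'
        · exact Finset.mem_union_left _ (Finset.mem_filter.2
            ⟨Finset.mem_sdiff.2 ⟨hv.1, hv'⟩, hv.2⟩)
      have h6 : ((W.filter fun v : Fin N => L v = L u₀).card : ℝ) ≤
          numLabel (fun v : Fin N => L v) S (L u₀) := by exact_mod_cast h4
      have h7 : (numLabel (fun v : Fin N => L v) S (L u₀) : ℝ) ≤
          (W.filter fun v : Fin N => L v = L u₀).card + 2 := by exact_mod_cast h5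
      have h8 : (S.card : ℝ) = W.card + 2 := by linarith
      rw [h8] at h3
      rw [abs_le]
      constructor <;> linarith [h3.1, h3.2]
    · intro h
      have h1 : ∀ v ∈ W, edgeLaw.real (edgeEvent a b L (F v)) = a * b := by
        intro v hv
        rw [hprob v hv]
        have e1 := hL u
        have e2 := hL u₀
        have e3 := hL v
        generalize L u = x at *
        generalize L u₀ = y at *
        generalize L v = z at *
        rcases e1 with rfl | rfl <;> rcases e2 with rfl | rfl <;> rcases e3 with rfl | rfl <;>
          first | exact absurd rfl h | (simp; done) | (simp; ring)
      rw [Finset.sum_congr rfl h1, Finset.sum_const, nsmul_eq_mul]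
      ring
  have h := hoeffding_indicator_abs hmeas hind W (t := (a - b) ^ 2 * W.card / 8) (by positivity)
  refine (measure_mono fun X hX => ?_).trans (h.trans (ENNReal.ofReal_le_ofReal (le_of_eq ?_)))
  · by_contra hcon
    rw [Set.mem_ofPred_eq, not_le, Finset.sum_sub_distrib, ← hcount, abs_lt] at hcon
    refine hX ?_
    by_cases hl : L u = L u₀
    · have := hmean.1 hl
      exact iff_of_true hl (by linarith)
    · have h1 := hmean.2 hl
      have : 0 ≤ (a - b) ^ 2 * W.card := by positivity
      exact iff_of_false hl (by rw [not_lt]; linarith)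
  · congr 2
    field_simp
    ring

end Edges

/-! ### Balance of labels -/

/-- The distribution of the label variables. -/
abbrev labelLaw : Measure (ℕ → Bool) :=
  Measure.infinitePi fun _ : ℕ => (PMF.uniformOfFintype Bool).toMeasure

/-- The label that is encoded by a bit. -/
def signOf (x : Bool) : SignType := if x then 1 else -1

open scoped Classical in
theorem labelLaw_balanced_le {N : ℕ} (S : Finset (Fin N)) {ζ : ℝ} (hζ : 0 ≤ ζ) :
    labelLaw {y | ¬ Balanced (fun v : Fin N => signOf (y v)) S ζ} ≤
      ENNReal.ofReal (2 * Real.exp (-(2 * ζ ^ 2 * S.card))) := by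
  have hm : ∀ _ : ℕ, MeasurableSet ({true} : Set Bool) := fun _ => measurableSet_singleton _
  have hmeas : ∀ v : Fin N, MeasurableSet
      {y : ℕ → Bool | ∀ e ∈ ({(v : ℕ)} : Finset ℕ), y e ∈ ({true} : Set Bool)} :=
    fun v => measurableSet_cylinder (X := fun _ => Bool) {(v : ℕ)} hm
  have hind : iIndepSet (fun v : Fin N =>
      {y : ℕ → Bool | ∀ e ∈ ({(v : ℕ)} : Finset ℕ), y e ∈ ({true} : Set Bool)}) labelLaw :=
    iIndepSet_cylinders (X := fun _ => Bool) _ (fun i j h => by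
      simpa using fun h' => h (Fin.ext h')) hm
  have hp : ∀ v : Fin N, labelLaw.real
      {y : ℕ → Bool | ∀ e ∈ ({(v : ℕ)} : Finset ℕ), y e ∈ ({true} : Set Bool)} = 1 / 2 := by
    intro v
    rw [infinitePi_cylinder (X := fun _ => Bool) _ _ hm, Finset.prod_singleton, measureReal_def,
      PMF.toMeasure_apply_singleton _ _ (measurableSet_singleton _)]
    simp
  have hsum : ∀ y : ℕ → Bool, ∑ v ∈ S, (({y : ℕ → Bool | ∀ e ∈ ({(v : ℕ)} : Finset ℕ),
      y e ∈ ({true} : Set Bool)}).indicator (fun _ => (1 : ℝ)) y - labelLaw.real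
        {y : ℕ → Bool | ∀ e ∈ ({(v : ℕ)} : Finset ℕ), y e ∈ ({true} : Set Bool)}) =
      (numLabel (fun v : Fin N => signOf (y v)) S 1 : ℝ) - S.card / 2 := by
    intro y
    rw [Finset.sum_sub_distrib, numLabel, Finset.card_filter, Nat.cast_sum]
    congr 1
    · refine Finset.sum_congr rfl fun v _ => ?_
      cases h : y v <;> simp [signOf, h]
    · rw [Finset.sum_congr rfl fun v _ => hp v, Finset.sum_const, nsmul_eq_mul]
      ring
  rcases Nat.eq_zero_or_pos S.card with h0 | h0
  · have : {y : ℕ → Bool | ¬ Balanced (fun v : Fin N => signOf (y v)) S ζ} = ∅ := by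
      refine Set.eq_empty_of_forall_notMem fun y hy => hy fun t _ => ?_
      rw [Finset.card_eq_zero.1 h0]
      simp [numLabel]
    rw [this, measure_empty]
    exact zero_le
  have hS0 : (0 : ℝ) < S.card := by exact_mod_cast h0
  have h := hoeffding_indicator_abs hmeas hind S (t := ζ * S.card) (by positivity)
  refine (measure_mono fun y hy => ?_).trans (h.trans (ENNReal.ofReal_le_ofReal (le_of_eq ?_)))
  · rw [Set.mem_ofPred_eq, hsum]
    by_contra hcon
    rw [not_le] at hcon
    refine hy fun t ht => ?_
    have h1 : (numLabel (fun v : Fin N => signOf (y v)) S 1 : ℝ) +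
        numLabel (fun v : Fin N => signOf (y v)) S (-1) = S.card :=
      numLabel_add fun v _ => by cases h : y v <;> simp [signOf]
    rcases ht with rfl | rfl
    · exact hcon.le
    · have h2 : (numLabel (fun v : Fin N => signOf (y v)) S (-1) : ℝ) - S.card / 2 =
          -((numLabel (fun v : Fin N => signOf (y v)) S 1 : ℝ) - S.card / 2) := by linarith
      rw [h2, abs_neg]
      exact hcon.le
  · congr 2
    field_simp

end GSBM

namespace GSBM

/-! ### Conditioning on locations and labels -/

theorem law_le_of_labels {d n : ℕ} {lam χ : ℝ} (hn : 2 ≤ n) {ε : ENNReal}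
    (P : (N : ℕ) → (Fin N → Fin d → ℕ) → (ℕ → Bool) → Prop)
    (h : ∀ N β, labelLaw {y | P N β y} ≤ ε) :
    law d lam n {ω | P ω.1 (cells n χ ω) ω.2.2.1} ≤ ε := by
  refine prod_le_of_fibers _ _ measurable_id _ fun N => ?_
  refine (measure_mono (t := {y | P N (fun v : Fin N => cellOf n χ (y.1 v)) y.2.1}) ?_).trans ?_
  · rintro y ⟨x, rfl, hx⟩
    exact hx
  refine prod_le_of_fibers _ _ (f := fun p => fun v : Fin N => cellOf n χ (p v)) ?_ _ fun β => ?_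
  · exact measurable_pi_lambda _ fun v => (measurable_cellOf hn).comp (measurable_pi_apply _)
  refine (measure_mono (t := {y | P N β y} ×ˢ Set.univ) ?_).trans ?_
  · rintro y ⟨x, rfl, hx⟩
    exact ⟨hx, trivial⟩
  · rw [Measure.prod_prod, measure_univ, mul_one]
    exact h N β

/-- Labels of the first `N` vertices, extended by `1`. -/
def extendLabels {N : ℕ} (c : Fin N → Bool) (i : ℕ) : SignType :=
  if h : i < N then signOf (c ⟨i, h⟩) else 1

@[simp] theorem extendLabels_val {N : ℕ} (c : Fin N → Bool) (v : Fin N) :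
    extendLabels c v = signOf (c v) := by
  simp [extendLabels]

theorem signOf_eq_one_or (x : Bool) : signOf x = 1 ∨ signOf x = -1 := by
  cases x <;> simp [signOf]

theorem extendLabels_eq_one_or {N : ℕ} (c : Fin N → Bool) (i : ℕ) :
    extendLabels c i = 1 ∨ extendLabels c i = -1 := by
  unfold extendLabels
  split_ifs
  · exact signOf_eq_one_or _
  · exact Or.inl rfl

/-- The labels of the vertices of a sample. -/
def labels {d : ℕ} (ω : Sample d) : ℕ → SignType := extendLabels fun v : Fin ω.1 => ω.2.2.1 v

theorem labels_val {d : ℕ} (ω : Sample d) (v : Fin ω.1) : labels ω v = label ω v := by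
  simp [labels, label, signOf]

/-- Conditioning in turn on the number of vertices, their blocks, and their labels. All three take
countably many values, and the edge variables are independent of them. -/
theorem law_le_of_edges {d n : ℕ} {lam χ : ℝ} (hn : 2 ≤ n) {ε : ENNReal}
    (P : (N : ℕ) → (Fin N → Fin d → ℕ) → (ℕ → SignType) → (Sym2 ℕ → unitInterval) → Prop)
    (h : ∀ N β L, (∀ i, L i = 1 ∨ L i = -1) → edgeLaw {X | P N β L X} ≤ ε) :
    law d lam n {ω | P ω.1 (cells n χ ω) (labels ω) ω.2.2.2} ≤ ε := by
  refine prod_le_of_fibers _ _ measurable_id _ fun N => ?_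
  refine (measure_mono (t := {y | P N (fun v : Fin N => cellOf n χ (y.1 v))
    (extendLabels fun v : Fin N => y.2.1 v) y.2.2}) ?_).trans ?_
  · rintro y ⟨x, rfl, hx⟩
    exact hx
  refine prod_le_of_fibers _ _ (f := fun p => fun v : Fin N => cellOf n χ (p v)) ?_ _ fun β => ?_
  · exact measurable_pi_lambda _ fun v => (measurable_cellOf hn).comp (measurable_pi_apply _)
  refine (measure_mono (t := {y | P N β (extendLabels fun v : Fin N => y.1 v) y.2}) ?_).trans ?_
  · rintro y ⟨x, rfl, hx⟩
    exact hx
  refine prod_le_of_fibers _ _ (f := fun y => fun v : Fin N => y v) ?_ _ fun c => ?_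
  · exact measurable_pi_lambda _ fun v => measurable_pi_apply _
  refine (measure_mono ?_).trans (h N β (extendLabels c) (extendLabels_eq_one_or c))
  rintro y ⟨x, rfl, hx⟩
  exact hx

/-! ### Rare events of labels and edges -/

variable {d : ℕ} {χ δ lam a b : ℝ}

/-- The root is a function of the block configuration and is therefore fixed before the labels are
drawn; no union over blocks is needed, and probability n^(-const) suffices. -/
theorem tendsto_unbalanced_root (R : ScheduleRule d χ δ) (hδ : 0 < δ) {ζ : ℝ} (hζ : 0 < ζ) :
    Tendsto (fun n : ℕ => law d lam n {ω | ∃ h : (visGraph n χ δ (cells n χ ω)).Connected,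
      ¬ Balanced (fun v => labels ω v) (vertsIn (cells n χ ω) (R n ω.1 (cells n χ ω) h).root.1) ζ})
      atTop (𝓝 0) := by
  refine tendsto_zero_of_eventually_le_ofReal
    (g := fun n : ℕ => 2 * Real.exp (-(2 * ζ ^ 2 * δ * Real.log n))) ?_ ?_
  · filter_upwards [eventually_ge_atTop 2] with n hn
    have key := law_le_of_labels (lam := lam) (χ := χ) hn
      (ε := ENNReal.ofReal (2 * Real.exp (-(2 * ζ ^ 2 * δ * Real.log n))))
      (fun N β y => ∃ h : (visGraph n χ δ β).Connected,
        ¬ Balanced (fun v => signOf (y v)) (vertsIn β (R n N β h).root.1) ζ) fun N β => ?_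
    · refine (measure_mono ?_).trans key
      rintro ω ⟨h, hω⟩
      refine ⟨h, ?_⟩
      simpa only [labels, extendLabels_val] using hω
    · by_cases h : (visGraph n χ δ β).Connected
      · have h1 : δ * Real.log n < ((vertsIn β (R n N β h).root.1).card : ℝ) :=
          (R n N β h).root.2
        generalize hS : vertsIn β (R n N β h).root.1 = S at h1
        have h2 := mul_le_mul_of_nonneg_left h1.le (by positivity : 0 ≤ 2 * ζ ^ 2)
        have h3 : 2 * Real.exp (-(2 * ζ ^ 2 * S.card)) ≤
            2 * Real.exp (-(2 * ζ ^ 2 * δ * Real.log n)) :=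
          mul_le_mul_of_nonneg_left (Real.exp_le_exp.2 (by linarith)) zero_le_two
        have h4 := (labelLaw_balanced_le S hζ.le).trans (ENNReal.ofReal_le_ofReal h3)
        refine (measure_mono ?_).trans h4
        rintro y ⟨_, hy⟩
        rw [hS] at hy
        exact hy
      · simp [h]
  · have := (tendsto_exp_neg_log (c := 2 * ζ ^ 2 * δ) (by positivity)).const_mul 2
    simpa using this

theorem tendsto_log_sq_mul_exp_neg_log {c : ℝ} (hc : 0 < c) :
    Tendsto (fun n : ℕ => Real.log n ^ 2 * Real.exp (-(c * Real.log n))) atTop (𝓝 0) := by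
  have h := ((Real.tendsto_pow_mul_exp_neg_atTop_nhds_zero 2).comp
    (tendsto_log_nat.const_mul_atTop hc)).const_mul (c ^ 2)⁻¹
  rw [mul_zero] at h
  refine h.congr fun n => ?_
  simp only [Function.comp]
  field_simp

theorem tendsto_misclassified_root (R : ScheduleRule d χ δ) (hδ : 0 < δ) (Δ : ℝ)
    (ha : a ∈ Set.Icc (0 : ℝ) 1) (hb : b ∈ Set.Icc (0 : ℝ) 1) (hab : a ≠ b) :
    Tendsto (fun n : ℕ => law d lam n {ω | ∃ h : (visGraph n χ δ (cells n χ ω)).Connected,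
      ∃ S, S = vertsIn (cells n χ ω) (R n ω.1 (cells n χ ω) h).root.1 ∧
      Balanced (fun v => labels ω v) S (|a - b| / 32) ∧ (S.card : ℝ) ≤ Δ * Real.log n ∧
      ∃ u₀ ∈ S, ∃ u ∈ S, u ≠ u₀ ∧ ¬ (labels ω u = labels ω u₀ ↔
        (a + b) ^ 2 * ((S.card : ℝ) - 2) / 4 <
          commonNeighbors (edgeGraph a b (labels ω) ω.2.2.2 ω.1) S u₀ u)}) atTop (𝓝 0) := by
  have hD : 0 < |a - b| := abs_pos.2 (sub_ne_zero.2 hab)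
  have hq : 0 < (a - b) ^ 4 / 32 := by
    have : (a - b) ^ 4 = |a - b| ^ 4 := by rw [← abs_pow, abs_of_nonneg (by positivity)]
    rw [this]; positivity
  set q := (a - b) ^ 4 / 32 with hqdef
  refine tendsto_zero_of_eventually_le_ofReal
    (g := fun n : ℕ => (Δ * Real.log n) ^ 2 * (2 * Real.exp (-(q * (δ * Real.log n - 2))))) ?_ ?_
  · have hbig : ∀ᶠ n : ℕ in atTop, 66 / |a - b| + 2 ≤ δ * Real.log n :=
      (tendsto_log_nat.const_mul_atTop hδ).eventually_ge_atTop _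
    filter_upwards [eventually_ge_atTop 2, hbig] with n hn hbig
    refine law_le_of_edges (lam := lam) (χ := χ) hn
      (fun N β L X => ∃ h : (visGraph n χ δ β).Connected,
      ∃ S, S = vertsIn β (R n N β h).root.1 ∧
      Balanced (fun v : Fin N => L v) S (|a - b| / 32) ∧ (S.card : ℝ) ≤ Δ * Real.log n ∧
      ∃ u₀ ∈ S, ∃ u ∈ S, u ≠ u₀ ∧ ¬ (L u = L u₀ ↔ (a + b) ^ 2 * ((S.card : ℝ) - 2) / 4 <
          commonNeighbors (edgeGraph a b L X N) S u₀ u)) fun N β L hL => ?_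
    by_cases hc : (visGraph n χ δ β).Connected
    swap
    · simp [hc]
    set S := vertsIn β (R n N β hc).root.1 with hS
    have hScard : δ * Real.log n < S.card := (R n N β hc).root.2
    by_cases hbal : Balanced (fun v : Fin N => L v) S (|a - b| / 32)
    swap
    · refine le_of_eq_of_le ?_ zero_le
      convert measure_empty (μ := edgeLaw)
      refine Set.eq_empty_of_forall_notMem ?_
      rintro X ⟨_, _, rfl, h, _⟩
      exact hbal h
    by_cases hcard : (S.card : ℝ) ≤ Δ * Real.log n
    swap
    · refine le_of_eq_of_le ?_ zero_le
      convert measure_empty (μ := edgeLaw)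
      refine Set.eq_empty_of_forall_notMem ?_
      rintro X ⟨_, _, rfl, _, h, _⟩
      exact hcard h
    -- A union over the at most (Δ log n)² ordered pairs of the root block, each failing with
    -- probability at most a negative power of n. This handles all choices of the reference vertex
    -- at once.
    refine measure_le_of_cover edgeLaw ((S ×ˢ S).filter fun p => p.2 ≠ p.1)
      (fun p => {X | ¬ (L p.2 = L p.1 ↔ (a + b) ^ 2 * ((S.card : ℝ) - 2) / 4 <
        commonNeighbors (edgeGraph a b L X N) S p.1 p.2)}) ?_ ?_ (by positivity) ?_
    · rintro X ⟨_, _, rfl, _, _, u₀, hu₀, u, hu, hne, h⟩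
      exact ⟨(u₀, u), by simp [hne]; exact ⟨hu₀, hu⟩, h⟩
    · have h1 : (((S ×ˢ S).filter fun p => p.2 ≠ p.1).card : ℝ) ≤ (S.card : ℝ) * S.card := by
        exact_mod_cast (Finset.card_filter_le _ _).trans_eq (Finset.card_product _ _)
      refine h1.trans ?_
      rw [pow_two]
      exact mul_self_le_mul_self (Nat.cast_nonneg _) hcard
    · rintro ⟨u₀, u⟩ hp
      simp only [Finset.mem_filter, Finset.mem_product] at hp
      have h66 : 66 ≤ |a - b| * ((S.card : ℝ) - 2) := by
        have h1 : 66 / |a - b| ≤ (S.card : ℝ) - 2 := by linarith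
        rwa [div_le_iff₀ hD, mul_comm] at h1
      refine (edgeLaw_common_le ha hb hbal hL h66 hp.1.1 hp.1.2 hp.2).trans
        (ENNReal.ofReal_le_ofReal ?_)
      gcongr
  · have h := (tendsto_log_sq_mul_exp_neg_log (c := q * δ) (by positivity)).const_mul
      (Δ ^ 2 * 2 * Real.exp (2 * q))
    rw [mul_zero] at h
    refine h.congr fun n => ?_
    rw [show -(q * (δ * Real.log n - 2)) = 2 * q + -(q * δ * Real.log n) by ring, Real.exp_add]
    ring

open scoped Classical in
-- M + 1 given vertices are all atypical with probability at most 2^(M + 1) n^(-3 - Δ). There are at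
-- most n^Δ such sets in a block and at most 18λ²n² choices of two blocks and a label, so the total
-- is O(1/n).
theorem tendsto_many_atypical (hδ : 0 < δ) {Δ : ℝ}
    (ha : a ∈ Set.Icc (0 : ℝ) 1) (hb : b ∈ Set.Icc (0 : ℝ) 1) {M : ℕ}
    (hM : 3 + Δ ≤ (|a - b| / 4) ^ 2 * δ / 2 * (M + 1)) :
    Tendsto (fun n : ℕ => law d lam n {ω | (ω.1 : ℝ) ≤ 3 * lam * n ∧
      (∀ z, ((vertsIn (cells n χ ω) z).card : ℝ) ≤ Δ * Real.log n) ∧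
      ∃ i j t, i ≠ j ∧ (t = 1 ∨ t = -1) ∧
        δ * Real.log n / 4 ≤ numLabel (fun v : Fin ω.1 => labels ω v) (vertsIn (cells n χ ω) i) t ∧
        M < (atypical (edgeGraph a b (labels ω) ω.2.2.2 ω.1) a b (fun v => labels ω v)
          (vertsIn (cells n χ ω) i) t (vertsIn (cells n χ ω) j)).card}) atTop (𝓝 0) := by
  refine tendsto_zero_of_eventually_le_ofReal
    (g := fun n : ℕ => 18 * lam ^ 2 * 2 ^ (M + 1) * Real.exp (-(1 * Real.log n))) ?_ ?_
  swap
  · have := (tendsto_exp_neg_log (c := 1) one_pos).const_mul (18 * lam ^ 2 * 2 ^ (M + 1))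
    rwa [mul_zero] at this
  filter_upwards [eventually_ge_atTop 2] with n hn
  have hlog : 0 < Real.log n := Real.log_pos (by exact_mod_cast hn)
  refine law_le_of_edges (lam := lam) (χ := χ) hn (fun N β L X => (N : ℝ) ≤ 3 * lam * n ∧
      (∀ z, ((vertsIn β z).card : ℝ) ≤ Δ * Real.log n) ∧
      ∃ i j t, i ≠ j ∧ (t = 1 ∨ t = -1) ∧
        δ * Real.log n / 4 ≤ numLabel (fun v : Fin N => L v) (vertsIn β i) t ∧
        M < (atypical (edgeGraph a b L X N) a b (fun v => L v)
          (vertsIn β i) t (vertsIn β j)).card) fun N β L hL => ?_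
  by_cases hN : (N : ℝ) ≤ 3 * lam * n
  swap
  · simp [hN]
  by_cases hβ : ∀ z, ((vertsIn β z).card : ℝ) ≤ Δ * Real.log n
  swap
  · simp [hβ]
  set ε := 2 ^ (M + 1) * Real.exp (-((3 + Δ) * Real.log n)) with hε
  have hpair : ∀ i j t, i ≠ j →
      δ * Real.log n / 4 ≤ numLabel (fun v : Fin N => L v) (vertsIn β i) t →
      edgeLaw {X | M < (atypical (edgeGraph a b L X N) a b (fun v => L v)
          (vertsIn β i) t (vertsIn β j)).card} ≤
        ENNReal.ofReal (Real.exp (Δ * Real.log n) * ε) := by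
    intro i j t hij hnum
    refine measure_le_of_cover edgeLaw ((vertsIn β j).powersetCard (M + 1))
      (fun T => {X | T ⊆ atypical (edgeGraph a b L X N) a b (fun v => L v)
        (vertsIn β i) t (vertsIn β j)}) ?_ ?_ (by positivity) ?_
    · intro X hX
      obtain ⟨T, hT, hTc⟩ := Finset.exists_subset_card_eq (Nat.succ_le_of_lt hX)
      exact ⟨T, Finset.mem_powersetCard.2 ⟨hT.trans (Finset.filter_subset _ _), hTc⟩, hT⟩
    · have h1 : (((vertsIn β j).powersetCard (M + 1)).card : ℝ) ≤ 2 ^ (vertsIn β j).card := by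
        rw [Finset.card_powersetCard]
        exact_mod_cast Nat.choose_le_two_pow _ _
      have h2 : (2 : ℝ) ≤ Real.exp 1 := by linarith [Real.add_one_le_exp 1]
      calc _ ≤ (2 : ℝ) ^ (vertsIn β j).card := h1
        _ ≤ Real.exp 1 ^ (vertsIn β j).card := by gcongr
        _ = Real.exp (vertsIn β j).card := by rw [← Real.exp_nat_mul, mul_one]
        _ ≤ _ := Real.exp_le_exp.2 (hβ j)
    · intro T hT
      rw [Finset.mem_powersetCard] at hT
      have hdisj : Disjoint (vertsIn β i) (vertsIn β j) := by
        rw [Finset.disjoint_left]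
        intro v hv hv'
        simp only [vertsIn, Finset.mem_filter, Finset.mem_univ, true_and] at hv hv'
        exact hij (hv.symm.trans hv')
      refine (edgeLaw_atypical_le ha hb hdisj t hT.1).trans (ENNReal.ofReal_le_ofReal ?_)
      rw [hT.2, hε]
      gcongr
      have h1 : (3 + Δ) * Real.log n ≤ (|a - b| / 4) ^ 2 * δ / 2 * (M + 1) * Real.log n := by
        gcongr
      have h2 := mul_le_mul_of_nonneg_left hnum
        (by positivity : 0 ≤ 2 * (|a - b| / 4) ^ 2 * ((M : ℝ) + 1))
      push_cast
      nlinarith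
  have hcover := measure_le_of_cover edgeLaw
    (S := {X | (N : ℝ) ≤ 3 * lam * n ∧ (∀ z, ((vertsIn β z).card : ℝ) ≤ Δ * Real.log n) ∧
      ∃ i j t, i ≠ j ∧ (t = 1 ∨ t = -1) ∧
        δ * Real.log n / 4 ≤ numLabel (fun v : Fin N => L v) (vertsIn β i) t ∧
        M < (atypical (edgeGraph a b L X N) a b (fun v => L v)
          (vertsIn β i) t (vertsIn β j)).card})
    -- Pairs of nonempty blocks are named by pairs of vertices, which makes the union finite and at
    -- most quadratic in the number of vertices.
    ((Finset.univ : Finset ((Fin N × Fin N) × Bool)).filter fun p => β p.1.1 ≠ β p.1.2 ∧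
      δ * Real.log n / 4 ≤ numLabel (fun v : Fin N => L v) (vertsIn β (β p.1.1)) (signOf p.2))
    (fun p => {X | M < (atypical (edgeGraph a b L X N) a b (fun v => L v)
          (vertsIn β (β p.1.1)) (signOf p.2) (vertsIn β (β p.1.2))).card})
    (C := 18 * lam ^ 2 * n ^ 2) (ε := Real.exp (Δ * Real.log n) * ε) ?_ ?_ (by positivity) ?_
  · refine hcover.trans (ENNReal.ofReal_le_ofReal (le_of_eq ?_))
    have hexp : (n : ℝ) = Real.exp (Real.log n) := (Real.exp_log (by positivity)).symm
    rw [hε, show -(1 * Real.log n) = Real.log n + Real.log n + Δ * Real.log n +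
      -((3 + Δ) * Real.log n) by ring, Real.exp_add, Real.exp_add, Real.exp_add, ← hexp]
    ring
  · rintro X ⟨-, -, i, j, t, hij, ht, hnum, hM⟩
    have h1 : 0 < numLabel (fun v : Fin N => L v) (vertsIn β i) t := by
      have : (0 : ℝ) < numLabel (fun v : Fin N => L v) (vertsIn β i) t :=
        lt_of_lt_of_le (by positivity) hnum
      exact_mod_cast this
    obtain ⟨x, hx⟩ := Finset.card_pos.1 h1
    obtain ⟨y, hy⟩ := Finset.card_pos.1 (lt_of_le_of_lt (Nat.zero_le _) hM)
    have hx' := (Finset.mem_filter.1 (Finset.mem_filter.1 hx).1).2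
    have hy' := (Finset.mem_filter.1 (Finset.mem_filter.1 hy).1).2
    obtain ⟨c, hc⟩ : ∃ c, signOf c = t := by
      rcases ht with rfl | rfl
      · exact ⟨true, rfl⟩
      · exact ⟨false, rfl⟩
    subst hx' hy' hc
    exact ⟨((x, y), c), by simpa using ⟨hij, hnum⟩, hM⟩
  · have h1 : ((Finset.univ : Finset ((Fin N × Fin N) × Bool)).card : ℝ) = 2 * (N : ℝ) ^ 2 := by
      simp
      ring
    refine le_trans (by exact_mod_cast Finset.card_filter_le _ _) (h1.le.trans ?_)
    calc 2 * (N : ℝ) ^ 2 ≤ 2 * (3 * lam * n) ^ 2 := by gcongr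
      _ = _ := by ring
  · rintro ⟨⟨x, y⟩, c⟩ hp
    simp only [Finset.mem_filter, Finset.mem_univ, true_and] at hp
    exact hpair _ _ _ hp.1 hp.2

end GSBM

namespace GSBM

/-! ### Phase I on typical samples -/

variable {d : ℕ} {χ δ lam a b : ℝ}

/-- Between visible blocks the distance constraint holds automatically, so the estimates for the
graph of independent edges apply. -/
theorem observed_adj_iff {n : ℕ} {ω : Sample d} {u v : Fin ω.1}
    (h : Visible d n χ (cells n χ ω u) (cells n χ ω v)) :
    (observed a b n ω).graph.Adj u v ↔ (edgeGraph a b (labels ω) ω.2.2.2 ω.1).Adj u v := by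
  have hd : torusDist d n (location n ω u) (location n ω v) ≤ radius d n :=
    h _ ⟨location_mem_region ω u, rfl⟩ _ ⟨location_mem_region ω v, rfl⟩
  simp only [observed, edgeGraph, edgeProb_mk, labels_val, hd, true_and]

/-- Zero is an offset because √d χ^(1/d) < 1. The root block is thus a subgraph without distance
constraint. -/
theorem visible_self {n : ℕ} (hn : 2 ≤ n) (h : BlockConstant d lam χ) {i : Fin d → ℕ}
    (hi : ∀ j, i j < blocksPerSide d n χ) : Visible d n χ i i := by
  have hχ := h.pos
  have hr : 0 < χ ^ (1 / (d : ℝ)) := Real.rpow_pos_of_pos hχ _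
  rw [← wrap_natCast hi]
  refine visible_wrap hn hχ ?_
  rw [sub_self, mem_offsets (inv_nonneg.2 hr.le)]
  have h1 : Real.sqrt d ≤ (χ ^ (1 / (d : ℝ)))⁻¹ := by
    rw [← one_div, le_div_iff₀ hr]
    nlinarith [h.1, mul_nonneg (Real.sqrt_nonneg d) hr.le]
  calc ∑ j : Fin d, (|(((0 : Fin d → ℤ) j : ℤ) : ℝ)| + 1) ^ 2 = Real.sqrt d ^ 2 := by
        simp [Real.sq_sqrt]
    _ ≤ _ := by gcongr

open scoped Classical in
theorem commonNeighbors_congr {N : ℕ} {G G' : SimpleGraph (Fin N)} {S : Finset (Fin N)}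
    (h : ∀ u ∈ S, ∀ v ∈ S, (G.Adj u v ↔ G'.Adj u v)) {u₀ u : Fin N} (hu₀ : u₀ ∈ S) (hu : u ∈ S) :
    commonNeighbors G S u₀ u = commonNeighbors G' S u₀ u := by
  unfold commonNeighbors
  congr 1
  refine Finset.filter_congr fun v hv => ?_
  have hv' := (Finset.mem_sdiff.1 hv).1
  rw [h _ hu₀ _ hv', h _ hu _ hv']

open scoped Classical in
theorem atypical_congr {N : ℕ} {G G' : SimpleGraph (Fin N)} {S S' : Finset (Fin N)}
    (h : ∀ u ∈ S', ∀ v ∈ S, (G.Adj u v ↔ G'.Adj u v)) (ℓ : Fin N → SignType) (t : SignType) :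
    atypical G a b ℓ S t S' = atypical G' a b ℓ S t S' := by
  unfold atypical
  refine Finset.filter_congr fun u hu => ?_
  have : degPlus G ℓ S t u = degPlus G' ℓ S t u := by
    unfold degPlus
    congr 1
    refine Finset.filter_congr fun v hv => ?_
    rw [h _ hu _ hv]
  rw [this]

theorem tendsto_union {Ω : ℕ → Type*} [∀ n, MeasurableSpace (Ω n)] {μ : ∀ n, Measure (Ω n)}
    {A B : ∀ n, Set (Ω n)} (hA : Tendsto (fun n => μ n (A n)) atTop (𝓝 0))
    (hB : Tendsto (fun n => μ n (B n)) atTop (𝓝 0)) :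
    Tendsto (fun n => μ n (A n ∪ B n)) atTop (𝓝 0) := by
  have h := hA.add hB
  rw [add_zero] at h
  exact tendsto_of_tendsto_of_tendsto_of_le_of_le tendsto_const_nhds h (fun _ => zero_le)
    fun n => measure_union_le _ _

/-- With high probability the visibility graph is connected and Phase I makes boundedly many
mistakes in every occupied block. -/
theorem exists_forall_card_mistakes_le
    (hlam : (d = 1 ∧ 1 < lam) ∨ (2 ≤ d ∧ 1 < lam * unitBallVol d))
    (hχ : BlockConstant d lam χ) :
    ∃ δ₀ : ℝ, 0 < δ₀ ∧ ∀ δ : ℝ, 0 < δ → δ < δ₀ → (∃ c : ℝ, 0 < c ∧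
      ∀ᶠ n : ℕ in atTop, ∀ A : Finset (Fin d → ℕ), (∀ z ∈ A, ∀ j, z j < blocksPerSide d n χ) →
        law d lam n {ω | ∀ z ∈ A, ¬ Occupied n δ (cells n χ ω) z} ≤
          ENNReal.ofReal (Real.exp (-(A.card * c * Real.log n)))) ∧
      ∀ a ∈ Set.Icc (0 : ℝ) 1, ∀ b ∈ Set.Icc (0 : ℝ) 1, a ≠ b → ∃ M : ℕ, ∀ R : ScheduleRule d χ δ,
        PhaseIWhp R lam a b fun n g σ₀ u₀ σ => ∀ i : Fin d → ℕ,
          Occupied n δ (assignment n χ g) i →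
            (mistakes σ₀ σ u₀ ∩ vertsIn (assignment n χ g) i).card ≤ M := by
  have hd : 0 < d := by rcases hlam with h | h <;> omega
  have hlam0 : 0 < lam := by
    rcases hlam with h | h
    · linarith [h.2]
    · by_contra hneg
      nlinarith [h.2, unitBallVol_pos d]
  have hχ0 := hχ.pos
  obtain ⟨m, D, P, hm, hP, hconn⟩ := exists_patterns hlam hχ
  obtain ⟨δ₀, hδ₀, c, hc, hmc, hvac⟩ := exists_vacancy_bound hd hχ0 hlam0 hm
  refine ⟨δ₀, hδ₀, fun δ hδ hδδ₀ => ⟨⟨c, hc, hvac δ hδδ₀⟩, fun a ha b hb hab => ?_⟩⟩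
  have hD : 0 < |a - b| := abs_pos.2 (sub_ne_zero.2 hab)
  set Δ := lam * χ * (Real.exp 1 - 1) + 2 with hΔ
  -- M is fixed before the rule R; the estimate for atypical vertices covers all pairs of blocks and
  -- so does not depend on the tree.
  obtain ⟨M, hM⟩ := exists_nat_ge ((3 + Δ) / ((|a - b| / 4) ^ 2 * δ / 2))
  refine ⟨M, fun R => ?_⟩
  have hM' : 3 + Δ ≤ (|a - b| / 4) ^ 2 * δ / 2 * (M + 1) := by
    rw [div_le_iff₀ (by positivity)] at hM
    nlinarith [show 0 < (|a - b| / 4) ^ 2 * δ / 2 by positivity]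
  have t1 := tendsto_vacant_pattern hd hχ0 hmc (hvac δ hδδ₀) hP
  have t2 := tendsto_crowded_block hd hχ0 hlam0
  have t3 := tendsto_card_ge (d := d) hlam0
  have t4 := tendsto_unbalanced_root (lam := lam) R hδ (ζ := |a - b| / 32) (by positivity)
  have t5 := tendsto_misclassified_root (lam := lam) R hδ Δ ha hb hab
  have t6 := tendsto_many_atypical (lam := lam) (χ := χ) (d := d) hδ ha hb hM'
  -- The bad events: a vacant pattern, a crowded block, too many vertices, unbalanced root labels, a
  -- misclassified pair in the root, and a pair of blocks with many atypical vertices. Outside them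
  -- the argument is deterministic.
  refine tendsto_measure_one_of_bad _ _ (fun n => ((((_ ∪ _) ∪ _) ∪ _) ∪ _) ∪ _) ?_
    (tendsto_union (tendsto_union (tendsto_union (tendsto_union (tendsto_union t1 t2) t3) t4) t5)
      t6)
  have hbig : ∀ᶠ n : ℕ in atTop, 32 * M ≤ |a - b| * (δ * Real.log n) :=
    ((tendsto_log_nat.const_mul_atTop hδ).const_mul_atTop hD).eventually_ge_atTop _
  filter_upwards [eventually_ge_atTop 2, hbig] with n hn hbig ω hω
  simp only [Set.compl_union, Set.mem_inter_iff, Set.mem_compl_iff, Set.mem_ofPred_eq] at hω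
  obtain ⟨⟨⟨⟨⟨b1, b2⟩, b3⟩, b4⟩, b5⟩, b6⟩ := hω
  have hcell : ∀ v j, cells n χ ω v j < blocksPerSide d n χ := fun v j => cellOf_lt hn hχ0 _ j
  have hC : (visGraph n χ δ (cells n χ ω)).Connected := by
    obtain ⟨h1, h2⟩ := hconn (fun z => Occupied n δ (cells n χ ω)
      (wrap (blocksPerSide d n χ) z)) fun y A hA => by
        by_contra hcon
        push Not at hcon
        exact b1 ⟨y, A, hA, hcon⟩
    exact visGraph_connected hn hχ0 hδ hcell h1 h2
  refine ⟨hC, fun (u₀ : Fin ω.1)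
    (hu₀ : u₀ ∈ vertsIn (cells n χ ω) (R n ω.1 (cells n χ ω) hC).root.1) i
    (hi : Occupied n δ (cells n χ ω) i) => ?_⟩
  have htruth : truth a b n ω = fun v : Fin ω.1 => labels ω v :=
    funext fun v => (labels_val ω v).symm
  rw [htruth]
  have hsize : ∀ z, ((vertsIn (cells n χ ω) z).card : ℝ) ≤ Δ * Real.log n := by
    intro z
    by_contra hcon
    exact b2 ⟨z, not_le.1 hcon⟩
  have hbal := by_contra fun h => b4 ⟨hC, h⟩
  obtain ⟨G, hG⟩ : ∃ G : SimpleGraph (Fin ω.1), G = (observed a b n ω).graph := ⟨_, rfl⟩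
  have hadj : ∀ i j, Visible d n χ i j → ∀ u ∈ vertsIn (cells n χ ω) i,
      ∀ v ∈ vertsIn (cells n χ ω) j,
        (G.Adj u v ↔ (edgeGraph a b (labels ω) ω.2.2.2 ω.1).Adj u v) := by
    intro i j hij u hu v hv
    rw [hG]
    refine observed_adj_iff (χ := χ) ?_
    rwa [(Finset.mem_filter.1 hu).2, (Finset.mem_filter.1 hv).2]
  have key := card_mistakes_le (G := G) (ℓ := fun v : Fin ω.1 => labels ω v) (u₀ := u₀) (M := M)
    (R n ω.1 (cells n χ ω) hC) ha hb hab
    (fun v => extendLabels_eq_one_or _ _) ?_ ?_ hbig ⟨i, hi⟩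
  · rw [hG] at key
    exact key
  · intro u hu hne
    by_contra hcon
    refine b5 ⟨hC, _, rfl, hbal, hsize _, u₀, hu₀, u, hu, hne, ?_⟩
    rwa [← commonNeighbors_congr (hadj _ _ (visible_self hn hχ
      (Occupied.lt_blocksPerSide hδ hcell (Subtype.prop _)))) hu₀ hu]
  · intro i j hij t ht hnum
    by_contra hcon
    refine b6 ⟨(not_le.1 b3).le, hsize, i.1, j.1, t, fun h => hij.1 (Subtype.ext h), ht, hnum, ?_⟩
    rw [← atypical_congr (hadj _ _ hij.symm.2)]
    exact not_le.1 hcon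

/-! ### Consequences -/

theorem PhaseIWhp.mono_of_rare {R : ScheduleRule d χ δ}
    {Q Q' : (n : ℕ) → (g : SpatialGraph d) → (Fin g.card → SignType) → Fin g.card →
      (Fin g.card → SignType) → Prop} (h : PhaseIWhp R lam a b Q) {E : (n : ℕ) → Set (Sample d)}
    (hE : Tendsto (fun n => law d lam n (E n)) atTop (𝓝 0))
    (himp : ∀ᶠ n in atTop, ∀ ω ∉ E n, ∀ u₀ σ, Q n (observed a b n ω) (truth a b n ω) u₀ σ →
      Q' n (observed a b n ω) (truth a b n ω) u₀ σ) : PhaseIWhp R lam a b Q' := by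
  have h1 := ENNReal.Tendsto.sub h hE (Or.inl ENNReal.one_ne_top)
  rw [tsub_zero] at h1
  refine tendsto_of_tendsto_of_tendsto_of_le_of_le' h1 tendsto_const_nhds ?_
    (Eventually.of_forall fun n => prob_le_one)
  filter_upwards [himp] with n hn
  rw [tsub_le_iff_right]
  refine (measure_mono ?_).trans (measure_union_le _ _)
  rintro ω ⟨hC, hQ⟩
  by_cases hω : ω ∈ E n
  · exact Or.inr hω
  · exact Or.inl ⟨hC, fun u₀ hu₀ => hn ω hω u₀ _ (hQ u₀ hu₀)⟩

/-- If every block of a set of vertices contains at most `x` of them, then there are at most `x`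
times as many vertices as blocks. -/
theorem card_le_mul_card_image_of_fibers {α β : Type*} [DecidableEq β] {f : α → β} {s : Finset α}
    {x : ℝ} (h : ∀ i, ((s.filter fun v => f v = i).card : ℝ) ≤ x) :
    (s.card : ℝ) ≤ x * (s.image f).card := by
  rw [Finset.card_eq_sum_card_image f s]
  push_cast
  rw [mul_comm, ← nsmul_eq_mul]
  exact Finset.sum_le_card_nsmul _ _ _ fun i _ => h i

open scoped Classical in
theorem card_in_occupied_le {n N k M : ℕ} {β : Fin N → Fin d → ℕ} (hβ : ∀ v j, β v j < k)
    {F : Finset (Fin N)} (h : ∀ i, Occupied n δ β i → (F ∩ vertsIn β i).card ≤ M) :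
    ((F.filter fun v => Occupied n δ β (β v)).card : ℝ) ≤ M * (k : ℝ) ^ d := by
  set F' := F.filter fun v => Occupied n δ β (β v) with hF'
  have hin : (F'.card : ℝ) ≤ M * (F'.image β).card := by
    refine card_le_mul_card_image_of_fibers fun i => ?_
    rcases (F'.filter fun v => β v = i).eq_empty_or_nonempty with he | ⟨v, hv⟩
    · simp [he]
    · rw [Finset.mem_filter, hF', Finset.mem_filter] at hv
      have hi : Occupied n δ β i := hv.2 ▸ hv.1.2
      refine Nat.cast_le.2 ((Finset.card_le_card fun w hw => ?_).trans (h i hi))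
      rw [Finset.mem_filter, hF', Finset.mem_filter] at hw
      exact Finset.mem_inter.2 ⟨hw.1.1, Finset.mem_filter.2 ⟨Finset.mem_univ _, hw.2⟩⟩
  have himg : ((F'.image β).card : ℝ) ≤ (k : ℝ) ^ d := by
    rw [← Nat.cast_pow, ← card_gridBlocks, Nat.cast_le]
    refine Finset.card_le_card fun z hz => ?_
    obtain ⟨v, -, rfl⟩ := Finset.mem_image.1 hz
    exact mem_gridBlocks.2 fun j => hβ v j
  exact hin.trans (by gcongr)

open scoped Classical in
-- Occupied blocks have at most M ≤ δ log n mistakes, and vacant ones have at most δ log n vertices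
-- altogether, so no distinction between blocks remains.
theorem card_le_mul_card_image_blocks {n N M : ℕ} {β : Fin N → Fin d → ℕ} {F F' : Finset (Fin N)}
    (h : ∀ i, Occupied n δ β i → (F ∩ vertsIn β i).card ≤ M) (hM : (M : ℝ) ≤ δ * Real.log n)
    (hF : F' ⊆ F) : (F'.card : ℝ) ≤ δ * Real.log n * (F'.image β).card := by
  refine card_le_mul_card_image_of_fibers fun i => ?_
  by_cases hi : Occupied n δ β i
  · refine le_trans (Nat.cast_le.2 ((Finset.card_le_card fun w hw => ?_).trans (h i hi))) hM
    have hw' := Finset.mem_filter.1 hw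
    exact Finset.mem_inter.2 ⟨hF hw'.1, Finset.mem_filter.2 ⟨Finset.mem_univ _, hw'.2⟩⟩
  · refine le_trans (Nat.cast_le.2 (Finset.card_le_card fun w hw => ?_)) (not_lt.1 hi)
    exact Finset.mem_filter.2 ⟨Finset.mem_univ _, (Finset.mem_filter.1 hw).2⟩

open scoped Classical in
-- Half of εn is left for the vertices outside the occupied blocks. The other half absorbs M
-- mistakes in each of at most 2n/(χ log n) blocks.
theorem card_mistakes_le_mul (hd : 0 < d) (hχ : 0 < χ) (hδ : 0 < δ) {M : ℕ} {R : ScheduleRule d χ δ}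
    (h : PhaseIWhp R lam a b fun n g σ₀ u₀ σ => ∀ i : Fin d → ℕ,
      Occupied n δ (assignment n χ g) i →
        (mistakes σ₀ σ u₀ ∩ vertsIn (assignment n χ g) i).card ≤ M) {c : ℝ} (hc : 0 < c)
    (hvac : ∀ᶠ n : ℕ in atTop, ∀ A : Finset (Fin d → ℕ),
      (∀ z ∈ A, ∀ j, z j < blocksPerSide d n χ) →
        law d lam n {ω | ∀ z ∈ A, ¬ Occupied n δ (cells n χ ω) z} ≤
          ENNReal.ofReal (Real.exp (-(A.card * c * Real.log n)))) {ε : ℝ} (hε : 0 < ε) :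
    PhaseIWhp R lam a b fun n _ σ₀ u₀ σ => ((mistakes σ₀ σ u₀).card : ℝ) ≤ ε * n := by
  refine h.mono_of_rare (tendsto_outside hd hχ hc hδ hvac (ε := ε / 2) (by positivity)) ?_
  have hbig : ∀ᶠ n : ℕ in atTop, (M : ℝ) ≤ ε / 2 * (χ / 2) * Real.log n :=
    (tendsto_log_nat.const_mul_atTop (by positivity)).eventually_ge_atTop _
  filter_upwards [eventually_ge_atTop 2, hbig, eventually_card_blocks_le hd hχ] with
    n hn hbig hk ω hω u₀ σ hM
  obtain ⟨F, hF⟩ : ∃ F : Finset (Fin ω.1), F = mistakes (truth a b n ω) σ u₀ := ⟨_, rfl⟩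
  suffices hgoal : (F.card : ℝ) ≤ ε * n by
    rw [hF] at hgoal
    exact hgoal
  have hM' : ∀ i, Occupied n δ (cells n χ ω) i → (F ∩ vertsIn (cells n χ ω) i).card ≤ M :=
    fun i hi => hF ▸ hM i hi
  have hsplit := Finset.card_filter_add_card_filter_not (s := F)
    (fun v => Occupied n δ (cells n χ ω) (cells n χ ω v))
  have hout : ((F.filter fun v => ¬ Occupied n δ (cells n χ ω) (cells n χ ω v)).card : ℝ) <
      ε / 2 * n := by
    by_contra hcon
    exact hω ⟨_, fun v hv => (Finset.mem_filter.1 hv).2, not_lt.1 hcon⟩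
  have h1 := card_in_occupied_le (β := cells n χ ω) (fun v j => cellOf_lt hn hχ _ j) hM'
  have h2 : M * (blocksPerSide d n χ : ℝ) ^ d ≤ ε / 2 * n := by
    calc _ ≤ ε / 2 * (χ / 2) * Real.log n * (blocksPerSide d n χ : ℝ) ^ d := by gcongr
      _ = ε / 2 * ((blocksPerSide d n χ : ℝ) ^ d * (χ / 2 * Real.log n)) := by ring
      _ ≤ _ := by gcongr; exact hk.1
  rw [← hsplit]
  push_cast
  linarith

theorem one_sub_le_agreement {N : ℕ} (hN : 0 < N) {σ₀ σ : Fin N → SignType} {u₀ : Fin N}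
    (hu₀ : σ₀ u₀ = 1 ∨ σ₀ u₀ = -1) {ε : ℝ} (h : ((mistakes σ₀ σ u₀).card : ℝ) ≤ ε * N) :
    1 - ε ≤ agreement σ σ₀ := by
  have hN' : (0 : ℝ) < N := Nat.cast_pos.2 hN
  have hsplit := Finset.card_filter_add_card_filter_not (s := (Finset.univ : Finset (Fin N)))
    (fun v => σ v ≠ σ₀ u₀ * σ₀ v)
  simp only [not_not, Finset.card_univ, Fintype.card_fin] at hsplit
  have h1 : ((mistakes σ₀ σ u₀).card : ℝ) +
      ((Finset.univ.filter fun v => σ v = σ₀ u₀ * σ₀ v).card : ℝ) = N := by exact_mod_cast hsplit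
  rw [agreement, le_div_iff₀ hN']
  have h2 : (1 - ε) * N ≤ ((Finset.univ.filter fun v => σ v = σ₀ u₀ * σ₀ v).card : ℝ) := by linarith
  refine h2.trans ?_
  rcases hu₀ with hu₀ | hu₀ <;> simp only [hu₀, one_mul, neg_one_mul]
  · exact le_max_left _ _
  · exact le_max_right _ _

open scoped Classical in
theorem card_mistakes_inter_nbhd_le (hd : 0 < d) (hχ : 0 < χ) (hδ : 0 < δ) {M : ℕ}
    {R : ScheduleRule d χ δ}
    (h : PhaseIWhp R lam a b fun n g σ₀ u₀ σ => ∀ i : Fin d → ℕ,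
      Occupied n δ (assignment n χ g) i →
        (mistakes σ₀ σ u₀ ∩ vertsIn (assignment n χ g) i).card ≤ M) {η : ℝ}
    (hη : δ < η / kappa d χ) :
    PhaseIWhp R lam a b fun n g σ₀ u₀ σ => ∀ u : Fin g.card,
      ((mistakes σ₀ σ u₀ ∩ nbhd n g u).card : ℝ) ≤ η * Real.log n := by
  have hκ := kappa_pos d hχ
  have hK : kappa d χ < η / δ := by
    rw [lt_div_iff₀ hκ] at hη
    rw [lt_div_iff₀ hδ]
    linarith
  -- No further rare event is needed. The strict inequality κ < η/δ absorbs the rounding in the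
  -- number of blocks that a neighbourhood meets.
  refine h.mono_of_rare (E := fun _ => ∅) (by simp) ?_
  have hbig : ∀ᶠ n : ℕ in atTop, (M : ℝ) ≤ δ * Real.log n :=
    (tendsto_log_nat.const_mul_atTop hδ).eventually_ge_atTop _
  filter_upwards [eventually_ge_atTop 2, hbig, eventually_card_near_blocks_le hd hχ hK] with
    n hn hbig hnear ω _ u₀ σ hM u
  have hlog : 0 < Real.log n := Real.log_pos (by exact_mod_cast hn)
  obtain ⟨F, hF⟩ : ∃ F : Finset (Fin ω.1), F = mistakes (truth a b n ω) σ u₀ := ⟨_, rfl⟩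
  obtain ⟨F', hF'⟩ : ∃ F' : Finset (Fin ω.1),
    F' = mistakes (truth a b n ω) σ u₀ ∩ nbhd n (observed a b n ω) u := ⟨_, rfl⟩
  have hM' : ∀ i, Occupied n δ (cells n χ ω) i → (F ∩ vertsIn (cells n χ ω) i).card ≤ M :=
    fun i hi => hF ▸ hM i hi
  have h1 := card_le_mul_card_image_blocks hM' hbig (F' := F')
    (by rw [hF, hF']; exact Finset.inter_subset_left)
  change ((mistakes (truth a b n ω) σ u₀ ∩ nbhd n (observed a b n ω) u).card : ℝ) ≤ _
  rw [← hF']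
  have hvis : ∀ v : Fin ω.1,
      v ∈ mistakes (truth a b n ω) σ u₀ ∩ nbhd n (observed a b n ω) u →
        torusDist d n (location n ω u) (location n ω v) ≤ radius d n := fun v hv =>
    (Finset.mem_filter.1 (Finset.mem_inter.1 hv).2).2
  have h2 := hnear (location n ω u) (F'.image (cells n χ ω)) fun i hi => by
    obtain ⟨v, hv, rfl⟩ := Finset.mem_image.1 hi
    exact ⟨location n ω v, location_mem_region ω v, rfl,
      hvis v (hF' ▸ hv)⟩
  calc (F'.card : ℝ) ≤ δ * Real.log n * (F'.image (cells n χ ω)).card := h1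
    _ ≤ δ * Real.log n * (η / δ) := by gcongr
    _ = η * Real.log n := by field_simp

end GSBM

end

/-! ### Assembly of the theorem -/

theorem theorem4 (d : ℕ) (lam : ℝ)
    (hlam : (d = 1 ∧ 1 < lam) ∨ (2 ≤ d ∧ 1 < lam * GSBM.unitBallVol d)) :
    (∃ χ : ℝ, GSBM.BlockConstant d lam χ) ∧
    ∀ χ : ℝ, GSBM.BlockConstant d lam χ →
      ∃ δ₀ : ℝ, 0 < δ₀ ∧
        ∀ δ : ℝ, 0 < δ → δ < δ₀ →
          ∀ a ∈ Set.Icc (0 : ℝ) 1, ∀ b ∈ Set.Icc (0 : ℝ) 1, a ≠ b →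
            -- a polynomial-time implementation
            (∃ R : GSBM.ScheduleRule d χ δ, GSBM.PolyTimePhaseI R a b) ∧
            ∃ M : ℕ, ∀ R : GSBM.ScheduleRule d χ δ,
              -- almost exact recovery
              (∀ ε : ℝ, 0 < ε →
                GSBM.PhaseIWhp R lam a b fun _ _ σ₀ _ σ => 1 - ε ≤ GSBM.agreement σ σ₀) ∧
              -- at most `M` mistakes in every occupied block
              (GSBM.PhaseIWhp R lam a b fun n g σ₀ u₀ σ =>
                ∀ i : Fin d → ℕ, GSBM.Occupied n δ (GSBM.assignment n χ g) i →
                  (GSBM.mistakes σ₀ σ u₀ ∩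
                    GSBM.vertsIn (GSBM.assignment n χ g) i).card ≤ M) ∧
              ∀ η : ℝ, 0 < η → δ < η / GSBM.kappa d χ →
                -- few mistakes in total
                (GSBM.PhaseIWhp R lam a b fun n _ σ₀ u₀ σ =>
                  ((GSBM.mistakes σ₀ σ u₀).card : ℝ) ≤ η * n / (χ * GSBM.kappa d χ)) ∧
                -- few mistakes in every neighbourhood
                (GSBM.PhaseIWhp R lam a b fun n g σ₀ u₀ σ =>
                  ∀ u : Fin g.card, ((GSBM.mistakes σ₀ σ u₀ ∩ GSBM.nbhd n g u).card : ℝ) ≤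
                    η * Real.log n) := by
  have hd : 0 < d := by rcases hlam with h | h <;> omega
  have hlam0 : 0 < lam := by
    rcases hlam with h | h
    · linarith [h.2]
    · by_contra hneg
      nlinarith [h.2, GSBM.unitBallVol_pos d]
  refine ⟨GSBM.exists_blockConstant hlam, fun χ hχ => ?_⟩
  have hχ0 := hχ.pos
  have hκ := GSBM.kappa_pos d hχ0
  obtain ⟨δ₀, hδ₀, hmain⟩ := GSBM.exists_forall_card_mistakes_le hlam hχ
  refine ⟨δ₀, hδ₀, fun δ hδ hδδ₀ a ha b hb hab =>
    ⟨⟨GSBM.bfsRule d χ hδ, GSBM.polyTimePhaseI_bfsRule hd hχ0 hδ a b⟩, ?_⟩⟩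
  obtain ⟨⟨c, hc, hvac⟩, hblocks⟩ := hmain δ hδ hδδ₀
  obtain ⟨M, hM⟩ := hblocks a ha b hb hab
  refine ⟨M, fun R => ⟨fun ε hε => ?_, hM R, fun η hη hδη => ⟨?_, ?_⟩⟩⟩
  -- With high probability there are more than λn/2 vertices, so ελn/2 mistakes are at most an ε
  -- fraction. The reference vertex shows that the vertex set is not empty.
  · refine (GSBM.card_mistakes_le_mul hd hχ0 hδ (hM R) hc hvac
      (ε := ε * (lam / 2)) (by positivity)).mono_of_rare (GSBM.tendsto_card_le hlam0) ?_
    refine Eventually.of_forall fun n ω hω u₀ σ hF => ?_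
    have hN : lam * n / 2 < ω.1 := not_le.1 hω
    refine GSBM.one_sub_le_agreement (Fin.pos u₀) ?_ (hF.trans ?_)
    · exact GSBM.signOf_eq_one_or _
    · calc ε * (lam / 2) * n = ε * (lam * n / 2) := by ring
        _ ≤ ε * ω.1 := by gcongr
  · have h := GSBM.card_mistakes_le_mul hd hχ0 hδ (hM R) hc hvac
      (ε := η / (χ * GSBM.kappa d χ)) (by positivity)
    simpa only [div_mul_eq_mul_div] using h
  · exact GSBM.card_mistakes_inter_nbhd_le hd hχ0 hδ (hM R) hδη
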